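/- Let $F/F^+$ be an unramified quadratic extension of $p$-adic fields with nontrivial automorphism $\sigma$, let $\varpi$ be a uniformizer of $F^+$, let $q$ be the cardinality of the residue field of $F^+$, and let $r\ge 1$. *Types.* Let $\mathrm{Typ}_r=\mathbb{Z}^r$ and $\mathrm{Typ}_r^{0,\flat}=\{e\in\mathbb{Z}^r: e_1\ge\cdots\ge e_r\ge 0\}$, and write $\mathbb{Z}[X]$ for the finitely supported functions $X\to\mathbb{Z}$ and $\delta_e$ for indicator functions. Write $\star$ for concatenation, $\lambda_k(e)=\#\{j: e_j=k\}$, and $\widetilde{\mathrm{inv}}(\epsilon)=\sum_{i<j}\max(0,\epsilon_i-\epsilon_j)$. *Straightening.* Let $\mathrm{Rel}_r^\flat\subseteq\mathbb{Z}[\mathrm{Typ}_r]$ be the span of the elements $\delta_u\star x\star\delta_v$, where $u,v$ are integer vectors (of total length $r-2$) and $x$ is $\delta_{(a,a+1)}-\delta_{(a+1,a)}$ ($a\in\mathbb{Z}$) or $\delta_{(a,b)}-\delta_{(a+1,b-1)}-(-q)^{b-a-1}(\delta_{(b,a)}-\delta_{(b-1,a+1)})$ ($a<b$), and of the elements $\delta_u\star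 y$, where $u\in\mathbb{Z}^{r-1}$ and $y$ is $\delta_{(-1)}-\delta_{(1)}$ or $\delta_{(-m)}-\delta_{(-m+2)}-q^{m-1}(\delta_{(m)}-\delta_{(m-2)})$ ($m>1$). The inclusion $\mathrm{Typ}_r^{0,\flat}\subseteq\mathrm{Typ}_r$ induces an isomorphism $\mathbb{Z}[\mathrm{Typ}_r^{0,\flat}]\xrightarrow{\sim}\mathbb{Z}[\mathrm{Typ}_r]/\mathrm{Rel}_r^\flat$ (this is part of the assertion); let $\mathrm{str}^\flat\colon\mathbb{Z}[\mathrm{Typ}_r]\to\mathbb{Z}[\mathrm{Typ}_r^{0,\flat}]$ be the projection followed by its inverse. *Hecke operators.* For $0\le i\le r$ let $\Delta^\flat_{i,r}$ be the endomorphism of $\mathbb{Z}[\mathrm{Typ}_r]$ with $$\Delta^\flat_{i,r}\delta_e=\sum_{\epsilon\in\{-1,0,1\}^r,\ \lambda_0(\epsilon)=r-i} q^{2\widetilde{\mathrm{inv}}(\epsilon)+\lambda_1(\epsilon)^2+(r-\lambda_{-1}(\epsilon))^2-(r-i)^2}\,\delta_{e+2\epsilon},$$ and let $S^\flat_{i,r}$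 be the adjoint operator on functions on $\mathrm{Typ}_r^{0,\flat}$, defined by $\langle S_{i,r}^\flat f,g\rangle=\langle f,\mathrm{str}^\flat(\Delta_{i,r}^\flat g)\rangle$ for all $g\in\mathbb{Z}[\mathrm{Typ}_r^{0,\flat}]$, where $\langle f,g\rangle=\sum_e f(e)g(e)$. Put $$T_r=\sum_{i=0}^r(-1)^i(q^2+1)^iq^{i^2-i}S^\flat_{r-i,r},\qquad T_r'=\sum_{i=1}^r i(-1)^{i-1}(q^2+1)^{i-1}q^{i^2-i}S^\flat_{r-i,r}.$$ *Lattice-counting functions.* A lattice $\Lambda$ in an $r$-dimensional hermitian space over $F$, with dual lattice $\Lambda^\vee$, has type $e$ if $\Lambda^\vee$ has an $\mathcal{O}_F$-basis $b_1,\dots,b_r$ such that $\varpi^{e_1}b_1,\dots,\varpi^{e_r}b_r$ is an $\mathcal{O}_F$-basis of $\Lambda$. For $e,f\in\mathrm{Typ}_r^{0,\flat}$ put $$\phi^\flat_e(f)=\sum_{\Lambda'\subseteq\Lambda_f,\ \Lambda'\text{ of type }e}c\bigl(\dim(\Lambda_f/(\varpi\Lambda_f+\Lambda'))\bigr),\qquad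 c(k)=\prod_{i=1}^k(1-q^{2i}),$$ where $\Lambda_f$ is a fixed lattice of type $f$, namely $\mathcal{O}_F^r$ with the hermitian form $\sum_i\varpi^{f_i}x_i\sigma(y_i)$ on $F^r$, and $\dim$ is taken over the residue field of $F$. Let $\Phi_{[1,\infty],0^{\le1}}$ be the $\mathbb{Z}$-span of the functions $\phi_e^\flat$ for $e\in\mathrm{Typ}_r^{0,\flat}$ with $\lambda_0(e)\le 1$. **Theorem.** Both $T_r\cdot\mathbb{Z}[\mathrm{Typ}_r^{0,\flat}]$ and $T_r'\cdot\mathbb{Z}[\mathrm{Typ}_r^{0,\flat}]$ are contained in $\Phi_{[1,\infty],0^{\le1}}$. -/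

import Mathlib

open scoped ValuativeRel

namespace HermitianHecke

/-! ### Types -/

/-- All integer vectors of length `r`. -/
abbrev Typ (r : ℕ) : Type := Fin r → ℤ

/-- The vectors `e₁ ≥ ⋯ ≥ e_r ≥ 0`. -/
def TypFlat (r : ℕ) : Type := {e : Typ r // Antitone e ∧ ∀ i, 0 ≤ e i}

/-- `λ_k(e)`, the number of entries of `e` that are equal to `k`. -/
def mult {r : ℕ} (k : ℤ) (e : Typ r) : ℕ := (Finset.univ.filter fun j => e j = k).card

/-- `∑_{i < j} max (0, ε_i - ε_j)`. -/
def invTilde {r : ℕ} (ε : Typ r) : ℕ :=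
  ∑ i : Fin r, ∑ j ∈ Finset.univ.filter (fun j => i < j), (ε i - ε j).toNat

/-- The indicator function at `e`. -/
noncomputable def delta {r : ℕ} (e : Typ r) : Typ r →₀ ℤ := Finsupp.single e 1

/-- `e` with the entries in positions `i` and `j` replaced by `a` and `b`. -/
def put {r : ℕ} (e : Typ r) (i j : Fin r) (a b : ℤ) : Typ r :=
  Function.update (Function.update e i a) j b

/-! ### Straightening relations -/

/-- The generators of the straightening relations. The first two families replace two
consecutive entries of a vector; in the second one the entries are `a < b` with `b = a + 1 + k`.
The last two families replace only the last entry; in the fourth one it is `-m` with `m = n + 2`. -/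
inductive IsRelator (q r : ℕ) : (Typ r →₀ ℤ) → Prop
  | swap (e : Typ r) (i j : Fin r) (hij : (i : ℕ) + 1 = j) (a : ℤ) :
      IsRelator q r (delta (put e i j a (a + 1)) - delta (put e i j (a + 1) a))
  | pair (e : Typ r) (i j : Fin r) (hij : (i : ℕ) + 1 = j) (a : ℤ) (k : ℕ) :
      IsRelator q r
        (delta (put e i j a (a + 1 + k)) - delta (put e i j (a + 1) (a + k))
          - (-(q : ℤ)) ^ k •
            (delta (put e i j (a + 1 + k) a) - delta (put e i j (a + k) (a + 1))))
  | lastOne (e : Typ r) (i : Fin r) (hi : (i : ℕ) + 1 = r) :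
      IsRelator q r (delta (Function.update e i (-1)) - delta (Function.update e i 1))
  | last (e : Typ r) (i : Fin r) (hi : (i : ℕ) + 1 = r) (n : ℕ) :
      IsRelator q r
        (delta (Function.update e i (-(n + 2 : ℤ))) - delta (Function.update e i (-(n : ℤ)))
          - (q : ℤ) ^ (n + 1) •
            (delta (Function.update e i (n + 2 : ℤ)) - delta (Function.update e i (n : ℤ))))

/-- The module of straightening relations. -/
noncomputable def relFlat (q r : ℕ) : Submodule ℤ (Typ r →₀ ℤ) := Submodule.span ℤ {x | IsRelator q r x}

/-- The natural map from `ℤ[TypFlat r]` to `ℤ[Typ r]` modulo the straightening relations. -/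
noncomputable def flatToQuotient (q r : ℕ) :
    (TypFlat r →₀ ℤ) →ₗ[ℤ] ((Typ r →₀ ℤ) ⧸ relFlat q r) :=
  (relFlat q r).mkQ ∘ₗ Finsupp.lmapDomain ℤ ℤ (fun e : TypFlat r => e.1)

open scoped Classical in
/-- The straightening map: the projection to the quotient by the straightening relations,
followed by the inverse of `flatToQuotient`. That `flatToQuotient` is bijective, so that the
second branch does not occur, is a part of what the main theorem asserts. -/
noncomputable def strFlat (q r : ℕ) : (Typ r →₀ ℤ) →ₗ[ℤ] (TypFlat r →₀ ℤ) :=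
  if h : Function.Bijective (flatToQuotient q r) then
    (LinearEquiv.ofBijective (flatToQuotient q r) h).symm.toLinearMap ∘ₗ (relFlat q r).mkQ
  else 0

/-! ### Hecke operators -/

/-- The translation `δ_e ↦ δ_{e + ε}`. -/
noncomputable def translate {r : ℕ} (ε : Typ r) : (Typ r →₀ ℤ) →ₗ[ℤ] (Typ r →₀ ℤ) :=
  Finsupp.lmapDomain ℤ ℤ (fun e => e + ε)

/-- The vectors in `{-1, 0, 1}^r` with exactly `r - i` entries equal to `0`. -/
def signVectors (r i : ℕ) : Finset (Typ r) :=
  (Fintype.piFinset fun _ : Fin r => ({-1, 0, 1} : Finset ℤ)).filter fun ε => mult 0 ε + i = r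

/-- `Δ_{i,r}`. The subtractions in the exponent do not truncate, since
`r - λ₋₁(ε) = λ₀(ε) + λ₁(ε)` and `r - i = λ₀(ε)` for the vectors `ε` that occur. -/
noncomputable def deltaFlat (q r i : ℕ) : (Typ r →₀ ℤ) →ₗ[ℤ] (Typ r →₀ ℤ) :=
  ∑ ε ∈ signVectors r i,
    (q : ℤ) ^ (2 * invTilde ε + (mult 1 ε ^ 2 + (r - mult (-1) ε) ^ 2 - (r - i) ^ 2)) •
      translate (2 • ε)

/-- The pairing of an arbitrary function on `TypFlat r` with a finitely supported one. -/
noncomputable def pairing {r : ℕ} (f : TypFlat r → ℤ) (g : TypFlat r →₀ ℤ) : ℤ :=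
  g.sum fun e c => f e * c

/-- `S_{i,r}`, the adjoint of `strFlat ∘ deltaFlat`: the operator for which the pairing of `S f`
with `δ_g` is the pairing of `f` with `strFlat (deltaFlat δ_g)`. -/
noncomputable def heckeS (q r i : ℕ) : (TypFlat r → ℤ) →ₗ[ℤ] (TypFlat r → ℤ) where
  toFun f g := pairing f (strFlat q r (deltaFlat q r i (delta g.1)))
  map_add' f₁ f₂ := by
    funext g
    simp [pairing, add_mul, Finsupp.sum_add]
  map_smul' c f := by
    funext g
    simp [pairing, mul_assoc, Finsupp.mul_sum]

/-- `T_r`. -/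
noncomputable def heckeT (q r : ℕ) : (TypFlat r → ℤ) →ₗ[ℤ] (TypFlat r → ℤ) :=
  ∑ i ∈ Finset.range (r + 1),
    ((-1) ^ i * ((q : ℤ) ^ 2 + 1) ^ i * (q : ℤ) ^ (i ^ 2 - i)) • heckeS q r (r - i)

/-- `T_r'`. -/
noncomputable def heckeT' (q r : ℕ) : (TypFlat r → ℤ) →ₗ[ℤ] (TypFlat r → ℤ) :=
  ∑ i ∈ Finset.Icc 1 r,
    ((i : ℤ) * (-1) ^ (i - 1) * ((q : ℤ) ^ 2 + 1) ^ (i - 1) * (q : ℤ) ^ (i ^ 2 - i)) •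
      heckeS q r (r - i)

/-- `ℤ[TypFlat r]`, as the submodule of finitely supported functions. -/
def finiteFunctions (r : ℕ) : Submodule ℤ (TypFlat r → ℤ) where
  carrier := {f | (Function.support f).Finite}
  zero_mem' := by simp
  add_mem' hf hg := (hf.union hg).subset (Function.support_add _ _)
  smul_mem' c f hf := hf.subset (Function.support_const_smul_subset c f)

/-! ### Hermitian lattices -/

section Lattices

variable (K L : Type*) [Field K] [ValuativeRel K] [Field L] [ValuativeRel L] [Algebra K L]

/-- The cardinality of the residue field. -/
noncomputable def residueCard : ℕ := Nat.card 𝓀[K]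

/-- The extension has ramification index one. (For local fields, whose residue fields are finite
and so perfect, this says that the extension is unramified.) -/
def IsUnramifiedExtension [ValuativeExtension K L] : Prop :=
  Function.Surjective (ValuativeExtension.mapValueGroupWithZero K L)

variable {K L}

/-- The dual lattice `{x | h(x, Λ) ⊆ 𝒪_L}`. -/
def dualLattice {W : Type*} [AddCommGroup W] [Module L W] {σ : L ≃ₐ[K] L}
    (h : W →ₗ[L] W →ₛₗ[(σ : L →+* L)] L) (Λ : Submodule 𝒪[L] W) : Submodule 𝒪[L] W where
  carrier := {x | ∀ y ∈ Λ, h x y ∈ 𝒪[L]}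
  zero_mem' y _ := by simp
  add_mem' {a b} ha hb y hy := by
    simpa using add_mem (ha y hy) (hb y hy)
  smul_mem' c x hx y hy := by
    have : h (c • x) y = (c : L) * h x y := by
      change h ((c : L) • x) y = _
      simp
    rw [this]
    exact mul_mem c.2 (hx y hy)

/-- `Λ` is a lattice of type `e`: the relative position of its dual and itself is `e`, that is,
there is a basis `b` of the dual lattice for which the `ϖ ^ e_i • b_i` are a basis of `Λ`. -/
def HasType {W : Type*} [AddCommGroup W] [Module L W] {σ : L ≃ₐ[K] L} (ϖ : 𝒪[K])
    (h : W →ₗ[L] W →ₛₗ[(σ : L →+* L)] L) {r : ℕ} (e : Typ r) (Λ : Submodule 𝒪[L] W) : Prop :=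
  ∃ b : Module.Basis (Fin r) L W,
    dualLattice h Λ = Submodule.span 𝒪[L] (Set.range b) ∧
    Λ = Submodule.span 𝒪[L] (Set.range fun i => algebraMap K L ϖ ^ e i • b i)

/-- `c(k) = ∏_{i = 1}^k (1 - q ^ (2 i))`. -/
def cFactor (q k : ℕ) : ℤ := ∏ i ∈ Finset.Icc 1 k, (1 - (q : ℤ) ^ (2 * i))

/-- The dimension over the residue field of `Λ / (𝔪 Λ + Λ')`, for `Λ' ⊆ Λ`. -/
noncomputable def quotientDim {W : Type*} [AddCommGroup W] [Module L W]
    (Λ Λ' : Submodule 𝒪[L] W) : ℕ :=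
  (Module.length 𝒪[L] (Λ ⧸ (𝓂[L] • (⊤ : Submodule 𝒪[L] Λ) ⊔ Λ'.submoduleOf Λ))).toNat

/-- The sum of `c(dim Λ / (𝔪 Λ + Λ'))` over all lattices `Λ' ⊆ Λ` of type `e`. -/
noncomputable def latticeSum {W : Type*} [AddCommGroup W] [Module L W] {σ : L ≃ₐ[K] L} (ϖ : 𝒪[K])
    (h : W →ₗ[L] W →ₛₗ[(σ : L →+* L)] L) {r : ℕ} (Λ : Submodule 𝒪[L] W) (e : Typ r) : ℤ :=
  ∑ᶠ (Λ' : Submodule 𝒪[L] W) (_ : Λ' ≤ Λ ∧ HasType ϖ h e Λ'),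
    cFactor (residueCard K) (quotientDim Λ Λ')

/-- The hermitian form `∑ ϖ ^ f_i x_i σ(y_i)` on `L ^ r`. -/
noncomputable def diagForm (σ : L ≃ₐ[K] L) (ϖ : 𝒪[K]) {r : ℕ} (f : Typ r) :
    (Fin r → L) →ₗ[L] (Fin r → L) →ₛₗ[(σ : L →+* L)] L :=
  LinearMap.mk₂'ₛₗ (RingHom.id L) (σ : L →+* L)
    (fun x y => ∑ i, algebraMap K L ϖ ^ f i * x i * σ (y i))
    (by intros; simp [mul_add, add_mul, Finset.sum_add_distrib])
    (by intros; simp only [Pi.smul_apply, smul_eq_mul, RingHom.id_apply, Finset.mul_sum]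
        exact Finset.sum_congr rfl fun _ _ => by ring)
    (by intros; simp [mul_add, Finset.sum_add_distrib])
    (by intros; simp only [Pi.smul_apply, smul_eq_mul, map_mul, Finset.mul_sum]
        exact Finset.sum_congr rfl fun _ _ => by simp; ring)

variable (L) in
/-- The lattice `𝒪_L ^ r` in `L ^ r`. -/
def stdLattice (r : ℕ) : Submodule 𝒪[L] (Fin r → L) where
  carrier := {x | ∀ i, x i ∈ 𝒪[L]}
  zero_mem' _ := zero_mem _
  add_mem' ha hb i := add_mem (ha i) (hb i)
  smul_mem' c _ hx i := mul_mem c.2 (hx i)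

/-- The lattice counting function attached to `e`. The lattice `𝒪_L ^ r` with the form
`diagForm σ ϖ f` serves as the lattice of type `f`. -/
noncomputable def phiFlat (σ : L ≃ₐ[K] L) (ϖ : 𝒪[K]) {r : ℕ} (e : TypFlat r) :
    TypFlat r → ℤ :=
  fun f => latticeSum ϖ (diagForm σ ϖ f.1) (stdLattice L r) e.1

/-- The span of the lattice counting functions attached to the vectors `e` with at most `k`
entries equal to `0`. -/
noncomputable def PhiSpan (σ : L ≃ₐ[K] L) (ϖ : 𝒪[K]) (r k : ℕ) : Submodule ℤ (TypFlat r → ℤ) :=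
  Submodule.span ℤ {φ | ∃ e : TypFlat r, mult 0 e.1 ≤ k ∧ φ = phiFlat σ ϖ e}

end Lattices

end HermitianHecke

/-! Write `X_k` for the shift of the k-th coordinate, `k = 0, …, r - 1`, so that Laurent polynomials
act on functions on `Typ r`, and put `Q = q²`, the order of the residue field of `L`.

Bijectivity. Non-dominant vectors are rewritten by vectors closer to `rhoVec`, which gives
surjectivity. After division by a character, the relations say that `1 + q⁻¹ X_i X_j⁻¹`
(neighbours), resp. `1 - q⁻¹ X_l²` (last entry), turns the function into one antisymmetric under a
shifted simple reflection of type C. Functionals with this symmetry arise by dividing a signed orbit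
sum by a product over the positive roots, as in Hall–Littlewood theory; they are triangular on
dominant vectors, which gives injectivity (`exists_separating`).

Lattices. Let `B` satisfy the relations for adjacent entries `a, a + 1` and `a, a + 2`. For a
lattice `M` of dominant type `e`, the sum over `𝔪M ⊆ N ⊆ M` of `(-τ)^J Q^(J(J-1)/2) B(type N)`, with
`J = dim M/N`, equals `(∏ (1 - τ Q^(r-1-k) X_k²) B)(e)` (`OrthBasis.finsum_wt_typ`). Suppose
moreover that `B` vanishes for large coordinate sums. Taking `τ = q²` at the lattice of type `f`, `τ
= 1` at its sublattices, and Möbius inversion (`finsum_inversion`) yields `(∏ (1 - q² Q^(r-1-k)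
X_k²) B)(f) = ∑_e A(e) φ_e(f)` with `A = ∏ (1 - Q^(r-1-k) X_k²) B`
(`act_denomInt_eq_sum_latticeSum`).

Hecke operators. Extend a finitely supported `g` to all vectors by straightening. After rescaling,
`T_r` is, up to a constant, the product of the factors `q² X_k² + X_k⁻² - (q² + 1) = X_k⁻² (1 -
X_k²) (1 - q² X_k²)`; `T_r'`, minus its derivative in the constant `q² + 1`, is the sum of the
products of all factors but one. Divide `g` by `∏ (1 - q² X_k²)` to get `H`, and let `B` be the
Hecke polynomial applied to `H`. The left side above is then `T_r g` or `T_r' g`, and it remains to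
see that `A` vanishes when the last two entries are zero. The polynomial applied to `H` there splits
explicitly into a part killed by the relation of the two neighbours and a part killed by the
relations of the last entry at `-1` and `-2` (`vanishing_mul`, `vanishing_add`). -/

namespace HermitianHecke

/-! ### Functions on integer vectors as a module over Laurent polynomials -/

section Shift

variable {r : ℕ} {k : Type*} [CommRing k]

/-- Translation of functions on `ℤ ^ r`. -/
def shift (v : Typ r) : Module.End k (Typ r → k) := LinearMap.funLeft k k (fun e => e + v)

/-- Laurent polynomials act on functions on `ℤ ^ r` by translations. -/
noncomputable def act : AddMonoidAlgebra k (Typ r) →ₐ[k] Module.End k (Typ r → k) :=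
  AddMonoidAlgebra.lift k (Module.End k (Typ r → k)) (Typ r)
    { toFun := fun v => shift v.toAdd
      map_one' := by
        ext m e
        simp [shift, LinearMap.funLeft_apply]
      map_mul' := fun v w => by
        ext m e
        simp [shift, LinearMap.funLeft_apply, Module.End.mul_apply]
        exact congrArg m (by abel) }

theorem act_single (v : Typ r) (c : k) (m : Typ r → k) (e : Typ r) :
    act (AddMonoidAlgebra.single v c) m e = c * m (e + v) := by
  simp [act, shift, LinearMap.funLeft_apply, AddMonoidAlgebra.lift_single]

theorem act_one_sub (v : Typ r) (c : k) (m : Typ r → k) (e : Typ r) :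
    act (1 - AddMonoidAlgebra.single v c) m e = m e - c * m (e + v) := by
  rw [map_sub, map_one, LinearMap.sub_apply, Pi.sub_apply, act_single, Module.End.one_apply]

/-- The action is compatible with affine changes of variables. -/
theorem act_comp_affine (s : Typ r ≃+ Typ r) (c : Typ r) (P : AddMonoidAlgebra k (Typ r))
    (m : Typ r → k) (e : Typ r) :
    act P (fun e => m (s e + c)) e =
      act (AddMonoidAlgebra.domCongr k k s P) m (s e + c) := by
  induction P using AddMonoidAlgebra.induction_linear with
  | zero => simp
  | add f g hf hg => simp only [map_add, LinearMap.add_apply, Pi.add_apply, hf, hg]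
  | single v a =>
    rw [act_single, AddMonoidAlgebra.domCongr_single, act_single, map_add]
    congr 2
    abel

/-- `m` vanishes where the height is large. -/
def Bdd (ht : Typ r →+ ℤ) (m : Typ r → k) : Prop := ∃ C : ℤ, ∀ e, C < ht e → m e = 0

/-- The hypothesis on `G` is what division by factors `1 - t X ^ v` provides: the support of the
quotient is that of `n` pushed down by the monoid generated by the `v`. Hence the bound for `n` also
serves for `G`. -/
theorem Bdd.of_support {ht : Typ r →+ ℤ} {n G : Typ r → k} (hn : Bdd ht n) {Φ : Set (Typ r)}
    (hΦ : ∀ v ∈ Φ, 0 ≤ ht v)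
    (hG : ∀ e, G e ≠ 0 → ∃ κ ∈ AddSubmonoid.closure Φ, n (e + κ) ≠ 0) : Bdd ht G := by
  obtain ⟨C, hC⟩ := hn
  refine ⟨C, fun e he => ?_⟩
  by_contra h
  obtain ⟨κ, hκ, h2⟩ := hG e h
  have hpos : 0 ≤ ht κ := by
    clear h2
    induction hκ using AddSubmonoid.closure_induction with
    | mem x hx => exact hΦ x hx
    | zero => simp
    | add x y _ _ hx hy => rw [map_add]; exact add_nonneg hx hy
  exact h2 (hC _ (by rw [map_add]; omega))

/-- Division by `1 - t X ^ v`. -/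
theorem exists_div_single (ht : Typ r →+ ℤ) (v : Typ r) (hv : 0 < ht v) (t : k)
    (n : Typ r → k) (hn : Bdd ht n) :
    ∃ G : Typ r → k, act (1 - AddMonoidAlgebra.single v t) G = n ∧
      ∀ e, G e ≠ 0 → ∃ j : ℕ, n (e + j • v) ≠ 0 := by
  obtain ⟨C, hC⟩ := hn
  have hz : ∀ e, ∀ j : ℕ, (C - ht e).toNat + 1 ≤ j → n (e + j • v) = 0 := by
    intro e j hj
    apply hC
    rw [map_add, map_nsmul, nsmul_eq_mul]
    have : (C - ht e) < j := by omega
    nlinarith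
  have key : ∀ e, ∀ N : ℕ, (∀ j : ℕ, N ≤ j → n (e + j • v) = 0) →
      (∑ᶠ j : ℕ, t ^ j * n (e + j • v)) = ∑ j ∈ Finset.range N, t ^ j * n (e + j • v) := by
    intro e N hN
    apply finsum_eq_sum_of_support_subset
    intro j hj
    rw [Function.mem_support] at hj
    simp only [Finset.coe_range, Set.mem_Iio]
    by_contra h
    exact hj (by rw [hN j (not_lt.mp h), mul_zero])
  -- The geometric series for `(1 - t X ^ v)⁻¹`; it is finite at each `e` because `n` vanishes at
  -- large height and `v` has positive height.
  refine ⟨fun e => ∑ᶠ j : ℕ, t ^ j * n (e + j • v), ?_, ?_⟩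
  · ext e
    rw [act_one_sub]
    have h1 := hz e
    set N := (C - ht e).toNat + 1
    have e1 : ∀ j : ℕ, e + v + j • v = e + (j + 1) • v := fun j => by
      rw [add_smul, one_smul]; abel
    rw [key e (N + 1) fun j hj => h1 j (by omega),
      key (e + v) N fun j hj => by rw [e1]; exact h1 _ (by omega),
      Finset.sum_range_succ', Finset.mul_sum]
    have : ∑ j ∈ Finset.range N, t ^ (j + 1) * n (e + (j + 1) • v) =
        ∑ i ∈ Finset.range N, t * (t ^ i * n (e + v + i • v)) :=
      Finset.sum_congr rfl fun j _ => by rw [e1]; ring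
    rw [this]
    simp
  · intro e he
    by_contra! h
    exact he (by simp only [h, mul_zero, finsum_zero])

/-- Division by a product of factors `1 - t X ^ v`. -/
theorem exists_div (ht : Typ r →+ ℤ) (Φ : Finset (Typ r)) (hΦ : ∀ v ∈ Φ, 0 < ht v)
    (t : Typ r → k) (n : Typ r → k) (hn : Bdd ht n) :
    ∃ G : Typ r → k, act (∏ v ∈ Φ, (1 - AddMonoidAlgebra.single v (t v))) G = n ∧
      ∀ e, G e ≠ 0 → ∃ κ ∈ AddSubmonoid.closure (Φ : Set (Typ r)), n (e + κ) ≠ 0 := by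
  classical
  induction Φ using Finset.induction_on with
  | empty =>
    refine ⟨n, by simp, fun e he => ⟨0, zero_mem _, by simpa using he⟩⟩
  | insert v Φ hv ih =>
    obtain ⟨G', h1, h2⟩ := ih fun w hw => hΦ w (Finset.mem_insert_of_mem hw)
    have hb : Bdd ht G' := hn.of_support
      (fun w hw => (hΦ w (Finset.mem_insert_of_mem hw)).le) h2
    obtain ⟨G, h3, h4⟩ := exists_div_single ht v (hΦ v (Finset.mem_insert_self _ _)) (t v) G' hb
    refine ⟨G, ?_, fun e he => ?_⟩
    · rw [Finset.prod_insert hv, mul_comm, map_mul, Module.End.mul_apply, h3, h1]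
    · obtain ⟨j, hj⟩ := h4 e he
      obtain ⟨κ, hκ, h⟩ := h2 _ hj
      refine ⟨j • v + κ, add_mem (nsmul_mem (AddSubmonoid.subset_closure (by simp)) j)
        (AddSubmonoid.closure_mono (by simp) hκ), ?_⟩
      rwa [← add_assoc]

/-- One factor at a time: iterating `G e = t v * G (e + v)` pushes the argument to heights where `G`
is zero. So division is unique among functions that vanish at large height. -/
theorem eq_zero_of_act_eq_zero (ht : Typ r →+ ℤ) (Φ : Finset (Typ r)) (hΦ : ∀ v ∈ Φ, 0 < ht v)
    (t : Typ r → k) (G : Typ r → k) (hG : Bdd ht G)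
    (h : act (∏ v ∈ Φ, (1 - AddMonoidAlgebra.single v (t v))) G = 0) : G = 0 := by
  classical
  induction Φ using Finset.induction_on generalizing G with
  | empty => simpa using h
  | insert v Φ hv ih =>
    rw [Finset.prod_insert hv, mul_comm, map_mul, Module.End.mul_apply] at h
    obtain ⟨C, hC⟩ := hG
    have hv0 := hΦ v (Finset.mem_insert_self _ _)
    have h0 := ih (fun w hw => hΦ w (Finset.mem_insert_of_mem hw)) _
      ⟨C, fun e he => by
        rw [act_one_sub, hC e he, hC (e + v) (by rw [map_add]; omega)]; simp⟩ h
    have h1 : ∀ e, G e = t v * G (e + v) := fun e => by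
      have := congrFun h0 e
      rw [act_one_sub] at this
      exact sub_eq_zero.mp this
    have h2 : ∀ j : ℕ, ∀ e, G e = t v ^ j * G (e + j • v) := by
      intro j
      induction j with
      | zero => simp
      | succ j ihj =>
        intro e
        rw [ihj e, h1 (e + j • v), succ_nsmul, pow_succ, ← add_assoc, mul_assoc]
    ext e
    rw [h2 ((C - ht e).toNat + 1) e, hC, mul_zero, Pi.zero_apply]
    rw [map_add, map_nsmul, nsmul_eq_mul]
    have : (C - ht e) < ((C - ht e).toNat + 1 : ℕ) := by omega
    nlinarith

/-- Division by an invariant product preserves antisymmetry under a reflection. -/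
theorem antisymm_of_act (ht : Typ r →+ ℤ) (Φ : Finset (Typ r)) (hΦ : ∀ v ∈ Φ, 0 < ht v)
    (t : Typ r → k) (s : Typ r ≃+ Typ r) (c : Typ r) (hs : ∀ e, ht (s e) = ht e)
    (hsΦ : ∀ v ∈ Φ, s v ∈ Φ) (hst : ∀ v, t (s v) = t v)
    (h : Typ r → k) (hb : Bdd ht h)
    (hn : ∀ e, act (∏ v ∈ Φ, (1 - AddMonoidAlgebra.single v (t v))) h e +
      act (∏ v ∈ Φ, (1 - AddMonoidAlgebra.single v (t v))) h (s e + c) = 0) (e : Typ r) :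
    h e + h (s e + c) = 0 := by
  classical
  have hinv : AddMonoidAlgebra.domCongr k k s (∏ v ∈ Φ, (1 - AddMonoidAlgebra.single v (t v))) =
      ∏ v ∈ Φ, (1 - AddMonoidAlgebra.single v (t v)) := by
    have himg : Φ.image s = Φ :=
      Finset.eq_of_subset_of_card_le (Finset.image_subset_iff.mpr hsΦ)
        (by rw [Finset.card_image_of_injective _ s.injective])
    rw [map_prod]
    conv_rhs => rw [← himg]
    rw [Finset.prod_image fun a _ b _ hab => s.injective hab]
    refine Finset.prod_congr rfl fun v _ => ?_
    rw [map_sub, map_one, AddMonoidAlgebra.domCongr_single, hst]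
  have hb2 : Bdd ht (h + fun e => h (s e + c)) := by
    obtain ⟨C, hC⟩ := hb
    refine ⟨max C (C - ht c), fun e he => ?_⟩
    rw [Pi.add_apply, hC e (by omega), hC (s e + c) (by rw [map_add, hs]; omega), add_zero]
  -- The sum of `h` and its reflected copy is annihilated by the product, since the product is
  -- invariant under `s`; uniqueness of division makes the sum zero.
  have := eq_zero_of_act_eq_zero ht Φ hΦ t _ hb2 (by
    ext e
    rw [map_add, Pi.add_apply, act_comp_affine, hinv, hn, Pi.zero_apply])
  exact congrFun this e

end Shift

/-! ### Coordinates, characters and reflections -/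

section Roots

variable {r : ℕ}

/-- The standard basis vectors. -/
def basisVec (i : Fin r) : Typ r := Pi.single i 1

/-- The vector `(r, r - 1, …, 1)`. -/
def rhoVec (r : ℕ) : Typ r := fun k => (r : ℤ) - k

theorem rhoVec_pos (k : Fin r) : 0 < rhoVec r k := by
  have := k.2
  simp only [rhoVec]
  omega

/-- The linear functional with coefficients `rhoVec`. -/
def height (r : ℕ) : Typ r →+ ℤ where
  toFun e := ∑ k, rhoVec r k * e k
  map_zero' := by simp
  map_add' e f := by simp [mul_add, Finset.sum_add_distrib]

theorem height_basisVec (i : Fin r) : height r (basisVec i) = rhoVec r i := by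
  simp [height, basisVec, Pi.single_apply]

/-- The permutation of coordinates by a transposition. -/
def swapEquiv (i j : Fin r) : Typ r ≃+ Typ r where
  toFun e := e ∘ Equiv.swap i j
  invFun e := e ∘ Equiv.swap i j
  left_inv e := by ext; simp
  right_inv e := by ext; simp
  map_add' _ _ := rfl

/-- The change of sign of a coordinate. -/
def negEquiv (i : Fin r) : Typ r ≃+ Typ r where
  toFun e := fun k => if k = i then - e k else e k
  invFun e := fun k => if k = i then - e k else e k
  left_inv e := by ext k; by_cases h : k = i <;> simp [h]
  right_inv e := by ext k; by_cases h : k = i <;> simp [h]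
  map_add' e f := by ext k; by_cases h : k = i <;> simp [h, add_comm]

theorem swapEquiv_apply (i j : Fin r) (e : Typ r) (k : Fin r) :
    swapEquiv i j e k = e (Equiv.swap i j k) := rfl

theorem negEquiv_apply (i : Fin r) (e : Typ r) (k : Fin r) :
    negEquiv i e k = if k = i then - e k else e k := rfl

theorem swapEquiv_basisVec (i j a : Fin r) :
    swapEquiv i j (basisVec a) = basisVec (Equiv.swap i j a) := by
  ext k
  rw [swapEquiv_apply, basisVec, basisVec, Pi.single_apply, Pi.single_apply]
  congr 1
  rw [eq_iff_iff, Equiv.swap_apply_eq_iff]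

theorem negEquiv_basisVec_self (i : Fin r) : negEquiv i (basisVec i) = - basisVec i := by
  ext k
  by_cases h : k = i <;> simp [negEquiv_apply, basisVec, h]

theorem negEquiv_basisVec_ne {i a : Fin r} (h : a ≠ i) :
    negEquiv i (basisVec a) = basisVec a := by
  ext k
  by_cases hk : k = i
  · subst hk
    simp [negEquiv_apply, basisVec, Pi.single_eq_of_ne' h]
  · simp [negEquiv_apply, hk]

theorem swapEquiv_eq_add {i j : Fin r} (hij : i ≠ j) (e : Typ r) :
    swapEquiv i j e = e + (e j - e i) • (basisVec i - basisVec j) := by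
  ext k
  rw [swapEquiv_apply]
  simp only [basisVec, Pi.add_apply, Pi.smul_apply, Pi.sub_apply, Pi.single_apply, smul_eq_mul]
  rcases eq_or_ne k i with rfl | hi
  · simp [hij]
  · rcases eq_or_ne k j with rfl | hj
    · simp [hij.symm]
    · simp [Equiv.swap_apply_of_ne_of_ne hi hj, hi, hj]

theorem negEquiv_eq_add (i : Fin r) (e : Typ r) :
    negEquiv i e = e + (- e i) • (basisVec i + basisVec i) := by
  ext k
  rw [negEquiv_apply]
  rcases eq_or_ne k i with rfl | hi
  · simp only [basisVec, if_true, Pi.add_apply, Pi.smul_apply, Pi.single_eq_same, smul_eq_mul]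
    ring
  · simp [basisVec, hi]

theorem put_eq_add {i j : Fin r} (hij : i ≠ j) (e : Typ r) (n : ℤ) :
    put e i j (e i + n) (e j - n) = e + n • (basisVec i - basisVec j) := by
  ext k
  simp only [put, basisVec, Pi.add_apply, Pi.smul_apply, Pi.sub_apply, Pi.single_apply,
    smul_eq_mul]
  rcases eq_or_ne k j with rfl | hj
  · simp [hij.symm, sub_eq_add_neg]
  · rcases eq_or_ne k i with rfl | hi
    · simp [hij]
    · simp [hi, hj]

theorem update_eq_add (i : Fin r) (e : Typ r) (n : ℤ) :
    Function.update e i (e i + 2 * n) = e + n • (basisVec i + basisVec i) := by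
  ext k
  rcases eq_or_ne k i with rfl | hi
  · simp [basisVec]; ring
  · simp [basisVec, hi]

/-- The character `e ↦ ∏ w_k ^ e_k`. -/
noncomputable def character {k : Type*} [Field k] (w : Fin r → k) (e : Typ r) : k :=
  ∏ i, w i ^ e i

variable {k : Type*} [Field k] {w : Fin r → k}

theorem character_ne_zero (hw : ∀ i, w i ≠ 0) (e : Typ r) : character w e ≠ 0 :=
  Finset.prod_ne_zero_iff.mpr fun i _ => zpow_ne_zero _ (hw i)

theorem character_add (hw : ∀ i, w i ≠ 0) (e f : Typ r) :
    character w (e + f) = character w e * character w f := by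
  simp only [character, Pi.add_apply, zpow_add₀ (hw _), Finset.prod_mul_distrib]

theorem character_zsmul (n : ℤ) (e : Typ r) :
    character w (n • e) = character w e ^ n := by
  rw [character, character, ← Finset.prod_zpow]
  exact Finset.prod_congr rfl fun i _ => by
    rw [Pi.smul_apply, smul_eq_mul, mul_comm, zpow_mul]

theorem character_basisVec (i : Fin r) : character w (basisVec i) = w i := by
  rw [character, Finset.prod_eq_single i]
  · simp [basisVec]
  · intro b _ hb
    simp [basisVec, hb]
  · simp

theorem character_neg (e : Typ r) :
    character w (- e) = (character w e)⁻¹ := by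
  simpa using character_zsmul (w := w) (-1) e

theorem character_sub (hw : ∀ i, w i ≠ 0) (e f : Typ r) :
    character w (e - f) = character w e * (character w f)⁻¹ := by
  rw [sub_eq_add_neg, character_add hw, character_neg]

/-- The relation between neighbouring coordinates, in terms of a rescaled function. -/
theorem pair_relation (hw : ∀ i, w i ≠ 0) (q : k) (hq : q ≠ 0) {i j : Fin r} (hij : i ≠ j)
    (hwij : w j = - q * w i) (G : Typ r → k) (e : Typ r) :
    character w e * (G e + q⁻¹ * G (e + (basisVec i - basisVec j)) +
      (G (swapEquiv i j e - (basisVec i - basisVec j)) + q⁻¹ * G (swapEquiv i j e))) =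
    character w e * G e - character w (e + (basisVec i - basisVec j)) *
        G (e + (basisVec i - basisVec j)) - (-q) ^ (e j - e i - 1) *
      (character w (swapEquiv i j e) * G (swapEquiv i j e) -
        character w (swapEquiv i j e - (basisVec i - basisVec j)) *
          G (swapEquiv i j e - (basisVec i - basisVec j))) := by
  have hq' : -q ≠ 0 := neg_ne_zero.mpr hq
  have h1 : character w (basisVec i - basisVec j) = (-q)⁻¹ := by
    rw [character_sub hw, character_basisVec, character_basisVec, hwij, mul_inv, mul_comm,
      mul_assoc, inv_mul_cancel₀ (hw i), mul_one]
  -- The root has character `(-q)⁻¹`, so swapping the entries multiplies the character by the power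
  -- of `-q` that occurs in the straightening relation; rescaling absorbs it.
  have h2 : character w (swapEquiv i j e) = character w e * (-q) ^ (- (e j - e i)) := by
    rw [swapEquiv_eq_add hij, character_add hw, character_zsmul, h1, inv_zpow']
  rw [character_add hw e, character_sub hw (swapEquiv i j e), h1, h2, inv_inv,
    zpow_sub_one₀ hq', zpow_neg]
  have h3 := zpow_ne_zero (e j - e i) hq'
  field_simp
  ring

/-- The relation for the last coordinate, in terms of a rescaled function. -/
theorem last_relation (hw : ∀ i, w i ≠ 0) (q : k) (hq : q ≠ 0) {i : Fin r}
    (hwi : q * w i ^ 2 = 1) (G : Typ r → k) (e : Typ r) :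
    character w e * (G e - q⁻¹ * G (e + (basisVec i + basisVec i)) +
      (G (negEquiv i e - (basisVec i + basisVec i)) - q⁻¹ * G (negEquiv i e))) =
    character w e * G e - character w (e + (basisVec i + basisVec i)) *
        G (e + (basisVec i + basisVec i)) - q ^ (- e i - 1) *
      (character w (negEquiv i e) * G (negEquiv i e) -
        character w (negEquiv i e - (basisVec i + basisVec i)) *
          G (negEquiv i e - (basisVec i + basisVec i))) := by
  have h1 : character w (basisVec i + basisVec i) = q⁻¹ := by
    rw [character_add hw, character_basisVec, ← sq]
    exact eq_inv_of_mul_eq_one_right hwi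
  have h2 : character w (negEquiv i e) = character w e * q ^ (e i) := by
    rw [negEquiv_eq_add, character_add hw, character_zsmul, h1, inv_zpow', neg_neg]
  rw [character_add hw e, character_sub hw (negEquiv i e), h1, h2, inv_inv,
    zpow_sub_one₀ hq, zpow_neg]
  have h3 := zpow_ne_zero (e i) hq
  field_simp
  ring

/-- The positive roots of type `C`. -/
def posRoots (r : ℕ) : Finset (Typ r) :=
  ((Finset.univ.filter fun p : Fin r × Fin r => p.1 < p.2).image
      fun p => basisVec p.1 - basisVec p.2) ∪
    (Finset.univ : Finset (Fin r × Fin r)).image fun p => basisVec p.1 + basisVec p.2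

theorem mem_posRoots {v : Typ r} : v ∈ posRoots r ↔
    (∃ i j : Fin r, i < j ∧ v = basisVec i - basisVec j) ∨
      ∃ i j : Fin r, v = basisVec i + basisVec j := by
  simp [posRoots, eq_comm]

theorem height_pos {v : Typ r} (hv : v ∈ posRoots r) : 0 < height r v := by
  rcases mem_posRoots.mp hv with ⟨i, j, hij, rfl⟩ | ⟨i, j, rfl⟩
  · rw [map_sub, height_basisVec, height_basisVec]
    simp only [rhoVec]
    have := Fin.lt_def.mp hij
    omega
  · rw [map_add, height_basisVec, height_basisVec]
    exact add_pos (rhoVec_pos i) (rhoVec_pos j)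

/-- A simple reflection permutes the positive roots other than its own; this makes the product over
the positive roots with one factor removed invariant. -/
theorem swap_mem_posRoots {i j : Fin r} (hij : (i : ℕ) + 1 = j) {v : Typ r} (hv : v ∈ posRoots r)
    (hne : v ≠ basisVec i - basisVec j) : swapEquiv i j v ∈ posRoots r := by
  rcases mem_posRoots.mp hv with ⟨a, b, hab, rfl⟩ | ⟨a, b, rfl⟩
  · rw [map_sub, swapEquiv_basisVec, swapEquiv_basisVec]
    refine mem_posRoots.mpr (Or.inl ⟨_, _, ?_, rfl⟩)
    have h : ¬ (a = i ∧ b = j) := by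
      rintro ⟨rfl, rfl⟩
      exact hne rfl
    simp only [Equiv.swap_apply_def, Fin.ext_iff, Fin.lt_def] at *
    split_ifs <;> omega
  · rw [map_add, swapEquiv_basisVec, swapEquiv_basisVec]
    exact mem_posRoots.mpr (Or.inr ⟨_, _, rfl⟩)

theorem neg_mem_posRoots {i : Fin r} (hi : (i : ℕ) + 1 = r) {v : Typ r} (hv : v ∈ posRoots r)
    (hne : v ≠ basisVec i + basisVec i) : negEquiv i v ∈ posRoots r := by
  have hlt : ∀ a : Fin r, a ≠ i → a < i := fun a ha => by
    have := a.2
    rw [Fin.lt_def]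
    have : (a : ℕ) ≠ i := fun h => ha (Fin.ext h)
    omega
  rcases mem_posRoots.mp hv with ⟨a, b, hab, rfl⟩ | ⟨a, b, rfl⟩
  · have ha : a ≠ i := by
      rintro rfl
      have := b.2
      have := Fin.lt_def.mp hab
      omega
    rw [map_sub, negEquiv_basisVec_ne ha]
    rcases eq_or_ne b i with rfl | hb
    · rw [negEquiv_basisVec_self, sub_neg_eq_add]
      exact mem_posRoots.mpr (Or.inr ⟨_, _, rfl⟩)
    · rw [negEquiv_basisVec_ne hb]
      exact hv
  · rw [map_add]
    rcases eq_or_ne a i with rfl | ha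
    · rcases eq_or_ne b a with rfl | hb
      · exact absurd rfl hne
      · rw [negEquiv_basisVec_self, negEquiv_basisVec_ne hb, neg_add_eq_sub]
        exact mem_posRoots.mpr (Or.inl ⟨_, _, hlt b hb, rfl⟩)
    · rw [negEquiv_basisVec_ne ha]
      rcases eq_or_ne b i with rfl | hb
      · rw [negEquiv_basisVec_self, ← sub_eq_add_neg]
        exact mem_posRoots.mpr (Or.inl ⟨_, _, hlt a ha, rfl⟩)
      · rw [negEquiv_basisVec_ne hb]
        exact hv

/-- The sum of the squares of the entries. -/
def sqNorm (e : Typ r) : ℤ := ∑ k, e k ^ 2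

theorem sqNorm_swapEquiv (i j : Fin r) (e : Typ r) : sqNorm (swapEquiv i j e) = sqNorm e :=
  Equiv.sum_comp (Equiv.swap i j) fun k => e k ^ 2

theorem sqNorm_negEquiv (i : Fin r) (e : Typ r) : sqNorm (negEquiv i e) = sqNorm e :=
  Finset.sum_congr rfl fun k _ => by
    rw [negEquiv_apply]
    split_ifs <;> ring

/-- Because of this, the affine reflection `e ↦ s e - α` of the relations becomes linear in the
variable `e + rhoVec r`. -/
theorem swapEquiv_rhoVec {i j : Fin r} (hij : (i : ℕ) + 1 = j) :
    swapEquiv i j (rhoVec r) = rhoVec r - (basisVec i - basisVec j) := by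
  have hne : i ≠ j := by
    rintro rfl
    omega
  rw [swapEquiv_eq_add hne]
  have : rhoVec r j - rhoVec r i = -1 := by
    simp only [rhoVec]
    omega
  rw [this, neg_one_smul, ← sub_eq_add_neg]

theorem negEquiv_rhoVec {i : Fin r} (hi : (i : ℕ) + 1 = r) :
    negEquiv i (rhoVec r) = rhoVec r - (basisVec i + basisVec i) := by
  rw [negEquiv_eq_add]
  have : rhoVec r i = 1 := by
    simp only [rhoVec]
    omega
  rw [this, neg_one_smul, ← sub_eq_add_neg]

/-- Division of an antisymmetric function by the product over the positive roots: the part that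
belongs to a simple reflection `s` with root `α`. -/
theorem antisymm_of_div {k : Type*} [Field k] (s : Typ r ≃+ Typ r) (hs : ∀ e, s (s e) = e)
    (α : Typ r) (hα : α ∈ posRoots r)
    (hsα : s α = - α) (hsΦ : ∀ v ∈ posRoots r, v ≠ α → s v ∈ posRoots r)
    (t : Typ r → k) (hst : ∀ v, t (s v) = t v) (n G : Typ r → k)
    (hn : Set.Finite (Function.support n))
    (hG : act (∏ v ∈ posRoots r, (1 - AddMonoidAlgebra.single v (t v))) G = n)
    (hsupp : ∀ e, G e ≠ 0 →
      ∃ κ ∈ AddSubmonoid.closure (posRoots r : Set (Typ r)), n (e + κ) ≠ 0)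
    (hnanti : ∀ e, n e + n (s e - α) = 0) (e : Typ r) :
    G e - t α * G (e + α) + (G (s e - α) - t α * G (s e)) = 0 := by
  classical
  -- The symmetrized height is invariant under `s` and zero on `α`, yet still positive on all other
  -- positive roots, as `s` permutes these. So uniqueness of division applies to the product without
  -- the factor of `α`.
  let ht : Typ r →+ ℤ := height r + (height r).comp s.toAddMonoidHom
  have ht_def : ∀ v, ht v = height r v + height r (s v) := fun v => rfl
  have htα : ht α = 0 := by rw [ht_def, hsα, map_neg, add_neg_cancel]
  have hpos : ∀ v ∈ (posRoots r).erase α, 0 < ht v := fun v hv => by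
    obtain ⟨h1, h2⟩ := Finset.mem_erase.mp hv
    exact add_pos (height_pos h2) (height_pos (hsΦ v h2 h1))
  have hbn : Bdd ht n := by
    obtain ⟨C, hC⟩ := (hn.image ht).bddAbove
    refine ⟨C, fun e he => ?_⟩
    by_contra h
    exact absurd (hC ⟨e, h, rfl⟩) (not_le.mpr he)
  have hbG : Bdd ht G := hbn.of_support (Φ := (posRoots r : Set (Typ r))) (fun v hv => by
    rcases eq_or_ne v α with rfl | hne
    · exact htα.ge
    · exact (hpos v (Finset.mem_erase.mpr ⟨hne, hv⟩)).le) hsupp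
  have key := antisymm_of_act ht ((posRoots r).erase α) hpos t s (-α)
    (fun e => by rw [ht_def, ht_def, hs, add_comm])
    (fun v hv => by
      obtain ⟨h1, h2⟩ := Finset.mem_erase.mp hv
      refine Finset.mem_erase.mpr ⟨fun h => ?_, hsΦ v h2 h1⟩
      have h3 : v = - α := by rw [← hsα, ← h, hs]
      have h4 := height_pos h2
      have h5 := height_pos hα
      rw [h3, map_neg] at h4
      omega)
    hst (act (1 - AddMonoidAlgebra.single α (t α)) G)
    (by
      obtain ⟨C, hC⟩ := hbG
      refine ⟨C, fun e he => ?_⟩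
      rw [act_one_sub, hC e he, hC (e + α) (by rw [map_add, htα]; omega)]
      simp)
    (fun e => by
      rw [← Module.End.mul_apply, ← map_mul, Finset.prod_erase_mul _ _ hα, hG,
        ← sub_eq_add_neg, hnanti]) e
  rw [act_one_sub, act_one_sub, ← sub_eq_add_neg, sub_add_cancel] at key
  exact key

end Roots

/-! ### An antisymmetric function -/

section Antisymmetric

variable {r : ℕ}

/-- The signed indicator function of the orbit of `μ` under signed permutations. -/
def orbitSign (k : Type*) [Field k] (μ y : Typ r) : k :=
  Matrix.det (Matrix.of fun i j => (if y i = μ j then (1 : k) else 0) - if y i = - μ j then 1 else 0)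

variable {k : Type*} [Field k] {μ : Typ r}

theorem orbitSign_swap {i j : Fin r} (hij : i ≠ j) (y : Typ r) :
    orbitSign k μ (swapEquiv i j y) = - orbitSign k μ y := by
  have := Matrix.det_permute (Equiv.swap i j)
    (Matrix.of fun i j => (if y i = μ j then (1 : k) else 0) - if y i = - μ j then 1 else 0)
  rw [Equiv.Perm.sign_swap hij] at this
  rw [Units.val_neg, Units.val_one, Int.cast_neg, Int.cast_one, neg_one_mul] at this
  exact this

theorem orbitSign_neg (i : Fin r) (y : Typ r) :
    orbitSign k μ (negEquiv i y) = - orbitSign k μ y := by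
  rw [orbitSign, orbitSign]
  set M := Matrix.of fun i j => (if y i = μ j then (1 : k) else 0) - if y i = - μ j then 1 else 0
    with hM
  have h := Matrix.det_updateRow_smul M i (-1) (M i)
  rw [Matrix.updateRow_eq_self] at h
  rw [← neg_one_mul, ← h]
  congr 1
  ext a b
  rw [Matrix.updateRow_apply, Matrix.of_apply, negEquiv_apply]
  by_cases h1 : a = i
  · subst h1
    rw [if_pos rfl, if_pos rfl, Pi.smul_apply, hM, Matrix.of_apply]
    simp only [neg_eq_iff_eq_neg, neg_neg, smul_eq_mul, neg_one_mul, neg_sub]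
  · rw [if_neg h1, if_neg h1, hM, Matrix.of_apply]

theorem exists_perm_of_orbitSign_ne_zero {y : Typ r} (h : orbitSign k μ y ≠ 0) :
    ∃ π : Equiv.Perm (Fin r), ∀ i, y (π i) = μ i ∨ y (π i) = - μ i := by
  rw [orbitSign, Matrix.det_apply] at h
  obtain ⟨π, -, hπ⟩ := Finset.exists_ne_zero_of_sum_ne_zero h
  refine ⟨π, fun i => ?_⟩
  have h1 : ∏ i, (Matrix.of fun i j => (if y i = μ j then (1 : k) else 0) -
      if y i = - μ j then 1 else 0) (π i) i ≠ 0 := fun h0 => hπ (by rw [h0, smul_zero])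
  have h2 := Finset.prod_ne_zero_iff.mp h1 i (Finset.mem_univ i)
  by_contra! hc
  exact h2 (by simp [hc.1, hc.2])

theorem sqNorm_eq_of_orbitSign_ne_zero {y : Typ r} (h : orbitSign k μ y ≠ 0) :
    sqNorm y = sqNorm μ := by
  obtain ⟨π, hπ⟩ := exists_perm_of_orbitSign_ne_zero h
  rw [sqNorm, sqNorm, ← Equiv.sum_comp π]
  exact Finset.sum_congr rfl fun i _ => by
    rcases hπ i with h | h <;> rw [h]
    ring

theorem finite_support_orbitSign (μ : Typ r) :
    (Function.support (orbitSign k μ)).Finite := by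
  have : (Set.pi Set.univ fun _ : Fin r => Set.range μ ∪ Set.range (-μ)).Finite :=
    Set.Finite.pi fun _ => (Set.finite_range _).union (Set.finite_range _)
  refine this.subset fun y hy => ?_
  obtain ⟨π, hπ⟩ := exists_perm_of_orbitSign_ne_zero hy
  intro i _
  rcases hπ (π.symm i) with h | h <;> rw [Equiv.apply_symm_apply] at h
  · exact Or.inl ⟨_, h.symm⟩
  · exact Or.inr ⟨_, h.symm⟩

/-- Strictly decreasing positive vectors form a strict fundamental domain for signed permutations:
positivity excludes signs, and an increasing permutation of `Fin r` is the identity. -/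
theorem eq_of_orbitSign_ne_zero {y : Typ r} (hy : StrictAnti y) (hμ : StrictAnti μ)
    (hy0 : ∀ i, 0 < y i) (hμ0 : ∀ i, 0 < μ i) (h : orbitSign k μ y ≠ 0) : y = μ := by
  obtain ⟨π, hπ⟩ := exists_perm_of_orbitSign_ne_zero h
  have h1 : ∀ i, y (π i) = μ i := fun i => by
    have := hy0 (π i)
    have := hμ0 i
    rcases hπ i with h | h <;> omega
  have h2 : StrictMono π := fun i j hij => by
    have := hμ hij
    rw [← h1, ← h1] at this
    exact hy.lt_iff_gt.mp this
  have h3 : ∀ i, π i = i := fun i => by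
    have : (OrderIso.refl (Fin r)) i = (h2.orderIsoOfSurjective _ π.surjective) i := by
      congr 1
      exact Subsingleton.elim _ _
    simpa using this.symm
  ext i
  rw [← h1 i, h3]

theorem orbitSign_self (hμ : StrictAnti μ) (hμ0 : ∀ i, 0 < μ i) : orbitSign k μ μ = 1 := by
  rw [orbitSign]
  convert Matrix.det_one (n := Fin r) (R := k)
  ext i j
  have h1 : μ i ≠ - μ j := by
    have := hμ0 i
    have := hμ0 j
    omega
  simp [Matrix.one_apply, h1, hμ.injective.eq_iff]

end Antisymmetric

/-! ### Straightening -/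

section Straightening

variable {r : ℕ}

theorem sum_put (F : Fin r → ℤ → ℤ) {i j : Fin r} (hij : i ≠ j) (e : Typ r) (a b : ℤ) :
    ∑ k, F k (put e i j a b k) = ∑ k, F k (e k) - F i (e i) - F j (e j) + F i a + F j b := by
  have hj : j ∈ Finset.univ.erase i := Finset.mem_erase.mpr ⟨hij.symm, Finset.mem_univ j⟩
  rw [← Finset.add_sum_erase _ _ (Finset.mem_univ i), ← Finset.add_sum_erase _ _ hj,
    ← Finset.add_sum_erase _ (fun k => F k (e k)) (Finset.mem_univ i),
    ← Finset.add_sum_erase _ (fun k => F k (e k)) hj]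
  have h1 : put e i j a b i = a := by simp [put, hij]
  have h2 : put e i j a b j = b := by simp [put]
  have h3 : ∑ k ∈ (Finset.univ.erase i).erase j, F k (put e i j a b k) =
      ∑ k ∈ (Finset.univ.erase i).erase j, F k (e k) := by
    refine Finset.sum_congr rfl fun k hk => ?_
    simp only [Finset.mem_erase] at hk
    simp [put, hk.1, hk.2.1]
  rw [h1, h2, h3]
  ring

theorem sum_update (F : Fin r → ℤ → ℤ) (i : Fin r) (e : Typ r) (a : ℤ) :
    ∑ k, F k (Function.update e i a k) = ∑ k, F k (e k) - F i (e i) + F i a := by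
  rw [← Finset.add_sum_erase _ _ (Finset.mem_univ i),
    ← Finset.add_sum_erase _ (fun k => F k (e k)) (Finset.mem_univ i)]
  have h3 : ∑ k ∈ Finset.univ.erase i, F k (Function.update e i a k) =
      ∑ k ∈ Finset.univ.erase i, F k (e k) := by
    refine Finset.sum_congr rfl fun k hk => ?_
    simp [(Finset.mem_erase.mp hk).1]
  rw [h3, Function.update_self]
  ring

theorem zsmul_sub_self (n : ℤ) (v : Typ r) : n • v - v = (n - 1) • v := by
  rw [sub_smul, one_smul]

theorem put_self {i j : Fin r} (e : Typ r) : put e i j (e i) (e j) = e := by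
  simp [put]

theorem antitone_of_adjacent {e : Typ r} (h : ∀ i j : Fin r, (i : ℕ) + 1 = j → e j ≤ e i) :
    Antitone e := by
  cases r with
  | zero => exact fun i => i.elim0
  | succ n => exact Fin.antitone_iff_succ_le.mpr fun i => h _ _ (by simp)

/-- The image in the quotient of the span of the dominant vectors of sum at least `c`. -/
noncomputable def dominantImage (q r : ℕ) (c : ℤ) : Submodule ℤ ((Typ r →₀ ℤ) ⧸ relFlat q r) :=
  (Finsupp.supported ℤ ℤ {f : TypFlat r | c ≤ ∑ k, f.1 k}).map (flatToQuotient q r)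

theorem mkQ_eq_zero_of_isRelator {q : ℕ} {x : Typ r →₀ ℤ} (h : IsRelator q r x) :
    (relFlat q r).mkQ x = 0 :=
  (Submodule.Quotient.mk_eq_zero _).mpr (Submodule.subset_span h)

/-- Induction on the squared distance to `rhoVec r`: each relator expresses a non-dominant vector by
vectors strictly closer to it. No relator lowers the sum of the entries in this rewriting, so the
bound `c` is carried along; it is needed later to bound straightened functions. -/
theorem mkQ_delta_mem_dominantImage (q : ℕ) (c : ℤ) (e : Typ r) (hc : c ≤ ∑ k, e k) :
    (relFlat q r).mkQ (delta e) ∈ dominantImage q r c := by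
  induction hN : (∑ k, (e k - rhoVec r k) ^ 2).toNat using Nat.strong_induction_on
    generalizing e with
  | _ N ih =>
  have ih' : ∀ f : Typ r, c ≤ ∑ k, f k →
      ∑ k, (f k - rhoVec r k) ^ 2 < ∑ k, (e k - rhoVec r k) ^ 2 →
      (relFlat q r).mkQ (delta f) ∈ dominantImage q r c := fun f hf hlt => by
    have h0 : 0 ≤ ∑ k, (f k - rhoVec r k) ^ 2 := Finset.sum_nonneg fun _ _ => sq_nonneg _
    exact ih _ (by omega) f hf rfl
  by_cases hd : ∃ i j : Fin r, (i : ℕ) + 1 = j ∧ e i < e j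
  · obtain ⟨i, j, hij, hlt⟩ := hd
    have hne : i ≠ j := by
      rintro rfl
      omega
    have hρ : rhoVec r i = rhoVec r j + 1 := by
      simp only [rhoVec]
      omega
    have hmem : ∀ a b : ℤ, a + b = e i + e j →
        (a - (rhoVec r j + 1)) ^ 2 + (b - rhoVec r j) ^ 2 <
          (e i - (rhoVec r j + 1)) ^ 2 + (e j - rhoVec r j) ^ 2 →
        (relFlat q r).mkQ (delta (put e i j a b)) ∈ dominantImage q r c := by
      intro a b hab hlt'
      apply ih'
      · rw [sum_put (fun _ x => x) hne]
        omega
      · rw [sum_put (fun k x => (x - rhoVec r k) ^ 2) hne, hρ]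
        linarith
    obtain ⟨n, hn⟩ : ∃ n : ℕ, e j = e i + 1 + n := ⟨(e j - e i - 1).toNat, by omega⟩
    -- For entries `a, a + 1` the relator `pair` is only twice the relator `swap`, so over `ℤ` the
    -- latter is indispensable.
    rcases Nat.eq_zero_or_pos n with rfl | hpos
    · have h := mkQ_eq_zero_of_isRelator (IsRelator.swap (q := q) e i j hij (e i))
      have hn' : e i + 1 = e j := by simpa using hn.symm
      rw [hn', put_self, map_sub, sub_eq_zero] at h
      rw [h]
      exact hmem _ _ (by ring) (by rw [hn]; push_cast; nlinarith)
    · have h := mkQ_eq_zero_of_isRelator (IsRelator.pair (q := q) e i j hij (e i) n)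
      have hn' : e i + 1 + n = e j := hn.symm
      have hn1 : (1 : ℤ) ≤ n := by exact_mod_cast hpos
      rw [hn', put_self, map_sub, map_sub, map_smul, map_sub, sub_sub, sub_eq_zero] at h
      rw [h]
      refine add_mem (hmem _ _ (by omega) (by rw [hn]; nlinarith))
        (Submodule.smul_mem _ _ (sub_mem (hmem _ _ (by omega) (by rw [hn]; nlinarith))
          (hmem _ _ (by omega) (by rw [hn]; nlinarith))))
  · push Not at hd
    have hanti : Antitone e := antitone_of_adjacent hd
    by_cases h0 : ∀ i, 0 ≤ e i
    · refine ⟨Finsupp.single ⟨e, hanti, h0⟩ 1, ?_, ?_⟩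
      · exact Finsupp.single_mem_supported ℤ _ (show c ≤ ∑ k, e k from hc)
      · exact congrArg (relFlat q r).mkQ (Finsupp.mapDomain_single (f := fun e : TypFlat r => e.1))
    · push Not at h0
      obtain ⟨i₀, hi₀⟩ := h0
      obtain ⟨i, hi⟩ : ∃ i : Fin r, (i : ℕ) + 1 = r :=
        ⟨⟨r - 1, by have := i₀.2; omega⟩, by have := i₀.2; simp; omega⟩
      have hneg : e i < 0 := lt_of_le_of_lt (hanti (Fin.le_def.mpr (by have := i₀.2; omega))) hi₀
      have hρ : rhoVec r i = 1 := by
        simp only [rhoVec]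
        omega
      have hmem : ∀ a : ℤ, e i ≤ a → (a - 1) ^ 2 < (e i - 1) ^ 2 →
          (relFlat q r).mkQ (delta (Function.update e i a)) ∈ dominantImage q r c := by
        intro a ha hlt'
        apply ih'
        · rw [sum_update (fun _ x => x)]
          omega
        · rw [sum_update (fun k x => (x - rhoVec r k) ^ 2), hρ]
          linarith
      by_cases h1 : e i = -1
      · have h := mkQ_eq_zero_of_isRelator (IsRelator.lastOne (q := q) e i hi)
        rw [← h1, Function.update_eq_self, map_sub, sub_eq_zero] at h
        rw [h]
        exact hmem _ (by omega) (by rw [h1]; norm_num)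
      · obtain ⟨n, hn⟩ : ∃ n : ℕ, e i = -(n + 2 : ℤ) := ⟨(- e i - 2).toNat, by omega⟩
        have h := mkQ_eq_zero_of_isRelator (IsRelator.last (q := q) e i hi n)
        rw [← hn, Function.update_eq_self, map_sub, map_sub, map_smul, map_sub, sub_sub,
          sub_eq_zero] at h
        rw [h]
        refine add_mem (hmem _ (by omega) (by rw [hn]; nlinarith))
          (Submodule.smul_mem _ _ (sub_mem (hmem _ (by omega) (by rw [hn]; nlinarith))
            (hmem _ (by omega) (by rw [hn]; nlinarith))))

theorem flatToQuotient_surjective (q r : ℕ) : Function.Surjective (flatToQuotient q r) := by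
  rw [← LinearMap.range_eq_top, eq_top_iff]
  rintro x -
  obtain ⟨x, rfl⟩ := (relFlat q r).mkQ_surjective x
  induction x using Finsupp.induction_linear with
  | zero => simp
  | add f g hf hg => rw [map_add]; exact add_mem hf hg
  | single e c =>
    have h : Finsupp.single e c = c • delta e := by simp [delta]
    rw [h, map_smul]
    refine Submodule.smul_mem _ _ ?_
    obtain ⟨y, -, hy⟩ := mkQ_delta_mem_dominantImage q (∑ k, e k) e le_rfl
    exact ⟨y, hy⟩

/-- A functional that kills the relators and separates `l` from the other dominant vectors that
are not shorter. -/
theorem exists_separating (q : ℕ) (hq : 2 ≤ q) (l : TypFlat r) :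
    ∃ B : Typ r → ℝ, (∀ x, IsRelator q r x → Finsupp.linearCombination ℤ B x = 0) ∧ B l.1 ≠ 0 ∧
      ∀ f : TypFlat r, B f.1 ≠ 0 → f ≠ l → sqNorm (f.1 + rhoVec r) < sqNorm (l.1 + rhoVec r) := by
  classical
  have hq0 : (q : ℝ) ≠ 0 := by positivity
  have hsq0 : Real.sqrt q ≠ 0 := by positivity
  set ρ := rhoVec r
  set μ := l.1 + ρ
  have hρanti : StrictAnti ρ := fun i j hij => by
    have := Fin.lt_def.mp hij
    simp only [ρ, rhoVec]
    omega
  have hdom : ∀ f : TypFlat r, StrictAnti (f.1 + ρ) ∧ ∀ i, 0 < (f.1 + ρ) i := fun f =>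
    ⟨f.2.1.add_strictAnti hρanti, fun i => add_pos_of_nonneg_of_pos (f.2.2 i) (rhoVec_pos i)⟩
  -- The numerator of a Weyl-type quotient: the signed orbit sum of `l + ρ`, in shifted coordinates.
  let n : Typ r → ℝ := fun e => orbitSign ℝ μ (e + ρ)
  have hnfin : (Function.support n).Finite :=
    (finite_support_orbitSign (k := ℝ) μ).preimage (add_left_injective ρ).injOn
  -- Squared length 4 singles out the long roots `2 e_i`. The values on the simple roots are those
  -- demanded by `last_relation` and `pair_relation`; depending only on the length, `t` is invariant
  -- under reflections.
  let t : Typ r → ℝ := fun v => if sqNorm v = 4 then (q : ℝ)⁻¹ else - (q : ℝ)⁻¹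
  have hbn : Bdd (height r) n := by
    obtain ⟨C, hC⟩ := (hnfin.image (height r)).bddAbove
    refine ⟨C, fun e he => ?_⟩
    by_contra h
    exact absurd (hC ⟨e, h, rfl⟩) (not_le.mpr he)
  obtain ⟨G, hG, hsupp⟩ := exists_div (height r) (posRoots r) (fun v hv => height_pos hv) t n hbn
  -- A strictly dominant vector pairs nonnegatively with sums of positive roots, so passing from `f
  -- + ρ` to `f + κ + ρ` with `κ ≠ 0` strictly increases the length. This gives the triangularity.
  have hcone : ∀ f : TypFlat r, ∀ κ ∈ AddSubmonoid.closure (posRoots r : Set (Typ r)),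
      0 ≤ ∑ i, (f.1 + ρ) i * κ i := by
    intro f κ hκ
    induction hκ using AddSubmonoid.closure_induction with
    | mem v hv =>
      have hb : ∀ a, ∑ i, (f.1 + ρ) i * basisVec a i = (f.1 + ρ) a := fun a => by
        simp [basisVec, Pi.single_apply]
      rcases mem_posRoots.mp hv with ⟨i, j, hij, rfl⟩ | ⟨i, j, rfl⟩
      · simp only [Pi.sub_apply, mul_sub, Finset.sum_sub_distrib, hb]
        exact sub_nonneg.mpr ((hdom f).1 hij).le
      · have h1 : ∑ k, (f.1 + ρ) k * (basisVec i + basisVec j) k =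
            (f.1 + ρ) i + (f.1 + ρ) j := by
          rw [← hb i, ← hb j, ← Finset.sum_add_distrib]
          exact Finset.sum_congr rfl fun k _ => by rw [Pi.add_apply (basisVec i), mul_add]
        rw [h1]
        exact add_nonneg ((hdom f).2 i).le ((hdom f).2 j).le
    | zero => simp
    | add x y _ _ hx hy =>
      simp only [Pi.add_apply x y, mul_add, Finset.sum_add_distrib]
      exact add_nonneg hx hy
  have hbound : ∀ f : TypFlat r, G f.1 ≠ 0 → f ≠ l →
      sqNorm (f.1 + ρ) < sqNorm (l.1 + ρ) := by
    intro f hf hne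
    obtain ⟨κ, hκ, h⟩ := hsupp f.1 hf
    have h1 := sqNorm_eq_of_orbitSign_ne_zero h
    have h2 : sqNorm (f.1 + κ + ρ) =
        sqNorm (f.1 + ρ) + 2 * ∑ i, (f.1 + ρ) i * κ i + sqNorm κ := by
      simp only [sqNorm, Finset.mul_sum, ← Finset.sum_add_distrib]
      exact Finset.sum_congr rfl fun i _ => by
        simp only [Pi.add_apply]
        ring
    have h3 := hcone f κ hκ
    rcases eq_or_ne κ 0 with rfl | hκ0
    · refine absurd ?_ hne
      rw [add_zero] at h
      have := eq_of_orbitSign_ne_zero (hdom f).1 (hdom l).1 (hdom f).2 (hdom l).2 h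
      exact Subtype.ext (add_right_cancel this)
    · have h4 : 0 < sqNorm κ := by
        obtain ⟨i, hi⟩ := Function.ne_iff.mp hκ0
        exact Finset.sum_pos' (fun _ _ => sq_nonneg _) ⟨i, Finset.mem_univ i, by
          have : κ i ≠ 0 := hi
          positivity⟩
      show sqNorm (f.1 + ρ) < sqNorm μ
      linarith
  have hnl : n l.1 = 1 := orbitSign_self (hdom l).1 (hdom l).2
  have hGl : G l.1 = 1 := by
    have h := congrFun hG l.1
    rw [hnl] at h
    -- the other terms of the product involve larger vectors
    have key : ∀ Φ ⊆ posRoots r,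
        act (∏ v ∈ Φ, (1 - AddMonoidAlgebra.single v (t v))) G l.1 = G l.1 ∧
        ∀ κ ∈ AddSubmonoid.closure (posRoots r : Set (Typ r)), κ ≠ 0 →
          act (∏ v ∈ Φ, (1 - AddMonoidAlgebra.single v (t v))) G (l.1 + κ) = 0 := by
      intro Φ
      induction Φ using Finset.induction_on with
      | empty =>
        refine fun _ => ⟨by simp, fun κ hκ hκ0 => ?_⟩
        simp only [Finset.prod_empty, map_one, Module.End.one_apply]
        by_contra hne
        obtain ⟨κ', hκ', h⟩ := hsupp _ hne
        have h1 := sqNorm_eq_of_orbitSign_ne_zero h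
        have h2 : sqNorm (l.1 + κ + κ' + ρ) =
            sqNorm (l.1 + ρ) + 2 * ∑ i, (l.1 + ρ) i * (κ + κ') i + sqNorm (κ + κ') := by
          simp only [sqNorm, Finset.mul_sum, ← Finset.sum_add_distrib]
          exact Finset.sum_congr rfl fun i _ => by
            simp only [Pi.add_apply]
            ring
        have h3 := hcone l (κ + κ') (add_mem hκ hκ')
        have h4 : 0 < sqNorm (κ + κ') := by
          have hk0 : κ + κ' ≠ 0 := by
            intro h0
            have hnn : ∀ κ ∈ AddSubmonoid.closure (posRoots r : Set (Typ r)),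
                0 ≤ height r κ ∧ (height r κ = 0 → κ = 0) := by
              intro κ hκ
              induction hκ using AddSubmonoid.closure_induction with
              | mem v hv =>
                have := height_pos hv
                exact ⟨this.le, fun h => absurd h this.ne'⟩
              | zero => simp
              | add x y _ _ hx hy =>
                rw [map_add]
                refine ⟨add_nonneg hx.1 hy.1, fun h => ?_⟩
                rw [hx.2 (by linarith [hx.1, hy.1]), hy.2 (by linarith [hx.1, hy.1]), add_zero]
            have hh := congrArg (height r) h0
            rw [map_add, map_zero] at hh
            exact hκ0 ((hnn κ hκ).2 (by linarith [(hnn κ hκ).1, (hnn κ' hκ').1]))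
          obtain ⟨i, hi⟩ := Function.ne_iff.mp hk0
          exact Finset.sum_pos' (fun _ _ => sq_nonneg _) ⟨i, Finset.mem_univ i, by
            have : (κ + κ') i ≠ 0 := hi
            positivity⟩
        have h5 : sqNorm (l.1 + κ + κ' + ρ) = sqNorm (l.1 + ρ) := h1
        linarith
      | insert v Φ hv ih =>
        intro hsub
        obtain ⟨ih1, ih2⟩ := ih fun w hw => hsub (Finset.mem_insert_of_mem hw)
        have hvΦ := hsub (Finset.mem_insert_self v Φ)
        have hvc := AddSubmonoid.subset_closure (s := (posRoots r : Set (Typ r))) hvΦ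
        have hv0 : v ≠ 0 := by
          rintro rfl
          simpa using height_pos hvΦ
        simp only [Finset.prod_insert hv, map_mul, Module.End.mul_apply, act_one_sub]
        refine ⟨by rw [ih1, ih2 v hvc hv0]; ring, fun κ hκ hκ0 => ?_⟩
        rw [ih2 κ hκ hκ0, add_assoc, ih2 (κ + v) (add_mem hκ hvc), mul_zero, sub_zero]
        intro h0
        have hn0 : 0 ≤ height r κ := by
          clear hκ0 h0
          induction hκ using AddSubmonoid.closure_induction with
          | mem v hv => exact (height_pos hv).le
          | zero => simp
          | add x y _ _ hx hy => rw [map_add]; exact add_nonneg hx hy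
        have hh := congrArg (height r) h0
        rw [map_add, map_zero] at hh
        linarith [height_pos hvΦ]
    rw [← (key _ (Finset.Subset.refl _)).1, h]
  -- Neighbouring weights have ratio `-q` and the last weight has square `1 / q`, as the two
  -- rescaled relations require; the square root is why the functional has real values.
  let w : Fin r → ℝ := fun k => (Real.sqrt q)⁻¹ * (-(q : ℝ)) ^ ((k : ℤ) - (r - 1))
  have hw : ∀ i, w i ≠ 0 := fun i =>
    mul_ne_zero (inv_ne_zero hsq0) (zpow_ne_zero _ (neg_ne_zero.mpr hq0))
  refine ⟨fun e => character w e * G e, ?_, ?_, ?_⟩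
  · intro x hx
    have hpair : ∀ i j : Fin r, (i : ℕ) + 1 = j → ∀ e : Typ r,
        G e + (q : ℝ)⁻¹ * G (e + (basisVec i - basisVec j)) +
          (G (swapEquiv i j e - (basisVec i - basisVec j)) +
            (q : ℝ)⁻¹ * G (swapEquiv i j e)) = 0 := by
      intro i j hij e
      have hne : i ≠ j := by
        rintro rfl
        omega
      have hs2 : sqNorm (basisVec i - basisVec j) = 2 := by
        rw [sqNorm, ← Finset.sum_subset (Finset.subset_univ {i, j})]
        · rw [Finset.sum_pair hne]
          simp [basisVec, hne, hne.symm]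
        · intro k _ hk
          simp only [Finset.mem_insert, Finset.mem_singleton, not_or] at hk
          simp [basisVec, hk.1, hk.2]
      have htα : t (basisVec i - basisVec j) = - (q : ℝ)⁻¹ := by simp [t, hs2]
      have h := antisymm_of_div (swapEquiv i j) (fun e => by ext k; simp [swapEquiv_apply])
        (basisVec i - basisVec j)
        (mem_posRoots.mpr (Or.inl ⟨i, j, Fin.lt_def.mpr (by omega), rfl⟩))
        (by rw [map_sub, swapEquiv_basisVec, swapEquiv_basisVec]; simp)
        (fun v hv hne => swap_mem_posRoots hij hv hne) t
        (fun v => by simp only [t, sqNorm_swapEquiv]) n G hnfin hG hsupp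
        (fun e => by
          have : swapEquiv i j e - (basisVec i - basisVec j) + ρ = swapEquiv i j (e + ρ) := by
            rw [map_add, swapEquiv_rhoVec hij]
            abel
          simp only [n]
          rw [this, orbitSign_swap hne, add_neg_cancel]) e
      rw [htα] at h
      linarith
    have hlast : ∀ i : Fin r, (i : ℕ) + 1 = r → ∀ e : Typ r,
        G e - (q : ℝ)⁻¹ * G (e + (basisVec i + basisVec i)) +
          (G (negEquiv i e - (basisVec i + basisVec i)) -
            (q : ℝ)⁻¹ * G (negEquiv i e)) = 0 := by
      intro i hi e
      have hs2 : sqNorm (basisVec i + basisVec i) = 4 := by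
        rw [sqNorm, Finset.sum_eq_single i]
        · simp [basisVec]
        · intro k _ hk
          simp [basisVec, hk]
        · simp
      have htα : t (basisVec i + basisVec i) = (q : ℝ)⁻¹ := by simp [t, hs2]
      have h := antisymm_of_div (negEquiv i)
        (fun e => by ext k; simp only [negEquiv_apply]; split_ifs <;> simp)
        (basisVec i + basisVec i) (mem_posRoots.mpr (Or.inr ⟨i, i, rfl⟩))
        (by rw [map_add, negEquiv_basisVec_self]; abel)
        (fun v hv hne => neg_mem_posRoots hi hv hne) t
        (fun v => by simp only [t, sqNorm_negEquiv]) n G hnfin hG hsupp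
        (fun e => by
          have : negEquiv i e - (basisVec i + basisVec i) + ρ = negEquiv i (e + ρ) := by
            rw [map_add, negEquiv_rhoVec hi]
            abel
          simp only [n]
          rw [this, orbitSign_neg, add_neg_cancel]) e
      rw [htα] at h
      exact h
    have hlc : ∀ e : Typ r, Finsupp.linearCombination ℤ (fun e => character w e * G e) (delta e) =
        character w e * G e := fun e => by simp [delta]
    have hwij : ∀ i j : Fin r, (i : ℕ) + 1 = j → w j = - (q : ℝ) * w i := by
      intro i j hij
      have : (j : ℤ) - (r - 1) = ((i : ℤ) - (r - 1)) + 1 := by omega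
      simp only [w]
      rw [this, zpow_add_one₀ (neg_ne_zero.mpr hq0)]
      ring
    have pairB : ∀ i j : Fin r, (i : ℕ) + 1 = j → ∀ e : Typ r, ∀ a : ℤ, ∀ k : ℕ,
        Finsupp.linearCombination ℤ (fun e => character w e * G e)
        (delta (put e i j a (a + 1 + k)) - delta (put e i j (a + 1) (a + k))
          - (-(q : ℤ)) ^ k •
            (delta (put e i j (a + 1 + k) a) - delta (put e i j (a + k) (a + 1)))) = 0 := by
      intro i j hij e a k
      have hne : i ≠ j := by
        rintro rfl
        omega
      set f := put e i j a (a + 1 + k) with hf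
      have hfi : f i = a := by simp [hf, put, hne]
      have hfj : f j = a + 1 + k := by simp [hf, put]
      have hput : ∀ c d : ℤ, put e i j c d = put f i j c d := fun c d => by
        ext x
        simp only [hf, put]
        rcases eq_or_ne x j with rfl | hxj
        · simp
        · rcases eq_or_ne x i with rfl | hxi
          · simp [hne]
          · simp [hxi, hxj]
      have h1 : put e i j (a + 1) (a + k) = f + (basisVec i - basisVec j) := by
        rw [hput, ← one_smul ℤ (basisVec i - basisVec j), ← put_eq_add hne, hfi, hfj]
        congr 1
        ring
      have h2 : put e i j (a + 1 + k) a = swapEquiv i j f := by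
        rw [hput, swapEquiv_eq_add hne, ← put_eq_add hne, hfi, hfj]
        congr 1 <;> ring
      have h3 : put e i j (a + k) (a + 1) = swapEquiv i j f - (basisVec i - basisVec j) := by
        rw [hput, swapEquiv_eq_add hne, add_sub_assoc, zsmul_sub_self, ← put_eq_add hne, hfi, hfj]
        congr 1 <;> ring
      have h := pair_relation hw (q : ℝ) hq0 hne (hwij i j hij) G f
      rw [hpair i j hij f, mul_zero, hfi, hfj,
        show a + 1 + (k : ℤ) - a - 1 = (k : ℤ) by ring, zpow_natCast] at h
      rw [h1, h2, h3, map_sub, map_sub, map_smul, map_sub, hlc, hlc, hlc, hlc, zsmul_eq_mul]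
      push_cast
      exact h.symm
    cases hx with
    | swap e i j hij a =>
      -- At `k = 0` the pair relation is twice the swap relation, and `2` can be cancelled in `ℝ`.
      have h := pairB i j hij e a 0
      simp only [Nat.cast_zero, add_zero, pow_zero, one_smul] at h
      simp only [map_sub] at h ⊢
      linarith
    | pair e i j hij a k => exact pairB i j hij e a k
    | lastOne e i hi =>
      set f := Function.update e i (-1) with hf
      have hwi : (q : ℝ) * w i ^ 2 = 1 := by
        have : (i : ℤ) - (r - 1) = 0 := by omega
        simp only [w, this, zpow_zero, mul_one, inv_pow]
        rw [Real.sq_sqrt (by positivity), mul_inv_cancel₀ hq0]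
      have hfi : f i = -1 := by simp [hf]
      have h1 : Function.update e i 1 = f + (basisVec i + basisVec i) := by
        rw [← one_smul ℤ (basisVec i + basisVec i), ← update_eq_add, hfi, hf,
          Function.update_idem]
        norm_num
      have h := last_relation hw (q : ℝ) hq0 hwi G f
      rw [hlast i hi f, mul_zero, negEquiv_eq_add, hfi, neg_neg, one_smul, add_sub_cancel_right] at h
      rw [h1, map_sub, hlc, hlc]
      simp at h
      linarith
    | last e i hi m =>
      set f := Function.update e i (-(m + 2 : ℤ)) with hf
      have hwi : (q : ℝ) * w i ^ 2 = 1 := by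
        have : (i : ℤ) - (r - 1) = 0 := by omega
        simp only [w, this, zpow_zero, mul_one, inv_pow]
        rw [Real.sq_sqrt (by positivity), mul_inv_cancel₀ hq0]
      have hfi : f i = -(m + 2 : ℤ) := by simp [hf]
      have hup : ∀ c : ℤ, Function.update e i c = Function.update f i c := fun c => by
        rw [hf, Function.update_idem]
      have h1 : Function.update e i (-(m : ℤ)) = f + (basisVec i + basisVec i) := by
        rw [← one_smul ℤ (basisVec i + basisVec i), ← update_eq_add, hfi, hup]
        congr 1
        ring
      have h2 : Function.update e i (m + 2 : ℤ) = negEquiv i f := by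
        rw [negEquiv_eq_add, ← update_eq_add, hfi, hup]
        congr 1
        ring
      have h3 : Function.update e i (m : ℤ) = negEquiv i f - (basisVec i + basisVec i) := by
        rw [negEquiv_eq_add, add_sub_assoc, zsmul_sub_self, ← update_eq_add, hfi, hup]
        congr 1
        ring
      have h := last_relation hw (q : ℝ) hq0 hwi G f
      rw [hlast i hi f, mul_zero, hfi,
        show -(-(m + 2 : ℤ)) - 1 = ((m + 1 : ℕ) : ℤ) by push_cast; ring, zpow_natCast] at h
      rw [h1, h2, h3, map_sub, map_sub, map_smul, map_sub, hlc, hlc, hlc, hlc, zsmul_eq_mul]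
      push_cast
      exact h.symm
  · simp only [hGl, mul_one]
    exact character_ne_zero hw _
  · intro f hf hne
    exact hbound f (right_ne_zero_of_mul hf) hne

/-- In a nonzero kernel element pick `l` in the support with `l + rhoVec r` of minimal length. The
functional of `exists_separating` kills every other term of the support, but not that of `l`. -/
theorem flatToQuotient_injective (q r : ℕ) (hq : 2 ≤ q) :
    Function.Injective (flatToQuotient q r) := by
  rw [← LinearMap.ker_eq_bot, LinearMap.ker_eq_bot']
  intro x hx
  by_contra hne
  obtain ⟨l, hl, hmin⟩ := Finset.exists_min_image x.support
    (fun f : TypFlat r => sqNorm (f.1 + rhoVec r)) (Finsupp.support_nonempty_iff.mpr hne)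
  obtain ⟨B, hB, hBl, hsep⟩ := exists_separating q hq l
  have hle : relFlat q r ≤ LinearMap.ker (Finsupp.linearCombination ℤ B) :=
    Submodule.span_le.mpr fun y hy => hB y hy
  have hmem : Finsupp.lmapDomain ℤ ℤ (fun e : TypFlat r => e.1) x ∈ relFlat q r :=
    (Submodule.Quotient.mk_eq_zero _).mp hx
  have h := hle hmem
  rw [LinearMap.mem_ker, Finsupp.lmapDomain_apply, Finsupp.linearCombination_mapDomain,
    Finsupp.linearCombination_apply, Finsupp.sum, Finset.sum_eq_single l] at h
  · rcases smul_eq_zero.mp h with h | h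
    · exact Finsupp.mem_support_iff.mp hl h
    · exact hBl h
  · intro f hf hfl
    by_cases h0 : B f.1 = 0
    · simp [h0]
    · exact absurd (hsep f h0 hfl) (not_lt.mpr (hmin f hf))
  · exact fun h => absurd hl h

theorem flatToQuotient_bijective (q r : ℕ) (hq : 2 ≤ q) :
    Function.Bijective (flatToQuotient q r) :=
  ⟨flatToQuotient_injective q r hq, flatToQuotient_surjective q r⟩

end Straightening

/-! ### Operators that preserve the straightening relations -/

section Relations

variable {r : ℕ} {k : Type*} [Field k]

/-- The variable attached to a coordinate, acting by translation. -/
noncomputable def var (i : Fin r) : AddMonoidAlgebra k (Typ r) :=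
  AddMonoidAlgebra.single (basisVec i) 1

/-- The inverse of `var i`. -/
noncomputable def varInv (i : Fin r) : AddMonoidAlgebra k (Typ r) :=
  AddMonoidAlgebra.single (- basisVec i) 1

theorem var_mul_varInv (i : Fin r) : (var i * varInv i : AddMonoidAlgebra k (Typ r)) = 1 := by
  rw [var, varInv, AddMonoidAlgebra.single_mul_single, add_neg_cancel, mul_one]
  rfl

theorem act_var (i : Fin r) (m : Typ r → k) (e : Typ r) : act (var i) m e = m (e + basisVec i) := by
  rw [var, act_single, one_mul]

theorem act_varInv (i : Fin r) (m : Typ r → k) (e : Typ r) :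
    act (varInv i) m e = m (e - basisVec i) := by
  rw [varInv, act_single, one_mul, sub_eq_add_neg]

theorem var_sq (i : Fin r) (c : k) : (algebraMap k (AddMonoidAlgebra k (Typ r)) c) * var i ^ 2 =
    AddMonoidAlgebra.single (basisVec i + basisVec i) c := by
  rw [var, sq, AddMonoidAlgebra.single_mul_single, mul_one, AddMonoidAlgebra.coe_algebraMap]
  simp [AddMonoidAlgebra.single_mul_single]

theorem domCongr_var (i j a : Fin r) :
    AddMonoidAlgebra.domCongr k k (swapEquiv i j) (var a) = var (Equiv.swap i j a) := by
  rw [var, AddMonoidAlgebra.domCongr_single, swapEquiv_basisVec, var]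

theorem domCongr_varInv (i j a : Fin r) :
    AddMonoidAlgebra.domCongr k k (swapEquiv i j) (varInv a) = varInv (Equiv.swap i j a) := by
  rw [varInv, AddMonoidAlgebra.domCongr_single, map_neg, swapEquiv_basisVec, varInv]

/-- The operators that preserve the functions which vanish on `Z`. -/
noncomputable def vanishingStabilizer (Z : Set (Typ r)) : Subalgebra k (AddMonoidAlgebra k (Typ r)) where
  carrier := {P | ∀ m : Typ r → k, (∀ e ∈ Z, m e = 0) → ∀ e ∈ Z, act P m e = 0}
  mul_mem' {P Q} hP hQ m hm := by
    rw [map_mul]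
    exact hP _ (hQ m hm)
  add_mem' {P Q} hP hQ m hm e he := by
    rw [map_add, LinearMap.add_apply, Pi.add_apply, hP m hm e he, hQ m hm e he, add_zero]
  algebraMap_mem' c m hm e he := by
    rw [AlgHom.commutes, Module.algebraMap_end_apply, Pi.smul_apply, hm e he, smul_zero]

theorem single_mem_vanishingStabilizer {Z : Set (Typ r)} {v : Typ r} (hv : ∀ e ∈ Z, e + v ∈ Z)
    (c : k) : AddMonoidAlgebra.single v c ∈ vanishingStabilizer (k := k) Z := fun m hm e he => by
  rw [act_single, hm _ (hv e he), mul_zero]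

/-- The relation for neighbouring coordinates. -/
def PairRel (q : k) (i j : Fin r) (m : Typ r → k) : Prop :=
  ∀ e, m e + q⁻¹ * m (e + (basisVec i - basisVec j)) +
    (m (swapEquiv i j e - (basisVec i - basisVec j)) + q⁻¹ * m (swapEquiv i j e)) = 0

theorem pairRel_iff {q : k} {i j : Fin r} {m : Typ r → k} :
    PairRel q i j m ↔
      ∀ e, act (1 - AddMonoidAlgebra.single (basisVec i - basisVec j) (-q⁻¹)) m e +
        act (1 - AddMonoidAlgebra.single (basisVec i - basisVec j) (-q⁻¹)) m
          (swapEquiv i j e + -(basisVec i - basisVec j)) = 0 := by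
  simp only [PairRel, act_one_sub, ← sub_eq_add_neg, sub_add_cancel, neg_mul, sub_neg_eq_add]

/-- The factor `1 + q⁻¹ X_i X_j⁻¹` commutes with `P`, and a symmetric `P` commutes with the shifted
reflection, so antisymmetry is preserved. -/
theorem PairRel.act {q : k} {i j : Fin r} {m : Typ r → k} (h : PairRel q i j m)
    {P : AddMonoidAlgebra k (Typ r)} (hP : AddMonoidAlgebra.domCongr k k (swapEquiv i j) P = P) :
    PairRel q i j (act P m) := by
  rw [pairRel_iff] at h ⊢
  intro e
  rw [← Module.End.mul_apply, ← map_mul, mul_comm, map_mul, Module.End.mul_apply]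
  nth_rewrite 2 [← hP]
  rw [← act_comp_affine, ← Pi.add_apply, ← map_add]
  have : HermitianHecke.act (1 - AddMonoidAlgebra.single (basisVec i - basisVec j) (-q⁻¹)) m +
      (fun e => HermitianHecke.act (1 - AddMonoidAlgebra.single (basisVec i - basisVec j) (-q⁻¹)) m
        (swapEquiv i j e + -(basisVec i - basisVec j))) = 0 := by
    ext e
    exact h e
  rw [this, map_zero, Pi.zero_apply]

/-- At `e + basisVec j` with equal entries `e i = e j`, the two halves of the relation coincide and
leave `2 q⁻¹` times the asserted quantity. -/
theorem PairRel.add_eq_zero [CharZero k] {q : k} (hq : q ≠ 0) {i j : Fin r} (hij : i ≠ j)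
    {m : Typ r → k} (h : PairRel q i j m) {e : Typ r} (he : e i = e j) :
    m (e + basisVec i) + q * m (e + basisVec j) = 0 := by
  have h1 := h (e + basisVec j)
  have h2 : swapEquiv i j (e + basisVec j) = e + basisVec i := by
    rw [map_add, swapEquiv_basisVec, Equiv.swap_apply_right, swapEquiv_eq_add hij, he, sub_self,
      zero_smul, add_zero]
  rw [h2, show e + basisVec j + (basisVec i - basisVec j) = e + basisVec i by abel,
    show e + basisVec i - (basisVec i - basisVec j) = e + basisVec j by abel] at h1
  have h3 : (2 : k) * (m (e + basisVec i) + q * m (e + basisVec j)) = 0 := by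
    have h4 : q * q⁻¹ = 1 := mul_inv_cancel₀ hq
    linear_combination q * h1 - 2 * m (e + basisVec i) * h4
  exact (mul_eq_zero.mp h3).resolve_left two_ne_zero

/-- The relation for the last coordinate. -/
structure LastRel (q : k) (l : Fin r) (m : Typ r → k) : Prop where
  neg_one : ∀ e : Typ r, e l = -1 → act (1 - var l ^ 2) m e = 0
  neg_two : ∀ e : Typ r, e l = -2 →
    act ((1 - var l ^ 2) * (1 + algebraMap k _ q * var l ^ 2)) m e = 0

/-- The factor of the Hecke polynomial attached to a coordinate. -/
noncomputable def heckeFactor (q : k) (i : Fin r) : AddMonoidAlgebra k (Typ r) :=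
  algebraMap k _ (q ^ 2) * var i ^ 2 + varInv i ^ 2 - algebraMap k _ (q ^ 2 + 1)

theorem var_mem_vanishingStabilizer {Z : Set (Typ r)} {a : Fin r}
    (hv : ∀ e ∈ Z, e + basisVec a ∈ Z) : var a ∈ vanishingStabilizer (k := k) Z :=
  single_mem_vanishingStabilizer hv 1

theorem varInv_mem_vanishingStabilizer {Z : Set (Typ r)} {a : Fin r}
    (hv : ∀ e ∈ Z, e - basisVec a ∈ Z) : varInv a ∈ vanishingStabilizer (k := k) Z :=
  single_mem_vanishingStabilizer (fun e he => by rw [← sub_eq_add_neg]; exact hv e he) 1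

/-- The factor `varInv l` moves the evaluation from `e l = 0` to `-1`, and `varInv l ^ 2 * (1 + q *
var l ^ 2)` moves it to `-2`, where `LastRel` gives zero; `a` and `b` do not leave the hyperplane.
-/
theorem last_vanishing {q : k} {l : Fin r} {K : Typ r → k} (hK : LastRel q l K)
    {a b : AddMonoidAlgebra k (Typ r)}
    (ha : a ∈ vanishingStabilizer {e : Typ r | e l = 0})
    (hb : b ∈ vanishingStabilizer {e : Typ r | e l = 0}) {e : Typ r} (he : e l = 0) :
    act ((1 - var l ^ 2) * (varInv l * a + varInv l * (algebraMap k _ q * var l + varInv l) * b))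
      K e = 0 := by
  have hx := var_mul_varInv (k := k) l
  have e1 : (1 - var l ^ 2) * (varInv l * a + varInv l * (algebraMap k _ q * var l + varInv l) * b)
      = a * (varInv l * (1 - var l ^ 2)) +
        b * (varInv l ^ 2 * ((1 - var l ^ 2) * (1 + algebraMap k _ q * var l ^ 2))) := by
    generalize algebraMap k (AddMonoidAlgebra k (Typ r)) q = c at *
    generalize var (k := k) l = x at *
    generalize varInv (k := k) l = y at *
    grind
  rw [e1, map_add, map_mul, map_mul _ b, LinearMap.add_apply, Pi.add_apply, Module.End.mul_apply,
    Module.End.mul_apply]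
  rw [ha _ _ e he, hb _ _ e he, add_zero]
  · intro e he
    rw [sq, map_mul, map_mul, Module.End.mul_apply, Module.End.mul_apply, act_varInv, act_varInv]
    refine hK.neg_two _ ?_
    have : e l = 0 := he
    simp [basisVec, this]
  · intro e he
    rw [map_mul, Module.End.mul_apply, act_varInv]
    refine hK.neg_one _ ?_
    have : e l = 0 := he
    simp [basisVec, this]

/-- The shape of a certificate for vanishing when both entries are zero. The multiple of `var i + q
* var l` by a symmetric `S` dies by `PairRel`; in the other part the factor `1 - q² X_l²` turns `H`
into `K`, to which `last_vanishing` applies. -/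
theorem vanishing_of_eq [CharZero k] {q : k} (hq : q ≠ 0) {i l : Fin r} (hil : i ≠ l)
    {H K : Typ r → k} (hH : PairRel q i l H) (hK : LastRel q l K)
    (hHK : act (1 - algebraMap k _ (q ^ 2) * var l ^ 2) H = K)
    {e : Typ r} (hei : e i = 0) (hel : e l = 0)
    {P S a b : AddMonoidAlgebra k (Typ r)}
    (hS : AddMonoidAlgebra.domCongr k k (swapEquiv i l) S = S)
    (ha : a ∈ vanishingStabilizer {e : Typ r | e l = 0})
    (hb : b ∈ vanishingStabilizer {e : Typ r | e l = 0})
    (h : P = (var i + algebraMap k _ q * var l) * S +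
      (1 - var l ^ 2) * (1 - algebraMap k _ (q ^ 2) * var l ^ 2) *
        (varInv l * a + varInv l * (algebraMap k _ q * var l + varInv l) * b)) :
    act P H e = 0 := by
  rw [h, map_add, LinearMap.add_apply, Pi.add_apply, map_mul _ _ S, Module.End.mul_apply]
  have h1 := (hH.act hS).add_eq_zero hq hil (hei.trans hel.symm)
  have h2 := last_vanishing hK ha hb hel
  rw [← hHK, ← Module.End.mul_apply, ← map_mul] at h2
  rw [map_add _ (var i), LinearMap.add_apply, Pi.add_apply, act_var, map_mul _ _ (var l), Module.End.mul_apply,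
    AlgHom.commutes, Module.algebraMap_end_apply, Pi.smul_apply, act_var, smul_eq_mul, h1, zero_add,
    mul_right_comm, h2]

theorem vanishing_mul [CharZero k] {q : k} (hq : q ≠ 0) {i l : Fin r} (hil : i ≠ l)
    {H K : Typ r → k} (hH : PairRel q i l H) (hK : LastRel q l K)
    (hHK : act (1 - algebraMap k _ (q ^ 2) * var l ^ 2) H = K)
    {e : Typ r} (hei : e i = 0) (hel : e l = 0) :
    act ((1 - var i ^ 2) * (1 - var l ^ 2) * (heckeFactor q i * heckeFactor q l)) H e = 0 := by
  have hx := var_mul_varInv (k := k) i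
  have hy := var_mul_varInv (k := k) l
  have hmem : ∀ c : k, algebraMap k _ c ∈ vanishingStabilizer {e : Typ r | e l = 0} :=
    fun c => Subalgebra.algebraMap_mem _ _
  have hmx : var (k := k) i ∈ vanishingStabilizer {e : Typ r | e l = 0} :=
    var_mem_vanishingStabilizer fun e he => by
      have : e l = 0 := he
      simp [basisVec, this, hil.symm]
  have hmy : varInv (k := k) i ∈ vanishingStabilizer {e : Typ r | e l = 0} :=
    varInv_mem_vanishingStabilizer fun e he => by
      have : e l = 0 := he
      simp [basisVec, this, hil.symm]
  have hqp : algebraMap k (AddMonoidAlgebra k (Typ r)) q * algebraMap k _ q⁻¹ = 1 := by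
    rw [← map_mul, mul_inv_cancel₀ hq, map_one]
  set c : AddMonoidAlgebra k (Typ r) := algebraMap k _ q with hc
  set p : AddMonoidAlgebra k (Typ r) := algebraMap k _ q⁻¹ with hp
  have hmc : c ∈ vanishingStabilizer {e : Typ r | e l = 0} := hmem q
  have hmp : p ∈ vanishingStabilizer {e : Typ r | e l = 0} := hmem q⁻¹
  have h1 : (1 : AddMonoidAlgebra k (Typ r)) ∈ vanishingStabilizer {e : Typ r | e l = 0} :=
    one_mem _
  -- An explicit certificate. `S` is symmetric in the two variables, while `a` and `b` involve only
  -- the variable of `i` and so preserve the hyperplane `e l = 0`. The identity itself follows from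
  -- `x x⁻¹ = 1` for both variables and for `q`.
  refine vanishing_of_eq hq hil hH hK hHK hei hel
    (S := -(c+1)*p*((1-var i^2)*(1-var l^2)*(varInv i-c^2*var i)*(varInv l-c^2*var l)*
      (varInv i+varInv l)))
    (a := (c+1)*p*(1+c)*(1-var i^2)*(varInv i-c^2*var i))
    (b := (1-var i^2)*(varInv i-c^2*var i)*(varInv i-var i)+
      (c+1)*p*(1-var i^2)*(varInv i-c^2*var i)*var i) ?_ ?_ ?_ ?_
  · simp only [map_mul, map_add, map_sub, map_neg, map_one, map_pow, domCongr_var,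
      domCongr_varInv, Equiv.swap_apply_left, Equiv.swap_apply_right, hc, hp, AlgEquiv.commutes]
    ring
  · exact mul_mem (mul_mem (mul_mem (mul_mem (add_mem hmc h1) hmp) (add_mem h1 hmc))
      (sub_mem h1 (pow_mem hmx 2))) (sub_mem hmy (mul_mem (pow_mem hmc 2) hmx))
  · exact add_mem (mul_mem (mul_mem (sub_mem h1 (pow_mem hmx 2))
      (sub_mem hmy (mul_mem (pow_mem hmc 2) hmx))) (sub_mem hmy hmx))
      (mul_mem (mul_mem (mul_mem (mul_mem (add_mem hmc h1) hmp) (sub_mem h1 (pow_mem hmx 2)))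
      (sub_mem hmy (mul_mem (pow_mem hmc 2) hmx))) hmx)
  · simp only [heckeFactor, map_add, map_pow, map_one, ← hc]
    clear_value c p
    generalize var (k := k) l = y at *
    generalize varInv (k := k) l = y' at *
    generalize var (k := k) i = x at *
    generalize varInv (k := k) i = x' at *
    clear hmem hmx hmy hmc hmp h1 hH hK hHK hc hp
    grind

theorem vanishing_add [CharZero k] {q : k} (hq : q ≠ 0) {i l : Fin r} (hil : i ≠ l)
    {H K : Typ r → k} (hH : PairRel q i l H) (hK : LastRel q l K)
    (hHK : act (1 - algebraMap k _ (q ^ 2) * var l ^ 2) H = K)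
    {e : Typ r} (hei : e i = 0) (hel : e l = 0) :
    act ((1 - var i ^ 2) * (1 - var l ^ 2) * (heckeFactor q i + heckeFactor q l)) H e = 0 := by
  have hx := var_mul_varInv (k := k) i
  have hy := var_mul_varInv (k := k) l
  have hmem : ∀ c : k, algebraMap k _ c ∈ vanishingStabilizer {e : Typ r | e l = 0} :=
    fun c => Subalgebra.algebraMap_mem _ _
  have hmx : var (k := k) i ∈ vanishingStabilizer {e : Typ r | e l = 0} :=
    var_mem_vanishingStabilizer fun e he => by
      have : e l = 0 := he
      simp [basisVec, this, hil.symm]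
  have hmy : varInv (k := k) i ∈ vanishingStabilizer {e : Typ r | e l = 0} :=
    varInv_mem_vanishingStabilizer fun e he => by
      have : e l = 0 := he
      simp [basisVec, this, hil.symm]
  have hqp : algebraMap k (AddMonoidAlgebra k (Typ r)) q * algebraMap k _ q⁻¹ = 1 := by
    rw [← map_mul, mul_inv_cancel₀ hq, map_one]
  set c : AddMonoidAlgebra k (Typ r) := algebraMap k _ q with hc
  set p : AddMonoidAlgebra k (Typ r) := algebraMap k _ q⁻¹ with hp
  have hmc : c ∈ vanishingStabilizer {e : Typ r | e l = 0} := hmem q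
  have hmp : p ∈ vanishingStabilizer {e : Typ r | e l = 0} := hmem q⁻¹
  have h1 : (1 : AddMonoidAlgebra k (Typ r)) ∈ vanishingStabilizer {e : Typ r | e l = 0} :=
    one_mem _
  -- The corresponding certificate for the sum of the two Hecke factors; again `a` and `b` are free
  -- of the variable of `l`.
  refine vanishing_of_eq hq hil hH hK hHK hei hel
    (S := (1-var i^2)*(1-var l^2)*(var i+var l)*
      (c^2+p*varInv i^2*varInv l^2-(c+1)*varInv i*varInv l))
    (a := -(1+p)*(1-var i^2)*(varInv i-c*var i))
    (b := (1-p)*(1-var i^2)) ?_ ?_ ?_ ?_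
  · simp only [map_mul, map_add, map_sub, map_one, map_pow, domCongr_var,
      domCongr_varInv, Equiv.swap_apply_left, Equiv.swap_apply_right, hc, hp, AlgEquiv.commutes]
    ring
  · exact mul_mem (mul_mem (neg_mem (add_mem h1 hmp)) (sub_mem h1 (pow_mem hmx 2)))
      (sub_mem hmy (mul_mem hmc hmx))
  · exact mul_mem (sub_mem h1 hmp) (sub_mem h1 (pow_mem hmx 2))
  · simp only [heckeFactor, map_add, map_pow, map_one, ← hc]
    clear_value c p
    generalize var (k := k) l = y at *
    generalize varInv (k := k) l = y' at *
    generalize var (k := k) i = x at *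
    generalize varInv (k := k) i = x' at *
    clear hmem hmx hmy hmc hmp h1 hH hK hHK hc hp
    grind

end Relations

/-! ### Division by the Hecke denominators -/

section Division

variable {r : ℕ} {k : Type*} [Field k]

/-- The sum of the coordinates. -/
def coordSum (r : ℕ) : Typ r →+ ℤ where
  toFun e := ∑ k, e k
  map_zero' := by simp
  map_add' e f := by simp [Finset.sum_add_distrib]

theorem coordSum_basisVec (i : Fin r) : coordSum r (basisVec i) = 1 := by
  simp [coordSum, basisVec, Pi.single_apply]

theorem coordSum_swapEquiv (i j : Fin r) (e : Typ r) :
    coordSum r (swapEquiv i j e) = coordSum r e :=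
  Equiv.sum_comp (Equiv.swap i j) e

theorem Bdd.act {R : Type*} [CommRing R] {ht : Typ r →+ ℤ} {m : Typ r → R} (h : Bdd ht m)
    (P : AddMonoidAlgebra R (Typ r)) : Bdd ht (act P m) := by
  induction P using AddMonoidAlgebra.induction_linear with
  | zero => exact ⟨0, fun e _ => by simp⟩
  | add f g hf hg =>
    obtain ⟨C, hC⟩ := hf
    obtain ⟨D, hD⟩ := hg
    exact ⟨max C D, fun e he => by
      rw [map_add, LinearMap.add_apply, Pi.add_apply, hC e (by omega), hD e (by omega), add_zero]⟩
  | single v a =>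
    obtain ⟨C, hC⟩ := h
    exact ⟨C - ht v, fun e he => by rw [act_single, hC _ (by rw [map_add]; omega), mul_zero]⟩

theorem injective_double : Function.Injective fun i : Fin r => basisVec i + basisVec i := by
  intro i j h
  have h1 := congrFun h i
  by_contra hne
  simp [basisVec, hne] at h1

/-- The factor `1 - c X_i ^ 2`. -/
noncomputable def denomFactor (c : k) (i : Fin r) : AddMonoidAlgebra k (Typ r) :=
  1 - algebraMap k _ c * var i ^ 2

theorem prod_denomFactor (c : k) (s : Finset (Fin r)) :
    ∏ i ∈ s, denomFactor c i =
      ∏ v ∈ s.image (fun i => basisVec i + basisVec i), (1 - AddMonoidAlgebra.single v c) := by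
  rw [Finset.prod_image fun a _ b _ h => injective_double h]
  exact Finset.prod_congr rfl fun i _ => by rw [denomFactor, var_sq]

/-- The full product of denominators is symmetric in the coordinates, and the coordinate sum is a
height invariant under permutations, so `antisymm_of_act` applies. -/
theorem PairRel.of_div {q c : k} {i j : Fin r} {H : Typ r → k} (hb : Bdd (coordSum r) H)
    (h : PairRel q i j (HermitianHecke.act (∏ a, denomFactor c a) H)) : PairRel q i j H := by
  rw [pairRel_iff] at h ⊢
  refine antisymm_of_act (coordSum r) (Finset.univ.image fun i => basisVec i + basisVec i) ?_
    (fun _ => c) (swapEquiv i j) _ (coordSum_swapEquiv i j) ?_ (fun _ => rfl) _ (hb.act _) ?_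
  · intro v hv
    obtain ⟨a, -, rfl⟩ := Finset.mem_image.mp hv
    rw [map_add, coordSum_basisVec]
    norm_num
  · intro v hv
    obtain ⟨a, -, rfl⟩ := Finset.mem_image.mp hv
    rw [map_add, swapEquiv_basisVec]
    exact Finset.mem_image_of_mem _ (Finset.mem_univ _)
  · intro e
    rw [← prod_denomFactor, ← Module.End.mul_apply, ← map_mul, mul_comm, map_mul,
      Module.End.mul_apply]
    exact h e

theorem denomFactor_mem {Z : Set (Typ r)} {a : Fin r} (hv : ∀ e ∈ Z, e + basisVec a ∈ Z) (c : k) :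
    denomFactor c a ∈ vanishingStabilizer (k := k) Z :=
  sub_mem (one_mem _) (mul_mem (Subalgebra.algebraMap_mem _ _)
    (pow_mem (var_mem_vanishingStabilizer hv) 2))

/-- The operator does not involve the coordinate `l`, so it acts on each hyperplane `e l = z`
separately. Cutting `n` off to one hyperplane and using the sum of the other coordinates as height,
injectivity of the operator gives the claim. -/
theorem vanishing_of_div {c : k} {l : Fin r} {n : Typ r → k} (hb : Bdd (coordSum r) n) (z : ℤ)
    (h : ∀ e : Typ r, e l = z → act (∏ a ∈ Finset.univ.erase l, denomFactor c a) n e = 0)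
    {e : Typ r} (he : e l = z) : n e = 0 := by
  classical
  let n' : Typ r → k := fun e => if e l = z then n e else 0
  have hP : ∀ Z : Set (Typ r), (∀ e ∈ Z, ∀ a ≠ l, e + basisVec a ∈ Z) →
      ∏ a ∈ Finset.univ.erase l, denomFactor c a ∈ vanishingStabilizer (k := k) Z := fun Z hZ =>
    prod_mem fun a ha => denomFactor_mem (fun e he => hZ e he a (Finset.ne_of_mem_erase ha)) c
  have hn' : act (∏ a ∈ Finset.univ.erase l, denomFactor c a) n' = 0 := by
    ext e
    by_cases he : e l = z
    · have h1 : act (∏ a ∈ Finset.univ.erase l, denomFactor c a) (n' - n) e = 0 := by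
        refine hP {e | e l = z} (fun e he a ha => ?_) _ (fun e he => ?_) e he
        · have : e l = z := he
          simp [basisVec, ha.symm, this]
        · have : e l = z := he
          simp [n', this]
      rw [map_sub, Pi.sub_apply, h e he, sub_zero] at h1
      exact h1
    · refine hP {e | e l ≠ z} (fun e he a ha => ?_) _ (fun e he => ?_) e he
      · have : e l ≠ z := he
        simp [basisVec, ha.symm, this]
      · have : e l ≠ z := he
        simp [n', this]
  rw [prod_denomFactor] at hn'
  let ht : Typ r →+ ℤ := coordSum r - (Pi.evalAddMonoidHom (fun _ => ℤ) l)
  have hht : ∀ e, ht e = coordSum r e - e l := fun e => rfl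
  have h0 := eq_zero_of_act_eq_zero ht _ (fun v hv => by
    obtain ⟨a, ha, rfl⟩ := Finset.mem_image.mp hv
    have ha' := Finset.ne_of_mem_erase ha
    rw [hht, map_add, coordSum_basisVec]
    simp [basisVec, ha'.symm]) (fun _ => c) n' (by
      obtain ⟨C, hC⟩ := hb
      refine ⟨C - z, fun e he => ?_⟩
      simp only [n']
      split_ifs with h1
      · rw [hht] at he
        exact hC e (by omega)
      · rfl) hn'
  have := congrFun h0 e
  simpa [n', he] using this

/-- Only denominators in the other coordinates are divided out: they preserve the hyperplanes `e l =
-1` and `e l = -2`, whereas the factor at `l` mixes hyperplanes. -/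
theorem LastRel.of_div {q c : k} {l : Fin r} {K : Typ r → k} (hb : Bdd (coordSum r) K)
    (h : LastRel q l (act (∏ a ∈ Finset.univ.erase l, denomFactor c a) K)) : LastRel q l K where
  neg_one e he := vanishing_of_div (c := c) (hb.act _) (-1) (fun e he => by
    rw [← Module.End.mul_apply, ← map_mul, mul_comm, map_mul, Module.End.mul_apply]
    exact h.neg_one e he) he
  neg_two e he := vanishing_of_div (c := c) (hb.act _) (-2) (fun e he => by
    rw [← Module.End.mul_apply, ← map_mul, mul_comm, map_mul, Module.End.mul_apply]
    exact h.neg_two e he) he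

theorem domCongr_prod_erase_heckeFactor (q : k) (i j a : Fin r) :
    AddMonoidAlgebra.domCongr k k (swapEquiv i j)
      (∏ b ∈ Finset.univ.erase a, heckeFactor q b) =
      ∏ b ∈ Finset.univ.erase (Equiv.swap i j a), heckeFactor q b := by
  rw [map_prod]
  refine Finset.prod_nbij (Equiv.swap i j) ?_ ((Equiv.swap i j).injective.injOn) ?_ ?_
  · intro b hb
    simpa using hb
  · intro b hb
    exact ⟨Equiv.swap i j b, by
      have : b ≠ Equiv.swap i j a := by simpa using hb
      simp only [Finset.coe_erase, Finset.coe_univ, Set.mem_sdiff, Set.mem_univ, true_and,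
        Set.mem_singleton_iff]
      rintro rfl
      simp at this, by simp⟩
  · intro b _
    simp only [heckeFactor, map_sub, map_add, map_mul, map_pow, domCongr_var, domCongr_varInv,
      AlgEquiv.commutes]

/-- The two Hecke polynomials: the product of the factors, and the sum of the products of all
factors but one. -/
noncomputable def heckePoly (q : k) (r : ℕ) : Bool → AddMonoidAlgebra k (Typ r)
  | false => ∏ a, heckeFactor q a
  | true => ∑ b, ∏ a ∈ Finset.univ.erase b, heckeFactor q a

theorem domCongr_heckePoly (q : k) (i j : Fin r) (b : Bool) :
    AddMonoidAlgebra.domCongr k k (swapEquiv i j) (heckePoly q r b) = heckePoly q r b := by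
  cases b with
  | false =>
    simp only [heckePoly]
    rw [map_prod, ← Equiv.prod_comp (Equiv.swap i j)]
    exact Finset.prod_congr rfl fun b _ => by
      simp only [heckeFactor, map_sub, map_add, map_mul, map_pow, domCongr_var, domCongr_varInv,
        AlgEquiv.commutes]
      simp
  | true =>
    simp only [heckePoly]
    rw [map_sum, ← Equiv.sum_comp (Equiv.swap i j)]
    exact Finset.sum_congr rfl fun a _ => by
      rw [domCongr_prod_erase_heckeFactor, Equiv.swap_apply_self]

/-- In terms of two chosen factors, the product of all factors is a multiple of their product, and
the sum of the products of all but one is a combination of their product and their sum. The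
coefficients involve only the other coordinates, so two vanishing statements suffice for both
operators. -/
theorem heckePoly_eq (q : k) {i l : Fin r} (hil : i ≠ l) (b : Bool) {Z : Set (Typ r)}
    (hZ : ∀ e ∈ Z, ∀ a, a ≠ i → a ≠ l → e + basisVec a ∈ Z ∧ e - basisVec a ∈ Z) :
    ∃ G₁ ∈ vanishingStabilizer (k := k) Z, ∃ G₂ ∈ vanishingStabilizer (k := k) Z,
      heckePoly q r b =
        G₁ * (heckeFactor q i * heckeFactor q l) + G₂ * (heckeFactor q i + heckeFactor q l) := by
  have hf : ∀ a, a ≠ i → a ≠ l → heckeFactor q a ∈ vanishingStabilizer (k := k) Z :=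
    fun a h1 h2 => sub_mem (add_mem (mul_mem (Subalgebra.algebraMap_mem _ _)
      (pow_mem (var_mem_vanishingStabilizer fun e he => (hZ e he a h1 h2).1) 2))
      (pow_mem (varInv_mem_vanishingStabilizer fun e he => (hZ e he a h1 h2).2) 2))
      (Subalgebra.algebraMap_mem _ _)
  set s : Finset (Fin r) := (Finset.univ.erase l).erase i with hs
  have hi : i ∈ Finset.univ.erase l := by simp [hil]
  have hms : ∀ a ∈ s, a ≠ i ∧ a ≠ l := fun a ha => by simpa [hs] using ha
  have hprod : ∀ t ⊆ s, ∏ a ∈ t, heckeFactor q a ∈ vanishingStabilizer (k := k) Z :=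
    fun t ht => prod_mem fun a ha => hf a (hms a (ht ha)).1 (hms a (ht ha)).2
  cases b with
  | false =>
    refine ⟨_, hprod s subset_rfl, 0, zero_mem _, ?_⟩
    rw [heckePoly, ← Finset.mul_prod_erase _ _ (Finset.mem_univ l), ← Finset.mul_prod_erase _ _ hi]
    ring
  | true =>
    refine ⟨∑ b ∈ s, ∏ a ∈ s.erase b, heckeFactor q a,
      sum_mem fun b _ => hprod _ (Finset.erase_subset _ _), _, hprod s subset_rfl, ?_⟩
    rw [heckePoly, ← Finset.add_sum_erase _ _ (Finset.mem_univ l), ← Finset.add_sum_erase _ _ hi,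
      ← Finset.mul_prod_erase _ _ hi, Finset.sum_mul]
    have h1 : ∏ a ∈ Finset.univ.erase i, heckeFactor q a =
        heckeFactor q l * ∏ a ∈ s, heckeFactor q a := by
      rw [← Finset.mul_prod_erase _ _ (show l ∈ Finset.univ.erase i by simp [hil.symm]), hs,
        Finset.erase_right_comm]
    have h2 : ∑ b ∈ s, ∏ a ∈ Finset.univ.erase b, heckeFactor q a =
        ∑ b ∈ s, (∏ a ∈ s.erase b, heckeFactor q a) * (heckeFactor q i * heckeFactor q l) := by
      refine Finset.sum_congr rfl fun b hb => ?_
      rw [← Finset.mul_prod_erase _ _ (show l ∈ Finset.univ.erase b by simp [(hms b hb).2.symm]),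
        ← Finset.mul_prod_erase _ _ (show i ∈ (Finset.univ.erase b).erase l by
          simp [(hms b hb).1.symm, hil]),
        show ((Finset.univ.erase b).erase l).erase i = s.erase b by
          rw [hs, Finset.erase_right_comm (a := b) (b := l), Finset.erase_right_comm (a := b)]]
      ring
    rw [h1, h2]
    ring

/-- The coefficients of a Hecke translate vanish where the last two coordinates do. -/
theorem heckePoly_vanishing [CharZero k] {q : k} (hq : q ≠ 0) {i l : Fin r} (hil : i ≠ l)
    {H : Typ r → k} (hb : Bdd (coordSum r) H)
    (hR : PairRel q i l (act (∏ a, denomFactor (q ^ 2) a) H))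
    (hL : LastRel q l (act (∏ a, denomFactor (q ^ 2) a) H)) (b : Bool)
    {e : Typ r} (hei : e i = 0) (hel : e l = 0) :
    act (∏ a, denomFactor 1 a) (act (heckePoly q r b) H) e = 0 := by
  have hH := hR.of_div hb
  -- The relation for the last entry survives only if the denominator of the coordinate `l` is kept;
  -- `H` itself satisfies the relation for neighbours.
  have hK : LastRel q l (act (denomFactor (q ^ 2) l) H) := by
    refine LastRel.of_div (c := q ^ 2) (hb.act _) ?_
    rwa [← Module.End.mul_apply, ← map_mul, Finset.prod_erase_mul _ _ (Finset.mem_univ l)]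
  set Z : Set (Typ r) := {e | e i = 0 ∧ e l = 0} with hZ
  have hst : ∀ e ∈ Z, ∀ a, a ≠ i → a ≠ l → e + basisVec a ∈ Z ∧ e - basisVec a ∈ Z := by
    rintro e ⟨h1, h2⟩ a hai hal
    simp [hZ, basisVec, h1, h2, hai.symm, hal.symm]
  obtain ⟨G₁, hG₁, G₂, hG₂, hG⟩ := heckePoly_eq q hil b hst
  have hi : i ∈ Finset.univ.erase l := by simp [hil]
  have hd : ∏ a ∈ (Finset.univ.erase l).erase i, denomFactor (1 : k) a ∈ vanishingStabilizer Z :=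
    prod_mem fun a ha => by
      have : a ≠ i ∧ a ≠ l := by simpa using ha
      exact denomFactor_mem (fun e he => (hst e he a this.1 this.2).1) 1
  have hd1 : ∀ a : Fin r, denomFactor (1 : k) a = 1 - var a ^ 2 := fun a => by
    rw [denomFactor, map_one, one_mul]
  rw [← Module.End.mul_apply, ← map_mul]
  have : (∏ a, denomFactor (1 : k) a) * heckePoly q r b =
      (∏ a ∈ (Finset.univ.erase l).erase i, denomFactor (1 : k) a) *
        (G₁ * ((1 - var i ^ 2) * (1 - var l ^ 2) * (heckeFactor q i * heckeFactor q l)) +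
          G₂ * ((1 - var i ^ 2) * (1 - var l ^ 2) * (heckeFactor q i + heckeFactor q l))) := by
    rw [hG, ← Finset.mul_prod_erase _ _ (Finset.mem_univ l), ← Finset.mul_prod_erase _ _ hi,
      hd1, hd1]
    ring
  rw [this, map_mul, Module.End.mul_apply]
  refine hd _ (fun e he => ?_) e ⟨hei, hel⟩
  rw [map_add, LinearMap.add_apply, Pi.add_apply, map_mul _ G₁, map_mul _ G₂,
    Module.End.mul_apply, Module.End.mul_apply,
    hG₁ _ (fun e he => vanishing_mul hq hil hH hK rfl he.1 he.2) e he,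
    hG₂ _ (fun e he => vanishing_add hq hil hH hK rfl he.1 he.2) e he, add_zero]

end Division

/-! ### Rescaling -/

section Rescaling

variable {r : ℕ} {w : Fin r → ℚ}

/-- The substitution that describes the action on functions divided by `character w`. -/
noncomputable def twist (w : Fin r → ℚ) (hw : ∀ i, w i ≠ 0) :
    AddMonoidAlgebra ℤ (Typ r) →ₐ[ℤ] AddMonoidAlgebra ℚ (Typ r) :=
  AddMonoidAlgebra.lift ℤ (AddMonoidAlgebra ℚ (Typ r)) (Typ r)
    { toFun := fun v => AddMonoidAlgebra.single v.toAdd (character w v.toAdd)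
      map_one' := by
        rw [toAdd_one, show character w 0 = 1 by simp [character]]
        rfl
      map_mul' := fun v u => by
        rw [toAdd_mul, character_add hw, AddMonoidAlgebra.single_mul_single] }

theorem twist_single (hw : ∀ i, w i ≠ 0) (v : Typ r) (c : ℤ) :
    twist w hw (AddMonoidAlgebra.single v c) =
      AddMonoidAlgebra.single v ((c : ℚ) * character w v) := by
  simp [twist, AddMonoidAlgebra.lift_single]

theorem cast_act (hw : ∀ i, w i ≠ 0) (P : AddMonoidAlgebra ℤ (Typ r)) (m : Typ r → ℤ) (e : Typ r) :
    ((act P m e : ℤ) : ℚ) =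
      character w e * act (twist w hw P) (fun e => (m e : ℚ) / character w e) e := by
  induction P using AddMonoidAlgebra.induction_linear with
  | zero => simp
  | add f g hf hg =>
    simp only [map_add, LinearMap.add_apply, Pi.add_apply, Int.cast_add, hf, hg, mul_add]
  | single v a =>
    rw [act_single, twist_single, act_single, character_add hw]
    have h1 := character_ne_zero hw e
    have h2 := character_ne_zero hw v
    push_cast
    field_simp

theorem act_div_character (hw : ∀ i, w i ≠ 0) (P : AddMonoidAlgebra ℤ (Typ r)) (m : Typ r → ℤ) :
    (fun e => ((act P m e : ℤ) : ℚ) / character w e) =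
      act (twist w hw P) (fun e => (m e : ℚ) / character w e) := by
  ext e
  rw [cast_act hw, mul_div_cancel_left₀ _ (character_ne_zero hw e)]

end Rescaling

/-! ### Extending functions along the straightening map -/

section Straighten

variable {r : ℕ}

/-- The function on all vectors obtained from `g` by straightening. -/
noncomputable def straighten (q r : ℕ) (g : TypFlat r → ℤ) (e : Typ r) : ℤ :=
  pairing g (strFlat q r (delta e))

theorem pairing_eq_linearCombination (g : TypFlat r → ℤ) (x : TypFlat r →₀ ℤ) :
    pairing g x = Finsupp.linearCombination ℤ g x := by
  rw [pairing, Finsupp.linearCombination_apply]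
  exact Finsupp.sum_congr fun e _ => mul_comm _ _

theorem pairing_strFlat (q : ℕ) (g : TypFlat r → ℤ) (x : Typ r →₀ ℤ) :
    pairing g (strFlat q r x) = Finsupp.linearCombination ℤ (straighten q r g) x := by
  rw [pairing_eq_linearCombination]
  induction x using Finsupp.induction_linear with
  | zero => simp
  | add f g hf hg => rw [map_add, map_add, map_add, hf, hg]
  | single e c =>
    have h : Finsupp.single e c = c • delta e := by simp [delta]
    rw [h, map_smul, map_smul, map_smul, ← pairing_eq_linearCombination]
    simp [straighten, delta]

variable {q : ℕ}

theorem strFlat_eq (hq : 2 ≤ q) {x : Typ r →₀ ℤ} {y : TypFlat r →₀ ℤ}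
    (h : flatToQuotient q r y = (relFlat q r).mkQ x) : strFlat q r x = y := by
  rw [strFlat, dif_pos (flatToQuotient_bijective q r hq)]
  exact (LinearEquiv.symm_apply_eq _).mpr h.symm

theorem straighten_relator (hq : 2 ≤ q) (g : TypFlat r → ℤ) {x : Typ r →₀ ℤ}
    (hx : IsRelator q r x) : Finsupp.linearCombination ℤ (straighten q r g) x = 0 := by
  rw [← pairing_strFlat, strFlat_eq hq (y := 0), pairing, Finsupp.sum_zero_index]
  rw [map_zero, mkQ_eq_zero_of_isRelator hx]

/-- Straightening does not lower the sum of the entries (`mkQ_delta_mem_dominantImage`), so a vector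
of large sum straightens to dominant vectors outside the finite support of `g`. -/
theorem bdd_straighten (hq : 2 ≤ q) {g : TypFlat r → ℤ} (hg : (Function.support g).Finite) :
    Bdd (coordSum r) (straighten q r g) := by
  obtain ⟨C, hC⟩ := (hg.image fun f => coordSum r f.1).bddAbove
  refine ⟨C, fun e he => ?_⟩
  obtain ⟨y, hy, hyx⟩ := mkQ_delta_mem_dominantImage q (∑ k, e k) e le_rfl
  rw [straighten, strFlat_eq hq hyx, pairing]
  refine Finset.sum_eq_zero fun f hf => ?_
  have h1 : ∑ k, e k ≤ ∑ k, f.1 k := (Finsupp.mem_supported ℤ y).mp hy hf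
  have h2 : g f = 0 := by
    by_contra h
    have : coordSum r f.1 ≤ C := hC ⟨f, h, rfl⟩
    have h3 : coordSum r e ≤ coordSum r f.1 := h1
    omega
  simp only [h2, zero_mul]

/-- The scaling factors `(-q) ^ (k - (r - 1))`. -/
noncomputable def scale (q r : ℕ) (k : Fin r) : ℚ := (-(q : ℚ)) ^ ((k : ℤ) - (r - 1))

theorem scale_ne_zero (hq : 2 ≤ q) (i : Fin r) : scale q r i ≠ 0 :=
  zpow_ne_zero _ (neg_ne_zero.mpr (by positivity))

theorem scale_adjacent (hq : 2 ≤ q) {i j : Fin r} (hij : (i : ℕ) + 1 = j) :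
    scale q r j = -(q : ℚ) * scale q r i := by
  have : (j : ℤ) - (r - 1) = ((i : ℤ) - (r - 1)) + 1 := by omega
  rw [scale, scale, this, zpow_add_one₀ (neg_ne_zero.mpr (by positivity)), mul_comm]

theorem scale_sq (hq : 2 ≤ q) (k : Fin r) :
    (q : ℚ) ^ (2 * (r - 1 - (k : ℕ))) * (scale q r k) ^ 2 = 1 := by
  have hq0 : (q : ℚ) ≠ 0 := by positivity
  have h : ((k : ℤ) - (r - 1)) = -((r - 1 - (k : ℕ) : ℕ) : ℤ) := by omega
  rw [scale, h, zpow_neg, zpow_natCast, inv_pow, ← pow_mul, mul_comm 2, neg_pow]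
  simp only [mul_comm _ 2, pow_mul, neg_one_sq, one_pow, one_mul]
  exact mul_inv_cancel₀ (by positivity)

theorem adjacent_ne {i j : Fin r} (hij : (i : ℕ) + 1 = j) : i ≠ j := by
  rintro rfl
  omega

/-- The relators are the rescaled relation at vectors with `e i < e j`. The relation is unchanged
under the shifted reflection, which carries all other vectors into this range. -/
theorem pairRel_straighten (hq : 2 ≤ q) (g : TypFlat r → ℤ) {i j : Fin r}
    (hij : (i : ℕ) + 1 = j) :
    PairRel (q : ℚ) i j (fun e => (straighten q r g e : ℚ) / character (scale q r) e) := by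
  have hne := adjacent_ne hij
  have hq0 : (q : ℚ) ≠ 0 := by positivity
  have hw := scale_ne_zero (r := r) hq
  have key : ∀ f : Typ r, f i < f j → (straighten q r g f : ℚ) -
      straighten q r g (f + (basisVec i - basisVec j)) - (-(q : ℚ)) ^ (f j - f i - 1) *
        (straighten q r g (swapEquiv i j f) -
          straighten q r g (swapEquiv i j f - (basisVec i - basisVec j))) = 0 := by
    intro f hf
    obtain ⟨n, hn⟩ : ∃ n : ℕ, f j = f i + 1 + n := ⟨(f j - f i - 1).toNat, by omega⟩
    have h1 : put f i j (f i + 1) (f i + n) = f + (basisVec i - basisVec j) := by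
      rw [← one_smul ℤ (basisVec i - basisVec j), ← put_eq_add hne, hn]
      congr 1
      ring
    have h2 : put f i j (f i + 1 + n) (f i) = swapEquiv i j f := by
      rw [swapEquiv_eq_add hne, ← put_eq_add hne, hn]
      congr 1 <;> ring
    have h3 : put f i j (f i + n) (f i + 1) = swapEquiv i j f - (basisVec i - basisVec j) := by
      rw [swapEquiv_eq_add hne, add_sub_assoc, zsmul_sub_self, ← put_eq_add hne, hn]
      congr 1 <;> ring
    have h := straighten_relator hq g (IsRelator.pair f i j hij (f i) n)
    have hlc : ∀ e : Typ r, Finsupp.linearCombination ℤ (straighten q r g) (delta e) =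
        straighten q r g e := fun e => by simp [delta]
    rw [h1, h2, h3, ← hn, put_self, map_sub, map_sub, map_smul, map_sub, hlc, hlc, hlc, hlc,
      smul_eq_mul] at h
    rw [hn, show f i + 1 + (n : ℤ) - f i - 1 = n by ring, zpow_natCast]
    exact_mod_cast h
  have key2 : ∀ f : Typ r, f i < f j →
      (straighten q r g f : ℚ) / character (scale q r) f +
        (q : ℚ)⁻¹ * (straighten q r g (f + (basisVec i - basisVec j)) /
          character (scale q r) (f + (basisVec i - basisVec j))) +
      (straighten q r g (swapEquiv i j f - (basisVec i - basisVec j)) /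
          character (scale q r) (swapEquiv i j f - (basisVec i - basisVec j)) +
        (q : ℚ)⁻¹ * (straighten q r g (swapEquiv i j f) /
          character (scale q r) (swapEquiv i j f))) = 0 := by
    intro f hf
    have h := pair_relation hw (q : ℚ) hq0 hne (scale_adjacent hq hij)
      (fun e => (straighten q r g e : ℚ) / character (scale q r) e) f
    have hc : ∀ e, character (scale q r) e *
        ((straighten q r g e : ℚ) / character (scale q r) e) = straighten q r g e :=
      fun e => mul_div_cancel₀ _ (character_ne_zero hw e)
    simp only [hc] at h
    rw [key f hf] at h
    exact (mul_eq_zero.mp h).resolve_left (character_ne_zero hw f)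
  intro e
  rcases lt_or_ge (e i) (e j) with hlt | hge
  · exact key2 e hlt
  -- The shifted reflection sends entries `(a, b)` to `(b - 1, a + 1)`, which are increasing if `a ≥
  -- b`.
  · have hs : swapEquiv i j (swapEquiv i j e - (basisVec i - basisVec j)) =
        e + (basisVec i - basisVec j) := by
      rw [map_sub, map_sub, swapEquiv_basisVec, swapEquiv_basisVec, Equiv.swap_apply_left,
        Equiv.swap_apply_right]
      have : swapEquiv i j (swapEquiv i j e) = e := by
        ext k
        simp [swapEquiv_apply]
      rw [this]
      abel
    have h := key2 (swapEquiv i j e - (basisVec i - basisVec j)) (by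
      simp [swapEquiv_apply, basisVec, hne, hne.symm]
      omega)
    rw [hs, add_sub_cancel_right, sub_add_cancel] at h
    linear_combination h

theorem lastRel_straighten (hq : 2 ≤ q) (g : TypFlat r → ℤ) {l : Fin r} (hl : (l : ℕ) + 1 = r) :
    LastRel (q : ℚ) l (fun e => (straighten q r g e : ℚ) / character (scale q r) e) := by
  have hw := scale_ne_zero (r := r) hq
  have hlc : ∀ e : Typ r, Finsupp.linearCombination ℤ (straighten q r g) (delta e) =
        straighten q r g e := fun e => by simp [delta]
  -- With weight `1` at the last coordinate, rescaling is invisible to shifts of that coordinate,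
  -- and the scaling factors are rational.
  have hwl : scale q r l = 1 := by
    rw [scale, show (l : ℤ) - (r - 1) = 0 by omega, zpow_zero]
  have hchi : ∀ e : Typ r, character (scale q r) (e + basisVec l) = character (scale q r) e :=
    fun e => by rw [character_add hw, character_basisVec, hwl, mul_one]
  have hup : ∀ e : Typ r, e + basisVec l + basisVec l = Function.update e l (e l + 2) := fun e => by
    have := update_eq_add l e 1
    rw [mul_one, one_smul, ← add_assoc] at this
    exact this.symm
  constructor
  · intro e he
    have h := straighten_relator hq g (IsRelator.lastOne e l hl)
    rw [map_sub, hlc, hlc, ← he, Function.update_eq_self] at h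
    rw [map_sub, map_one, LinearMap.sub_apply, Pi.sub_apply, sq, map_mul, Module.End.mul_apply,
      act_var, act_var, Module.End.one_apply, hchi, hchi, hup e, he, ← sub_div]
    norm_num
    left
    exact_mod_cast h
  · intro e he
    have h := straighten_relator hq g (IsRelator.last e l hl 0)
    rw [map_sub, map_sub, map_smul, map_sub, hlc, hlc, hlc, hlc] at h
    have e1 : (1 - var l ^ 2) * (1 + algebraMap ℚ (AddMonoidAlgebra ℚ (Typ r)) q * var l ^ 2) =
        1 - var l ^ 2 + algebraMap ℚ _ (q : ℚ) * (var l ^ 2 - var l ^ 2 * var l ^ 2) := by ring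
    rw [e1]
    have he' : Function.update e l (-2) = e := by rw [← he, Function.update_eq_self]
    have h0 : e + basisVec l + basisVec l = Function.update e l 0 := by
      rw [hup, he]
      norm_num
    have h4 : Function.update e l 0 + basisVec l + basisVec l = Function.update e l 2 := by
      rw [hup, Function.update_self, Function.update_idem]
      norm_num
    have hc : character (scale q r) (Function.update e l 0) = character (scale q r) e := by
      rw [← h0, hchi, hchi]
    have hc2 : character (scale q r) (Function.update e l 2) = character (scale q r) e := by
      rw [← h4, hchi, hchi, hc]
    simp only [sq, map_add, map_sub, map_mul, map_one, LinearMap.add_apply, LinearMap.sub_apply,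
      Pi.add_apply, Pi.sub_apply, Module.End.mul_apply, AlgHom.commutes, Module.algebraMap_end_apply,
      Pi.smul_apply, act_var, Module.End.one_apply, hchi, h0, h4, hc, hc2, smul_eq_mul]
    norm_num [he'] at h
    have h' : (straighten q r g e : ℚ) - straighten q r g (Function.update e l 0) -
        q * (straighten q r g (Function.update e l 2) -
          straighten q r g (Function.update e l 0)) = 0 := by exact_mod_cast h
    linear_combination (character (scale q r) e)⁻¹ * h'

end Straighten

/-! ### The Hecke operators as Laurent polynomials -/

section Hecke

variable {q r : ℕ}

theorem mult_eq_sum (c : ℤ) (ε : Typ r) : mult c ε = ∑ j, if ε j = c then 1 else 0 := by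
  rw [mult, Finset.card_filter]

theorem mult_cons (c x : ℤ) (ε : Typ r) :
    mult c (Fin.cons x ε : Typ (r + 1)) = (if x = c then 1 else 0) + mult c ε := by
  rw [mult_eq_sum, mult_eq_sum, Fin.sum_univ_succ]
  simp

theorem invTilde_cons (x : ℤ) (ε : Typ r) :
    invTilde (Fin.cons x ε : Typ (r + 1)) = ∑ j, (x - ε j).toNat + invTilde ε := by
  have h : ∀ (n : ℕ) (ε : Typ n), invTilde ε =
      ∑ i, ∑ j, if i < j then (ε i - ε j).toNat else 0 := fun n ε => by
    simp only [invTilde, Finset.sum_filter]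
  rw [h, h, Fin.sum_univ_succ, Fin.sum_univ_succ]
  simp [Fin.sum_univ_succ]

/-- The exponent of `q` attached to an entry of a sign vector. -/
def signWeight (r : ℕ) (k : Fin r) (x : ℤ) : ℕ :=
  if x = 1 then 2 + 4 * (r - 1 - k) else if x = 0 then 2 * (r - 1 - k) else 0

theorem mult_add_mult_add_mult (ε : Typ r) (h : ∀ k, ε k = -1 ∨ ε k = 0 ∨ ε k = 1) :
    mult 0 ε + mult 1 ε + mult (-1) ε = r := by
  simp only [mult_eq_sum, ← Finset.sum_add_distrib]
  rw [Finset.sum_congr rfl (g := fun _ => 1)]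
  · simp
  · intro k _
    rcases h k with h | h | h <;> simp [h]

/-- The exponent in the Hecke operators is quadratic in the multiplicities. Once `λ₀² - λ₀` is
added, which is the role of `q ^ (i ^ 2 - i)` in `T_r`, it becomes a sum of contributions of the
single positions; the induction prepends an entry. This is why `T_r` is given by a product of
one-variable factors. -/
theorem sum_signWeight (ε : Typ r) (h : ∀ k, ε k = -1 ∨ ε k = 0 ∨ ε k = 1) :
    2 * invTilde ε + 2 * mult 1 ε ^ 2 + 2 * mult 0 ε * mult 1 ε + mult 0 ε ^ 2 =
      mult 0 ε + ∑ k, signWeight r k (ε k) := by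
  induction r with
  | zero => simp [invTilde, mult]
  | succ n ih =>
    obtain ⟨x, ε, rfl⟩ : ∃ x ε', ε = Fin.cons x ε' := ⟨ε 0, Fin.tail ε, (Fin.cons_self_tail ε).symm⟩
    have hε : ∀ k, ε k = -1 ∨ ε k = 0 ∨ ε k = 1 := fun k => by simpa using h k.succ
    have hx : x = -1 ∨ x = 0 ∨ x = 1 := by simpa using h 0
    have h1 := ih ε hε
    have h2 := mult_add_mult_add_mult ε hε
    have h3 : ∑ k, signWeight (n + 1) k ((Fin.cons x ε : Typ (n + 1)) k) =
        signWeight (n + 1) 0 x + ∑ k, signWeight n k (ε k) := by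
      rw [Fin.sum_univ_succ, Fin.cons_zero]
      congr 1
      refine Finset.sum_congr rfl fun k _ => ?_
      rw [Fin.cons_succ, signWeight, signWeight]
      have : n + 1 - 1 - (k.succ : ℕ) = n - 1 - k := by simp; omega
      rw [this]
    rw [h3, invTilde_cons, mult_cons, mult_cons]
    have e1 : ∑ j, ((1 : ℤ) - ε j).toNat = mult 0 ε + 2 * mult (-1) ε := by
      rw [mult_eq_sum, mult_eq_sum, Finset.mul_sum, ← Finset.sum_add_distrib]
      exact Finset.sum_congr rfl fun k _ => by rcases hε k with h | h | h <;> simp [h]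
    have e0 : ∑ j, ((0 : ℤ) - ε j).toNat = mult (-1) ε := by
      rw [mult_eq_sum]
      exact Finset.sum_congr rfl fun k _ => by rcases hε k with h | h | h <;> simp [h]
    have e2 : ∑ j, ((-1 : ℤ) - ε j).toNat = 0 := by
      exact Finset.sum_eq_zero fun k _ => by rcases hε k with h | h | h <;> simp [h]
    clear h3 ih
    generalize ∑ k, signWeight n k (ε k) = S at *
    rcases hx with rfl | rfl | rfl
    · rw [e2]
      simp [signWeight]
      linarith
    · rw [e0]
      simp [signWeight]
      nlinarith
    · rw [e1]
      simp [signWeight]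
      nlinarith

/-- All vectors with entries in `{-1, 0, 1}`. -/
def allSigns (r : ℕ) : Finset (Typ r) := Fintype.piFinset fun _ : Fin r => ({-1, 0, 1} : Finset ℤ)

theorem mem_allSigns {ε : Typ r} : ε ∈ allSigns r ↔ ∀ k, ε k = -1 ∨ ε k = 0 ∨ ε k = 1 := by
  simp [allSigns]

theorem act_prod_sum {R : Type*} [CommRing R] (a : Fin r → ℤ → R) (m : Typ r → R) (e : Typ r) :
    act (∏ k, ∑ x ∈ ({-1, 0, 1} : Finset ℤ), AddMonoidAlgebra.single (x • (2 • basisVec k)) (a k x))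
      m e = ∑ ε ∈ allSigns r, (∏ k, a k (ε k)) * m (e + 2 • ε) := by
  rw [Finset.prod_univ_sum, map_sum, LinearMap.sum_apply, Finset.sum_apply]
  refine Finset.sum_congr rfl fun ε _ => ?_
  have : ∏ k, AddMonoidAlgebra.single (ε k • (2 • basisVec k)) (a k (ε k)) =
      AddMonoidAlgebra.single (2 • ε) (∏ k, a k (ε k)) := by
    have h : ∀ s : Finset (Fin r), ∏ k ∈ s, AddMonoidAlgebra.single (ε k • (2 • basisVec k))
        (a k (ε k)) = AddMonoidAlgebra.single (∑ k ∈ s, ε k • (2 • basisVec k))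
          (∏ k ∈ s, a k (ε k)) := by
      classical
      intro s
      induction s using Finset.induction_on with
      | empty => simp; rfl
      | insert k s hk ih =>
        rw [Finset.prod_insert hk, ih, AddMonoidAlgebra.single_mul_single, Finset.sum_insert hk,
          Finset.prod_insert hk]
    rw [h]
    congr 1
    ext j
    simp [basisVec, Finset.sum_apply, Pi.single_apply, mul_comm]
  rw [this, act_single]

theorem heckeS_apply (i : ℕ) (g : TypFlat r → ℤ) (f : TypFlat r) :
    heckeS q r i g f = ∑ ε ∈ signVectors r i,
      (q : ℤ) ^ (2 * invTilde ε + (mult 1 ε ^ 2 + (r - mult (-1) ε) ^ 2 - (r - i) ^ 2)) *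
        straighten q r g (f.1 + 2 • ε) := by
  change pairing g (strFlat q r (deltaFlat q r i (delta f.1))) = _
  rw [pairing_strFlat, deltaFlat, LinearMap.sum_apply, map_sum]
  refine Finset.sum_congr rfl fun ε _ => ?_
  rw [LinearMap.smul_apply, map_smul, smul_eq_mul]
  congr 1
  simp [translate, delta]

/-- The operator of index `r - i` collects the sign vectors with `i` zeros, so the sum over `i` runs
over all sign vectors, with weight `c` of the number of zeros times a power of `q` that factors over
the positions. -/
theorem sum_heckeS (c : ℕ → ℤ) (s : Finset ℕ) (hs : s ⊆ Finset.range (r + 1))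
    (hc : ∀ i ∈ Finset.range (r + 1), i ∉ s → c i = 0) (g : TypFlat r → ℤ) (f : TypFlat r) :
    (∑ i ∈ s, (c i * (q : ℤ) ^ (i ^ 2 - i)) • heckeS q r (r - i)) g f =
      ∑ ε ∈ allSigns r, c (mult 0 ε) * (q : ℤ) ^ (∑ k, signWeight r k (ε k)) *
        straighten q r g (f.1 + 2 • ε) := by
  have h0 : ∑ i ∈ s, (c i * (q : ℤ) ^ (i ^ 2 - i)) • heckeS q r (r - i) =
      ∑ i ∈ Finset.range (r + 1), (c i * (q : ℤ) ^ (i ^ 2 - i)) • heckeS q r (r - i) :=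
    Finset.sum_subset hs fun i hi his => by rw [hc i hi his, zero_mul, zero_smul]
  rw [h0, LinearMap.sum_apply, Finset.sum_apply]
  have hle : ∀ ε : Typ r, mult 0 ε ≤ r := fun ε => by
    simpa [mult] using Finset.card_filter_le (Finset.univ : Finset (Fin r)) fun j => ε j = 0
  rw [← Finset.sum_fiberwise_of_maps_to (s := allSigns r) (t := Finset.range (r + 1))
    (g := fun ε => mult 0 ε) fun ε _ => by
      rw [Finset.mem_range]
      exact Nat.lt_succ_of_le (hle ε)]
  refine Finset.sum_congr rfl fun i hi => ?_
  have hir : i ≤ r := by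
    rw [Finset.mem_range] at hi
    omega
  rw [LinearMap.smul_apply, Pi.smul_apply, heckeS_apply, smul_eq_mul, Finset.mul_sum]
  have hset : signVectors r (r - i) = (allSigns r).filter fun ε => mult 0 ε = i := by
    ext ε
    simp only [signVectors, allSigns, Finset.mem_filter]
    have := hle ε
    constructor <;> rintro ⟨h1, h2⟩ <;> exact ⟨h1, by omega⟩
  rw [hset]
  refine Finset.sum_congr rfl fun ε hε => ?_
  obtain ⟨hε', rfl⟩ := Finset.mem_filter.mp hε
  have h1 := sum_signWeight ε (mem_allSigns.mp hε')
  have h2 := mult_add_mult_add_mult ε (mem_allSigns.mp hε')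
  have h3 : r - mult (-1) ε = mult 0 ε + mult 1 ε := by omega
  have h4 : r - (r - mult 0 ε) = mult 0 ε := by omega
  have h5 : mult 1 ε ^ 2 + (mult 0 ε + mult 1 ε) ^ 2 - mult 0 ε ^ 2 =
      2 * mult 1 ε ^ 2 + 2 * mult 0 ε * mult 1 ε := by
    rw [Nat.sub_eq_iff_eq_add (by nlinarith)]
    ring
  have h6 : mult 0 ε ≤ mult 0 ε ^ 2 := Nat.le_self_pow two_ne_zero _
  have h7 : ∑ k, signWeight r k (ε k) = (mult 0 ε ^ 2 - mult 0 ε) +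
      (2 * invTilde ε + (2 * mult 1 ε ^ 2 + 2 * mult 0 ε * mult 1 ε)) := by omega
  rw [h3, h4, h5, h7, pow_add (q : ℤ) (mult 0 ε ^ 2 - mult 0 ε)]
  ring

/-- The coefficients of the factor of the Hecke polynomial attached to a coordinate. -/
def heckeCoeff (q r : ℕ) (k : Fin r) (x : ℤ) : ℤ :=
  (if x = 0 then -((q : ℤ) ^ 2 + 1) else 1) * (q : ℤ) ^ signWeight r k x

/-- The coefficients of the derivative of the factor attached to `j`. -/
def heckeCoeffErase (q r : ℕ) (j k : Fin r) (x : ℤ) : ℤ :=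
  (if k = j then (if x = 0 then 1 else 0) else (if x = 0 then -((q : ℤ) ^ 2 + 1) else 1)) *
    (q : ℤ) ^ signWeight r k x

/-- The Laurent polynomials by which the Hecke operators act. -/
noncomputable def heckePolyInt (q r : ℕ) : Bool → AddMonoidAlgebra ℤ (Typ r)
  | false => ∏ k, ∑ x ∈ ({-1, 0, 1} : Finset ℤ),
      AddMonoidAlgebra.single (x • (2 • basisVec k)) (heckeCoeff q r k x)
  | true => ∑ j, ∏ k, ∑ x ∈ ({-1, 0, 1} : Finset ℤ),
      AddMonoidAlgebra.single (x • (2 • basisVec k)) (heckeCoeffErase q r j k x)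

/-- `T_r` and `T_r'`. -/
noncomputable def heckeOp (q r : ℕ) : Bool → (TypFlat r → ℤ) →ₗ[ℤ] (TypFlat r → ℤ)
  | false => heckeT q r
  | true => heckeT' q r

theorem act_heckePolyInt (b : Bool) (g : TypFlat r → ℤ) (f : TypFlat r) :
    act (heckePolyInt q r b) (straighten q r g) f.1 = heckeOp q r b g f := by
  cases b with
  | false =>
    rw [heckePolyInt, act_prod_sum, heckeOp, heckeT,
      sum_heckeS (fun i => (-1) ^ i * ((q : ℤ) ^ 2 + 1) ^ i) _ subset_rfl
        (fun i hi h => absurd hi h)]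
    refine Finset.sum_congr rfl fun ε _ => ?_
    congr 1
    simp only [heckeCoeff]
    rw [Finset.prod_mul_distrib, Finset.prod_pow_eq_pow_sum, Finset.prod_ite, Finset.prod_const_one,
      Finset.prod_const, mul_one, ← mul_pow, neg_one_mul]
    rfl
  | true =>
    rw [heckePolyInt, map_sum, LinearMap.sum_apply, Finset.sum_apply, heckeOp, heckeT',
      sum_heckeS (fun i => (i : ℤ) * (-1) ^ (i - 1) * ((q : ℤ) ^ 2 + 1) ^ (i - 1)) _
        (fun i hi => by
          simp only [Finset.mem_Icc] at hi
          rw [Finset.mem_range]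
          omega)
        (fun i hi h => by
          simp only [Finset.mem_range, Finset.mem_Icc] at hi h
          have : i = 0 := by omega
          simp [this])]
    simp only [act_prod_sum]
    rw [Finset.sum_comm]
    refine Finset.sum_congr rfl fun ε _ => ?_
    rw [← Finset.sum_mul]
    congr 1
    -- The term of `j` survives only if `ε j = 0`, so summing over `j` produces the number of zeros:
    -- this is the factor `i` in `T_r'`.
    have h1 : ∀ j, ∏ k, heckeCoeffErase q r j k (ε k) =
        (if ε j = 0 then (-((q : ℤ) ^ 2 + 1)) ^ (mult 0 ε - 1) else 0) *
          (q : ℤ) ^ (∑ k, signWeight r k (ε k)) := by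
      intro j
      simp only [heckeCoeffErase]
      rw [Finset.prod_mul_distrib, Finset.prod_pow_eq_pow_sum,
        ← Finset.mul_prod_erase _ _ (Finset.mem_univ j), if_pos rfl]
      congr 1
      split_ifs with h
      · rw [one_mul, Finset.prod_congr rfl (g := fun k => if ε k = 0 then -((q : ℤ) ^ 2 + 1) else 1)
          fun k hk => by rw [if_neg (Finset.ne_of_mem_erase hk)], Finset.prod_ite,
          Finset.prod_const_one, Finset.prod_const, mul_one]
        congr 1
        rw [mult, ← Finset.card_erase_of_mem (a := j) (by simp [h]), Finset.filter_erase]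
      · rw [zero_mul]
    simp only [h1]
    rw [← Finset.sum_mul, ← Finset.sum_filter, Finset.sum_const, ← mult, nsmul_eq_mul,
      neg_pow ((q : ℤ) ^ 2 + 1), mul_assoc (mult 0 ε : ℤ) ((-1) ^ _)]

end Hecke

/-! ### The expansion of a Hecke translate -/

section Expansion

variable {q r : ℕ}

/-- The product of the factors `1 - c q ^ (2 (r - 1 - k)) X_k ^ 2`. -/
noncomputable def denomInt (q r : ℕ) (c : ℤ) : AddMonoidAlgebra ℤ (Typ r) :=
  ∏ k : Fin r, (1 - AddMonoidAlgebra.single (basisVec k + basisVec k)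
    (c * (q : ℤ) ^ (2 * (r - 1 - (k : ℕ)))))

theorem character_double (w : Fin r → ℚ) (hw : ∀ i, w i ≠ 0) (k : Fin r) :
    character w (basisVec k + basisVec k) = w k ^ 2 := by
  rw [character_add hw, character_basisVec, sq]

theorem twist_denomInt (hq : 2 ≤ q) (c : ℤ) :
    twist (scale q r) (scale_ne_zero hq) (denomInt q r c) = ∏ k, denomFactor (c : ℚ) k := by
  rw [denomInt, map_prod]
  refine Finset.prod_congr rfl fun k _ => ?_
  rw [map_sub, map_one, twist_single, denomFactor, var_sq,
    character_double _ (scale_ne_zero hq)]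
  congr 2
  push_cast
  rw [mul_assoc, scale_sq hq, mul_one]

/-- By `scale_sq` the characters of `±2 basisVec k` are `q ^ (∓2 (r - 1 - k))`. Together with
`signWeight` all three terms acquire the same factor `q ^ (2 (r - 1 - k))`, and the remaining
trinomial no longer depends on the position. -/
theorem twist_sum_coeff (hq : 2 ≤ q) (k : Fin r) (a : ℤ → ℤ) :
    twist (scale q r) (scale_ne_zero hq) (∑ x ∈ ({-1, 0, 1} : Finset ℤ),
      AddMonoidAlgebra.single (x • (2 • basisVec k)) (a x * (q : ℤ) ^ signWeight r k x)) =
    algebraMap ℚ _ ((q : ℚ) ^ (2 * (r - 1 - (k : ℕ)))) *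
      (algebraMap ℚ _ (a 1 * (q : ℚ) ^ 2) * var k ^ 2 + algebraMap ℚ _ (a (-1) : ℚ) * varInv k ^ 2 +
        algebraMap ℚ _ (a 0 : ℚ)) := by
  have hw := scale_ne_zero (r := r) hq
  have hs := scale_sq hq k
  have hs0 := hw k
  have hq0 : (q : ℚ) ≠ 0 := by positivity
  have hinv : ((scale q r k) ^ 2)⁻¹ = (q : ℚ) ^ (2 * (r - 1 - (k : ℕ))) :=
    (eq_inv_of_mul_eq_one_left hs).symm
  rw [Finset.sum_insert (by decide), Finset.sum_pair (by decide), map_add, map_add, twist_single,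
    twist_single, twist_single, two_nsmul, neg_one_smul, zero_smul, one_smul, character_neg,
    character_double _ hw, hinv]
  have h1 : ∀ c : ℚ, algebraMap ℚ (AddMonoidAlgebra ℚ (Typ r)) c =
      AddMonoidAlgebra.single 0 c := fun c => by
    rw [AddMonoidAlgebra.coe_algebraMap]
    rfl
  rw [var, varInv, sq (AddMonoidAlgebra.single (basisVec k) (1 : ℚ)),
    sq (AddMonoidAlgebra.single (-basisVec k) (1 : ℚ)), AddMonoidAlgebra.single_mul_single,
    AddMonoidAlgebra.single_mul_single, h1, h1, h1, h1, mul_add, mul_add]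
  simp only [AddMonoidAlgebra.single_mul_single, zero_add]
  rw [add_comm, add_assoc, add_comm, show character (scale q r) 0 = 1 by simp [character],
    ← neg_add]
  simp only [signWeight]
  norm_num
  congr 2
  · congr 1
    have h2 : (q : ℚ) ^ (2 + 4 * (r - 1 - (k : ℕ))) = (q : ℚ) ^ (2 * (r - 1 - (k : ℕ))) *
        ((q : ℚ) ^ (2 * (r - 1 - (k : ℕ))) * (q : ℚ) ^ 2) := by
      rw [← pow_add, ← pow_add]
      congr 1
      ring
    rw [h2]
    linear_combination (a 1 : ℚ) * (q : ℚ) ^ (2 * (r - 1 - (k : ℕ))) * (q : ℚ) ^ 2 * hs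
  · congr 1
    ring
  · rw [mul_comm]

theorem twist_heckePolyInt (hq : 2 ≤ q) (b : Bool) :
    twist (scale q r) (scale_ne_zero hq) (heckePolyInt q r b) =
      algebraMap ℚ _ (∏ k : Fin r, (q : ℚ) ^ (2 * (r - 1 - (k : ℕ)))) * heckePoly (q : ℚ) r b := by
  have hfac : ∀ k : Fin r, twist (scale q r) (scale_ne_zero hq)
      (∑ x ∈ ({-1, 0, 1} : Finset ℤ), AddMonoidAlgebra.single (x • (2 • basisVec k))
        ((if x = 0 then -((q : ℤ) ^ 2 + 1) else 1) * (q : ℤ) ^ signWeight r k x)) =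
      algebraMap ℚ _ ((q : ℚ) ^ (2 * (r - 1 - (k : ℕ)))) * heckeFactor (q : ℚ) k := fun k => by
    rw [twist_sum_coeff hq k fun x => if x = 0 then -((q : ℤ) ^ 2 + 1) else 1, heckeFactor]
    congr 1
    simp only [one_ne_zero, if_false, if_true, neg_eq_zero, Int.cast_one, map_one, one_mul,
      Int.cast_neg, map_neg]
    push_cast
    ring
  cases b with
  | false =>
    rw [heckePolyInt, heckePoly, map_prod, map_prod, ← Finset.prod_mul_distrib]
    exact Finset.prod_congr rfl fun k _ => hfac k
  | true =>
    rw [heckePolyInt, heckePoly, map_sum, map_prod, Finset.mul_sum]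
    refine Finset.sum_congr rfl fun j _ => ?_
    rw [map_prod, ← Finset.mul_prod_erase _ _ (Finset.mem_univ j),
      ← Finset.mul_prod_erase _ (fun k : Fin r => algebraMap ℚ (AddMonoidAlgebra ℚ (Typ r)) _)
        (Finset.mem_univ j), mul_assoc, ← Finset.prod_mul_distrib]
    congr 1
    · simp only [heckeCoeffErase, if_true]
      rw [twist_sum_coeff hq j fun x => if x = 0 then 1 else 0]
      norm_num
    · refine Finset.prod_congr rfl fun k hk => ?_
      simp only [heckeCoeffErase, if_neg (Finset.ne_of_mem_erase hk)]
      exact hfac k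

/-- The expansion of a Hecke translate: it is the image of a function `B` that satisfies the
relations for neighbouring coordinates, and another image of `B` vanishes where the last two
coordinates are zero. -/
theorem exists_expansion (hq : 2 ≤ q) (b : Bool) {g : TypFlat r → ℤ}
    (hg : (Function.support g).Finite) :
    ∃ B : Typ r → ℤ, Bdd (coordSum r) B ∧
      (∀ (e : Typ r) (i j : Fin r), (i : ℕ) + 1 = j → e j = e i + 1 → B e = B (swapEquiv i j e)) ∧
      (∀ (e : Typ r) (i j : Fin r), (i : ℕ) + 1 = j → e j = e i + 2 →
        B e = (1 + q) * B (e + (basisVec i - basisVec j)) - q * B (swapEquiv i j e)) ∧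
      (∀ f : TypFlat r, act (denomInt q r ((q : ℤ) ^ 2)) B f.1 = heckeOp q r b g f) ∧
      ∀ (e : Typ r) (i j : Fin r), (i : ℕ) + 1 = j → (j : ℕ) + 1 = r → e i = 0 → e j = 0 →
        act (denomInt q r 1) B e = 0 := by
  classical
  have hw := scale_ne_zero (r := r) hq
  have hq0 : (q : ℚ) ≠ 0 := by positivity
  have hbG := bdd_straighten (r := r) hq hg
  -- The division by the denominators is carried out over `ℤ`, before rescaling, so that the
  -- expansion coefficients are integers.
  obtain ⟨Hu, hHu, hbH⟩ : ∃ Hu : Typ r → ℤ,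
      act (denomInt q r ((q : ℤ) ^ 2)) Hu = straighten q r g ∧ Bdd (coordSum r) Hu := by
    -- The coefficient has to be a function of the vector; at `2 basisVec k` only the summand of `k`
    -- is nonzero, which gives the coefficient in `denomInt`.
    let t : Typ r → ℤ := fun v =>
      ∑ k, if v k = 0 then 0 else (q : ℤ) ^ 2 * (q : ℤ) ^ (2 * (r - 1 - (k : ℕ)))
    have hΦ : ∀ v ∈ (Finset.univ : Finset (Fin r)).image fun i => basisVec i + basisVec i,
        0 < coordSum r v := by
      intro v hv
      obtain ⟨a, -, rfl⟩ := Finset.mem_image.mp hv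
      rw [map_add, coordSum_basisVec]
      norm_num
    obtain ⟨Hu, h1, h2⟩ := exists_div (coordSum r) _ hΦ t _ hbG
    refine ⟨Hu, ?_, hbG.of_support (fun v hv => (hΦ v hv).le) h2⟩
    rw [← h1, denomInt, Finset.prod_image fun a _ b _ h => injective_double h]
    congr 2
    refine Finset.prod_congr rfl fun k _ => ?_
    congr 2
    simp only [t]
    rw [Finset.sum_eq_single k]
    · simp [basisVec]
    · intro j _ hj
      simp [basisVec, hj]
    · simp
  set H : Typ r → ℚ := fun e => (Hu e : ℚ) / character (scale q r) e with hH
  have hbHq : Bdd (coordSum r) H := by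
    obtain ⟨C, hC⟩ := hbH
    exact ⟨C, fun e he => by simp [hH, hC e he]⟩
  have hR : act (∏ a, denomFactor ((q : ℚ) ^ 2) a) H =
      fun e => (straighten q r g e : ℚ) / character (scale q r) e := by
    rw [← hHu, act_div_character hw, twist_denomInt hq]
    push_cast
    rfl
  set c : ℚ := ∏ k : Fin r, (q : ℚ) ^ (2 * (r - 1 - (k : ℕ))) with hc
  have hB : (fun e => ((act (heckePolyInt q r b) Hu e : ℤ) : ℚ) / character (scale q r) e) =
      c • act (heckePoly (q : ℚ) r b) H := by
    rw [act_div_character hw, twist_heckePolyInt hq, map_mul, AlgHom.commutes]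
    rfl
  have hpair : ∀ i j : Fin r, (i : ℕ) + 1 = j → ∀ e : Typ r,
      ((act (heckePolyInt q r b) Hu e : ℤ) : ℚ) -
        (act (heckePolyInt q r b) Hu (e + (basisVec i - basisVec j)) : ℤ) -
        (-(q : ℚ)) ^ (e j - e i - 1) * ((act (heckePolyInt q r b) Hu (swapEquiv i j e) : ℤ) -
          (act (heckePolyInt q r b) Hu (swapEquiv i j e - (basisVec i - basisVec j)) : ℤ)) = 0 := by
    intro i j hij e
    have h1 : PairRel (q : ℚ) i j H :=
      PairRel.of_div hbHq (c := (q : ℚ) ^ 2) (by rw [hR]; exact pairRel_straighten hq g hij)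
    have h2 := h1.act (domCongr_heckePoly (q : ℚ) i j b)
    have h3 : PairRel (q : ℚ) i j (fun e => ((act (heckePolyInt q r b) Hu e : ℤ) : ℚ) /
        character (scale q r) e) := by
      rw [hB]
      intro e
      have := h2 e
      simp only [Pi.smul_apply, smul_eq_mul]
      linear_combination c * this
    have h4 := pair_relation hw (q : ℚ) hq0 (adjacent_ne hij) (scale_adjacent hq hij)
      (fun e => ((act (heckePolyInt q r b) Hu e : ℤ) : ℚ) / character (scale q r) e) e
    have h5 := h3 e
    simp only at h5
    rw [h5, mul_zero] at h4
    have hcc : ∀ e, character (scale q r) e *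
        (((act (heckePolyInt q r b) Hu e : ℤ) : ℚ) / character (scale q r) e) =
          (act (heckePolyInt q r b) Hu e : ℤ) :=
      fun e => mul_div_cancel₀ _ (character_ne_zero hw e)
    simp only [hcc] at h4
    exact h4.symm
  -- Since the operators commute, applying the denominators to this `B` restores the straightened
  -- `g` and leaves the Hecke polynomial.
  refine ⟨act (heckePolyInt q r b) Hu, hbH.act _, ?_, ?_, ?_, ?_⟩
  · intro e i j hij he
    have h1 := hpair i j hij e
    have h2 : swapEquiv i j e = e + (basisVec i - basisVec j) := by
      rw [swapEquiv_eq_add (adjacent_ne hij), he, add_sub_cancel_left, one_smul]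
    rw [h2, he, add_sub_cancel_right, show e i + 1 - e i - 1 = 0 by ring, zpow_zero] at h1
    rw [h2]
    have h3 : ((act (heckePolyInt q r b) Hu e : ℤ) : ℚ) =
        (act (heckePolyInt q r b) Hu (e + (basisVec i - basisVec j)) : ℤ) := by linarith
    exact_mod_cast h3
  · intro e i j hij he
    have h1 := hpair i j hij e
    have h2 : swapEquiv i j e - (basisVec i - basisVec j) = e + (basisVec i - basisVec j) := by
      rw [swapEquiv_eq_add (adjacent_ne hij), he, add_sub_cancel_left, add_sub_assoc,
        zsmul_sub_self]
      norm_num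
    rw [h2, he, show e i + 2 - e i - 1 = 1 by ring, zpow_one] at h1
    have h3 : ((act (heckePolyInt q r b) Hu e : ℤ) : ℚ) =
        (1 + q) * (act (heckePolyInt q r b) Hu (e + (basisVec i - basisVec j)) : ℤ) -
          q * (act (heckePolyInt q r b) Hu (swapEquiv i j e) : ℤ) := by linarith
    exact_mod_cast h3
  · intro f
    rw [← Module.End.mul_apply, ← map_mul, mul_comm, map_mul, Module.End.mul_apply, hHu,
      act_heckePolyInt]
  · intro e i j hij hj hei hej
    have h1 := cast_act hw (denomInt q r 1) (act (heckePolyInt q r b) Hu) e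
    rw [hB, twist_denomInt hq, map_smul, Pi.smul_apply, Int.cast_one,
      heckePoly_vanishing hq0 (adjacent_ne hij) hbHq
        (by rw [hR]; exact pairRel_straighten hq g hij)
        (by rw [hR]; exact lastRel_straighten hq g hj) b hei hej, smul_zero, mul_zero] at h1
    exact_mod_cast h1

end Expansion

/-! ### Intervals of submodules killed by the maximal ideal -/

section Intervals

open IsLocalRing Submodule

variable {R W : Type*} [CommRing R] [IsLocalRing R] [AddCommGroup W] [Module R W]

/-- The index of `A` in `V`. -/
noncomputable def idx (A V : Submodule R W) : ℕ := A.toAddSubgroup.relIndex V.toAddSubgroup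

theorem idx_mul {A M V : Submodule R W} (h1 : A ≤ M) (h2 : M ≤ V) :
    idx A M * idx M V = idx A V :=
  AddSubgroup.relIndex_mul_relIndex _ _ _ h1 h2

theorem idx_self (A : Submodule R W) : idx A A = 1 := AddSubgroup.relIndex_self _

theorem card_quotient (A V : Submodule R W) : Nat.card (V ⧸ A.submoduleOf V) = idx A V := rfl

theorem finite_quotient {A V : Submodule R W} (h : idx A V ≠ 0) :
    Finite (V ⧸ A.submoduleOf V) :=
  Nat.finite_of_card_ne_zero (by rwa [card_quotient])

theorem idx_sup {N H D : Submodule R W} (h : (D ⊔ N) ⊓ H = N) (hN : N ≤ H) :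
    idx (D ⊔ N) (D ⊔ H) = idx N H := by
  have h1 : D ⊔ H = H ⊔ (D ⊔ N) := by
    rw [sup_comm, ← sup_assoc, sup_comm H D, sup_assoc, sup_eq_left.mpr hN]
  rw [h1, idx, sup_toAddSubgroup H, AddSubgroup.relIndex_sup_right, ← AddSubgroup.inf_relIndex_right,
    idx]
  congr 1
  exact congrArg toAddSubgroup h

theorem finite_Icc_of_idx {A V : Submodule R W} (h : idx A V ≠ 0) : (Set.Icc A V).Finite := by
  have := finite_quotient h
  refine Set.Finite.of_injOn (f := fun M => (A.submoduleOf V).mkQ '' (M.submoduleOf V : Set V))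
    (t := Set.univ) (fun _ _ => Set.mem_univ _) ?_ Set.finite_univ
  have key : ∀ M N : Submodule R W, M ∈ Set.Icc A V → N ∈ Set.Icc A V →
      (A.submoduleOf V).mkQ '' (M.submoduleOf V : Set V) =
        (A.submoduleOf V).mkQ '' (N.submoduleOf V : Set V) → M ≤ N := by
    intro M N hM hN h x hx
    have h1 : (A.submoduleOf V).mkQ ⟨x, hM.2 hx⟩ ∈
        (A.submoduleOf V).mkQ '' (N.submoduleOf V : Set V) := h ▸ ⟨⟨x, hM.2 hx⟩, hx, rfl⟩
    obtain ⟨y, hy, hyx⟩ := h1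
    have h2 := (Submodule.Quotient.eq _).mp hyx
    have h3 : (y : W) - x ∈ A := h2
    have h4 : (y : W) ∈ N := hy
    have := N.sub_mem h4 (hN.1 h3)
    simpa using this
  exact fun M hM N hN h => le_antisymm (key M N hM hN h) (key N M hN hM h.symm)

/-- The interval between `A` and `V` is a vector space over the residue field, of finite
dimension. -/
structure Elem (A V : Submodule R W) : Prop where
  le : A ≤ V
  smul_mem : ∀ a ∈ maximalIdeal R, ∀ v ∈ V, a • v ∈ A
  idx_ne_zero : idx A V ≠ 0

namespace Elem

variable {A M V : Submodule R W}

theorem left (h : Elem A V) (h1 : A ≤ M) (h2 : M ≤ V) : Elem A M :=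
  ⟨h1, fun a ha v hv => h.smul_mem a ha v (h2 hv), fun h0 => h.idx_ne_zero (by
    rw [← idx_mul h1 h2, h0, zero_mul])⟩

theorem right (h : Elem A V) (h1 : A ≤ M) (h2 : M ≤ V) : Elem M V :=
  ⟨h2, fun a ha v hv => h1 (h.smul_mem a ha v hv), fun h0 => h.idx_ne_zero (by
    rw [← idx_mul h1 h2, h0, mul_zero])⟩

theorem finite_Icc (h : Elem A V) : (Set.Icc A V).Finite := finite_Icc_of_idx h.idx_ne_zero

theorem exists_coatom (h : Elem A V) (hne : A ≠ V) :
    ∃ H v, A ≤ H ∧ v ∉ H ∧ H ⊔ span R {v} = V := by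
  have hfin : {H | A ≤ H ∧ H < V}.Finite :=
    h.finite_Icc.subset fun H hH => ⟨hH.1, hH.2.le⟩
  obtain ⟨H, hH⟩ := hfin.exists_maximal ⟨A, le_rfl, lt_of_le_of_ne h.le hne⟩
  obtain ⟨v, hv, hvH⟩ := SetLike.exists_of_lt hH.prop.2
  refine ⟨H, v, hH.prop.1, hvH, ?_⟩
  by_contra hne'
  have hle : H ⊔ span R {v} ≤ V :=
    sup_le hH.prop.2.le ((span_singleton_le_iff_mem _ _).mpr hv)
  have h1 := hH.le_of_ge ⟨hH.prop.1.trans le_sup_left, lt_of_le_of_ne hle hne'⟩ le_sup_left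
  exact hvH (h1 (mem_sup_right (mem_span_singleton_self v)))

end Elem

theorem mem_maximalIdeal_of_smul_mem {H : Submodule R W} {v : W} (hv : v ∉ H) {a : R}
    (h : a • v ∈ H) : a ∈ maximalIdeal R := by
  rw [mem_maximalIdeal, mem_nonunits_iff]
  intro hu
  apply hv
  have := H.smul_mem ((hu.unit⁻¹ : Rˣ) : R) h
  rwa [smul_smul, IsUnit.val_inv_mul, one_smul] at this

theorem idx_step {H : Submodule R W} {v : W} (hv : v ∉ H)
    (hm : ∀ a ∈ maximalIdeal R, a • v ∈ H) :
    idx H (H ⊔ span R {v}) = Nat.card (ResidueField R) := by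
  rw [idx, sup_comm, sup_toAddSubgroup, AddSubgroup.relIndex_sup_right]
  change idx H (span R {v}) = _
  rw [← card_quotient]
  let f : R →ₗ[R] span R {v} ⧸ H.submoduleOf (span R {v}) :=
    (H.submoduleOf (span R {v})).mkQ ∘ₗ
      LinearMap.toSpanSingleton R _ ⟨v, mem_span_singleton_self v⟩
  have hsurj : Function.Surjective f := by
    intro y
    obtain ⟨⟨y, hy⟩, rfl⟩ := Submodule.mkQ_surjective _ y
    obtain ⟨a, rfl⟩ := mem_span_singleton.mp hy
    exact ⟨a, rfl⟩
  have hker : LinearMap.ker f = maximalIdeal R := by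
    ext a
    have : f a = 0 ↔ a • v ∈ H := by
      change Submodule.Quotient.mk (a • (⟨v, mem_span_singleton_self v⟩ : span R {v})) = _ ↔ _
      rw [Submodule.Quotient.mk_eq_zero]
      rfl
    rw [LinearMap.mem_ker, this]
    exact ⟨fun h => mem_maximalIdeal_of_smul_mem hv h, fun h => hm a h⟩
  have e := f.quotKerEquivOfSurjective hsurj
  rw [hker] at e
  exact (Nat.card_congr e.toEquiv).symm

/-- Induction along a flag. -/
theorem Elem.induction {A : Submodule R W} {P : Submodule R W → Prop} (h0 : P A)
    (h1 : ∀ H v, Elem A H → v ∉ H → Elem A (H ⊔ span R {v}) → P H → P (H ⊔ span R {v}))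
    {V : Submodule R W} (h : Elem A V) : P V := by
  induction hn : idx A V using Nat.strong_induction_on generalizing V with
  | _ n ih =>
  by_cases hne : A = V
  · exact hne ▸ h0
  · obtain ⟨H, v, hAH, hv, rfl⟩ := h.exists_coatom hne
    refine h1 H v (h.left hAH le_sup_left) hv h (ih _ ?_ (h.left hAH le_sup_left) rfl)
    rw [← hn, ← idx_mul hAH (le_sup_left : H ≤ H ⊔ span R {v})]
    have h2 := (h.left hAH le_sup_left).idx_ne_zero
    have h3 : idx H (H ⊔ span R {v}) ≠ 0 := (h.right hAH le_sup_left).idx_ne_zero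
    have h4 : idx H (H ⊔ span R {v}) ≠ 1 := fun h => by
      have : H ⊔ span R {v} ≤ H := AddSubgroup.relIndex_eq_one.mp h
      exact hv (this (mem_sup_right (mem_span_singleton_self v)))
    exact lt_mul_of_one_lt_right (Nat.pos_of_ne_zero h2) (by omega)

variable (R) in
/-- The cardinality of the residue field. -/
noncomputable def resCard : ℕ := Nat.card (ResidueField R)

theorem one_lt_resCard [Finite (ResidueField R)] : 1 < resCard R := Finite.one_lt_card

/-- The dimension of an elementary interval. -/
noncomputable def dim (A V : Submodule R W) : ℕ := Nat.log (resCard R) (idx A V)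

/-- The multiples of `v` by elements of the maximal ideal. -/
def radSpan (R : Type*) [CommRing R] [IsLocalRing R] [Module R W] (v : W) : Submodule R W :=
  Submodule.map (LinearMap.toSpanSingleton R W v) (maximalIdeal R)

theorem mem_radSpan {v w : W} : w ∈ radSpan R v ↔ ∃ a ∈ maximalIdeal R, a • v = w := by
  simp [radSpan]

variable [Finite (ResidueField R)]

theorem dim_eq_of_idx {A V : Submodule R W} {n : ℕ} (h : idx A V = resCard R ^ n) :
    dim A V = n := by
  rw [dim, h, Nat.log_pow one_lt_resCard]

theorem Elem.idx_eq {A V : Submodule R W} (h : Elem A V) : idx A V = resCard R ^ dim A V := by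
  suffices ∃ n, idx A V = resCard R ^ n by
    obtain ⟨n, hn⟩ := this
    rw [dim_eq_of_idx hn, hn]
  refine Elem.induction (P := fun V => ∃ n, idx A V = resCard R ^ n) ⟨0, idx_self A⟩ ?_ h
  rintro H v hH hv hHv ⟨n, hn⟩
  refine ⟨n + 1, ?_⟩
  rw [← idx_mul hH.le (le_sup_left : H ≤ H ⊔ span R {v}), hn, pow_succ, resCard]
  congr 1
  exact idx_step hv fun a ha => hH.le (hHv.smul_mem a ha v (mem_sup_right (mem_span_singleton_self v)))

theorem dim_self (A : Submodule R W) : dim A A = 0 := dim_eq_of_idx (idx_self A)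

theorem Elem.dim_add {A M V : Submodule R W} (h : Elem A V) (h1 : A ≤ M) (h2 : M ≤ V) :
    dim A V = dim A M + dim M V :=
  dim_eq_of_idx (by rw [← idx_mul h1 h2, (h.left h1 h2).idx_eq, (h.right h1 h2).idx_eq, pow_add])

theorem Elem.eq_of_dim {A V : Submodule R W} (h : Elem A V) (h0 : dim A V = 0) : A = V := by
  have := h.idx_eq
  rw [h0, pow_zero] at this
  exact le_antisymm h.le (AddSubgroup.relIndex_eq_one.mp this)

theorem dim_step {H : Submodule R W} {v : W} (hv : v ∉ H)
    (hm : ∀ a ∈ maximalIdeal R, a • v ∈ H) : dim H (H ⊔ span R {v}) = 1 :=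
  dim_eq_of_idx (by rw [idx_step hv hm, pow_one, resCard])

section Decomposition

variable {A H : Submodule R W} {v : W}

/-- The position of `v` relative to the interval between `A` and `H` that allows to describe the
submodules between `radSpan R v ⊔ A` and `H ⊔ span R {v}`. -/
def Separated (A H : Submodule R W) (v : W) : Prop :=
  ∀ N ∈ Set.Icc A H, ∀ u ∈ H, ∀ a : R, u + a • v ∈ radSpan R v ⊔ N → a ∈ maximalIdeal R ∧ u ∈ N

/-- The case of a step in a flag, where the multiples of `v` by the maximal ideal already lie in
`A`. The other case, `separated_of_perp`, concerns an orthogonal vector, whose multiples meet `H`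
trivially. -/
theorem separated_of_notMem (hv : v ∉ H) (hm : ∀ a ∈ maximalIdeal R, a • v ∈ A) :
    Separated A H v := by
  intro N hN u hu a h
  have hrad : radSpan R v ≤ N := fun x hx => by
    obtain ⟨b, hb, rfl⟩ := mem_radSpan.mp hx
    exact hN.1 (hm b hb)
  rw [sup_eq_right.mpr hrad] at h
  have h1 : a • v ∈ H := by
    have := H.sub_mem (hN.2 h) hu
    rwa [add_sub_cancel_left] at this
  have h2 := mem_maximalIdeal_of_smul_mem hv h1
  refine ⟨h2, ?_⟩
  have := N.sub_mem h (hN.1 (hm a h2))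
  rwa [add_sub_cancel_right] at this

theorem Separated.radSpan_sup_inf (hs : Separated A H v) {N : Submodule R W}
    (hN : N ∈ Set.Icc A H) : (radSpan R v ⊔ N) ⊓ H = N := by
  refine le_antisymm (fun u hu => ?_) (le_inf le_sup_right hN.2)
  have := hs N hN u hu.2 0 (by simpa using hu.1)
  exact this.2

theorem Separated.span_sup_inf (hs : Separated A H v) (hA : Elem A H) {N : Submodule R W}
    (hN : N ∈ Set.Icc A H) {y : W} (hy : y ∈ H) : (N ⊔ span R {v + y}) ⊓ H = N := by
  refine le_antisymm (fun u hu => ?_) (le_inf le_sup_left hN.2)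
  obtain ⟨h1, h2⟩ := hu
  obtain ⟨n, hn, z, hz, rfl⟩ := mem_sup.mp h1
  obtain ⟨a, rfl⟩ := mem_span_singleton.mp hz
  have h3 : a • v ∈ H := by
    have := H.sub_mem (H.sub_mem h2 (hN.2 hn)) (H.smul_mem a hy)
    simpa using this
  have h4 := hs N hN (-(a • v)) (H.neg_mem h3) a (by simp)
  have h5 : a • v ∈ N := by simpa using N.neg_mem h4.2
  rw [smul_add]
  exact N.add_mem hn (N.add_mem h5 (hN.1 (hA.smul_mem a h4.1 y hy)))

theorem Separated.notMem (hs : Separated A H v) (hA : Elem A H) {y : W} (hy : y ∈ H) :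
    v + y ∉ radSpan R v ⊔ H := by
  intro h
  have := hs H ⟨hA.le, le_rfl⟩ y hy 1 (by rwa [one_smul, add_comm])
  exact (Ideal.ne_top_iff_one _).mp (maximalIdeal.isMaximal R).ne_top this.1

theorem radSpan_le (hA : Elem A H) {N : Submodule R W} (hN : N ∈ Set.Icc A H) {y : W} (hy : y ∈ H) :
    radSpan R v ≤ N ⊔ span R {v + y} := by
  intro x hx
  obtain ⟨a, ha, rfl⟩ := mem_radSpan.mp hx
  have h1 : a • v = -(a • y) + a • (v + y) := by
    rw [smul_add]
    abel
  rw [h1]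
  exact add_mem (mem_sup_left (neg_mem (hN.1 (hA.smul_mem a ha y hy))))
    (mem_sup_right (smul_mem _ _ (mem_span_singleton_self _)))

/-- The submodules of `H ⊔ span R {v}` in terms of those of `H`. -/
theorem eq_or_exists_of_mem_Icc {M : Submodule R W} (hA : Elem A H)
    (hM : M ∈ Set.Icc (radSpan R v ⊔ A) (H ⊔ span R {v})) :
    M = radSpan R v ⊔ (M ⊓ H) ∨ ∃ y ∈ H, M = (M ⊓ H) ⊔ span R {v + y} := by
  have hMA : M ⊓ H ∈ Set.Icc A H := ⟨le_inf (le_sup_right.trans hM.1) hA.le, inf_le_right⟩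
  by_cases h : ∃ u ∈ H, ∃ a : R, a ∉ maximalIdeal R ∧ u + a • v ∈ M
  · obtain ⟨u, hu, a, ha, hua⟩ := h
    have ha' : IsUnit a := by
      by_contra h
      exact ha h
    obtain ⟨a, rfl⟩ := ha'
    right
    refine ⟨((a⁻¹ : Rˣ) : R) • u, H.smul_mem _ hu, ?_⟩
    have h1 : v + ((a⁻¹ : Rˣ) : R) • u ∈ M := by
      have := M.smul_mem ((a⁻¹ : Rˣ) : R) hua
      rwa [smul_add, smul_smul, Units.inv_mul, one_smul, add_comm] at this
    refine le_antisymm (fun m hm => ?_)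
      (sup_le inf_le_left ((span_singleton_le_iff_mem _ _).mpr h1))
    obtain ⟨u', hu', z, hz, rfl⟩ := mem_sup.mp (hM.2 hm)
    obtain ⟨b, rfl⟩ := mem_span_singleton.mp hz
    have h2 : u' + b • v = (u' - b • ((a⁻¹ : Rˣ) : R) • u) + b • (v + ((a⁻¹ : Rˣ) : R) • u) := by
      rw [smul_add]
      abel
    rw [h2]
    refine add_mem (mem_sup_left ⟨?_, H.sub_mem hu' (H.smul_mem _ (H.smul_mem _ hu))⟩)
      (mem_sup_right (smul_mem _ _ (mem_span_singleton_self _)))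
    have := M.sub_mem hm (M.smul_mem b h1)
    rwa [h2, add_sub_cancel_right] at this
  · push Not at h
    left
    refine le_antisymm (fun m hm => ?_) (sup_le (le_sup_left.trans hM.1) inf_le_left)
    obtain ⟨u', hu', z, hz, rfl⟩ := mem_sup.mp (hM.2 hm)
    obtain ⟨b, rfl⟩ := mem_span_singleton.mp hz
    have hb : b ∈ maximalIdeal R := by
      by_contra hb
      exact h u' hu' b hb hm
    have hbv : b • v ∈ radSpan R v := mem_radSpan.mpr ⟨b, hb, rfl⟩
    have hu'M : u' ∈ M := by
      have := M.sub_mem hm (hM.1 (mem_sup_left hbv))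
      rwa [add_sub_cancel_right] at this
    exact add_mem (mem_sup_right ⟨hu'M, hu'⟩) (mem_sup_left hbv)

theorem elem_extend (hs : Separated A H v) (hA : Elem A H) :
    Elem (radSpan R v ⊔ A) (H ⊔ span R {v}) := by
  have hrad : radSpan R v ≤ span R {v} := fun x hx => by
    obtain ⟨a, -, rfl⟩ := mem_radSpan.mp hx
    exact smul_mem _ _ (mem_span_singleton_self v)
  have h1 : radSpan R v ⊔ H ⊔ span R {v} = H ⊔ span R {v} := by
    rw [sup_comm (radSpan R v), sup_assoc, sup_eq_right.mpr hrad]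
  refine ⟨sup_le (hrad.trans le_sup_right) (hA.le.trans le_sup_left), ?_, ?_⟩
  · intro a ha x hx
    obtain ⟨u, hu, z, hz, rfl⟩ := mem_sup.mp hx
    obtain ⟨b, rfl⟩ := mem_span_singleton.mp hz
    rw [smul_add, smul_smul]
    exact add_mem (mem_sup_right (hA.smul_mem a ha u hu))
      (mem_sup_left (mem_radSpan.mpr ⟨a * b, Ideal.mul_mem_right _ _ ha, rfl⟩))
  · have h2 : v ∉ radSpan R v ⊔ H := by simpa using hs.notMem hA H.zero_mem
    rw [← idx_mul (sup_le_sup_left hA.le _ : radSpan R v ⊔ A ≤ radSpan R v ⊔ H)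
      (by rw [← h1]; exact le_sup_left), idx_sup (hs.radSpan_sup_inf ⟨le_rfl, hA.le⟩) hA.le, ← h1,
      idx_step h2 fun a ha => mem_sup_left (mem_radSpan.mpr ⟨a, ha, rfl⟩)]
    exact mul_ne_zero hA.idx_ne_zero (by
      have := one_lt_resCard (R := R)
      rw [resCard] at this
      omega)

theorem dim_radSpan_sup (hs : Separated A H v) (hA : Elem A H) {N : Submodule R W}
    (hN : N ∈ Set.Icc A H) : dim (radSpan R v ⊔ N) (H ⊔ span R {v}) = dim N H + 1 := by
  have hrad : radSpan R v ≤ span R {v} := fun x hx => by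
    obtain ⟨a, -, rfl⟩ := mem_radSpan.mp hx
    exact smul_mem _ _ (mem_span_singleton_self v)
  have h1 : radSpan R v ⊔ H ⊔ span R {v} = H ⊔ span R {v} := by
    rw [sup_comm (radSpan R v), sup_assoc, sup_eq_right.mpr hrad]
  have h2 : v ∉ radSpan R v ⊔ H := by simpa using hs.notMem hA H.zero_mem
  refine dim_eq_of_idx ?_
  rw [← idx_mul (sup_le_sup_left hN.2 _ : radSpan R v ⊔ N ≤ radSpan R v ⊔ H)
      (by rw [← h1]; exact le_sup_left), idx_sup (hs.radSpan_sup_inf hN) hN.2, ← h1,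
      idx_step h2 fun a ha => mem_sup_left (mem_radSpan.mpr ⟨a, ha, rfl⟩),
      (hA.right hN.1 hN.2).idx_eq, pow_succ, resCard]

theorem dim_radSpan_sup_span (hs : Separated A H v) (hA : Elem A H) {N : Submodule R W}
    (hN : N ∈ Set.Icc A H) {y : W} (hy : y ∈ H) :
    dim (radSpan R v ⊔ N) (N ⊔ span R {v + y}) = 1 := by
  have h1 : N ⊔ span R {v + y} = (radSpan R v ⊔ N) ⊔ span R {v + y} := by
    rw [sup_assoc, eq_comm, sup_eq_right]
    exact radSpan_le hA hN hy
  have h3 := hs.notMem hA hy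
  rw [h1]
  refine dim_step (fun h => h3 (sup_le_sup_left hN.2 _ h)) fun a ha => ?_
  rw [smul_add]
  exact add_mem (mem_sup_left (mem_radSpan.mpr ⟨a, ha, rfl⟩))
    (mem_sup_right (hN.1 (hA.smul_mem a ha y hy)))

theorem span_sup_le (hA : Elem A H) {N : Submodule R W}
    (hN : N ∈ Set.Icc A H) {y : W} (hy : y ∈ H) :
    N ⊔ span R {v + y} ∈ Set.Icc (radSpan R v ⊔ A) (H ⊔ span R {v}) :=
  ⟨sup_le (radSpan_le hA hN hy) (hN.1.trans le_sup_left),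
    sup_le (hN.2.trans le_sup_left) ((span_singleton_le_iff_mem _ _).mpr
      (add_mem (mem_sup_right (mem_span_singleton_self v)) (mem_sup_left hy)))⟩

theorem dim_span_sup (hs : Separated A H v) (hA : Elem A H) {N : Submodule R W}
    (hN : N ∈ Set.Icc A H) {y : W} (hy : y ∈ H) :
    dim (N ⊔ span R {v + y}) (H ⊔ span R {v}) = dim N H := by
  have hN' := span_sup_le (v := v) hA hN hy
  have h1 := ((elem_extend hs hA).right (sup_le_sup_left hN.1 _) (sup_le
      (le_sup_left.trans (elem_extend hs hA).le) (hN.2.trans le_sup_left))).dim_add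
    (sup_le (radSpan_le hA hN hy) le_sup_left) hN'.2
  rw [dim_radSpan_sup hs hA hN, dim_radSpan_sup_span hs hA hN hy] at h1
  omega

theorem span_sup_eq_iff (hs : Separated A H v) (hA : Elem A H) {N : Submodule R W}
    (hN : N ∈ Set.Icc A H) {y z : W} (hy : y ∈ H) (hz : z ∈ H) :
    N ⊔ span R {v + y} = N ⊔ span R {v + z} ↔ y - z ∈ N := by
  constructor
  · intro h
    rw [← hs.span_sup_inf hA hN hz]
    refine ⟨?_, H.sub_mem hy hz⟩
    have h1 : v + y ∈ N ⊔ span R {v + z} := h ▸ mem_sup_right (mem_span_singleton_self _)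
    have := sub_mem h1 (mem_sup_right (mem_span_singleton_self (v + z)))
    simpa using this
  · have key : ∀ y z : W, y - z ∈ N → N ⊔ span R {v + y} ≤ N ⊔ span R {v + z} := fun y z h => by
      refine sup_le le_sup_left ((span_singleton_le_iff_mem _ _).mpr ?_)
      have h1 : v + y = (y - z) + (v + z) := by abel
      rw [h1]
      exact add_mem (mem_sup_left h) (mem_sup_right (mem_span_singleton_self _))
    exact fun h => le_antisymm (key y z h) (key z y (by simpa using N.neg_mem h))

/-- Summation over an interval by means of a separated vector. -/
theorem finsum_Icc_extend (hs : Separated A H v) (hA : Elem A H)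
    (F : Submodule R W → ℤ) :
    ∑ᶠ M ∈ Set.Icc (radSpan R v ⊔ A) (H ⊔ span R {v}), F M =
      ∑ᶠ N ∈ Set.Icc A H, (F (radSpan R v ⊔ N) +
        ∑ᶠ y : H ⧸ N.submoduleOf H, F (N ⊔ span R {v + (y.out : W)})) := by
  classical
  have hE := elem_extend hs hA
  rw [finsum_mem_eq_finite_toFinset_sum _ hE.finite_Icc,
    finsum_mem_eq_finite_toFinset_sum _ hA.finite_Icc,
    ← Finset.sum_fiberwise_of_maps_to (t := hA.finite_Icc.toFinset) (g := fun M => M ⊓ H)]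
  · refine Finset.sum_congr rfl fun N hN => ?_
    have hN : N ∈ Set.Icc A H := by simpa using hN
    have := finite_quotient (hA.right hN.1 hN.2).idx_ne_zero
    have := Fintype.ofFinite (H ⧸ N.submoduleOf H)
    rw [finsum_eq_sum_of_fintype]
    have hinj : Function.Injective fun y : H ⧸ N.submoduleOf H =>
        N ⊔ span R {v + (y.out : W)} := by
      intro y z h
      have h1 := (span_sup_eq_iff hs hA hN y.out.2 z.out.2).mp h
      rw [← Quotient.out_eq y, ← Quotient.out_eq z]
      exact (Submodule.Quotient.eq _).mpr h1
    -- The submodules with a given intersection `N` with `H` are `radSpan R v ⊔ N` and the graphs `N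
    -- ⊔ span R {v + y}`, with `y` running over `H` modulo `N`.
    have hfib : hE.finite_Icc.toFinset.filter (fun M => M ⊓ H = N) =
        insert (radSpan R v ⊔ N) (Finset.univ.image fun y : H ⧸ N.submoduleOf H =>
          N ⊔ span R {v + (y.out : W)}) := by
      ext M
      simp only [Finset.mem_filter, Set.Finite.mem_toFinset, Finset.mem_insert, Finset.mem_image,
        Finset.mem_univ, true_and]
      constructor
      · rintro ⟨hM, rfl⟩
        rcases eq_or_exists_of_mem_Icc hA hM with h | ⟨y, hy, h⟩
        · exact Or.inl h
        · right
          refine ⟨Submodule.Quotient.mk ⟨y, hy⟩, ?_⟩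
          refine Eq.trans ?_ h.symm
          rw [span_sup_eq_iff hs hA hN (Subtype.prop _) hy]
          have := (Submodule.Quotient.eq ((M ⊓ H).submoduleOf H)).mp
            (Quotient.out_eq (Submodule.Quotient.mk (p := (M ⊓ H).submoduleOf H) ⟨y, hy⟩))
          exact this
      · rintro (rfl | ⟨y, rfl⟩)
        · exact ⟨⟨sup_le_sup_left hN.1 _, sup_le (le_sup_left.trans hE.le)
            (hN.2.trans le_sup_left)⟩, hs.radSpan_sup_inf hN⟩
        · exact ⟨span_sup_le hA hN y.out.2, hs.span_sup_inf hA hN y.out.2⟩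
    rw [hfib, Finset.sum_insert, Finset.sum_image fun a _ b _ h => hinj h]
    intro h
    obtain ⟨y, -, hy⟩ := Finset.mem_image.mp h
    have h1 : v + (y.out : W) ∈ radSpan R v ⊔ N := by
      rw [← hy]
      exact mem_sup_right (mem_span_singleton_self _)
    exact hs.notMem hA y.out.2 (sup_le_sup_left hN.2 _ h1)
  · intro M hM
    have hM : M ∈ Set.Icc (radSpan R v ⊔ A) (H ⊔ span R {v}) := by simpa using hM
    simpa using ⟨(le_sup_right : A ≤ _).trans hM.1, hA.le⟩

end Decomposition

section Sums

variable {A V : Submodule R W}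

/-- The weight `(-t) ^ J Q ^ (J (J - 1) / 2)`. -/
def wt (Q t : ℤ) (J : ℕ) : ℤ := (-t) ^ J * Q ^ (J.choose 2)

theorem wt_zero (Q t : ℤ) : wt Q t 0 = 1 := by simp [wt]

theorem wt_succ (Q t : ℤ) (J : ℕ) : wt Q t (J + 1) = -t * Q ^ J * wt Q t J := by
  rw [wt, wt, Nat.choose_succ_succ' J 1, Nat.choose_one_right, pow_succ, pow_add]
  ring

theorem finsum_quotient_const {N H : Submodule R W} (h : Elem N H) (c : ℤ) :
    ∑ᶠ _ : H ⧸ N.submoduleOf H, c = (resCard R : ℤ) ^ dim N H * c := by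
  have := finite_quotient h.idx_ne_zero
  have := Fintype.ofFinite (H ⧸ N.submoduleOf H)
  rw [finsum_eq_sum_of_fintype, Finset.sum_const, Finset.card_univ, ← Nat.card_eq_fintype_card,
    card_quotient, h.idx_eq, nsmul_eq_mul]
  push_cast
  rfl

/-- Summation over an interval by means of a coatom. -/
theorem finsum_Icc_step {H : Submodule R W} {v : W} (hA : Elem A H) (hv : v ∉ H)
    (hm : ∀ a ∈ maximalIdeal R, a • v ∈ A) (F : Submodule R W → ℤ) :
    ∑ᶠ M ∈ Set.Icc A (H ⊔ span R {v}), F M =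
      ∑ᶠ N ∈ Set.Icc A H, (F N +
        ∑ᶠ y : H ⧸ N.submoduleOf H, F (N ⊔ span R {v + (y.out : W)})) := by
  have hrad : radSpan R v ≤ A := fun x hx => by
    obtain ⟨a, ha, rfl⟩ := mem_radSpan.mp hx
    exact hm a ha
  have h := finsum_Icc_extend (separated_of_notMem hv hm) hA F
  rw [sup_eq_right.mpr hrad] at h
  rw [h]
  refine finsum_mem_congr rfl fun N hN => ?_
  rw [sup_eq_right.mpr (hrad.trans hN.1)]

theorem dim_step_facts {H : Submodule R W} {v : W} (hA : Elem A H) (hv : v ∉ H)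
    (hm : ∀ a ∈ maximalIdeal R, a • v ∈ A) {N : Submodule R W} (hN : N ∈ Set.Icc A H) :
    dim N (H ⊔ span R {v}) = dim N H + 1 ∧ ∀ y ∈ H,
      dim (N ⊔ span R {v + y}) (H ⊔ span R {v}) = dim N H ∧
      dim A (N ⊔ span R {v + y}) = dim A N + 1 := by
  have hrad : radSpan R v ≤ A := fun x hx => by
    obtain ⟨a, ha, rfl⟩ := mem_radSpan.mp hx
    exact hm a ha
  have hs := separated_of_notMem hv hm
  have h0 := elem_extend hs hA
  rw [sup_eq_right.mpr hrad] at h0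
  have h1 := dim_radSpan_sup hs hA hN
  rw [sup_eq_right.mpr (hrad.trans hN.1)] at h1
  refine ⟨h1, fun y hy => ⟨dim_span_sup hs hA hN hy, ?_⟩⟩
  have h2 := dim_radSpan_sup_span hs hA hN hy
  rw [sup_eq_right.mpr (hrad.trans hN.1)] at h2
  have h3 := span_sup_le (v := v) hA hN hy
  rw [sup_eq_right.mpr hrad] at h3
  rw [(h0.left h3.1 h3.2).dim_add hN.1 le_sup_left, h2]

/-- The `q`-binomial theorem, along a flag. With `d = dim N H`, the submodules over `N` contribute
`wt (d + 1) + Q ^ d * wt d`, which is `1 - t` times the weight with `t` replaced by `t Q`. -/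
theorem finsum_wt (h : Elem A V) (t : ℤ) :
    ∑ᶠ M ∈ Set.Icc A V, wt (resCard R) t (dim M V) =
      ∏ i ∈ Finset.range (dim A V), (1 - t * (resCard R : ℤ) ^ i) := by
  refine Elem.induction (A := A) (P := fun V => ∀ t, ∑ᶠ M ∈ Set.Icc A V,
    wt (resCard R) t (dim M V) = ∏ i ∈ Finset.range (dim A V), (1 - t * (resCard R : ℤ) ^ i))
    ?_ ?_ h t
  · intro t
    simp [dim_self, wt_zero]
  · intro H v hH hv hHv ih t
    have hm : ∀ a ∈ maximalIdeal R, a • v ∈ A := fun a ha =>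
      hHv.smul_mem a ha v (mem_sup_right (mem_span_singleton_self v))
    rw [finsum_Icc_step hH hv hm, (dim_step_facts hH hv hm ⟨le_rfl, hH.le⟩).1,
      Finset.prod_range_succ']
    have h1 : ∀ N ∈ Set.Icc A H, wt (resCard R) t (dim N (H ⊔ span R {v})) +
        ∑ᶠ y : H ⧸ N.submoduleOf H, wt (resCard R) t
          (dim (N ⊔ span R {v + (y.out : W)}) (H ⊔ span R {v})) =
        (1 - t) * wt (resCard R) (t * resCard R) (dim N H) := by
      intro N hN
      have h2 := dim_step_facts hH hv hm hN
      rw [finsum_congr fun y => by rw [(h2.2 _ (Quotient.out y).2).1], h2.1,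
        finsum_quotient_const (hH.right hN.1 hN.2), wt_succ, wt, wt, neg_mul_eq_neg_mul, mul_pow]
      ring
    rw [finsum_mem_congr rfl h1, ← mul_finsum_mem _ _, ih, pow_zero, mul_one,
      mul_comm]
    congr 1
    refine Finset.prod_congr rfl fun i _ => ?_
    rw [pow_succ]
    ring

/-- At `t = 1` the weight is the Möbius function of the lattice of subspaces. The dimension is
counted from the bottom here; the same induction gives a product that contains the factor `1 - Q ^
0`. -/
theorem finsum_wt_one (h : Elem A V) (hne : A ≠ V) :
    ∑ᶠ M ∈ Set.Icc A V, wt (resCard R) 1 (dim A M) = 0 := by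
  have key : ∑ᶠ M ∈ Set.Icc A V, wt (resCard R) 1 (dim A M) =
      ∏ i ∈ Finset.range (dim A V), (1 - (resCard R : ℤ) ^ i) := by
    refine Elem.induction (A := A) (P := fun V => ∑ᶠ M ∈ Set.Icc A V, wt (resCard R) 1 (dim A M) =
      ∏ i ∈ Finset.range (dim A V), (1 - (resCard R : ℤ) ^ i)) ?_ ?_ h
    · simp [dim_self, wt_zero]
    · intro H v hH hv hHv ih
      have hm : ∀ a ∈ maximalIdeal R, a • v ∈ A := fun a ha =>
        hHv.smul_mem a ha v (mem_sup_right (mem_span_singleton_self v))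
      rw [finsum_Icc_step hH hv hm, (dim_step_facts hH hv hm ⟨le_rfl, hH.le⟩).1,
        Finset.prod_range_succ, ← ih, mul_comm, mul_finsum_mem _ _]
      refine finsum_mem_congr rfl fun N hN => ?_
      have h2 := dim_step_facts hH hv hm hN
      rw [finsum_congr fun y => by rw [(h2.2 _ (Quotient.out y).2).2],
        finsum_quotient_const (hH.right hN.1 hN.2), wt_succ, hH.dim_add hN.1 hN.2, pow_add]
      ring
  rw [key]
  refine Finset.prod_eq_zero (i := 0) ?_ (by simp)
  rw [Finset.mem_range]
  exact Nat.pos_of_ne_zero fun h0 => hne (h.eq_of_dim h0)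

/-- The number of hyperplanes, `(Q ^ d - 1) / (Q - 1)`: those of `H ⊔ span R {v}` are `H` itself and
`Q` graphs over each hyperplane of `H`. -/
theorem finsum_coatoms (h : Elem A V) :
    ((resCard R : ℤ) - 1) * ∑ᶠ M ∈ Set.Icc A V, (if dim M V = 1 then 1 else 0) =
      (resCard R : ℤ) ^ dim A V - 1 := by
  refine Elem.induction (A := A) (P := fun V => ((resCard R : ℤ) - 1) *
    ∑ᶠ M ∈ Set.Icc A V, (if dim M V = 1 then 1 else 0) = (resCard R : ℤ) ^ dim A V - 1) ?_ ?_ h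
  · simp [dim_self]
  · intro H v hH hv hHv ih
    have hm : ∀ a ∈ maximalIdeal R, a • v ∈ A := fun a ha =>
      hHv.smul_mem a ha v (mem_sup_right (mem_span_singleton_self v))
    rw [finsum_Icc_step hH hv hm, (dim_step_facts hH hv hm ⟨le_rfl, hH.le⟩).1]
    have h1 : ∀ N ∈ Set.Icc A H, ((if dim N (H ⊔ span R {v}) = 1 then 1 else 0) +
        ∑ᶠ y : H ⧸ N.submoduleOf H, (if dim (N ⊔ span R {v + (y.out : W)}) (H ⊔ span R {v}) = 1
          then (1 : ℤ) else 0)) =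
        (if N = H then 1 else 0) + resCard R * (if dim N H = 1 then 1 else 0) := by
      intro N hN
      have h2 := dim_step_facts hH hv hm hN
      rw [finsum_congr fun y => by rw [(h2.2 _ (Quotient.out y).2).1],
        finsum_quotient_const (hH.right hN.1 hN.2), h2.1]
      congr 1
      · have : dim N H + 1 = 1 ↔ N = H := by
          rw [Nat.add_eq_right]
          exact ⟨fun h => (hH.right hN.1 hN.2).eq_of_dim h, fun h => h ▸ dim_self _⟩
        simp only [this]
      · split_ifs with h
        · rw [h, pow_one]
        · simp
    have h3 : ∑ᶠ N ∈ Set.Icc A H, (if N = H then (1 : ℤ) else 0) = 1 := by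
      rw [finsum_mem_def, finsum_eq_single _ H]
      · simp [hH.le]
      · intro N hN
        simp [hN, Set.indicator]
    rw [finsum_mem_congr rfl h1, finsum_mem_add_distrib hH.finite_Icc, h3,
      ← mul_finsum_mem _ _, mul_add, mul_left_comm, ih, pow_succ]
    ring

open scoped Classical in
/-- The sum over the lines in `V / N` in terms of the vectors. -/
theorem finsum_vectors (h : Elem A V) (F : Submodule R W → ℤ) :
    ∑ᶠ y : V ⧸ A.submoduleOf V, (if y = 0 then 0 else F (A ⊔ span R {(y.out : W)})) =
      ∑ᶠ M ∈ Set.Icc A V, (if dim A M = 1 then ((resCard R : ℤ) - 1) * F M else 0) := by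
  classical
  have := finite_quotient h.idx_ne_zero
  have := Fintype.ofFinite (V ⧸ A.submoduleOf V)
  rw [finsum_eq_sum_of_fintype, finsum_mem_eq_finite_toFinset_sum _ h.finite_Icc,
    ← Finset.sum_fiberwise_of_maps_to (t := h.finite_Icc.toFinset)
      (g := fun y : V ⧸ A.submoduleOf V => A ⊔ span R {(y.out : W)})]
  · refine Finset.sum_congr rfl fun M hM => ?_
    have hM : M ∈ Set.Icc A V := by simpa using hM
    have hmem : ∀ y : V ⧸ A.submoduleOf V, (y.out : W) ∈ A ↔ y = 0 := fun y => by
      have h1 : y = Submodule.Quotient.mk y.out := (Quotient.out_eq y).symm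
      nth_rewrite 2 [h1]
      rw [Submodule.Quotient.mk_eq_zero]
      rfl
    have hstep : ∀ y : V ⧸ A.submoduleOf V, y ≠ 0 → dim A (A ⊔ span R {(y.out : W)}) = 1 :=
      fun y hy => dim_step (fun h => hy ((hmem y).mp h)) fun a ha => h.smul_mem a ha _ y.out.2
    split_ifs with hd
    · have h1 : ∀ y ∈ Finset.univ.filter
          (fun y : V ⧸ A.submoduleOf V => A ⊔ span R {(y.out : W)} = M),
          (if y = 0 then 0 else F (A ⊔ span R {(y.out : W)})) = F M := by
        intro y hy
        have hy : A ⊔ span R {(y.out : W)} = M := by simpa using hy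
        have hy0 : y ≠ 0 := by
          intro h0
          have : span R {(y.out : W)} ≤ A :=
            (span_singleton_le_iff_mem _ _).mpr ((hmem y).mpr h0)
          rw [sup_eq_left.mpr this] at hy
          rw [hy, dim_self] at hd
          exact absurd hd (by norm_num)
        rw [if_neg hy0, hy]
      rw [Finset.sum_congr rfl h1, Finset.sum_const, nsmul_eq_mul]
      congr 1
      -- The classes that generate `M` together with the zero class form `M / A`, which has `resCard
      -- R` elements.
      have hcard : (Finset.univ.filter
          (fun y : V ⧸ A.submoduleOf V => A ⊔ span R {(y.out : W)} = M)).card + 1 = resCard R := by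
        have h2 : insert 0 (Finset.univ.filter
          (fun y : V ⧸ A.submoduleOf V => A ⊔ span R {(y.out : W)} = M)) =
            Finset.univ.filter (fun y : V ⧸ A.submoduleOf V => (y.out : W) ∈ M) := by
          ext y
          simp only [Finset.mem_insert, Finset.mem_filter, Finset.mem_univ, true_and]
          constructor
          · rintro (h0 | h0)
            · exact hM.1 ((hmem y).mpr h0)
            · rw [← h0]
              exact mem_sup_right (mem_span_singleton_self _)
          · intro hy
            by_cases h0 : y = 0
            · exact Or.inl h0
            · right
              have hle : A ⊔ span R {(y.out : W)} ≤ M :=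
                sup_le hM.1 ((span_singleton_le_iff_mem _ _).mpr hy)
              have h3 := (h.left hM.1 hM.2).dim_add le_sup_left hle
              rw [hd, hstep y h0] at h3
              exact ((h.left hM.1 hM.2).right le_sup_left hle).eq_of_dim (by omega)
        rw [← Finset.card_insert_of_notMem, h2]
        · have h4 : idx A M = resCard R := by
            rw [(h.left hM.1 hM.2).idx_eq, hd, pow_one]
          rw [← h4, ← card_quotient, ← Fintype.card_subtype, ← Nat.card_eq_fintype_card]
          let f : M ⧸ A.submoduleOf M →ₗ[R] V ⧸ A.submoduleOf V :=
            Submodule.mapQ _ _ (Submodule.inclusion hM.2) fun x hx => hx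
          have hf : ∀ m : M, f (Submodule.Quotient.mk m) =
              Submodule.Quotient.mk (Submodule.inclusion hM.2 m) := fun m => rfl
          have hout : ∀ (z : V), ((Quotient.out (Submodule.Quotient.mk z :
              V ⧸ A.submoduleOf V) : V) : W) - z ∈ A := fun z =>
            (Submodule.Quotient.eq (A.submoduleOf V)).mp (Quotient.out_eq (Submodule.Quotient.mk z :
              V ⧸ A.submoduleOf V))
          refine (Nat.card_congr (Equiv.ofBijective (fun m => (⟨f m, ?_⟩ :
            {y : V ⧸ A.submoduleOf V // (y.out : W) ∈ M})) ⟨?_, ?_⟩)).symm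
          · obtain ⟨m, rfl⟩ := Submodule.mkQ_surjective _ m
            have h5 := M.add_mem (hM.1 (hout (Submodule.inclusion hM.2 m))) m.2
            rw [Submodule.coe_inclusion, sub_add_cancel] at h5
            exact h5
          · intro m m' hmm
            obtain ⟨m, rfl⟩ := Submodule.mkQ_surjective _ m
            obtain ⟨m', rfl⟩ := Submodule.mkQ_surjective _ m'
            have h6 := congrArg Subtype.val hmm
            have h7 : (m : W) - m' ∈ A := (Submodule.Quotient.eq (A.submoduleOf V)).mp h6
            exact (Submodule.Quotient.eq _).mpr h7
          · rintro ⟨y, hy⟩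
            exact ⟨Submodule.Quotient.mk ⟨y.out, hy⟩, Subtype.ext (Quotient.out_eq y)⟩
        · intro h0
          have h0 : A ⊔ span R {((0 : V ⧸ A.submoduleOf V).out : W)} = M := by simpa using h0
          have : span R {((0 : V ⧸ A.submoduleOf V).out : W)} ≤ A :=
            (span_singleton_le_iff_mem _ _).mpr ((hmem 0).mpr rfl)
          rw [sup_eq_left.mpr this] at h0
          rw [h0, dim_self] at hd
          exact absurd hd (by norm_num)
      rw [← hcard]
      push_cast
      ring
    · refine Finset.sum_eq_zero fun y hy => ?_
      have hy : A ⊔ span R {(y.out : W)} = M := by simpa using hy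
      split_ifs with h0
      · rfl
      · exact absurd (hy ▸ hstep y h0) hd
  · intro y _
    simpa using h.le.trans' le_rfl

end Sums

end Intervals

/-! ### Double counting and Möbius inversion over intervals of submodules -/

section IntervalSums

open IsLocalRing Submodule

variable {R W : Type*} [CommRing R] [IsLocalRing R] [AddCommGroup W] [Module R W]
  [Finite (ResidueField R)]

open scoped Classical in
theorem finsum_Icc_eq_sum {U V A B : Submodule R W} (h : (Set.Icc U V).Finite) (hA : U ≤ A)
    (hB : B ≤ V) (F : Submodule R W → ℤ) :
    ∑ᶠ M ∈ Set.Icc A B, F M = ∑ M ∈ h.toFinset, if A ≤ M ∧ M ≤ B then F M else 0 := by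
  have hsub : Set.Icc A B ⊆ Set.Icc U V := Set.Icc_subset_Icc hA hB
  rw [finsum_mem_eq_finite_toFinset_sum _ (h.subset hsub), ← Finset.sum_filter]
  refine Finset.sum_congr ?_ fun _ _ => rfl
  ext M
  simp only [Set.Finite.mem_toFinset, Finset.mem_filter]
  exact ⟨fun hM => ⟨hsub hM, hM⟩, fun hM => hM.2⟩

open scoped Classical in
-- Double counting of pairs `N ≤ M` of relative dimension one: a line `M / N` has `Q - 1` nonzero
-- vectors, and `M` has `(Q ^ dim A M - 1) / (Q - 1)` such `N`.
theorem finsum_pairs {A V : Submodule R W} (h : Elem A V) (g : ℕ → ℤ) (F : Submodule R W → ℤ) :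
    ∑ᶠ N ∈ Set.Icc A V, g (dim N V) * ∑ᶠ y : V ⧸ N.submoduleOf V,
        (if y = 0 then 0 else F (N ⊔ span R {(y.out : W)})) =
      ∑ᶠ M ∈ Set.Icc A V, g (dim M V + 1) * ((resCard R : ℤ) ^ dim A M - 1) * F M := by
  have hfin := h.finite_Icc
  have h1 : ∀ N ∈ Set.Icc A V, g (dim N V) * ∑ᶠ y : V ⧸ N.submoduleOf V,
        (if y = 0 then 0 else F (N ⊔ span R {(y.out : W)})) =
      ∑ M ∈ hfin.toFinset, if N ≤ M ∧ M ≤ V then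
        (if dim N M = 1 then g (dim M V + 1) * (((resCard R : ℤ) - 1) * F M) else 0) else 0 := by
    intro N hN
    have hNV := h.right hN.1 hN.2
    rw [finsum_vectors hNV, mul_finsum_mem, ← finsum_Icc_eq_sum hfin hN.1 le_rfl]
    refine finsum_mem_congr rfl fun M hM => ?_
    split_ifs with hd
    · rw [hNV.dim_add hM.1 hM.2, hd, add_comm]
    · rw [mul_zero]
  have h2 : ∀ M ∈ Set.Icc A V, g (dim M V + 1) * ((resCard R : ℤ) ^ dim A M - 1) * F M =
      ∑ N ∈ hfin.toFinset, if A ≤ N ∧ N ≤ M then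
        (if dim N M = 1 then g (dim M V + 1) * (((resCard R : ℤ) - 1) * F M) else 0) else 0 := by
    intro M hM
    rw [← finsum_coatoms (h.left hM.1 hM.2), ← finsum_Icc_eq_sum hfin le_rfl hM.2, mul_finsum_mem,
      mul_finsum_mem, finsum_mem_mul]
    refine finsum_mem_congr rfl fun N hN => ?_
    split_ifs <;> ring
  rw [finsum_mem_congr rfl h1, finsum_mem_congr rfl h2,
    finsum_Icc_eq_sum hfin le_rfl le_rfl, finsum_Icc_eq_sum hfin le_rfl le_rfl]
  rw [← Finset.sum_filter, ← Finset.sum_filter]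
  have h3 : hfin.toFinset.filter (fun M => A ≤ M ∧ M ≤ V) = hfin.toFinset := by
    rw [Finset.filter_eq_self]
    intro M hM
    simpa using hM
  rw [h3, Finset.sum_comm]
  refine Finset.sum_congr rfl fun M hM => Finset.sum_congr rfl fun N hN => ?_
  have hM : A ≤ M ∧ M ≤ V := by simpa using hM
  have hN : A ≤ N ∧ N ≤ V := by simpa using hN
  simp only [hM.2, and_true, hN.1, true_and]

/-- A submodule of finite index that is stable in the sense of the socle is everything. -/
theorem eq_of_socle {M N : Submodule R W} (hle : M ≤ N) {x : R}
    (hx : ∀ a ∈ maximalIdeal R, x ∣ a) (hN : ∀ z ∈ N, ∃ k : ℕ, x ^ k • z ∈ M)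
    (h : ∀ z ∈ N, (∀ a ∈ maximalIdeal R, a • z ∈ M) → z ∈ M) : M = N := by
  refine le_antisymm hle fun z hz => ?_
  obtain ⟨k, hk⟩ := hN z hz
  induction k with
  | zero => simpa using hk
  | succ k ih =>
    apply ih
    refine h _ (N.smul_mem _ hz) fun a ha => ?_
    obtain ⟨b, rfl⟩ := hx a ha
    rw [smul_smul, mul_comm x b, mul_assoc, ← pow_succ', ← smul_smul]
    exact M.smul_mem b hk

/-- The submodule of the elements of `N` whose multiples by the maximal ideal lie in `M`. -/
def socle (M N : Submodule R W) : Submodule R W where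
  carrier := {z | z ∈ N ∧ ∀ a ∈ maximalIdeal R, a • z ∈ M}
  zero_mem' := ⟨N.zero_mem, fun a _ => by simp⟩
  add_mem' hx hy := ⟨N.add_mem hx.1 hy.1, fun a ha => by
    rw [smul_add]
    exact M.add_mem (hx.2 a ha) (hy.2 a ha)⟩
  smul_mem' c x hx := ⟨N.smul_mem c hx.1, fun a ha => by
    rw [smul_comm]
    exact M.smul_mem c (hx.2 a ha)⟩

open scoped Classical in
/-- Inversion of summation over elementary subintervals. -/
theorem finsum_inversion {U V : Submodule R W} (hidx : idx U V ≠ 0) (hUV : U ≤ V)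
    (hU : U ≤ maximalIdeal R • V) {x : R} (hx : ∀ a ∈ maximalIdeal R, x ∣ a)
    (hxU : ∃ k : ℕ, ∀ z ∈ V, x ^ k • z ∈ U) (b : Submodule R W → ℤ) (t : ℤ) :
    ∑ᶠ N ∈ Set.Icc U V, (∏ i ∈ Finset.range (dim (maximalIdeal R • V ⊔ N) V),
        (1 - t * (resCard R : ℤ) ^ i)) *
        (∑ᶠ M ∈ Set.Icc (U ⊔ maximalIdeal R • N) N, wt (resCard R) 1 (dim M N) * b M) =
      ∑ᶠ N ∈ Set.Icc (maximalIdeal R • V) V, wt (resCard R) t (dim N V) * b N := by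
  have hfin := finite_Icc_of_idx hidx
  set S := hfin.toFinset with hS
  have hmS : ∀ {M}, M ∈ S ↔ U ≤ M ∧ M ≤ V := fun {M} => by simp [hS]
  have helem : ∀ M N : Submodule R W, U ≤ M → M ≤ N → N ≤ V → maximalIdeal R • N ≤ M →
      Elem M N := fun M N h1 h2 h3 h4 =>
    ⟨h2, fun a ha v hv => h4 (smul_mem_smul ha hv), fun h0 => hidx (by
      rw [← idx_mul h1 (h2.trans h3), ← idx_mul h2 h3, h0, zero_mul, mul_zero])⟩
  have hsm : ∀ N ≤ V, maximalIdeal R • N ≤ maximalIdeal R • V := fun N hN => smul_mono_right _ hN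
  have hle : maximalIdeal R • V ≤ V := smul_le_right
  -- The `q`-binomial theorem read backwards: the product becomes a sum over the `P` that contain
  -- both `𝔪V` and `N`.
  have hc : ∀ N ∈ S, ∏ i ∈ Finset.range (dim (maximalIdeal R • V ⊔ N) V),
      (1 - t * (resCard R : ℤ) ^ i) =
      ∑ P ∈ S, if maximalIdeal R • V ≤ P ∧ N ≤ P then wt (resCard R) t (dim P V) else 0 := by
    intro N hN
    rw [← finsum_wt (helem _ _ (hU.trans le_sup_left) (sup_le hle (hmS.mp hN).2) le_rfl le_sup_left),
      finsum_Icc_eq_sum hfin (hU.trans le_sup_left) le_rfl]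
    refine Finset.sum_congr rfl fun P hP => ?_
    simp only [sup_le_iff, (hmS.mp hP).2, and_true]
  have h1 : ∑ᶠ N ∈ Set.Icc U V, (∏ i ∈ Finset.range (dim (maximalIdeal R • V ⊔ N) V),
        (1 - t * (resCard R : ℤ) ^ i)) *
        (∑ᶠ M ∈ Set.Icc (U ⊔ maximalIdeal R • N) N, wt (resCard R) 1 (dim M N) * b M) =
      ∑ N ∈ S, ∑ P ∈ S, ∑ M ∈ S,
        if (maximalIdeal R • V ≤ P ∧ N ≤ P) ∧ (maximalIdeal R • N ≤ M ∧ M ≤ N) then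
          wt (resCard R) t (dim P V) * (wt (resCard R) 1 (dim M N) * b M) else 0 := by
    rw [finsum_mem_eq_finite_toFinset_sum _ hfin]
    refine Finset.sum_congr rfl fun N hN => ?_
    rw [hc N hN, finsum_Icc_eq_sum hfin le_sup_left (hmS.mp hN).2, Finset.sum_mul_sum]
    refine Finset.sum_congr rfl fun P _ => Finset.sum_congr rfl fun M hM => ?_
    simp only [sup_le_iff, (hmS.mp hM).1, true_and]
    by_cases h2 : maximalIdeal R • V ≤ P ∧ N ≤ P <;>
      by_cases h3 : maximalIdeal R • N ≤ M ∧ M ≤ N <;> simp [h2, h3]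
  have hmob : ∀ P ∈ S, ∀ M ∈ S, ∑ N ∈ S, (if N ≤ P ∧ (maximalIdeal R • N ≤ M ∧ M ≤ N) then
      wt (resCard R) 1 (dim M N) else 0) = if M = P then 1 else 0 := by
    intro P hP M hM
    by_cases hMP : M ≤ P
    -- For fixed `M ≤ P`, the `N` that occur form the interval from `M` to the socle of `P` modulo
    -- `M`. The Möbius sum over it vanishes unless the socle is trivial, which forces `M = P` since
    -- a power of `x` maps `P` into `M`.
    · have hs : ∀ N : Submodule R W, N ≤ P ∧ (maximalIdeal R • N ≤ M ∧ M ≤ N) ↔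
          M ≤ N ∧ N ≤ socle M P := by
        intro N
        constructor
        · rintro ⟨h2, h3, h4⟩
          exact ⟨h4, fun z hz => ⟨h2 hz, fun a ha => h3 (smul_mem_smul ha hz)⟩⟩
        · rintro ⟨h2, h3⟩
          exact ⟨fun z hz => (h3 hz).1, smul_le.mpr fun a ha z hz => (h3 hz).2 a ha, h2⟩
      have hsP : socle M P ≤ P := fun z hz => hz.1
      have hMs : M ≤ socle M P := fun z hz => ⟨hMP hz, fun a _ => M.smul_mem a hz⟩
      have hE : Elem M (socle M P) := helem _ _ (hmS.mp hM).1 hMs (hsP.trans (hmS.mp hP).2)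
        (smul_le.mpr fun a ha z hz => hz.2 a ha)
      simp only [hs]
      rw [← finsum_Icc_eq_sum hfin (hmS.mp hM).1 (hsP.trans (hmS.mp hP).2)
        (fun N => wt (resCard R) 1 (dim M N))]
      split_ifs with h2
      · subst h2
        have : socle M M = M := le_antisymm hsP hMs
        rw [this]
        simp [dim_self, wt_zero]
      · refine finsum_wt_one hE fun h3 => h2 ?_
        obtain ⟨k, hk⟩ := hxU
        refine eq_of_socle hMP hx (fun z hz => ⟨k, (hmS.mp hM).1 (hk z ((hmS.mp hP).2 hz))⟩) ?_
        intro z hz hz2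
        rw [h3]
        exact ⟨hz, hz2⟩
    · rw [if_neg fun h => hMP h.le]
      refine Finset.sum_eq_zero fun N _ => if_neg ?_
      rintro ⟨h2, -, h3⟩
      exact hMP (h3.trans h2)
  rw [h1, Finset.sum_comm, finsum_Icc_eq_sum hfin hU le_rfl]
  refine Finset.sum_congr rfl fun P hP => ?_
  rw [Finset.sum_comm]
  have h4 : ∀ M ∈ S, ∑ N ∈ S, (if (maximalIdeal R • V ≤ P ∧ N ≤ P) ∧
        (maximalIdeal R • N ≤ M ∧ M ≤ N) then
          wt (resCard R) t (dim P V) * (wt (resCard R) 1 (dim M N) * b M) else 0) =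
      if maximalIdeal R • V ≤ P then wt (resCard R) t (dim P V) * b M * (if M = P then 1 else 0)
      else 0 := by
    intro M hM
    by_cases h5 : maximalIdeal R • V ≤ P
    · rw [if_pos h5, ← hmob P hP M hM, Finset.mul_sum]
      refine Finset.sum_congr rfl fun N _ => ?_
      simp only [h5, true_and]
      split_ifs <;> ring
    · rw [if_neg h5]
      exact Finset.sum_eq_zero fun N _ => if_neg fun h => h5 h.1.1
  rw [Finset.sum_congr rfl h4]
  by_cases h5 : maximalIdeal R • V ≤ P
  · have hPS : P ∈ S := hP
    simp [h5, (hmS.mp hP).2, hPS]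
  · simp [h5]

end IntervalSums

/-! ### Divisibility by powers of a uniformizer -/

section Valuation

variable {L : Type*} [Field L] [ValuativeRel L]

/-- `ϖ` generates the maximal ideal of the valuation ring, and the valuation is discrete. -/
structure IsUnif (ϖ : L) : Prop where
  ne_zero : ϖ ≠ 0
  mem : ϖ ∈ 𝒪[L]
  inv_notMem : ϖ⁻¹ ∉ 𝒪[L]
  exists_ord : ∀ x : L, x ≠ 0 → ∃ n : ℤ, ϖ ^ (-n) * x ∈ 𝒪[L] ∧ ϖ ^ n * x⁻¹ ∈ 𝒪[L]

/-- `x` has valuation at least `n`. -/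
def VGe (ϖ : L) (n : ℤ) (x : L) : Prop := ϖ ^ (-n) * x ∈ 𝒪[L]

/-- `x` has valuation `n`. -/
def VEq (ϖ : L) (n : ℤ) (x : L) : Prop := VGe ϖ n x ∧ VGe ϖ (-n) x⁻¹ ∧ x ≠ 0

variable {ϖ : L}

theorem vge_zero_iff {x : L} : VGe ϖ 0 x ↔ x ∈ 𝒪[L] := by simp [VGe]

theorem VGe.zero (n : ℤ) : VGe ϖ n 0 := by simp [VGe]

theorem VGe.add {n : ℤ} {x y : L} (hx : VGe ϖ n x) (hy : VGe ϖ n y) : VGe ϖ n (x + y) := by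
  rw [VGe, mul_add]
  exact add_mem hx hy

theorem VGe.neg {n : ℤ} {x : L} (hx : VGe ϖ n x) : VGe ϖ n (-x) := by
  rw [VGe, mul_neg]
  exact neg_mem hx

theorem VGe.sub {n : ℤ} {x y : L} (hx : VGe ϖ n x) (hy : VGe ϖ n y) : VGe ϖ n (x - y) := by
  rw [sub_eq_add_neg]
  exact hx.add hy.neg

theorem VGe.sum {ι : Type*} {s : Finset ι} {n : ℤ} {f : ι → L} (h : ∀ i ∈ s, VGe ϖ n (f i)) :
    VGe ϖ n (∑ i ∈ s, f i) := by
  rw [VGe, Finset.mul_sum]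
  exact sum_mem h

namespace IsUnif

theorem vge_mul (hϖ : IsUnif ϖ) {m n : ℤ} {x y : L} (hx : VGe ϖ m x) (hy : VGe ϖ n y) :
    VGe ϖ (m + n) (x * y) := by
  have h := mul_mem hx hy
  rw [VGe, neg_add, zpow_add₀ hϖ.ne_zero]
  convert h using 1
  ring

theorem vge_mul_left (hϖ : IsUnif ϖ) {n : ℤ} {x y : L} (hx : x ∈ 𝒪[L]) (hy : VGe ϖ n y) :
    VGe ϖ n (x * y) := by
  simpa using hϖ.vge_mul (vge_zero_iff.mpr hx) hy

theorem vge_mono (hϖ : IsUnif ϖ) {m n : ℤ} {x : L} (h : m ≤ n) (hx : VGe ϖ n x) : VGe ϖ m x := by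
  obtain ⟨k, rfl⟩ := Int.le.dest h
  have h1 : ϖ ^ (-m) * x = ϖ ^ k * (ϖ ^ (-(m + k)) * x) := by
    rw [← mul_assoc, ← zpow_natCast, ← zpow_add₀ hϖ.ne_zero]
    congr 2
    ring
  rw [VGe, h1]
  exact mul_mem (pow_mem hϖ.mem k) hx

theorem mem_of_vge (hϖ : IsUnif ϖ) {n : ℤ} (hn : 0 ≤ n) {x : L} (hx : VGe ϖ n x) : x ∈ 𝒪[L] :=
  vge_zero_iff.mp (hϖ.vge_mono hn hx)

theorem veq_zpow (hϖ : IsUnif ϖ) (n : ℤ) : VEq ϖ n (ϖ ^ n) := by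
  refine ⟨?_, ?_, zpow_ne_zero _ hϖ.ne_zero⟩
  · rw [VGe, ← zpow_add₀ hϖ.ne_zero, neg_add_cancel, zpow_zero]
    exact one_mem _
  · rw [VGe, neg_neg, mul_inv_cancel₀ (zpow_ne_zero _ hϖ.ne_zero)]
    exact one_mem _

theorem veq_one (hϖ : IsUnif ϖ) : VEq ϖ 0 (1 : L) := by simpa using hϖ.veq_zpow 0

theorem veq_self (hϖ : IsUnif ϖ) : VEq ϖ 1 ϖ := by simpa using hϖ.veq_zpow 1

theorem veq_mul (hϖ : IsUnif ϖ) {m n : ℤ} {x y : L} (hx : VEq ϖ m x) (hy : VEq ϖ n y) :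
    VEq ϖ (m + n) (x * y) := by
  refine ⟨hϖ.vge_mul hx.1 hy.1, ?_, mul_ne_zero hx.2.2 hy.2.2⟩
  rw [mul_inv, neg_add]
  exact hϖ.vge_mul hx.2.1 hy.2.1

theorem exists_veq (hϖ : IsUnif ϖ) {x : L} (hx : x ≠ 0) : ∃ n, VEq ϖ n x := by
  obtain ⟨n, h1, h2⟩ := hϖ.exists_ord x hx
  exact ⟨n, h1, by rwa [VGe, neg_neg], hx⟩

theorem vge_iff (hϖ : IsUnif ϖ) {m n : ℤ} {x : L} (hx : VEq ϖ n x) : VGe ϖ m x ↔ m ≤ n := by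
  refine ⟨fun h => ?_, fun h => hϖ.vge_mono h hx.1⟩
  by_contra hlt
  have h1 := hϖ.vge_mul h hx.2.1
  rw [mul_inv_cancel₀ hx.2.2] at h1
  have h2 := hϖ.vge_mono (show 1 ≤ m + -n by omega) h1
  rw [VGe, mul_one, zpow_neg, zpow_one] at h2
  exact hϖ.inv_notMem h2

theorem veq_of_vge (hϖ : IsUnif ϖ) {n : ℤ} {x : L} (h1 : VGe ϖ n x) (h2 : ¬ VGe ϖ (n + 1) x) :
    VEq ϖ n x := by
  have hx : x ≠ 0 := by
    rintro rfl
    exact h2 (VGe.zero _)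
  obtain ⟨k, hk⟩ := hϖ.exists_veq hx
  rw [hϖ.vge_iff hk] at h1 h2
  have : k = n := by omega
  exact this ▸ hk

theorem not_vge (hϖ : IsUnif ϖ) {m n : ℤ} {x : L} (hx : VEq ϖ n x) (h : n < m) :
    ¬ VGe ϖ m x := fun h' =>
  absurd ((hϖ.vge_iff hx).mp h') (not_le.mpr h)

theorem veq_add (hϖ : IsUnif ϖ) {n : ℤ} {x y : L} (hx : VEq ϖ n x) (hy : VGe ϖ (n + 1) y) :
    VEq ϖ n (x + y) := by
  refine hϖ.veq_of_vge (hx.1.add (hϖ.vge_mono (by omega) hy)) fun h => ?_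
  have := h.sub hy
  rw [add_sub_cancel_right] at this
  exact hϖ.not_vge hx (by omega) this

theorem vge_mul_iff (hϖ : IsUnif ϖ) {m n : ℤ} {x y : L} (hy : VEq ϖ n y) :
    VGe ϖ m (x * y) ↔ VGe ϖ (m - n) x := by
  constructor
  · intro h
    have := hϖ.vge_mul h hy.2.1
    rwa [mul_assoc, mul_inv_cancel₀ hy.2.2, mul_one, ← sub_eq_add_neg] at this
  · intro h
    have := hϖ.vge_mul h hy.1
    rwa [sub_add_cancel] at this

theorem vge_zpow_mul_iff (hϖ : IsUnif ϖ) {m n : ℤ} {x : L} :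
    VGe ϖ m (ϖ ^ n * x) ↔ VGe ϖ (m - n) x := by
  rw [mul_comm, hϖ.vge_mul_iff (hϖ.veq_zpow n)]

theorem mem_maximalIdeal_iff (hϖ : IsUnif ϖ) (x : 𝒪[L]) : x ∈ 𝓂[L] ↔ VGe ϖ 1 (x : L) := by
  rw [IsLocalRing.mem_maximalIdeal, mem_nonunits_iff]
  constructor
  · intro h
    by_contra h1
    have h2 := hϖ.veq_of_vge (n := 0) (vge_zero_iff.mpr x.2) (by simpa using h1)
    have h3 : (x : L)⁻¹ ∈ 𝒪[L] := by simpa [VGe] using h2.2.1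
    exact h (IsUnit.of_mul_eq_one ⟨_, h3⟩ (Subtype.ext (mul_inv_cancel₀ h2.2.2)))
  · rintro h ⟨u, rfl⟩
    have h1 : ((u : 𝒪[L]) : L) * ((u⁻¹ : (𝒪[L])ˣ) : 𝒪[L]) = 1 := by
      exact_mod_cast congrArg Subtype.val u.mul_inv
    have h2 := hϖ.vge_mul h (vge_zero_iff.mpr ((u⁻¹ : (𝒪[L])ˣ) : 𝒪[L]).2)
    rw [h1] at h2
    exact hϖ.not_vge hϖ.veq_one (by norm_num) h2

end IsUnif

end Valuation

/-! ### Boxes -/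

section Boxes

variable {L : Type*} [Field L] [ValuativeRel L] {W : Type*} [AddCommGroup W] [Module L W]
  {ι : Type*} [Fintype ι]

/-- The combinations of the `v_i` with coefficients of valuation at least `k_i`. -/
def box (ϖ : L) (v : ι → W) (k : ι → ℤ) : Submodule 𝒪[L] W where
  carrier := {z | ∃ c : ι → L, (∀ i, VGe ϖ (k i) (c i)) ∧ z = ∑ i, c i • v i}
  zero_mem' := ⟨0, fun i => VGe.zero _, by simp⟩
  add_mem' := by
    rintro _ _ ⟨c, hc, rfl⟩ ⟨d, hd, rfl⟩
    exact ⟨c + d, fun i => (hc i).add (hd i), by simp [add_smul, Finset.sum_add_distrib]⟩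
  smul_mem' := by
    rintro a _ ⟨c, hc, rfl⟩
    refine ⟨fun i => (a : L) * c i, fun i => ?_, ?_⟩
    · have := mul_mem a.2 (hc i)
      rw [VGe]
      convert this using 1
      ring
    · rw [Finset.smul_sum]
      exact Finset.sum_congr rfl fun i _ => (smul_smul (a : L) (c i) (v i))

variable {ϖ : L} {v : ι → W} {k : ι → ℤ}

theorem mem_box {z : W} : z ∈ box ϖ v k ↔ ∃ c : ι → L, (∀ i, VGe ϖ (k i) (c i)) ∧
    z = ∑ i, c i • v i := Iff.rfl

theorem sum_mem_box_iff (hv : LinearIndependent L v) {c : ι → L} :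
    ∑ i, c i • v i ∈ box ϖ v k ↔ ∀ i, VGe ϖ (k i) (c i) := by
  refine ⟨fun ⟨d, hd, h⟩ i => ?_, fun h => ⟨c, h, rfl⟩⟩
  have : c i = d i := by
    have h1 : ∑ i, (c i - d i) • v i = 0 := by
      simp only [sub_smul, Finset.sum_sub_distrib, h, sub_self]
    have := Fintype.linearIndependent_iff.mp hv _ h1 i
    exact sub_eq_zero.mp this
  exact this ▸ hd i

theorem smul_mem_box (hϖ : IsUnif ϖ) (i : ι) {c : L} (hc : VGe ϖ (k i) c) :
    c • v i ∈ box ϖ v k := by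
  classical
  refine ⟨Pi.single i c, fun j => ?_, by simp [Pi.single_apply]⟩
  rcases eq_or_ne j i with rfl | h
  · simpa using hc
  · simpa [h] using VGe.zero _

theorem span_eq_box (hϖ : IsUnif ϖ) :
    Submodule.span 𝒪[L] (Set.range fun i => ϖ ^ k i • v i) = box ϖ v k := by
  refine le_antisymm (Submodule.span_le.mpr ?_) ?_
  · rintro _ ⟨i, rfl⟩
    exact smul_mem_box hϖ i (hϖ.veq_zpow _).1
  · rintro _ ⟨c, hc, rfl⟩
    refine Submodule.sum_mem _ fun i _ => ?_
    have : c i • v i = (⟨ϖ ^ (-k i) * c i, hc i⟩ : 𝒪[L]) • (ϖ ^ k i • v i) := by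
      change _ = (ϖ ^ (-k i) * c i) • (ϖ ^ k i • v i)
      rw [smul_smul, mul_right_comm, ← zpow_add₀ hϖ.ne_zero]
      simp
    rw [this]
    exact Submodule.smul_mem _ _ (Submodule.subset_span ⟨i, rfl⟩)

theorem box_mono (hϖ : IsUnif ϖ) {k' : ι → ℤ} (h : k ≤ k') : box ϖ v k' ≤ box ϖ v k := by
  rintro _ ⟨c, hc, rfl⟩
  exact ⟨c, fun i => hϖ.vge_mono (h i) (hc i), rfl⟩

theorem idx_box_update [DecidableEq ι] (hϖ : IsUnif ϖ) (hv : LinearIndependent L v) (i : ι) :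
    idx (box ϖ v (Function.update k i (k i + 1))) (box ϖ v k) = resCard 𝒪[L] := by
  have hle : k ≤ Function.update k i (k i + 1) := by
    intro j
    rcases eq_or_ne j i with rfl | h
    · simp
    · simp [h]
  have h1 : box ϖ v (Function.update k i (k i + 1)) ⊔ Submodule.span 𝒪[L] {ϖ ^ k i • v i} =
      box ϖ v k := by
    refine le_antisymm (sup_le (box_mono hϖ hle) ((Submodule.span_singleton_le_iff_mem _ _).mpr
      (smul_mem_box hϖ i (hϖ.veq_zpow _).1))) ?_
    rintro _ ⟨c, hc, rfl⟩
    rw [← Finset.sum_erase_add _ _ (Finset.mem_univ i)]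
    refine Submodule.add_mem_sup (Submodule.sum_mem _ fun j hj => smul_mem_box hϖ j ?_) ?_
    · rw [Function.update_of_ne (Finset.ne_of_mem_erase hj)]
      exact hc j
    · have : c i • v i = (⟨ϖ ^ (-k i) * c i, hc i⟩ : 𝒪[L]) • (ϖ ^ k i • v i) := by
        change _ = (ϖ ^ (-k i) * c i) • (ϖ ^ k i • v i)
        rw [smul_smul, mul_right_comm, ← zpow_add₀ hϖ.ne_zero]
        simp
      rw [this]
      exact Submodule.smul_mem _ _ (Submodule.mem_span_singleton_self _)
  rw [← h1, resCard]
  refine idx_step ?_ ?_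
  · intro h
    have h2 : ϖ ^ k i • v i = ∑ j, (Pi.single i (ϖ ^ k i) : ι → L) j • v j := by
      simp [Pi.single_apply]
    rw [h2, sum_mem_box_iff hv] at h
    have := h i
    rw [Function.update_self, Pi.single_eq_same] at this
    exact hϖ.not_vge (hϖ.veq_zpow _) (by omega) this
  · intro a ha
    have h2 : a • (ϖ ^ k i • v i) = ((a : L) * ϖ ^ k i) • v i := smul_smul (a : L) _ _
    rw [h2]
    refine smul_mem_box hϖ i ?_
    rw [Function.update_self, add_comm]
    exact hϖ.vge_mul ((hϖ.mem_maximalIdeal_iff a).mp ha) (hϖ.veq_zpow _).1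

theorem idx_box (hϖ : IsUnif ϖ) (hv : LinearIndependent L v) (n : ι → ℕ) :
    idx (box ϖ v (fun i => k i + n i)) (box ϖ v k) = resCard 𝒪[L] ^ ∑ i, n i := by
  classical
  induction hs : ∑ i, n i generalizing n with
  | zero =>
    have : ∀ i, n i = 0 := by simpa using hs
    simp [this, idx_self]
  | succ s ih =>
    obtain ⟨i, hi⟩ : ∃ i, n i ≠ 0 := by
      by_contra! h
      simp [h] at hs
    let n' := Function.update n i (n i - 1)
    have hn' : ∑ j, n' j = s := by
      have e1 := Finset.add_sum_erase _ n (Finset.mem_univ i)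
      have e2 := Finset.add_sum_erase _ n' (Finset.mem_univ i)
      have e3 : ∑ j ∈ Finset.univ.erase i, n' j = ∑ j ∈ Finset.univ.erase i, n j :=
        Finset.sum_congr rfl fun j hj => by simp [n', Finset.ne_of_mem_erase hj]
      have e4 : n' i = n i - 1 := by simp [n']
      omega
    have h1 := ih n' hn'
    have h2 := idx_box_update (k := fun j => k j + (n' j : ℤ)) hϖ hv i
    have h3 : Function.update (fun j => k j + (n' j : ℤ)) i (k i + (n' i : ℤ) + 1) =
        fun j => k j + (n j : ℤ) := by
      ext j
      rcases eq_or_ne j i with rfl | h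
      · simp [n']
        omega
      · simp [n', h]
    rw [h3] at h2
    rw [← idx_mul (M := box ϖ v fun j => k j + (n' j : ℤ)) _ _, h1, h2, pow_succ, mul_comm]
    · refine box_mono hϖ fun j => ?_
      rcases eq_or_ne j i with rfl | h
      · simp [n']
      · simp [n', h]
    · exact box_mono hϖ fun j => by simp

end Boxes

/-! ### Hermitian forms over a field with a discrete valuation and an involution -/

section Herm

variable {L : Type*} [Field L] [ValuativeRel L]

/-- The properties of an unramified quadratic extension of local fields that are used, for the
nontrivial automorphism `σ` and a uniformizer `ϖ` of the smaller field. -/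
structure UnramInvol (σ : L →+* L) (ϖ : L) (q : ℕ) : Prop where
  unif : IsUnif ϖ
  invol : ∀ x, σ (σ x) = x
  fix : σ ϖ = ϖ
  mem : ∀ x ∈ 𝒪[L], σ x ∈ 𝒪[L]
  exists_trace : ∃ τ ∈ 𝒪[L], τ + σ τ = 1
  exists_skew : ∃ θ, VEq ϖ 0 θ ∧ σ θ = -θ
  card : Nat.card 𝓀[L] = q ^ 2
  two_le : 2 ≤ q
  card_norm : ∀ c, VEq ϖ 0 c → σ c = c →
    Nat.card {s : 𝓀[L] // ∃ t : 𝒪[L], IsLocalRing.residue 𝒪[L] t = s ∧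
      VGe ϖ 1 ((t : L) * σ t - c)} = q + 1

variable {σ : L →+* L} {ϖ : L} {q : ℕ}

namespace UnramInvol

theorem map_zpow (hσ : UnramInvol σ ϖ q) (n : ℤ) : σ (ϖ ^ n) = ϖ ^ n := by rw [map_zpow₀, hσ.fix]

theorem vge_map (hσ : UnramInvol σ ϖ q) {n : ℤ} {x : L} (hx : VGe ϖ n x) : VGe ϖ n (σ x) := by
  have := hσ.mem _ hx
  rwa [map_mul, hσ.map_zpow] at this

theorem veq_map (hσ : UnramInvol σ ϖ q) {n : ℤ} {x : L} (hx : VEq ϖ n x) : VEq ϖ n (σ x) :=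
  ⟨hσ.vge_map hx.1, by rw [← map_inv₀]; exact hσ.vge_map hx.2.1, (map_ne_zero σ).mpr hx.2.2⟩

end UnramInvol

variable {W : Type*} [AddCommGroup W] [Module L W]

/-- The form is hermitian. -/
def IsHerm (h : W →ₗ[L] W →ₛₗ[σ] L) : Prop := ∀ x y, h y x = σ (h x y)

/-- The elements of `M` whose products with all elements of `M` have valuation at least `m`. -/
def lev (ϖ : L) (h : W →ₗ[L] W →ₛₗ[σ] L) (M : Submodule 𝒪[L] W) (m : ℤ) :
    Submodule 𝒪[L] W where
  carrier := {z | z ∈ M ∧ ∀ y ∈ M, VGe ϖ m (h z y)}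
  zero_mem' := ⟨zero_mem _, fun y _ => by simpa using VGe.zero m⟩
  add_mem' ha hb := ⟨add_mem ha.1 hb.1, fun y hy => by simpa using (ha.2 y hy).add (hb.2 y hy)⟩
  smul_mem' c x hx := ⟨Submodule.smul_mem _ c hx.1, fun y hy => by
    have h1 : h (c • x) y = (c : L) * h x y := by
      change h ((c : L) • x) y = _
      simp
    rw [h1, VGe, mul_left_comm]
    exact mul_mem c.2 (hx.2 y hy)⟩

variable {ι κ : Type*} [Fintype ι] [Fintype κ]

/-- `M` is the orthogonal sum of the lines generated by the vectors `v_i`, whose norms have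
valuation `e_i`. -/
structure OrthBasis (h : W →ₗ[L] W →ₛₗ[σ] L) (ϖ : L) (v : ι → W) (e : ι → ℤ)
    (M : Submodule 𝒪[L] W) : Prop where
  orth : ∀ i j, i ≠ j → h (v i) (v j) = 0
  ord : ∀ i, VEq ϖ (e i) (h (v i) (v i))
  eq : M = box ϖ v 0

variable {h : W →ₗ[L] W →ₛₗ[σ] L} {v : ι → W} {e : ι → ℤ} {M : Submodule 𝒪[L] W}

namespace OrthBasis

theorem apply_sum (hb : OrthBasis h ϖ v e M) (c : ι → L) (j : ι) :
    h (∑ i, c i • v i) (v j) = c j * h (v j) (v j) := by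
  rw [map_sum, LinearMap.sum_apply, Finset.sum_eq_single j]
  · simp
  · intro i _ hij
    simp [hb.orth i j hij]
  · simp

theorem linearIndependent (hb : OrthBasis h ϖ v e M) : LinearIndependent L v := by
  rw [Fintype.linearIndependent_iff]
  intro c hc i
  have := hb.apply_sum c i
  rw [hc, map_zero, LinearMap.zero_apply] at this
  exact (mul_eq_zero.mp this.symm).resolve_right (hb.ord i).2.2

theorem apply_sum_sum (hb : OrthBasis h ϖ v e M) (c d : ι → L) :
    h (∑ i, c i • v i) (∑ i, d i • v i) = ∑ i, c i * σ (d i) * h (v i) (v i) := by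
  rw [map_sum]
  refine Finset.sum_congr rfl fun j _ => ?_
  rw [map_smulₛₗ, hb.apply_sum, smul_eq_mul]
  ring

theorem sum_mem_iff (hb : OrthBasis h ϖ v e M) {c : ι → L} :
    ∑ i, c i • v i ∈ M ↔ ∀ i, c i ∈ 𝒪[L] := by
  rw [hb.eq, sum_mem_box_iff hb.linearIndependent]
  simp [vge_zero_iff]

theorem exists_sum (hb : OrthBasis h ϖ v e M) {z : W} (hz : z ∈ M) :
    ∃ c : ι → L, (∀ i, c i ∈ 𝒪[L]) ∧ z = ∑ i, c i • v i := by
  rw [hb.eq] at hz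
  obtain ⟨c, hc, rfl⟩ := hz
  exact ⟨c, fun i => vge_zero_iff.mp (hc i), rfl⟩

theorem mem (hb : OrthBasis h ϖ v e M) (hϖ : IsUnif ϖ) (i : ι) : v i ∈ M := by
  rw [hb.eq]
  simpa using smul_mem_box (k := (0 : ι → ℤ)) (v := v) hϖ i (c := 1) hϖ.veq_one.1

theorem nondegenerate (hb : OrthBasis h ϖ v e M) (hϖ : IsUnif ϖ) {z : W}
    (hz : ∃ c : ι → L, z = ∑ i, c i • v i) (h0 : ∀ y ∈ M, h z y = 0) : z = 0 := by
  obtain ⟨c, rfl⟩ := hz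
  refine Finset.sum_eq_zero fun i _ => ?_
  have := h0 _ (hb.mem hϖ i)
  rw [hb.apply_sum] at this
  rw [(mul_eq_zero.mp this).resolve_right (hb.ord i).2.2, zero_smul]

theorem reindex (hb : OrthBasis h ϖ v e M) (s : κ ≃ ι) :
    OrthBasis h ϖ (v ∘ s) (e ∘ s) M := by
  refine ⟨fun i j hij => hb.orth _ _ (s.injective.ne hij), fun i => hb.ord _, ?_⟩
  rw [hb.eq]
  ext z
  simp only [mem_box]
  constructor
  · rintro ⟨c, hc, rfl⟩
    exact ⟨c ∘ s, fun i => hc _, (Equiv.sum_comp s fun i => c i • v i).symm⟩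
  · rintro ⟨c, hc, rfl⟩
    refine ⟨c ∘ s.symm, fun i => hc _, ?_⟩
    rw [← Equiv.sum_comp s]
    simp

theorem lev_eq (hσ : UnramInvol σ ϖ q) (hb : OrthBasis h ϖ v e M) (m : ℤ) :
    lev ϖ h M m = box ϖ v (fun i => ((m - e i).toNat : ℤ)) := by
  have hϖ := hσ.unif
  ext z
  constructor
  · rintro ⟨hz, hz'⟩
    obtain ⟨c, hc, rfl⟩ := hb.exists_sum hz
    refine (sum_mem_box_iff hb.linearIndependent).mpr fun i => ?_
    have h1 := hz' _ (hb.mem hϖ i)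
    rw [hb.apply_sum, hϖ.vge_mul_iff (hb.ord i)] at h1
    rcases le_total (m - e i) 0 with h2 | h2
    · rw [Int.toNat_of_nonpos h2]
      exact vge_zero_iff.mpr (hc i)
    · rwa [Int.toNat_of_nonneg h2]
  · rintro ⟨c, hc, rfl⟩
    refine ⟨hb.sum_mem_iff.mpr fun i => hϖ.mem_of_vge (by positivity) (hc i), fun y hy => ?_⟩
    obtain ⟨d, hd, rfl⟩ := hb.exists_sum hy
    rw [hb.apply_sum_sum]
    refine VGe.sum fun i _ => ?_
    rw [hϖ.vge_mul_iff (hb.ord i), mul_comm]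
    exact hϖ.vge_mul_left (hσ.mem _ (hd i)) (hϖ.vge_mono (Int.self_le_toNat _) (hc i))

theorem idx_lev (hσ : UnramInvol σ ϖ q) (hb : OrthBasis h ϖ v e M) (m : ℤ) :
    idx (lev ϖ h M m) M = (q ^ 2) ^ ∑ i, (m - e i).toNat := by
  have h1 := idx_box (k := (0 : ι → ℤ)) hσ.unif hb.linearIndependent
    (fun i => (m - e i).toNat)
  rw [← hb.eq] at h1
  have h2 : q ^ 2 = resCard 𝒪[L] := hσ.card.symm
  rw [hb.lev_eq hσ, h2]
  simpa using h1

end OrthBasis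

/-- The second difference in `m` of the positive part of `m - e i` is the indicator of `e i = m`; so
these sums determine the multiset of the `e i`. -/
theorem count_map_univ (e : ι → ℤ) (m : ℤ) :
    ((Finset.univ.val.map e).count m : ℤ) =
      ∑ i, ((m + 1 - e i).toNat : ℤ) - 2 * ∑ i, ((m - e i).toNat : ℤ) +
        ∑ i, ((m - 1 - e i).toNat : ℤ) := by
  rw [Multiset.count_map, ← Finset.filter_val, Finset.card_val, Finset.card_filter,
    Nat.cast_sum, Finset.mul_sum, ← Finset.sum_sub_distrib, ← Finset.sum_add_distrib]
  refine Finset.sum_congr rfl fun i _ => ?_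
  split_ifs with h
  · subst h
    simp
  · have : m ≠ e i := h
    push_cast
    omega

theorem map_univ_eq_of_sum_toNat {e : ι → ℤ} {e' : κ → ℤ}
    (hs : ∀ m : ℤ, ∑ i, (m - e i).toNat = ∑ i, (m - e' i).toNat) :
    Finset.univ.val.map e = Finset.univ.val.map e' := by
  ext m
  have h1 := count_map_univ e m
  have h2 := count_map_univ e' m
  simp only [← Nat.cast_sum, hs] at h1 h2
  exact_mod_cast h1.trans h2.symm

/-- The submodules `lev ϖ h M m` do not depend on a basis, and their indices in `M` determine the
sums of the positive parts of `m - e i` for all `m`. -/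
theorem OrthBasis.unique (hσ : UnramInvol σ ϖ q) (hb : OrthBasis h ϖ v e M) {v' : κ → W}
    {e' : κ → ℤ} (hb' : OrthBasis h ϖ v' e' M) :
    Finset.univ.val.map e = Finset.univ.val.map e' := by
  refine map_univ_eq_of_sum_toNat fun m => ?_
  have h1 := (hb.idx_lev hσ m).symm.trans (hb'.idx_lev hσ m)
  exact Nat.pow_right_injective (a := q ^ 2) (by nlinarith [hσ.two_le]) h1

/-- `M` has an orthogonal basis whose norms have the valuations in the multiset. -/
def OrthType (h : W →ₗ[L] W →ₛₗ[σ] L) (ϖ : L) (M : Submodule 𝒪[L] W) (s : Multiset ℤ) : Prop :=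
  ∃ (n : ℕ) (v : Fin n → W) (e : Fin n → ℤ), OrthBasis h ϖ v e M ∧ s = Finset.univ.val.map e

open scoped Classical in
/-- The multiset of the valuations of the norms of an orthogonal basis of `M`. -/
noncomputable def typ (h : W →ₗ[L] W →ₛₗ[σ] L) (ϖ : L) (M : Submodule 𝒪[L] W) : Multiset ℤ :=
  if hM : ∃ s, OrthType h ϖ M s then hM.choose else 0

theorem OrthBasis.orthType (hb : OrthBasis h ϖ v e M) :
    OrthType h ϖ M (Finset.univ.val.map e) := by
  refine ⟨_, _, _, hb.reindex (Fintype.equivFin ι).symm, ?_⟩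
  rw [← Multiset.map_map]
  congr 1
  exact (Multiset.map_univ_val_equiv (Fintype.equivFin ι).symm).symm

theorem OrthType.typ_eq (hσ : UnramInvol σ ϖ q) {s : Multiset ℤ} (hs : OrthType h ϖ M s) :
    typ h ϖ M = s := by
  have hM : ∃ s, OrthType h ϖ M s := ⟨s, hs⟩
  rw [typ, dif_pos hM]
  obtain ⟨n, v, e, hb, he⟩ := hM.choose_spec
  obtain ⟨n', v', e', hb', he'⟩ := hs
  rw [he, he', hb.unique hσ hb']

theorem OrthBasis.typ_eq (hσ : UnramInvol σ ϖ q) (hb : OrthBasis h ϖ v e M) :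
    typ h ϖ M = Finset.univ.val.map e := hb.orthType.typ_eq hσ

/-! ### Existence of orthogonal bases -/

theorem herm_smul_left (a : 𝒪[L]) (x y : W) : h (a • x) y = (a : L) * h x y := by
  change h ((a : L) • x) y = _
  simp

theorem herm_smul_right (a : 𝒪[L]) (x y : W) : h x (a • y) = σ (a : L) * h x y := by
  change h x ((a : L) • y) = _
  simp

/-- Polarization by means of an element of trace one, which avoids dividing by 2: if all norms were
more divisible than some product `h z y`, the norm of a suitable `z + t y` would still be `ϖ ^ m` up
to higher terms. -/
theorem exists_norm_veq (hσ : UnramInvol σ ϖ q) (hh : IsHerm h) {m : ℤ}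
    (hm : ∀ z ∈ M, ∀ y ∈ M, VGe ϖ m (h z y)) {z y : W} (hz : z ∈ M) (hy : y ∈ M)
    (hzy : ¬ VGe ϖ (m + 1) (h z y)) : ∃ w ∈ M, VEq ϖ m (h w w) := by
  have hϖ := hσ.unif
  by_contra! hno
  have hnorm : ∀ w ∈ M, VGe ϖ (m + 1) (h w w) := fun w hw => by
    by_contra h1
    exact hno w hw (hϖ.veq_of_vge (hm w hw w hw) h1)
  obtain ⟨τ, hτ, hτ1⟩ := hσ.exists_trace
  have hα := hϖ.veq_of_vge (hm z hz y hy) hzy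
  -- Chosen so that the two mixed terms are `τ ϖ ^ m` and its conjugate, with sum `ϖ ^ m`.
  set t : L := σ (τ * ϖ ^ m * (h z y)⁻¹) with ht
  have htm : t ∈ 𝒪[L] := by
    refine hσ.mem _ (vge_zero_iff (ϖ := ϖ).mp ?_)
    have := hϖ.vge_mul (hϖ.vge_mul (vge_zero_iff.mpr hτ) (hϖ.veq_zpow m).1) hα.2.1
    convert this using 1
    ring
  have hw : z + (⟨t, htm⟩ : 𝒪[L]) • y ∈ M := add_mem hz (Submodule.smul_mem _ _ hy)
  have h1 := hnorm _ hw
  have hs : σ t * h z y = τ * ϖ ^ m := by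
    rw [ht, hσ.invol, mul_assoc, inv_mul_cancel₀ hα.2.2, mul_one]
  have h2 : h (z + (⟨t, htm⟩ : 𝒪[L]) • y) (z + (⟨t, htm⟩ : 𝒪[L]) • y) =
      h z z + t * σ t * h y y + ϖ ^ m := by
    have hs' : t * h y z = σ τ * ϖ ^ m := by
      rw [hh z y]
      have := congrArg σ hs
      rwa [map_mul, hσ.invol, map_mul, hσ.map_zpow] at this
    simp only [map_add, LinearMap.add_apply, herm_smul_left, herm_smul_right]
    rw [hs, hs']
    linear_combination ϖ ^ m * hτ1
  rw [h2] at h1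
  have h3 := h1.sub ((hnorm z hz).add
    (hϖ.vge_mul_left (mul_mem htm (hσ.mem _ htm)) (hnorm y hy)))
  rw [add_sub_cancel_left] at h3
  exact hϖ.not_vge (hϖ.veq_zpow m) (by omega) h3

theorem exists_int_min {P : ℤ → Prop} {C : ℤ} (hC : P C) (hne : ∃ n, ¬ P n)
    (hP : ∀ m n, m ≤ n → P n → P m) :
    ∃ m, P m ∧ ¬ P (m + 1) := by
  obtain ⟨n, hn⟩ := hne
  by_contra! hno
  have : ∀ k : ℕ, P (C + k) := by
    intro k
    induction k with
    | zero => simpa using hC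
    | succ k ih => simpa [add_assoc] using hno _ ih
  refine hn (hP _ _ ?_ (this (n - C).toNat))
  omega

/-- Extension of an orthogonal basis by a vector. -/
theorem OrthBasis.cons (hσ : UnramInvol σ ϖ q) (hh : IsHerm h) {n : ℕ} {v : Fin n → W}
    {e : Fin n → ℤ} {M : Submodule 𝒪[L] W} (hb : OrthBasis h ϖ v e M) {w : W} {m : ℤ}
    (hw : VEq ϖ m (h w w)) (hperp : ∀ z ∈ M, h z w = 0) :
    OrthBasis h ϖ (Fin.cons w v : Fin (n + 1) → W) (Fin.cons m e : Fin (n + 1) → ℤ)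
      (M ⊔ Submodule.span 𝒪[L] {w}) := by
  have h1 : ∀ i, h (v i) w = 0 := fun i => hperp _ (hb.mem hσ.unif i)
  have h2 : ∀ i, h w (v i) = 0 := fun i => by rw [hh (v i) w, h1, map_zero]
  refine ⟨?_, ?_, ?_⟩
  · intro i j hij
    induction i using Fin.cases with
    | zero =>
      induction j using Fin.cases with
      | zero => exact absurd rfl hij
      | succ j => simpa using h2 j
    | succ i =>
      induction j using Fin.cases with
      | zero => simpa using h1 i
      | succ j => simpa using hb.orth i j (fun h => hij (congrArg _ h))
  · intro i
    induction i using Fin.cases with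
    | zero => simpa using hw
    | succ i => simpa using hb.ord i
  · ext z
    rw [Submodule.mem_sup]
    constructor
    · rintro ⟨y, hy, z, hz, rfl⟩
      obtain ⟨c, hc, rfl⟩ := hb.exists_sum hy
      obtain ⟨a, rfl⟩ := Submodule.mem_span_singleton.mp hz
      refine ⟨Fin.cons (a : L) c, ?_, ?_⟩
      · intro i
        induction i using Fin.cases with
        | zero => exact vge_zero_iff.mpr a.2
        | succ i => exact vge_zero_iff.mpr (hc i)
      · rw [Fin.sum_univ_succ]
        simp only [Fin.cons_zero, Fin.cons_succ]
        exact add_comm _ _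
    · rintro ⟨c, hc, rfl⟩
      refine ⟨∑ i : Fin n, c i.succ • v i, hb.sum_mem_iff.mpr fun i => vge_zero_iff.mp (hc i.succ),
        (⟨c 0, vge_zero_iff.mp (hc 0)⟩ : 𝒪[L]) • w,
        Submodule.smul_mem _ _ (Submodule.mem_span_singleton_self _), ?_⟩
      rw [Fin.sum_univ_succ]
      simp only [Fin.cons_zero, Fin.cons_succ]
      exact add_comm _ _

/-- The elements of `M` orthogonal to `w`. -/
def perp (h : W →ₗ[L] W →ₛₗ[σ] L) (M : Submodule 𝒪[L] W) (w : W) : Submodule 𝒪[L] W where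
  carrier := {z | z ∈ M ∧ h z w = 0}
  zero_mem' := ⟨zero_mem _, by simp⟩
  add_mem' ha hb := ⟨add_mem ha.1 hb.1, by simp [ha.2, hb.2]⟩
  smul_mem' a x hx := ⟨Submodule.smul_mem _ a hx.1, by rw [herm_smul_left, hx.2, mul_zero]⟩

/-- The form on `M` is bounded and nondegenerate. -/
structure NondegLat (h : W →ₗ[L] W →ₛₗ[σ] L) (ϖ : L) (M : Submodule 𝒪[L] W) : Prop where
  bdd : ∃ C : ℤ, ∀ z ∈ M, ∀ y ∈ M, VGe ϖ C (h z y)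
  nondeg : ∀ z ∈ M, (∀ y ∈ M, h z y = 0) → z = 0

/-- If the products of `w` with `M` are divisible by the norm of `w`, then `w` splits off. -/
theorem perp_sup_span (hσ : UnramInvol σ ϖ q) {m : ℤ} {w : W} (hm : ∀ z ∈ M, VGe ϖ m (h z w))
    (hwM : w ∈ M) (hw : VEq ϖ m (h w w)) : perp h M w ⊔ Submodule.span 𝒪[L] {w} = M := by
  refine le_antisymm (sup_le (fun z hz => hz.1)
    ((Submodule.span_singleton_le_iff_mem _ _).mpr hwM)) fun z hz => ?_
  have hc : h z w * (h w w)⁻¹ ∈ 𝒪[L] := by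
    have := hσ.unif.vge_mul (hm z hz) hw.2.1
    rw [add_neg_cancel] at this
    exact vge_zero_iff.mp this
  rw [Submodule.mem_sup]
  refine ⟨z - (⟨_, hc⟩ : 𝒪[L]) • w, ⟨sub_mem hz (Submodule.smul_mem _ _ hwM), ?_⟩,
    (⟨_, hc⟩ : 𝒪[L]) • w, Submodule.smul_mem _ _ (Submodule.mem_span_singleton_self _), by simp⟩
  rw [map_sub, LinearMap.sub_apply, herm_smul_left, mul_assoc, inv_mul_cancel₀ hw.2.2, mul_one,
    sub_self]

theorem NondegLat.perp (hM : NondegLat h ϖ M) {w : W}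
    (hsplit : HermitianHecke.perp h M w ⊔ Submodule.span 𝒪[L] {w} = M) :
    NondegLat h ϖ (HermitianHecke.perp h M w) := by
  obtain ⟨C, hC⟩ := hM.bdd
  refine ⟨⟨C, fun z hz y hy => hC z hz.1 y hy.1⟩, fun z hz h0 => hM.nondeg z hz.1 fun y hy => ?_⟩
  rw [← hsplit, Submodule.mem_sup] at hy
  obtain ⟨y₁, hy₁, y₂, hy₂, rfl⟩ := hy
  obtain ⟨a, rfl⟩ := Submodule.mem_span_singleton.mp hy₂
  rw [map_add, herm_smul_right, h0 y₁ hy₁, hz.2, mul_zero, add_zero]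

/-- Take the minimal valuation `m` of all products. Some vector has norm of valuation exactly `m`,
hence splits off orthogonally; its complement spans a smaller space. -/
theorem NondegLat.exists_orthBasis [FiniteDimensional L W] (hσ : UnramInvol σ ϖ q) (hh : IsHerm h)
    {M : Submodule 𝒪[L] W} (hM : NondegLat h ϖ M) :
    ∃ (n : ℕ) (v : Fin n → W) (e : Fin n → ℤ), OrthBasis h ϖ v e M := by
  have hϖ := hσ.unif
  induction hn : Module.finrank L (Submodule.span L (M : Set W)) using Nat.strong_induction_on
    generalizing M with
  | _ n ih =>
  by_cases hbot : M = ⊥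
  · refine ⟨0, Fin.elim0, Fin.elim0, fun i => i.elim0, fun i => i.elim0, ?_⟩
    rw [hbot, eq_comm, eq_bot_iff]
    rintro _ ⟨c, -, rfl⟩
    simp
  obtain ⟨z, hz, hz0⟩ := (Submodule.ne_bot_iff M).mp hbot
  have hex : ∃ y ∈ M, h z y ≠ 0 := by
    by_contra! hno
    exact hz0 (hM.nondeg z hz hno)
  obtain ⟨y, hy, hzy⟩ := hex
  obtain ⟨C, hC⟩ := hM.bdd
  obtain ⟨m, hm, hm'⟩ := exists_int_min (P := fun m => ∀ z ∈ M, ∀ y ∈ M, VGe ϖ m (h z y)) hC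
    (by
      obtain ⟨k, hk⟩ := hϖ.exists_veq hzy
      exact ⟨k + 1, fun hno => hϖ.not_vge hk (by omega) (hno z hz y hy)⟩)
    (fun m n hmn hP z hz y hy => hϖ.vge_mono hmn (hP z hz y hy))
  push Not at hm'
  obtain ⟨z₁, hz₁, y₁, hy₁, hzy₁⟩ := hm'
  obtain ⟨w, hwM, hw⟩ := exists_norm_veq hσ hh hm hz₁ hy₁ hzy₁
  have hsplit := perp_sup_span hσ (fun z hz => hm z hz w hwM) hwM hw
  have hwp : ∀ x ∈ Submodule.span L (HermitianHecke.perp h M w : Set W), h x w = 0 := by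
    intro x hx
    induction hx using Submodule.span_induction with
    | mem x hx => exact hx.2
    | zero => simp
    | add x y _ _ hx hy => simp [hx, hy]
    | smul a x _ hx => simp [hx]
  have hlt : Submodule.span L (HermitianHecke.perp h M w : Set W) <
      Submodule.span L (M : Set W) := by
    refine lt_of_le_of_ne (Submodule.span_mono fun x hx => hx.1) fun heq => ?_
    have := hwp w (heq ▸ Submodule.subset_span hwM)
    exact hw.2.2 this
  obtain ⟨k, v, e, hb⟩ := ih _ (hn ▸ Submodule.finrank_lt_finrank_of_lt hlt) (hM.perp hsplit) rfl
  exact ⟨k + 1, _, _, hsplit ▸ hb.cons hσ hh hw fun z hz => hz.2⟩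

theorem OrthBasis.nondegLat (hσ : UnramInvol σ ϖ q) (hb : OrthBasis h ϖ v e M) :
    NondegLat h ϖ M := by
  refine ⟨?_, fun z hz h0 => ?_⟩
  · obtain ⟨C, hC⟩ : ∃ C : ℤ, ∀ i, C ≤ e i := by
      obtain ⟨C, hC⟩ := (Set.finite_range e).bddBelow
      exact ⟨C, fun i => hC ⟨i, rfl⟩⟩
    refine ⟨C, fun z hz y hy => ?_⟩
    obtain ⟨c, hc, rfl⟩ := hb.exists_sum hz
    obtain ⟨d, hd, rfl⟩ := hb.exists_sum hy
    rw [hb.apply_sum_sum]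
    exact VGe.sum fun i _ => hσ.unif.vge_mul_left (mul_mem (hc i) (hσ.mem _ (hd i)))
      (hσ.unif.vge_mono (hC i) (hb.ord i).1)
  · obtain ⟨c, -, hc⟩ := hb.exists_sum hz
    exact hb.nondegenerate hσ.unif ⟨c, hc⟩ h0

theorem OrthType.nondegLat (hσ : UnramInvol σ ϖ q) {s : Multiset ℤ} (hs : OrthType h ϖ M s) :
    NondegLat h ϖ M := by
  obtain ⟨n, v, e, hb, -⟩ := hs
  exact hb.nondegLat hσ

theorem OrthType.cons (hσ : UnramInvol σ ϖ q) (hh : IsHerm h) {s : Multiset ℤ}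
    (hs : OrthType h ϖ M s) {w : W} {m : ℤ}
    (hw : VEq ϖ m (h w w)) (hperp : ∀ z ∈ M, h z w = 0) :
    OrthType h ϖ (M ⊔ Submodule.span 𝒪[L] {w}) (m ::ₘ s) := by
  obtain ⟨n, v, e, hb, rfl⟩ := hs
  refine ⟨n + 1, _, _, hb.cons hσ hh hw hperp, ?_⟩
  simp [Fin.univ_succ, Multiset.map_map, Function.comp_def]

theorem NondegLat.exists_orthType [FiniteDimensional L W] (hσ : UnramInvol σ ϖ q) (hh : IsHerm h)
    (hM : NondegLat h ϖ M) : ∃ s, OrthType h ϖ M s := by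
  obtain ⟨n, v, e, hb⟩ := hM.exists_orthBasis hσ hh
  exact ⟨_, n, v, e, hb, rfl⟩

theorem NondegLat.of_smul_mem (hσ : UnramInvol σ ϖ q) {U : Submodule 𝒪[L] W}
    (hU : NondegLat h ϖ U) (n : ℕ) (hUM : U ≤ M) (hMU : ∀ z ∈ M, ϖ ^ n • z ∈ U) :
    NondegLat h ϖ M := by
  have hϖ := hσ.unif
  have hn : ϖ ^ n ≠ 0 := pow_ne_zero _ hϖ.ne_zero
  obtain ⟨C, hC⟩ := hU.bdd
  refine ⟨⟨C - n - n, fun z hz y hy => ?_⟩, fun z hz h0 => ?_⟩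
  · have h1 := hC _ (hMU z hz) _ (hMU y hy)
    have h2 : h (ϖ ^ n • z) (ϖ ^ n • y) = ϖ ^ (n : ℤ) * (ϖ ^ (n : ℤ) * h z y) := by
      simp [hσ.fix]
    rwa [h2, hϖ.vge_zpow_mul_iff, hϖ.vge_zpow_mul_iff] at h1
  · have := hU.nondeg _ (hMU z hz) fun y hy => by simp [h0 y (hUM hy)]
    exact (smul_eq_zero.mp this).resolve_left hn

end Herm

section Reflection

variable {L : Type*} [Field L] [ValuativeRel L] {σ : L →+* L} {ϖ : L} {q : ℕ}
  {W : Type*} [AddCommGroup W] [Module L W] {h : W →ₗ[L] W →ₛₗ[σ] L} {M U : Submodule 𝒪[L] W}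

/-! ### Isometries -/

/-- A quasi-reflection. -/
def quasiRefl (h : W →ₗ[L] W →ₛₗ[σ] L) (a : L) (w : W) : W →ₗ[L] W :=
  LinearMap.id - a • (h.flip w).smulRight w

theorem quasiRefl_apply (a : L) (w z : W) : quasiRefl h a w z = z - (a * h z w) • w := by
  simp [quasiRefl, mul_smul]

theorem quasiRefl_isometry (hσ : UnramInvol σ ϖ q) (hh : IsHerm h) {a : L} {w : W}
    (ha : a + σ a = a * σ a * h w w) (y z : W) :
    h (quasiRefl h a w y) (quasiRefl h a w z) = h y z := by
  simp only [quasiRefl_apply, map_sub, LinearMap.sub_apply, map_smulₛₗ, LinearMap.smul_apply,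
    map_mul, smul_eq_mul, RingHom.id_apply]
  rw [← hh z w]
  linear_combination - (h y w) * (h w z) * ha

theorem quasiRefl_quasiRefl {a b : L} {w : W} (ha : a + b = a * b * h w w) (z : W) :
    quasiRefl h b w (quasiRefl h a w z) = z := by
  have h1 : b * h (z - (a * h z w) • w) w = - (a * h z w) := by
    simp only [map_sub, LinearMap.sub_apply, map_smul, LinearMap.smul_apply, smul_eq_mul]
    linear_combination h z w * ha
  rw [quasiRefl_apply, quasiRefl_apply, h1]
  simp

theorem OrthType.map (g : W →ₗ[L] W) (hg : ∀ y z, h (g y) (g z) = h y z) {s : Multiset ℤ}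
    (hs : OrthType h ϖ M s) : OrthType h ϖ (Submodule.map (g.restrictScalars 𝒪[L]) M) s := by
  obtain ⟨n, v, e, hb, rfl⟩ := hs
  refine ⟨n, g ∘ v, e, ⟨fun i j hij => by simp [hg, hb.orth i j hij],
    fun i => by simpa [hg] using hb.ord i, ?_⟩, rfl⟩
  rw [hb.eq]
  ext z
  simp only [Submodule.mem_map, mem_box]
  constructor
  · rintro ⟨_, ⟨c, hc, rfl⟩, rfl⟩
    exact ⟨c, hc, by simp⟩
  · rintro ⟨c, hc, rfl⟩
    exact ⟨_, ⟨c, hc, rfl⟩, by simp⟩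

theorem typ_map {g g' : W →ₗ[L] W} (hg : ∀ y z, h (g y) (g z) = h y z)
    (hg' : ∀ z, g' (g z) = z) (hgg' : ∀ z, g (g' z) = z) :
    typ h ϖ (Submodule.map (g.restrictScalars 𝒪[L]) M) = typ h ϖ M := by
  have hi : ∀ y z, h (g' y) (g' z) = h y z := fun y z => by
    rw [← hg, hgg', hgg']
  have : OrthType h ϖ (Submodule.map (g.restrictScalars 𝒪[L]) M) = OrthType h ϖ M := by
    ext s
    refine ⟨fun hs => ?_, fun hs => hs.map g hg⟩
    have := hs.map g' hi
    rw [← Submodule.map_comp] at this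
    convert this
    ext z
    simp [hg']
  have hif : ∀ P Q : Multiset ℤ → Prop, P = Q →
      (open scoped Classical in if hM : ∃ s, P s then hM.choose else 0) =
        (open scoped Classical in if hM : ∃ s, Q s then hM.choose else 0) := by
    rintro P _ rfl
    rfl
  exact hif _ _ this

theorem exists_unit_trace (hσ : UnramInvol σ ϖ q) : ∃ τ, VEq ϖ 0 τ ∧ τ + σ τ = 1 := by
  have hϖ := hσ.unif
  obtain ⟨τ, hτ, hτ1⟩ := hσ.exists_trace
  by_cases h1 : VGe ϖ (0 + 1) τ
  · refine ⟨σ τ, ?_, by rw [hσ.invol, add_comm, hτ1]⟩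
    rw [eq_sub_of_add_eq' hτ1, sub_eq_add_neg]
    exact hϖ.veq_add hϖ.veq_one h1.neg
  · exact ⟨τ, hϖ.veq_of_vge (vge_zero_iff.mpr hτ) h1, hτ1⟩

/-- The data of a quasi-reflection along `n_i + μ v`: the trace condition makes it unitary, and
integrality of `l + y μ` controls where it sends a vector with coefficient `y` at `n_i`. If `c` is
integral, the pole of `l` is supplied by a skew unit; otherwise the norm term `μ σ(μ) c` has the
required pole itself. -/
theorem exists_reflection_data (hσ : UnramInvol σ ϖ q) {c y : L} (hc : VGe ϖ (-1) c)
    (hcσ : σ c = c) (hy : VEq ϖ (-1) y) :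
    ∃ μ l, VEq ϖ 0 μ ∧ VEq ϖ (-1) l ∧ l + σ l = 1 + μ * σ μ * c ∧ l + y * μ ∈ 𝒪[L] := by
  have hϖ := hσ.unif
  obtain ⟨τ, hτ, hτ1⟩ := exists_unit_trace hσ
  have hτ0 := hτ.2.2
  have hy0 := hy.2.2
  have inv_veq : ∀ {n : ℤ} {x : L}, VEq ϖ n x → VEq ϖ (-n) x⁻¹ := fun {n x} hx =>
    ⟨hx.2.1, by rw [neg_neg, inv_inv]; exact hx.1, inv_ne_zero hx.2.2⟩
  have neg_veq : ∀ {n : ℤ} {x : L}, VEq ϖ n x → VEq ϖ n (-x) := fun {n x} hx =>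
    ⟨hx.1.neg, by rw [inv_neg]; exact hx.2.1.neg, neg_ne_zero.mpr hx.2.2⟩
  by_cases h0 : VGe ϖ (-1 + 1) c
  · rw [neg_add_cancel] at h0
    obtain ⟨θ, hθ, hθσ⟩ := hσ.exists_skew
    have hϖ0 := hϖ.ne_zero
    set μ := θ * (ϖ * y)⁻¹ with hμ
    have hμ0 : VEq ϖ 0 μ := by
      exact (by norm_num : (0 : ℤ) + -(1 + -1) = 0) ▸
        hϖ.veq_mul hθ (inv_veq (hϖ.veq_mul hϖ.veq_self hy))
    have hρ : VGe ϖ 0 (τ * (1 + μ * σ μ * c)) := by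
      have h2 := hϖ.vge_mul (hϖ.veq_mul hμ0 (hσ.veq_map hμ0)).1 h0
      have := hϖ.vge_mul hτ.1 (hϖ.veq_one.1.add h2)
      simpa using this
    have hθϖ : VEq ϖ (-1) (θ * ϖ⁻¹) := by
      simpa using hϖ.veq_mul hθ (inv_veq hϖ.veq_self)
    refine ⟨μ, -(θ * ϖ⁻¹) + τ * (1 + μ * σ μ * c), hμ0,
      hϖ.veq_add (neg_veq hθϖ) (by simpa using hρ), ?_, ?_⟩
    · simp only [map_add, map_neg, map_mul, map_inv₀, hσ.fix, hθσ, hσ.invol, hcσ, map_one]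
      linear_combination (1 + μ * σ μ * c) * hτ1
    · have : -(θ * ϖ⁻¹) + τ * (1 + μ * σ μ * c) + y * μ = τ * (1 + μ * σ μ * c) := by
        rw [hμ]
        field_simp
        ring
      rw [this]
      exact vge_zero_iff.mp hρ
  · have hc1 := hϖ.veq_of_vge hc h0
    have hc0 := hc1.2.2
    set μ := σ (-(y * (τ * c)⁻¹)) with hμ
    have hσμ : σ μ = -(y * (τ * c)⁻¹) := by rw [hμ, hσ.invol]
    have hμ0 : VEq ϖ 0 μ := by
      exact (by norm_num : (-1 : ℤ) + -(0 + -1) = 0) ▸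
        hσ.veq_map (neg_veq (hϖ.veq_mul hy (inv_veq (hϖ.veq_mul hτ hc1))))
    have hμc : VEq ϖ (-1) (μ * σ μ * c) := by
      simpa using hϖ.veq_mul (hϖ.veq_mul hμ0 (hσ.veq_map hμ0)) hc1
    refine ⟨μ, τ * (1 + μ * σ μ * c), hμ0, ?_, ?_, ?_⟩
    · rw [add_comm 1]
      simpa using hϖ.veq_mul hτ (hϖ.veq_add hμc (by simpa using hϖ.veq_one.1))
    · simp only [map_add, map_mul, hσ.invol, hcσ, map_one]
      linear_combination (1 + μ * σ μ * c) * hτ1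
    · have : τ * (1 + μ * σ μ * c) + y * μ = τ := by
        rw [hσμ]
        field_simp
        ring
      rw [this]
      exact vge_zero_iff.mp hτ.1

variable {ι : Type*} [Fintype ι] {n : ι → W} {e : ι → ℤ} {N : Submodule 𝒪[L] W}

theorem sup_span_congr {R X : Type*} [Ring R] [AddCommGroup X] [Module R X] {U : Submodule R X}
    {x y : X} (hxy : x - y ∈ U) : U ⊔ Submodule.span R {x} = U ⊔ Submodule.span R {y} := by
  have key : ∀ {x y : X}, x - y ∈ U → U ⊔ Submodule.span R {x} ≤ U ⊔ Submodule.span R {y} := by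
    intro x y hxy
    refine sup_le le_sup_left ((Submodule.span_singleton_le_iff_mem _ _).mpr ?_)
    rw [← sub_add_cancel x y]
    exact Submodule.add_mem_sup hxy (Submodule.mem_span_singleton_self _)
  refine le_antisymm (key hxy) (key ?_)
  rw [← neg_sub]
  exact neg_mem hxy

theorem smul_mem_of_vge {z : W} {d : L} (hd : VGe ϖ 0 d) (hz : z ∈ M) : d • z ∈ M :=
  M.smul_mem (⟨d, vge_zero_iff.mp hd⟩ : 𝒪[L]) hz

theorem smul_mem_span_smul (hϖ : IsUnif ϖ) {v : W} {d : L} (hd : VGe ϖ 1 d) :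
    d • v ∈ Submodule.span 𝒪[L] {ϖ • v} := by
  have : d • v = (d * ϖ⁻¹) • (ϖ • v) := by
    rw [smul_smul, inv_mul_cancel_right₀ hϖ.ne_zero]
  rw [this]
  refine smul_mem_of_vge (ϖ := ϖ) ?_ (Submodule.mem_span_singleton_self _)
  simpa using hϖ.vge_mul hd hϖ.veq_self.2.1

theorem sup_span_add_eq (hϖ : IsUnif ϖ) {v y : W} (hy : ϖ • y ∈ N) :
    N ⊔ Submodule.span 𝒪[L] {ϖ • v} ⊔ Submodule.span 𝒪[L] {v + y} =
      N ⊔ Submodule.span 𝒪[L] {v + y} := by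
  refine le_antisymm (sup_le (sup_le le_sup_left ?_) le_sup_right)
    (sup_le (le_sup_left.trans le_sup_left) le_sup_right)
  rw [Submodule.span_singleton_le_iff_mem]
  have h1 : ϖ • v = -(ϖ • y) + ϖ • (v + y) := by rw [smul_add]; abel
  rw [h1]
  exact Submodule.add_mem_sup (neg_mem hy)
    (smul_mem_of_vge (hϖ.vge_mono (by norm_num) hϖ.veq_self.1) (Submodule.mem_span_singleton_self _))

/-- Adding `v` to a vector that is not integral at a basis vector of small norm does not change
the isometry class of the lattice that it generates. -/
theorem typ_sup_span_add (hσ : UnramInvol σ ϖ q) (hh : IsHerm h) (hb : OrthBasis h ϖ n e N)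
    {v : W} {x : ℤ} (hv : VEq ϖ x (h v v)) (hperp : ∀ i, h (n i) v = 0) {c : ι → L}
    (hc : ∀ i, VGe ϖ (-1) (c i)) {i : ι} (hi : VEq ϖ (-1) (c i)) (hei : e i ≤ x + 1) :
    typ h ϖ (N ⊔ Submodule.span 𝒪[L] {v + ∑ j, c j • n j}) =
      typ h ϖ (N ⊔ Submodule.span 𝒪[L] {ϖ • v} ⊔ Submodule.span 𝒪[L] {∑ j, c j • n j}) := by
  have hϖ := hσ.unif
  set y := ∑ j, c j • n j with hy
  set U := N ⊔ Submodule.span 𝒪[L] {ϖ • v} with hU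
  have hperp' : ∀ i, h v (n i) = 0 := fun i => by rw [hh (n i) v, hperp, map_zero]
  have ha := hb.ord i
  set a := h (n i) (n i) with ha'
  have ha0 := ha.2.2
  have haσ : σ a = a := (hh (n i) (n i)).symm
  have hvσ : σ (h v v) = h v v := (hh v v).symm
  have hc0 : VGe ϖ (-1) (h v v * a⁻¹) :=
    hϖ.vge_mono (by omega) (hϖ.vge_mul hv.1 ha.2.1)
  obtain ⟨μ, l, hμ, hl, htr, hly⟩ := exists_reflection_data hσ hc0
    (by rw [map_mul, map_inv₀, haσ, hvσ]) hi
  have hl0 := hl.2.2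
  -- The quasi-reflection along `w` with multiplier `(l a)⁻¹` preserves `U` and sends `y` into `v +
  -- y + U`; so it is an isometry between the two lattices.
  set w := n i + μ • v with hw
  have hww : h w w = a * (l + σ l) := by
    rw [htr]
    simp only [hw, map_add, LinearMap.add_apply, map_smulₛₗ, LinearMap.smul_apply, hperp, hperp',
      RingHom.id_apply, smul_eq_mul]
    field_simp
    ring
  have hzw : ∀ (d : ι → L) (b : L), h (∑ j, d j • n j + b • v) w = d i * a + b * σ μ * h v v := by
    intro d b
    simp only [hw, map_add, LinearMap.add_apply, map_smulₛₗ, LinearMap.smul_apply, hperp',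
      smul_eq_mul, hb.apply_sum, RingHom.id_apply, mul_zero, add_zero]
    have : h (∑ j, d j • n j) v = 0 := by
      simp [map_sum, hperp]
    rw [this]
    ring
  have hdw : ∀ d, VGe ϖ 1 d → d • w ∈ U := by
    intro d hd
    rw [hw, smul_add, smul_smul]
    exact Submodule.add_mem_sup (smul_mem_of_vge (hϖ.vge_mono (by norm_num) hd) (hb.mem hϖ i))
      (smul_mem_span_smul hϖ (by simpa using hϖ.vge_mul hd hμ.1))
  have hpres : ∀ l', VEq ϖ (-1) l' → ∀ z ∈ U, quasiRefl h (l' * a)⁻¹ w z ∈ U := by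
    intro l' hl' z hz
    rw [quasiRefl_apply]
    refine sub_mem hz (hdw _ ?_)
    obtain ⟨z₁, hz₁, z₂, hz₂, rfl⟩ := Submodule.mem_sup.mp hz
    obtain ⟨d, hd, rfl⟩ := hb.exists_sum hz₁
    obtain ⟨b, rfl⟩ := Submodule.mem_span_singleton.mp hz₂
    have h1 : b • ϖ • v = ((b : L) * ϖ) • v := smul_smul (b : L) _ _
    rw [h1, hzw]
    have h2 : (l' * a)⁻¹ * (d i * a + b * ϖ * σ μ * h v v) =
        l'⁻¹ * (d i + (b * (σ μ * (ϖ * (h v v * a⁻¹))))) := by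
      have := hl'.2.2
      field_simp
    rw [h2]
    have h3 : VGe ϖ 0 (ϖ * (h v v * a⁻¹)) := by simpa using hϖ.vge_mul hϖ.veq_self.1 hc0
    have h4 := hϖ.vge_mul_left b.2 (hϖ.vge_mul (hσ.veq_map hμ).1 h3)
    rw [add_zero] at h4
    simpa using hϖ.vge_mul hl'.2.1 ((vge_zero_iff.mpr (hd i)).add h4)
  set lam := (l * a)⁻¹ with hlam
  have hlamσ : σ lam = (σ l * a)⁻¹ := by rw [hlam, map_inv₀, map_mul, haσ]
  have hσl0 : σ l ≠ 0 := (hσ.veq_map hl).2.2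
  have hcond : lam + σ lam = lam * σ lam * h w w := by
    rw [hlamσ, hww, hlam]
    field_simp
    ring
  have hinv1 : ∀ z, quasiRefl h (σ lam) w (quasiRefl h lam w z) = z := quasiRefl_quasiRefl hcond
  have hinv2 : ∀ z, quasiRefl h lam w (quasiRefl h (σ lam) w z) = z :=
    quasiRefl_quasiRefl (by rw [add_comm, hcond]; ring)
  have hmapU : Submodule.map ((quasiRefl h lam w).restrictScalars 𝒪[L]) U = U := by
    refine le_antisymm ?_ fun z hz => ?_
    · rintro _ ⟨z, hz, rfl⟩
      exact hpres l hl z hz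
    · refine ⟨quasiRefl h (σ lam) w z, ?_, hinv2 z⟩
      rw [hlamσ]
      exact hpres _ (hσ.veq_map hl) z hz
  have hϖy : ϖ • y ∈ N := by
    rw [hy, Finset.smul_sum]
    simp only [smul_smul]
    exact hb.sum_mem_iff.mpr fun j => (vge_zero_iff (ϖ := ϖ)).mp (by
      simpa using hϖ.vge_mul hϖ.veq_self.1 (hc j))
  have hgy : quasiRefl h lam w y - (v + y) ∈ U := by
    have h1 := hzw c 0
    rw [zero_smul, add_zero, zero_mul, zero_mul, add_zero] at h1
    have h2 : quasiRefl h lam w y - (v + y) =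
        (-(l⁻¹ * c i)) • n i + (-(l⁻¹ * (l + c i * μ))) • v := by
      rw [quasiRefl_apply, h1, hlam, hw]
      have e1 : (l * a)⁻¹ * (c i * a) = l⁻¹ * c i := by field_simp
      have e2 : l⁻¹ * (l + c i * μ) = 1 + l⁻¹ * c i * μ := by field_simp
      rw [e1, e2]
      module
    rw [h2]
    refine Submodule.add_mem_sup (smul_mem_of_vge (ϖ := ϖ) ?_ (hb.mem hϖ i))
      (smul_mem_span_smul hϖ ?_)
    · simpa using (hϖ.vge_mul hl.2.1 hi.1).neg
    · simpa using (hϖ.vge_mul hl.2.1 (vge_zero_iff.mpr hly)).neg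
  rw [← typ_map (M := U ⊔ _) (quasiRefl_isometry hσ hh hcond) hinv1 hinv2, Submodule.map_sup, hmapU,
    Submodule.map_span, Set.image_singleton]
  have hrs : (quasiRefl h lam w).restrictScalars 𝒪[L] y = quasiRefl h lam w y := rfl
  rw [hrs, sup_span_congr hgy, sup_span_add_eq hϖ hϖy]

end Reflection

section Adjoin

variable {L : Type*} [Field L] [ValuativeRel L] {σ : L →+* L} {ϖ : L} {q : ℕ}
  {W : Type*} [AddCommGroup W] [Module L W] {h : W →ₗ[L] W →ₛₗ[σ] L} {M U : Submodule 𝒪[L] W}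

/-! ### Types of lattices generated by one more vector -/

theorem OrthType.of_perp (hσ : UnramInvol σ ϖ q) (hh : IsHerm h) {m : ℤ} {w : W}
    (hm : ∀ z ∈ M, VGe ϖ m (h z w)) (hwM : w ∈ M) (hw : VEq ϖ m (h w w)) {s : Multiset ℤ}
    (hs : OrthType h ϖ (perp h M w) s) : OrthType h ϖ M (m ::ₘ s) := by
  have := hs.cons hσ hh hw fun z hz => hz.2
  rwa [perp_sup_span hσ hm hwM hw] at this

theorem vge_sup_span (hσ : UnramInvol σ ϖ q) {m : ℤ} {w ω : W} (hU : ∀ z ∈ U, VGe ϖ m (h z w))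
    (hω : VGe ϖ m (h ω w)) : ∀ z ∈ U ⊔ Submodule.span 𝒪[L] {ω}, VGe ϖ m (h z w) := by
  intro z hz
  obtain ⟨z₁, hz₁, z₂, hz₂, rfl⟩ := Submodule.mem_sup.mp hz
  obtain ⟨b, rfl⟩ := Submodule.mem_span_singleton.mp hz₂
  rw [map_add, LinearMap.add_apply, herm_smul_left]
  exact (hU _ hz₁).add (hσ.unif.vge_mul_left b.2 hω)

theorem nondegLat_sup_span (hσ : UnramInvol σ ϖ q) (hU : NondegLat h ϖ U) {ω : W}
    (hω : ϖ • ω ∈ U) : NondegLat h ϖ (U ⊔ Submodule.span 𝒪[L] {ω}) := by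
  refine hU.of_smul_mem hσ 1 le_sup_left fun z hz => ?_
  obtain ⟨z₁, hz₁, z₂, hz₂, rfl⟩ := Submodule.mem_sup.mp hz
  obtain ⟨b, rfl⟩ := Submodule.mem_span_singleton.mp hz₂
  rw [pow_one, smul_add, smul_comm]
  exact add_mem (smul_mem_of_vge (hσ.unif.vge_mono (by norm_num) hσ.unif.veq_self.1) hz₁)
    (U.smul_mem b hω)

/-- If `a h(ω, z) ∈ h(U, z)`, where `h(U, z)` is smaller than `h(ω, z)`, then `a` is not a unit. -/
theorem mem_of_add_smul_mem (hσ : UnramInvol σ ϖ q) {m : ℤ} {z ω : W}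
    (hU : ∀ u ∈ U, VGe ϖ (m + 1) (h u z)) (hω : VEq ϖ m (h ω z)) (hωU : ϖ • ω ∈ U) {y : W}
    (hy : y ∈ U ⊔ Submodule.span 𝒪[L] {ω}) (hyz : h y z = 0) : y ∈ U := by
  obtain ⟨z₁, hz₁, z₂, hz₂, rfl⟩ := Submodule.mem_sup.mp hy
  obtain ⟨b, rfl⟩ := Submodule.mem_span_singleton.mp hz₂
  rw [map_add, LinearMap.add_apply, herm_smul_left] at hyz
  have h1 : VGe ϖ (m + 1) ((b : L) * h ω z) := by
    rw [eq_neg_of_add_eq_zero_right hyz]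
    exact (hU _ hz₁).neg
  rw [hσ.unif.vge_mul_iff hω, add_sub_cancel_left] at h1
  have h2 := smul_mem_span_smul (v := ω) hσ.unif h1
  exact add_mem hz₁ ((Submodule.span_singleton_le_iff_mem _ _).mpr hωU h2)

/-- The vector `ω` splits off the larger lattice and `ϖ ω` splits off `U`, with the same orthogonal
complement; only one exponent changes, by two. -/
theorem orthType_sup_span_of_anisotropic [FiniteDimensional L W] (hσ : UnramInvol σ ϖ q)
    (hh : IsHerm h) (hU : NondegLat h ϖ U) {ω : W} {x : ℤ} (hωU : ϖ • ω ∈ U)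
    (hω : VEq ϖ x (h ω ω)) (hUω : ∀ u ∈ U, VGe ϖ (x + 1) (h u ω)) :
    ∃ s, OrthType h ϖ U ((x + 2) ::ₘ s) ∧
      OrthType h ϖ (U ⊔ Submodule.span 𝒪[L] {ω}) (x ::ₘ s) := by
  have hϖ := hσ.unif
  set M := U ⊔ Submodule.span 𝒪[L] {ω} with hM
  have hωM : ω ∈ M := Submodule.mem_sup_right (Submodule.mem_span_singleton_self _)
  have hMω : ∀ z ∈ M, VGe ϖ x (h z ω) :=
    vge_sup_span hσ (fun u hu => hϖ.vge_mono (by omega) (hUω u hu)) hω.1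
  obtain ⟨s, hs⟩ := ((nondegLat_sup_span hσ hU hωU).perp
    (perp_sup_span hσ hMω hωM hω)).exists_orthType hσ hh
  refine ⟨s, ?_, hs.of_perp hσ hh hMω hωM hω⟩
  have hperp : perp h U (ϖ • ω) = perp h M ω := by
    ext z
    constructor
    · rintro ⟨hz, hz'⟩
      refine ⟨Submodule.mem_sup_left hz, ?_⟩
      rw [map_smulₛₗ, hσ.fix, smul_eq_mul] at hz'
      exact (mul_eq_zero.mp hz').resolve_left hϖ.ne_zero
    · rintro ⟨hz, hz'⟩
      exact ⟨mem_of_add_smul_mem hσ hUω hω hωU hz hz', by rw [map_smulₛₗ, hz', smul_zero]⟩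
  rw [← hM, ← hperp] at hs
  refine hs.of_perp hσ hh (fun z hz => ?_) hωU ?_
  · rw [map_smulₛₗ, hσ.fix, smul_eq_mul]
    have := hϖ.vge_mul hϖ.veq_self.1 (hUω z hz)
    rwa [show 1 + (x + 1) = x + 2 by ring] at this
  · rw [map_smulₛₗ, hσ.fix, smul_eq_mul, map_smul, LinearMap.smul_apply, smul_eq_mul]
    have := hϖ.veq_mul hϖ.veq_self (hϖ.veq_mul hϖ.veq_self hω)
    rwa [show 1 + (1 + x) = x + 2 by ring] at this

/-- A modular plane splits off. -/
theorem OrthType.of_perp_perp [FiniteDimensional L W] (hσ : UnramInvol σ ϖ q) (hh : IsHerm h)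
    (hM : NondegLat h ϖ M) {k : ℤ} {a b : W} (haM : a ∈ M) (hbM : b ∈ M)
    (hMa : ∀ z ∈ M, VGe ϖ k (h z a)) (hMb : ∀ z ∈ M, VGe ϖ k (h z b))
    (hab : VEq ϖ k (h a b)) (hbb : VGe ϖ (k + 1) (h b b)) :
    ∃ s, OrthType h ϖ (perp h (perp h M a) b) s ∧ OrthType h ϖ M (k ::ₘ k ::ₘ s) := by
  have hϖ := hσ.unif
  -- The plane contains a vector whose norm has valuation exactly `k`: either `a` itself, or `a + t
  -- b` with `t` chosen by means of an element of trace one. Gram–Schmidt then provides the second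
  -- vector.
  obtain ⟨t, ht, hnorm⟩ : ∃ t ∈ 𝒪[L], VEq ϖ k (h (a + t • b) (a + t • b)) := by
    by_cases haa : VGe ϖ (k + 1) (h a a)
    · obtain ⟨τ, hτ, hτ1⟩ := hσ.exists_trace
      set t : L := σ (τ * ϖ ^ k * (h a b)⁻¹) with ht
      have htm : t ∈ 𝒪[L] := by
        refine hσ.mem _ ((vge_zero_iff (ϖ := ϖ)).mp ?_)
        have := hϖ.vge_mul (hϖ.vge_mul (vge_zero_iff.mpr hτ) (hϖ.veq_zpow k).1) hab.2.1
        simpa using this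
      have hs : σ t * h a b = τ * ϖ ^ k := by
        rw [ht, hσ.invol, mul_assoc, inv_mul_cancel₀ hab.2.2, mul_one]
      have hs' : t * h b a = σ τ * ϖ ^ k := by
        rw [hh a b]
        have := congrArg σ hs
        rwa [map_mul, hσ.invol, map_mul, hσ.map_zpow] at this
      refine ⟨t, htm, ?_⟩
      have h2 : h (a + t • b) (a + t • b) = ϖ ^ k + (h a a + t * σ t * h b b) := by
        simp only [map_add, LinearMap.add_apply, map_smulₛₗ, LinearMap.smul_apply, smul_eq_mul,
          RingHom.id_apply]
        rw [mul_add, hs']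
        linear_combination hs + ϖ ^ k * hτ1
      rw [h2]
      exact hϖ.veq_add (hϖ.veq_zpow k) (haa.add (hϖ.vge_mul_left (mul_mem htm (hσ.mem _ htm)) hbb))
    · refine ⟨0, zero_mem _, ?_⟩
      rw [zero_smul, add_zero]
      exact hϖ.veq_of_vge (hMa a haM) haa
  set a' := a + t • b with ha'
  have ha'M : a' ∈ M := add_mem haM (smul_mem_of_vge ((vge_zero_iff (ϖ := ϖ)).mpr ht) hbM)
  have hza' : ∀ z, h z a' = h z a + σ t * h z b := fun z => by
    rw [ha', map_add, map_smulₛₗ, smul_eq_mul]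
  have hMa' : ∀ z ∈ M, VGe ϖ k (h z a') := fun z hz => by
    rw [hza']
    exact (hMa z hz).add (hϖ.vge_mul_left (hσ.mem _ ht) (hMb z hz))
  have hab' : VEq ϖ k (h a' b) := by
    have : h a' b = h a b + t * h b b := by
      rw [ha', map_add, LinearMap.add_apply, map_smul, LinearMap.smul_apply, smul_eq_mul]
    rw [this]
    exact hϖ.veq_add hab (hϖ.vge_mul_left ht hbb)
  have hba' : VEq ϖ k (h b a') := hh a' b ▸ hσ.veq_map hab'
  set d := h b a' * (h a' a')⁻¹ with hd
  have hdm : VGe ϖ 0 d := by simpa using hϖ.vge_mul hba'.1 hnorm.2.1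
  set b' := b - d • a' with hb'
  have hb'a' : h b' a' = 0 := by
    rw [hb', map_sub, LinearMap.sub_apply, map_smul, LinearMap.smul_apply, smul_eq_mul, hd,
      mul_assoc, inv_mul_cancel₀ hnorm.2.2, mul_one, sub_self]
  have hb'M : b' ∈ perp h M a' := ⟨sub_mem hbM (smul_mem_of_vge hdm ha'M), hb'a'⟩
  have hzb' : ∀ z, h z a' = 0 → h z b' = h z b := fun z hz => by
    rw [hb', map_sub, map_smulₛₗ, hz, smul_zero, sub_zero]
  have hnorm' : VEq ϖ k (h b' b') := by
    rw [hzb' _ hb'a', hb', map_sub, LinearMap.sub_apply, map_smul, LinearMap.smul_apply,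
      smul_eq_mul, hd, sub_eq_neg_add]
    refine hϖ.veq_add ?_ hbb
    have h1 := hϖ.veq_mul (hϖ.veq_mul hba' ⟨hnorm.2.1, by rw [neg_neg, inv_inv]; exact hnorm.1,
      inv_ne_zero hnorm.2.2⟩) hab'
    rw [show k + -k + k = k by ring] at h1
    exact ⟨h1.1.neg, by rw [inv_neg]; exact h1.2.1.neg, neg_ne_zero.mpr h1.2.2⟩
  have hMb' : ∀ z ∈ perp h M a', VGe ϖ k (h z b') := fun z hz => by
    rw [hzb' z hz.2]
    exact hMb z hz.1
  have hR : perp h (perp h M a') b' = perp h (perp h M a) b := by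
    ext z
    constructor
    · rintro ⟨⟨h1, h2⟩, h3⟩
      rw [hzb' z h2] at h3
      rw [hza', h3, mul_zero, add_zero] at h2
      exact ⟨⟨h1, h2⟩, h3⟩
    · rintro ⟨⟨h1, h2⟩, h3⟩
      have h4 : h z a' = 0 := by rw [hza', h2, h3, mul_zero, add_zero]
      exact ⟨⟨h1, h4⟩, by rw [hzb' z h4, h3]⟩
  obtain ⟨s, hs⟩ := ((hM.perp (perp_sup_span hσ hMa' ha'M hnorm)).perp
    (perp_sup_span hσ hMb' hb'M hnorm')).exists_orthType hσ hh
  exact ⟨s, hR ▸ hs, (hs.of_perp hσ hh hMb' hb'M hnorm').of_perp hσ hh hMa' ha'M hnorm⟩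

/-- The plane of `ω` and `z` is modular of exponent `x + 1` in the larger lattice, and the plane of
`z` and `ϖ ω` is modular of exponent `x + 2` in `U`. The two planes have the same orthogonal
complement. -/
theorem orthType_sup_span_of_isotropic [FiniteDimensional L W] (hσ : UnramInvol σ ϖ q)
    (hh : IsHerm h) (hU : NondegLat h ϖ U) {ω z : W} {x : ℤ} (hωU : ϖ • ω ∈ U)
    (hω : VGe ϖ (x + 1) (h ω ω)) (hUω : ∀ u ∈ U, VGe ϖ (x + 1) (h u ω)) (hzU : z ∈ U)
    (hωz : VEq ϖ (x + 1) (h ω z)) (hUz : ∀ u ∈ U, VGe ϖ (x + 2) (h u z)) :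
    ∃ s, OrthType h ϖ U ((x + 2) ::ₘ (x + 2) ::ₘ s) ∧
      OrthType h ϖ (U ⊔ Submodule.span 𝒪[L] {ω}) ((x + 1) ::ₘ (x + 1) ::ₘ s) := by
  have hϖ := hσ.unif
  set M := U ⊔ Submodule.span 𝒪[L] {ω} with hM
  have hωM : ω ∈ M := Submodule.mem_sup_right (Submodule.mem_span_singleton_self _)
  have hx : x + 1 + 1 = x + 2 := by ring
  obtain ⟨s, hs, hsM⟩ := OrthType.of_perp_perp hσ hh (nondegLat_sup_span hσ hU hωU) hωM
    (Submodule.mem_sup_left hzU) (vge_sup_span hσ hUω hω)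
    (vge_sup_span hσ (fun u hu => hϖ.vge_mono (by omega) (hUz u hu)) hωz.1) hωz
    (hx ▸ hUz z hzU)
  refine ⟨s, ?_, hsM⟩
  have hϖω : ∀ y, h y (ϖ • ω) = ϖ * h y ω := fun y => by
    rw [map_smulₛₗ, hσ.fix, smul_eq_mul]
  have hzω : VEq ϖ (x + 1) (h z ω) := hh ω z ▸ hσ.veq_map hωz
  have hx' : 1 + (x + 1) = x + 2 := by ring
  obtain ⟨s', hs', hsU⟩ := OrthType.of_perp_perp hσ hh hU (k := x + 2) hzU hωU hUz
    (fun u hu => by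
      rw [hϖω]
      exact hx' ▸ hϖ.vge_mul hϖ.veq_self.1 (hUω u hu))
    (by
      rw [hϖω]
      exact hx' ▸ hϖ.veq_mul hϖ.veq_self hzω)
    (by
      rw [hϖω, map_smul, LinearMap.smul_apply, smul_eq_mul]
      have := hϖ.vge_mul hϖ.veq_self.1 (hϖ.vge_mul hϖ.veq_self.1 hω)
      rwa [show 1 + (1 + (x + 1)) = x + 2 + 1 by ring] at this)
  have hR : perp h (perp h U z) (ϖ • ω) = perp h (perp h M ω) z := by
    ext y
    constructor
    · rintro ⟨⟨h1, h2⟩, h3⟩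
      rw [hϖω] at h3
      exact ⟨⟨Submodule.mem_sup_left h1, (mul_eq_zero.mp h3).resolve_left hϖ.ne_zero⟩, h2⟩
    · rintro ⟨⟨h1, h2⟩, h3⟩
      exact ⟨⟨mem_of_add_smul_mem hσ (hx.symm ▸ hUz) hωz hωU h1 h3, h3⟩, by rw [hϖω, h2, mul_zero]⟩
  rw [hR] at hs'
  rwa [← hs'.typ_eq hσ, hs.typ_eq hσ] at hsU

end Adjoin

/-! ### Straightening by adjacent exchanges -/

/-- The relations for the exchange of adjacent entries `a, a + 1` and `a, a + 2`. -/
structure Rels (q : ℕ) (β : List ℤ → ℤ) : Prop where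
  swap : ∀ l a l', β (l ++ a :: (a + 1) :: l') = β (l ++ (a + 1) :: a :: l')
  pair : ∀ l a l', β (l ++ a :: (a + 2) :: l') =
    (1 + q) * β (l ++ (a + 1) :: (a + 1) :: l') - q * β (l ++ (a + 2) :: a :: l')

section Lists

variable {q : ℕ} {β : List ℤ → ℤ}

theorem Rels.cons (hβ : Rels q β) (x : ℤ) : Rels q fun l => β (x :: l) :=
  ⟨fun l a l' => hβ.swap (x :: l) a l', fun l a l' => hβ.pair (x :: l) a l'⟩

/-- The value at the decreasing list of the elements of a multiset. -/
def sortVal (β : List ℤ → ℤ) (s : Multiset ℤ) : ℤ := β (s.sort (· ≥ ·))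

theorem sortVal_cons {x : ℤ} {s : Multiset ℤ} (hs : ∀ y ∈ s, y ≤ x) :
    sortVal β (x ::ₘ s) = sortVal (fun l => β (x :: l)) s := by
  rw [sortVal, sortVal, Multiset.sort_cons]
  exact hs

theorem sortVal_coe {l : List ℤ} (hl : l.Pairwise (· ≥ ·)) : sortVal β (l : Multiset ℤ) = β l := by
  rw [sortVal, Multiset.coe_sort, List.mergeSort_of_pairwise]
  simpa using hl

/-- By the swap relation `x` moves unchanged past every entry `x + 1`, and stops in front of the
entries that are at most `x`. -/
theorem Rels.insert_of_le_succ (hβ : Rels q β) {x : ℤ} {l : List ℤ} (hl : l.Pairwise (· ≥ ·))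
    (hx : ∀ y ∈ l, y ≤ x + 1) : β (x :: l) = sortVal β (x ::ₘ (l : Multiset ℤ)) := by
  induction l generalizing β with
  | nil => simp [sortVal]
  | cons y l ih =>
    rw [List.pairwise_cons] at hl
    rcases (hx y (by simp)).lt_or_eq with hy | rfl
    · rw [sortVal_cons, sortVal_coe (List.pairwise_cons.mpr hl)]
      intro z hz
      rcases List.mem_cons.mp (Multiset.mem_coe.mp hz) with rfl | hz
      · omega
      · have := hl.1 z hz
        omega
    · rw [← Multiset.cons_coe, Multiset.cons_swap, sortVal_cons, ← ih (hβ.cons _) hl.2]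
      · exact hβ.swap [] x l
      · exact fun z hz => hx z (by simp [hz])
      · intro z hz
        rcases Multiset.mem_cons.mp hz with rfl | hz
        · omega
        · exact hx z (by simpa using Or.inr hz)

/-- Each passage of `x` across an entry `x + 2` costs a factor `-q` and splits off `1 + q` times a
list with `x + 1, x + 1`. The geometric series in `-q` sums these up to `1 - (-q) ^ count`. -/
theorem Rels.insert_of_le_add_two (hβ : Rels q β) {x : ℤ} {l : List ℤ}
    (hl : l.Pairwise (· ≥ ·)) (hx : ∀ y ∈ l, y ≤ x + 2) :
    β (x :: l) = (-(q : ℤ)) ^ (l.count (x + 2)) * sortVal β (x ::ₘ (l : Multiset ℤ)) +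
      (1 - (-(q : ℤ)) ^ (l.count (x + 2))) *
        sortVal β ((x + 1) ::ₘ (x + 1) ::ₘ (l : Multiset ℤ).erase (x + 2)) := by
  induction l generalizing β with
  | nil => simp [sortVal]
  | cons y l ih =>
    have hl' := hl
    rw [List.pairwise_cons] at hl
    by_cases hy : y = x + 2
    · subst hy
      have hx' : ∀ z ∈ l, z ≤ x + 2 := fun z hz => hx z (by simp [hz])
      have hxm : ∀ z ∈ (l : Multiset ℤ), z ≤ x + 2 := hx'
      have h1 := hβ.pair [] x l
      simp only [List.nil_append] at h1
      have h2 := ih (hβ.cons (x + 2)) hl.2 hx'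
      have h3 : sortVal (fun l => β ((x + 2) :: l)) (x ::ₘ (l : Multiset ℤ)) =
          sortVal β (x ::ₘ (x + 2) ::ₘ (l : Multiset ℤ)) := by
        rw [Multiset.cons_swap]
        refine (sortVal_cons fun z hz => ?_).symm
        rcases Multiset.mem_cons.mp hz with rfl | hz
        · omega
        · exact hxm z hz
      have h4 : β ((x + 1) :: (x + 1) :: l) =
          sortVal β ((x + 1) ::ₘ (x + 1) ::ₘ (l : Multiset ℤ)) := by
        have e1 := (hβ.cons (x + 1)).insert_of_le_succ hl.2 (x := x + 1)
          (fun z hz => by have := hx' z hz; omega)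
        rw [e1, sortVal]
        have e2 := hβ.insert_of_le_succ (x := x + 1)
          (l := Multiset.sort ((x + 1) ::ₘ (l : Multiset ℤ)) (· ≥ ·))
          (Multiset.pairwise_sort _ _) (fun z hz => by
            rw [Multiset.mem_sort] at hz
            rcases Multiset.mem_cons.mp hz with rfl | hz
            · omega
            · have := hxm z hz
              omega)
        rw [e2, Multiset.sort_eq]
      rw [← Multiset.cons_coe, Multiset.erase_cons_head, List.count_cons_self, h1, h2, h3, h4,
        pow_succ]
      by_cases h0 : l.count (x + 2) = 0
      · rw [h0]
        ring
      · have hmem : (x + 2) ∈ (l : Multiset ℤ) :=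
          Multiset.mem_coe.mpr (List.count_pos_iff.mp (Nat.pos_of_ne_zero h0))
        have h5 : sortVal (fun l => β ((x + 2) :: l))
            ((x + 1) ::ₘ (x + 1) ::ₘ (l : Multiset ℤ).erase (x + 2)) =
            sortVal β ((x + 1) ::ₘ (x + 1) ::ₘ (l : Multiset ℤ)) := by
          rw [← sortVal_cons]
          · rw [Multiset.cons_swap, Multiset.cons_swap (x + 2), Multiset.cons_erase hmem]
          · intro z hz
            rcases Multiset.mem_cons.mp hz with rfl | hz
            · omega
            rcases Multiset.mem_cons.mp hz with rfl | hz
            · omega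
            exact hxm z (Multiset.mem_of_mem_erase hz)
        rw [h5]
        ring
    · have hle : ∀ z ∈ y :: l, z ≤ x + 1 := by
        have := hx y (by simp)
        intro z hz
        rcases List.mem_cons.mp hz with rfl | hz
        · omega
        · have := hl.1 z hz
          omega
      have h0 : (y :: l).count (x + 2) = 0 := List.count_eq_zero.mpr fun hm => by
        have := hle _ hm
        omega
      rw [h0, hβ.insert_of_le_succ hl' hle]
      ring

theorem Rels.insert_sort (hβ : Rels q β) {x : ℤ} {s : Multiset ℤ} (hx : ∀ y ∈ s, y ≤ x + 2) :
    β (x :: s.sort (· ≥ ·)) = (-(q : ℤ)) ^ (s.count (x + 2)) * sortVal β (x ::ₘ s) +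
      (1 - (-(q : ℤ)) ^ (s.count (x + 2))) *
        sortVal β ((x + 1) ::ₘ (x + 1) ::ₘ s.erase (x + 2)) := by
  have := hβ.insert_of_le_add_two (x := x) (Multiset.pairwise_sort s (· ≥ ·))
    fun y hy => hx y ((Multiset.mem_sort _).mp hy)
  rwa [← Multiset.coe_count, Multiset.sort_eq] at this

end Lists

/-! ### Counting values of sums of norms -/

/-- Summing over one more norm variable turns a function on `F` with one value at zero and another
elsewhere into a function of the same kind, whose two values differ by `-q` times the old
difference: a norm is zero once and takes each nonzero value `q + 1` times. -/
theorem sum_sum_norm {k A : Type*} [Fintype k] [AddCommGroup A] [DecidableEq A] {q : ℕ}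
    (hk : Fintype.card k = q ^ 2) (F : AddSubgroup A) {a : ℕ} (N : Fin a → k → A)
    (hF : ∀ j s, N j s ∈ F) (h0 : ∀ j, (Finset.univ.filter fun s => N j s = 0).card = 1)
    (hc : ∀ j, ∀ c ∈ F, c ≠ 0 → (Finset.univ.filter fun s => N j s = c).card = q + 1)
    (f : A → ℤ) (u w : ℤ) (hf : ∀ c ∈ F, f c = if c = 0 then w else u) {c : A} (hcF : c ∈ F)
    (hc0 : c ≠ 0) :
    ∑ s : Fin a → k, f (∑ j, N j (s j)) - ∑ s : Fin a → k, f (c + ∑ j, N j (s j)) =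
      (-(q : ℤ)) ^ a * (w - u) := by
  induction a generalizing f u w with
  | zero => simp [hf 0 F.zero_mem, hf c hcF, hc0]
  | succ a ih =>
    have key : ∀ d ∈ F, ∑ s₀, f (d + N 0 s₀) =
        if d = 0 then w + ((q : ℤ) ^ 2 - 1) * u else (q + 1) * w + ((q : ℤ) ^ 2 - (q + 1)) * u := by
      intro d hd
      have h1 : ∑ s₀, f (d + N 0 s₀) =
          ∑ s₀, (u + if N 0 s₀ = -d then w - u else 0) := by
        refine Finset.sum_congr rfl fun s₀ _ => ?_
        rw [hf _ (F.add_mem hd (hF 0 s₀))]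
        simp only [add_eq_zero_iff_neg_eq, eq_comm (a := -d)]
        split_ifs <;> ring
      rw [h1, Finset.sum_add_distrib, Finset.sum_const, Finset.card_univ, hk,
        ← Finset.sum_filter, Finset.sum_const]
      split_ifs with hd0
      · rw [hd0, neg_zero, h0]
        simp
        ring
      · rw [hc 0 (-d) (F.neg_mem hd) (neg_ne_zero.mpr hd0)]
        simp
        ring
    have hsplit : ∀ d : A, ∑ s : Fin (a + 1) → k, f (d + ∑ j, N j (s j)) =
        ∑ s : Fin a → k, ∑ s₀, f ((d + ∑ j : Fin a, N j.succ (s j)) + N 0 s₀) := by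
      intro d
      rw [← (Fin.consEquiv fun _ => k).sum_comp, Fintype.sum_prod_type_right]
      refine Finset.sum_congr rfl fun s _ => Finset.sum_congr rfl fun s₀ _ => ?_
      rw [Fin.sum_univ_succ]
      simp only [Fin.consEquiv_apply, Fin.cons_zero, Fin.cons_succ]
      congr 1
      abel
    have h2 := ih (fun j => N j.succ) (fun j => hF _) (fun j => h0 _) (fun j => hc _)
      (fun d => ∑ s₀, f (d + N 0 s₀)) _ _ key
    have h3 := hsplit 0
    simp only [zero_add] at h3
    rw [h3, hsplit c, h2]
    ring

/-! ### Lattices generated by one more vector: the local identity -/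

section LocalIdentity

variable {L : Type*} [Field L] [ValuativeRel L] {σ : L →+* L} {ϖ : L} {q : ℕ}
  {W : Type*} [AddCommGroup W] [Module L W] {h : W →ₗ[L] W →ₛₗ[σ] L} {M N U : Submodule 𝒪[L] W}
  {ι : Type*} [Fintype ι] {n : ι → W} {e : ι → ℤ} {β : List ℤ → ℤ}

theorem radSpan_eq (hϖ : IsUnif ϖ) (v : W) :
    radSpan 𝒪[L] v = Submodule.span 𝒪[L] {ϖ • v} := by
  refine le_antisymm (fun z hz => ?_) ((Submodule.span_singleton_le_iff_mem _ _).mpr ?_)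
  · obtain ⟨a, ha, rfl⟩ := mem_radSpan.mp hz
    exact smul_mem_span_smul (d := (a : L)) hϖ ((hϖ.mem_maximalIdeal_iff a).mp ha)
  · exact mem_radSpan.mpr ⟨⟨ϖ, hϖ.mem⟩, (hϖ.mem_maximalIdeal_iff _).mpr hϖ.veq_self.1, rfl⟩

theorem residue_eq_zero_iff (hϖ : IsUnif ϖ) (x : 𝒪[L]) :
    IsLocalRing.residue 𝒪[L] x = 0 ↔ VGe ϖ 1 (x : L) := by
  rw [IsLocalRing.residue_eq_zero_iff, hϖ.mem_maximalIdeal_iff]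

theorem residue_eq_iff (hϖ : IsUnif ϖ) (x y : 𝒪[L]) :
    IsLocalRing.residue 𝒪[L] x = IsLocalRing.residue 𝒪[L] y ↔ VGe ϖ 1 ((x : L) - y) := by
  rw [← sub_eq_zero, ← map_sub, residue_eq_zero_iff hϖ]
  rfl

/-- Whether the norm of `ω`, divided by `ϖ ^ x`, is a unit decides between the anisotropic and the
isotropic case; uniqueness of types removes the dependence on the complement. -/
theorem sortVal_typ_sup_span [FiniteDimensional L W] (hσ : UnramInvol σ ϖ q) (hh : IsHerm h)
    {s : Multiset ℤ} {x : ℤ} (hU : OrthType h ϖ U ((x + 2) ::ₘ s)) {ω z : W} (hωU : ϖ • ω ∈ U)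
    (hUω : ∀ u ∈ U, VGe ϖ (x + 1) (h u ω)) (hzU : z ∈ U) (hωz : VEq ϖ (x + 1) (h ω z))
    (hUz : ∀ u ∈ U, VGe ϖ (x + 2) (h u z)) (E : 𝒪[L]) (hE : h ω ω = ϖ ^ x * E)
    [Decidable (IsLocalRing.residue 𝒪[L] E = 0)] :
    sortVal β (typ h ϖ (U ⊔ Submodule.span 𝒪[L] {ω})) =
      if IsLocalRing.residue 𝒪[L] E = 0 then
        sortVal β ((x + 1) ::ₘ (x + 1) ::ₘ s.erase (x + 2)) else sortVal β (x ::ₘ s) := by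
  have hϖ := hσ.unif
  split_ifs with h0
  · rw [residue_eq_zero_iff hϖ] at h0
    obtain ⟨t, h1, h2⟩ := orthType_sup_span_of_isotropic hσ hh (hU.nondegLat hσ) hωU
      (by rw [hE]; exact hϖ.vge_mul (hϖ.veq_zpow x).1 h0) hUω hzU hωz hUz
    have h3 := (hU.typ_eq hσ).symm.trans (h1.typ_eq hσ)
    rw [Multiset.cons_inj_right] at h3
    rw [h2.typ_eq hσ, h3, Multiset.erase_cons_head]
  · rw [residue_eq_zero_iff hϖ] at h0
    have hE' : VEq ϖ 0 (E : L) := hϖ.veq_of_vge (vge_zero_iff.mpr E.2) (by simpa using h0)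
    obtain ⟨t, h1, h2⟩ := orthType_sup_span_of_anisotropic hσ hh (hU.nondegLat hσ) hωU
      (by rw [hE]; simpa using hϖ.veq_mul (hϖ.veq_zpow x) hE') hUω
    have h3 := (hU.typ_eq hσ).symm.trans (h1.typ_eq hσ)
    rw [Multiset.cons_inj_right] at h3
    rw [h2.typ_eq hσ, h3]

theorem card_norm_fibre [Fintype 𝓀[L]] [DecidableEq 𝓀[L]] (hσ : UnramInvol σ ϖ q)
    {u : L} (hu : VEq ϖ 0 u) (huσ : σ u = u)
    (lift : 𝓀[L] → 𝒪[L]) (hlift : ∀ s, IsLocalRing.residue 𝒪[L] (lift s) = s) (N : 𝓀[L] → 𝒪[L])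
    (hN : ∀ s, (N s : L) = lift s * σ (lift s) * u) :
    (Finset.univ.filter fun s => IsLocalRing.residue 𝒪[L] (N s) = 0).card = 1 ∧
    ∀ c : 𝒪[L], σ (c : L) = c → IsLocalRing.residue 𝒪[L] c ≠ 0 →
      (Finset.univ.filter fun s =>
        IsLocalRing.residue 𝒪[L] (N s) = IsLocalRing.residue 𝒪[L] c).card = q + 1 := by
  have hϖ := hσ.unif
  constructor
  · rw [Finset.card_eq_one]
    refine ⟨0, ?_⟩
    ext s
    simp only [Finset.mem_filter, Finset.mem_univ, true_and, Finset.mem_singleton]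
    rw [residue_eq_zero_iff hϖ, hN, hϖ.vge_mul_iff hu, sub_zero]
    constructor
    · intro h1
      by_contra hs
      rw [← hlift s, residue_eq_zero_iff hϖ] at hs
      have h2 : VEq ϖ 0 ((lift s : 𝒪[L]) : L) :=
        hϖ.veq_of_vge (vge_zero_iff.mpr (lift s).2) (by simpa using hs)
      exact hϖ.not_vge (hϖ.veq_mul h2 (hσ.veq_map h2)) (by norm_num) h1
    · intro hs
      rw [← hlift s, residue_eq_zero_iff hϖ] at hs
      rw [mul_comm]
      exact hϖ.vge_mul_left (hσ.mem _ (lift s).2) hs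
  · classical
    intro c hcσ hc
    rw [Ne, residue_eq_zero_iff hϖ] at hc
    have hc' : VEq ϖ 0 (c : L) := hϖ.veq_of_vge (vge_zero_iff.mpr c.2) (by simpa using hc)
    have hu' : VEq ϖ 0 u⁻¹ := ⟨by simpa using hu.2.1, by simpa using hu.1, inv_ne_zero hu.2.2⟩
    rw [← hσ.card_norm (c * u⁻¹) (by simpa using hϖ.veq_mul hc' hu')
      (by rw [map_mul, map_inv₀, hcσ, huσ]), Nat.card_eq_fintype_card, Fintype.card_subtype]
    congr 1
    ext s
    simp only [Finset.mem_filter, Finset.mem_univ, true_and]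
    rw [residue_eq_iff hϖ, hN]
    have h1 : (lift s : L) * σ (lift s) * u - c = (lift s * σ (lift s) - c * u⁻¹) * u := by
      have := hu.2.2
      field_simp
    rw [h1, hϖ.vge_mul_iff hu, sub_zero]
    constructor
    · exact fun h2 => ⟨lift s, hlift s, h2⟩
    · rintro ⟨t, ht, h2⟩
      have h3 : VGe ϖ 1 ((lift s : L) - t) := by rw [← residue_eq_iff hϖ, hlift, ht]
      have h4 : (lift s : L) * σ (lift s) - c * u⁻¹ =
          (t * σ t - c * u⁻¹) + (σ (lift s) * (lift s - t) + t * σ (lift s - t)) := by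
        rw [map_sub]
        ring
      rw [h4]
      exact h2.add ((hϖ.vge_mul_left (hσ.mem _ (lift s).2) h3).add
        (hϖ.vge_mul_left t.2 (hσ.vge_map h3)))

theorem OrthBasis.exists_sum_of_smul_mem (hϖ : IsUnif ϖ) (hb : OrthBasis h ϖ n e N) {z : W}
    (hz : ϖ • z ∈ N) : ∃ c : ι → L, (∀ i, VGe ϖ (-1) (c i)) ∧ z = ∑ i, c i • n i := by
  obtain ⟨c, hc, hcz⟩ := hb.exists_sum hz
  refine ⟨fun i => ϖ⁻¹ * c i, fun i => ?_, ?_⟩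
  · simpa using hϖ.vge_mul hϖ.veq_self.2.1 (vge_zero_iff.mpr (hc i))
  · simp only [mul_smul]
    rw [← Finset.smul_sum, ← hcz, smul_smul, inv_mul_cancel₀ hϖ.ne_zero, one_smul]

/-- The comparison of the lattices generated by `N` and vectors `v + y` with those generated by
`N`, `ϖ v` and `y`. -/
theorem finsum_typ_sup_span_add [FiniteDimensional L W] [Finite 𝓀[L]] (hσ : UnramInvol σ ϖ q)
    (hh : IsHerm h) (hβ : Rels q β) (hb : OrthBasis h ϖ n e N) {v : W} {x : ℤ}
    (hv : VEq ϖ x (h v v)) (hperp : ∀ i, h (n i) v = 0) (he : ∀ i, e i ≤ x + 2)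
    {H : Submodule 𝒪[L] W} (hHN : ∀ z ∈ H, ϖ • z ∈ N)
    (hH : ∀ i, e i = x + 2 → ϖ⁻¹ • n i ∈ H) (hfin : idx N H ≠ 0)
    [DecidableEq (H ⧸ N.submoduleOf H)] :
    ∑ᶠ y : H ⧸ N.submoduleOf H,
        sortVal β (typ h ϖ (N ⊔ Submodule.span 𝒪[L] {v + (y.out : W)})) =
      β (x :: (typ h ϖ N).sort (· ≥ ·)) + ∑ᶠ y : H ⧸ N.submoduleOf H, (if y = 0 then 0 else
        sortVal β (typ h ϖ (radSpan 𝒪[L] v ⊔ (N ⊔ Submodule.span 𝒪[L] {(y.out : W)})))) := by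
  classical
  have hϖ := hσ.unif
  have hϖ0 := hϖ.ne_zero
  have := finite_quotient hfin
  have := Fintype.ofFinite (H ⧸ N.submoduleOf H)
  have := Fintype.ofFinite 𝓀[L]
  set U := N ⊔ Submodule.span 𝒪[L] {ϖ • v} with hU
  have hperp' : ∀ i, h v (n i) = 0 := fun i => by rw [hh (n i) v, hperp, map_zero]
  have htyp := hb.typ_eq hσ
  have hUtyp : OrthType h ϖ U ((x + 2) ::ₘ typ h ϖ N) := by
    rw [htyp]
    refine hb.orthType.cons hσ hh ?_ fun z hz => ?_
    · rw [map_smulₛₗ, hσ.fix, smul_eq_mul, map_smul, LinearMap.smul_apply, smul_eq_mul]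
      have := hϖ.veq_mul hϖ.veq_self (hϖ.veq_mul hϖ.veq_self hv)
      rwa [show 1 + (1 + x) = x + 2 by ring] at this
    · obtain ⟨c, -, rfl⟩ := hb.exists_sum hz
      simp [hperp]
  -- the two summands as functions of a representative
  have hP : ∀ (y : H ⧸ N.submoduleOf H) (z : H), Submodule.Quotient.mk z = y →
      N ⊔ Submodule.span 𝒪[L] {v + (y.out : W)} = U ⊔ Submodule.span 𝒪[L] {v + (z : W)} := by
    intro y z hz
    rw [hU, sup_span_add_eq hϖ (hHN z z.2)]
    refine sup_span_congr ?_
    rw [add_sub_add_left_eq_sub]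
    exact (Submodule.Quotient.eq (N.submoduleOf H)).mp (y.out_eq'.trans hz.symm)
  have hR : ∀ (y : H ⧸ N.submoduleOf H) (z : H), Submodule.Quotient.mk z = y →
      radSpan 𝒪[L] v ⊔ (N ⊔ Submodule.span 𝒪[L] {(y.out : W)}) =
        U ⊔ Submodule.span 𝒪[L] {(z : W)} := by
    intro y z hz
    rw [radSpan_eq hϖ, ← sup_assoc, sup_comm _ N]
    exact sup_span_congr (Submodule.mem_sup_left
      ((Submodule.Quotient.eq (N.submoduleOf H)).mp (y.out_eq'.trans hz.symm)))
  -- the basis vectors of maximal norm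
  set a := Fintype.card {i // e i = x + 2} with ha
  let f : Fin a → ι := fun j => ((Fintype.equivFin {i // e i = x + 2}).symm j : ι)
  have hf : Function.Injective f :=
    Subtype.val_injective.comp (Fintype.equivFin _).symm.injective
  have hef : ∀ j, e (f j) = x + 2 := fun j => ((Fintype.equivFin {i // e i = x + 2}).symm j).2
  have hfr : ∀ i, e i = x + 2 → ∃ j, f j = i := fun i hi =>
    ⟨Fintype.equivFin {i // e i = x + 2} ⟨i, hi⟩, by simp [f]⟩
  have hcount : (typ h ϖ N).count (x + 2) = a := by
    rw [htyp, Multiset.count_map, ← Finset.filter_val, Finset.card_val, ha, Fintype.card_subtype]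
    congr 1
    ext i
    simp [eq_comm]
  let lift : 𝓀[L] → 𝒪[L] := fun s => (IsLocalRing.residue_surjective s).choose
  have hlift : ∀ s, IsLocalRing.residue 𝒪[L] (lift s) = s := fun s =>
    (IsLocalRing.residue_surjective s).choose_spec
  -- Coefficients of representatives with poles only along the basis vectors whose norm exponent is
  -- `x + 2`, one for each tuple of residues.
  let cf : (Fin a → 𝓀[L]) → ι → L := fun s =>
    Function.extend f (fun j => ϖ⁻¹ * (lift (s j) : L)) 0
  have hcf : ∀ s j, cf s (f j) = ϖ⁻¹ * (lift (s j) : L) := fun s j => hf.extend_apply _ _ _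
  have hcf0 : ∀ s i, e i ≠ x + 2 → cf s i = 0 := fun s i hi =>
    Function.extend_apply' _ _ _ (by rintro ⟨j, rfl⟩; exact hi (hef j))
  have hsumf : ∀ G : ι → L, (∀ i, e i ≠ x + 2 → G i = 0) → ∑ i, G i = ∑ j, G (f j) := fun G hG =>
    (Fintype.sum_of_injective f hf _ G (fun i hi => hG i fun h1 => hi (hfr i h1)) fun _ => rfl).symm
  have hcfv : ∀ s i, VGe ϖ (-1) (cf s i) := by
    intro s i
    by_cases hi : e i = x + 2
    · obtain ⟨j, rfl⟩ := hfr i hi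
      rw [hcf]
      simpa using hϖ.vge_mul hϖ.veq_self.2.1 (vge_zero_iff.mpr (lift (s j)).2)
    · rw [hcf0 s i hi]
      exact VGe.zero _
  have hyH : ∀ s, ∑ i, cf s i • n i ∈ H := by
    intro s
    refine Submodule.sum_mem _ fun i _ => ?_
    by_cases hi : e i = x + 2
    · obtain ⟨j, rfl⟩ := hfr i hi
      rw [hcf, mul_comm, mul_smul]
      exact H.smul_mem _ (hH _ hi)
    · rw [hcf0 s i hi, zero_smul]
      exact H.zero_mem
  let φ : (Fin a → 𝓀[L]) → H ⧸ N.submoduleOf H := fun s =>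
    Submodule.Quotient.mk ⟨∑ i, cf s i • n i, hyH s⟩
  have hφeq : ∀ s (z : H) (c : ι → L), (z : W) = ∑ i, c i • n i →
      (Submodule.Quotient.mk z = φ s ↔ ∀ i, c i - cf s i ∈ 𝒪[L]) := by
    intro s z c hz
    rw [← hb.sum_mem_iff]
    simp only [sub_smul, Finset.sum_sub_distrib]
    rw [← hz]
    exact Submodule.Quotient.eq (N.submoduleOf H)
  have hres : ∀ s s' : 𝓀[L], ϖ⁻¹ * (lift s : L) - ϖ⁻¹ * (lift s' : L) ∈ 𝒪[L] ↔ s = s' := by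
    intro s s'
    rw [← mul_sub, ← vge_zero_iff (ϖ := ϖ), ← zpow_neg_one, hϖ.vge_zpow_mul_iff, zero_sub, neg_neg,
      ← residue_eq_iff hϖ, hlift, hlift]
  have hφ : Function.Injective φ := by
    intro s s' hss
    have h1 := (hφeq s' ⟨_, hyH s⟩ (cf s) rfl).mp hss
    ext j
    have h2 := h1 (f j)
    rwa [hcf, hcf, hres] at h2
  have hφ0 : φ 0 = 0 := by
    refine (((hφeq 0 0 0 (by simp)).mpr fun i => ?_).symm).trans rfl
    by_cases hi : e i = x + 2
    · obtain ⟨j, rfl⟩ := hfr i hi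
      have h0 := hlift 0
      rw [residue_eq_zero_iff hϖ] at h0
      rw [hcf, Pi.zero_apply, Pi.zero_apply, zero_sub, ← vge_zero_iff (ϖ := ϖ)]
      simpa using (hϖ.vge_mul hϖ.veq_self.2.1 h0).neg
    · rw [hcf0 0 i hi]
      simpa using zero_mem _
  -- products with the elements of `U`
  have hpair : ∀ (d c : ι → L) (b ε : L), h (∑ i, d i • n i + b • v) (ε • v + ∑ i, c i • n i) =
      ∑ i, d i * σ (c i) * h (n i) (n i) + b * σ ε * h v v := by
    intro d c b ε
    have h1 : h (∑ i, d i • n i) v = 0 := by simp [hperp]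
    have h2 : h v (∑ i, c i • n i) = 0 := by simp [hperp']
    rw [map_add, map_add, LinearMap.add_apply, LinearMap.add_apply, hb.apply_sum_sum]
    simp only [map_smulₛₗ, LinearMap.smul_apply, h1, h2, smul_eq_mul, RingHom.id_apply]
    ring
  have hUrep : ∀ u ∈ U, ∃ (d : ι → L) (b : L), (∀ i, d i ∈ 𝒪[L]) ∧ VGe ϖ 1 b ∧
      u = ∑ i, d i • n i + b • v := by
    intro u hu
    obtain ⟨z₁, hz₁, z₂, hz₂, rfl⟩ := Submodule.mem_sup.mp hu
    obtain ⟨d, hd, rfl⟩ := hb.exists_sum hz₁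
    obtain ⟨b, rfl⟩ := Submodule.mem_span_singleton.mp hz₂
    exact ⟨d, b * ϖ, hd, by simpa using hϖ.vge_mul_left b.2 hϖ.veq_self.1, by
      rw [mul_smul]; rfl⟩
  have hUω : ∀ s (ε : L), ε ∈ 𝒪[L] → ∀ u ∈ U,
      VGe ϖ (x + 1) (h u (ε • v + ∑ i, cf s i • n i)) := by
    intro s ε hε u hu
    obtain ⟨d, b, hd, hbv, rfl⟩ := hUrep u hu
    rw [hpair]
    refine (VGe.sum fun i _ => ?_).add ?_
    · by_cases hi : e i = x + 2
      · have := hϖ.vge_mul (hϖ.vge_mul_left (hd i) (hσ.vge_map (hcfv s i))) (hi ▸ hb.ord i).1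
        rwa [show -1 + (x + 2) = x + 1 by ring] at this
      · rw [hcf0 s i hi]
        simpa using VGe.zero _
    · rw [mul_comm b, mul_assoc, add_comm]
      exact hϖ.vge_mul_left (hσ.mem _ hε) (hϖ.vge_mul hbv hv.1)
  have hϖω : ∀ s (ε : L), ε ∈ 𝒪[L] → ϖ • (ε • v + ∑ i, cf s i • n i) ∈ U := by
    intro s ε hε
    rw [smul_add, add_comm, smul_comm]
    exact Submodule.add_mem_sup (hHN _ (hyH s))
      (Submodule.smul_mem _ (⟨ε, hε⟩ : 𝒪[L]) (Submodule.mem_span_singleton_self _))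
  -- norms
  have hu0 : VEq ϖ 0 (ϖ ^ (-x) * h v v) := by
    simpa using hϖ.veq_mul (hϖ.veq_zpow (-x)) hv
  have hu : ∀ j, VEq ϖ 0 (ϖ ^ (-(x + 2)) * h (n (f j)) (n (f j))) := fun j => by
    have := hϖ.veq_mul (hϖ.veq_zpow (-(x + 2))) (hef j ▸ hb.ord (f j))
    rwa [neg_add_cancel] at this
  let Nm : Fin a → 𝓀[L] → 𝒪[L] := fun j s =>
    ⟨lift s * σ (lift s) * (ϖ ^ (-(x + 2)) * h (n (f j)) (n (f j))),
      mul_mem (mul_mem (lift s).2 (hσ.mem _ (lift s).2)) (vge_zero_iff.mp (hu j).1)⟩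
  let c₀ : 𝒪[L] := ⟨ϖ ^ (-x) * h v v, vge_zero_iff.mp hu0.1⟩
  have hnorm : ∀ s (ε : 𝒪[L]), σ (ε : L) = ε → h ((ε : L) • v + ∑ i, cf s i • n i)
      ((ε : L) • v + ∑ i, cf s i • n i) = ϖ ^ x * ((ε * ε * c₀ + ∑ j, Nm j (s j) : 𝒪[L]) : L) := by
    intro s ε hε
    have h1 := hpair (cf s) (cf s) ε ε
    rw [add_comm] at h1
    rw [h1, hsumf _ (fun i hi => by rw [hcf0 s i hi]; simp), add_comm]
    push_cast
    rw [mul_add, Finset.mul_sum]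
    congr 1
    · simp only [c₀]
      rw [hε, mul_left_comm, ← mul_assoc (ϖ ^ x), ← zpow_add₀ hϖ0]
      simp
    · refine Finset.sum_congr rfl fun j _ => ?_
      simp only [Nm, hcf, map_mul, map_inv₀, hσ.fix]
      rw [mul_left_comm (ϖ ^ x), ← mul_assoc (ϖ ^ x), ← zpow_add₀ hϖ0,
        show x + -(x + 2) = -2 by ring]
      rw [zpow_neg]
      norm_cast
      field_simp
  set I := sortVal β ((x + 1) ::ₘ (x + 1) ::ₘ (typ h ϖ N).erase (x + 2)) with hI
  set An := sortVal β (x ::ₘ typ h ϖ N) with hAn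
  let G : 𝓀[L] → ℤ := fun c => if c = 0 then I else An
  have hG1 : ∀ s, sortVal β (typ h ϖ (U ⊔ Submodule.span 𝒪[L] {v + ∑ i, cf s i • n i})) =
      G (IsLocalRing.residue 𝒪[L] c₀ + ∑ j, IsLocalRing.residue 𝒪[L] (Nm j (s j))) := by
    intro s
    have h1 := hnorm s 1 (by simp)
    have h2 := hUω s 1 (one_mem _)
    have h3 := hϖω s 1 (one_mem _)
    simp only [OneMemClass.coe_one, one_smul, one_mul] at h1 h2 h3
    have h4 := sortVal_typ_sup_span (β := β) hσ hh hUtyp (z := ϖ • v) h3 h2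
      (Submodule.mem_sup_right (Submodule.mem_span_singleton_self _)) ?_ ?_ _ h1
    · rw [h4, map_add, map_sum]
    · have e1 : h (v + ∑ i, cf s i • n i) (ϖ • v) = ϖ * h v v := by
        have := hpair (cf s) 0 1 ϖ
        rw [add_comm] at this
        simpa [hσ.fix] using this
      rw [e1, add_comm]
      exact hϖ.veq_mul hϖ.veq_self hv
    · intro u hu
      obtain ⟨d, b, hd, hbv, rfl⟩ := hUrep u hu
      have := hpair d 0 b ϖ
      simp only [Pi.zero_apply, zero_smul, Finset.sum_const_zero, add_zero, map_zero, mul_zero,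
        zero_mul, zero_add, hσ.fix] at this
      rw [this, show x + 2 = 1 + 1 + x by ring]
      exact hϖ.vge_mul (hϖ.vge_mul hbv hϖ.veq_self.1) hv.1
  have hG2 : ∀ s, s ≠ 0 → sortVal β (typ h ϖ (U ⊔ Submodule.span 𝒪[L] {∑ i, cf s i • n i})) =
      G (∑ j, IsLocalRing.residue 𝒪[L] (Nm j (s j))) := by
    intro s hs
    obtain ⟨j, hj⟩ : ∃ j, s j ≠ 0 := Function.ne_iff.mp hs
    have h1 := hnorm s 0 (by simp)
    have h2 := hUω s 0 (zero_mem _)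
    have h3 := hϖω s 0 (zero_mem _)
    simp only [ZeroMemClass.coe_zero, zero_smul, zero_mul, zero_add] at h1 h2 h3
    have h4 := sortVal_typ_sup_span (β := β) hσ hh hUtyp (z := n (f j)) h3 h2
      (Submodule.mem_sup_left (hb.mem hϖ _)) ?_ ?_ _ h1
    · rw [h4, map_sum]
    · rw [hb.apply_sum, hcf]
      have hl : VEq ϖ 0 ((lift (s j) : 𝒪[L]) : L) := by
        refine hϖ.veq_of_vge (vge_zero_iff.mpr (lift (s j)).2) fun h5 => hj ?_
        rw [← hlift (s j), residue_eq_zero_iff hϖ]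
        simpa using h5
      have h6 : VEq ϖ (-1) ϖ⁻¹ := by simpa using hϖ.veq_zpow (-1)
      have := hϖ.veq_mul (hϖ.veq_mul h6 hl) (hef j ▸ hb.ord (f j))
      rwa [show -1 + 0 + (x + 2) = x + 1 by ring] at this
    · intro u hu
      obtain ⟨d, b, hd, hbv, rfl⟩ := hUrep u hu
      rw [map_add, LinearMap.add_apply, hb.apply_sum, map_smul, LinearMap.smul_apply, hperp',
        smul_zero, add_zero]
      exact hϖ.vge_mul_left (hd _) (hef j ▸ hb.ord (f j)).1
  -- the difference of the two sums
  rw [finsum_eq_sum_of_fintype, finsum_eq_sum_of_fintype, ← sub_eq_iff_eq_add,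
    ← Finset.sum_sub_distrib]
  -- For every class that is not of the special form `φ s` the two terms agree, so only tuples of
  -- residues remain.
  rw [← Fintype.sum_of_injective φ hφ (fun s =>
    G (IsLocalRing.residue 𝒪[L] c₀ + ∑ j, IsLocalRing.residue 𝒪[L] (Nm j (s j))) -
      if s = 0 then 0 else G (∑ j, IsLocalRing.residue 𝒪[L] (Nm j (s j))))]
  · have hNm : ∀ j s, σ (Nm j s : L) = Nm j s := fun j s => by
      simp only [Nm, map_mul, hσ.invol, hσ.map_zpow]
      rw [← hh]
      ring
    have hc₀ : σ (c₀ : L) = c₀ := by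
      simp only [c₀, map_mul, hσ.map_zpow]
      rw [← hh]
    -- The residues of elements fixed by `σ`. All norms lie here, and each nonzero element has `q +
    -- 1` preimages.
    let F : AddSubgroup 𝓀[L] :=
      { carrier := {c | ∃ d : 𝒪[L], σ (d : L) = d ∧ IsLocalRing.residue 𝒪[L] d = c}
        zero_mem' := ⟨0, by simp, by simp⟩
        add_mem' := by
          rintro _ _ ⟨d, hd, rfl⟩ ⟨d', hd', rfl⟩
          exact ⟨d + d', by simp [hd, hd'], by simp⟩
        neg_mem' := by
          rintro _ ⟨d, hd, rfl⟩
          exact ⟨-d, by simp [hd], by simp⟩ }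
    have huσ : ∀ j, σ (ϖ ^ (-(x + 2)) * h (n (f j)) (n (f j))) =
        ϖ ^ (-(x + 2)) * h (n (f j)) (n (f j)) := fun j => by
      rw [map_mul, hσ.map_zpow, ← hh]
    have hfib := fun j => card_norm_fibre hσ (hu j) (huσ j) lift hlift (Nm j) fun s => rfl
    -- The two sums count values of a sum of norms, once shifted by the nonzero residue of the norm
    -- of `v`. Their difference carries the same power `(-q) ^ a` as the insertion of `x` into the
    -- sorted type.
    have hmain := sum_sum_norm (q := q) (by rw [← Nat.card_eq_fintype_card]; exact hσ.card) F
      (fun j s => IsLocalRing.residue 𝒪[L] (Nm j s)) (fun j s => ⟨_, hNm j s, rfl⟩)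
      (fun j => (hfib j).1) (fun j c hc hc0 => by
        obtain ⟨d, hd, rfl⟩ := hc
        exact (hfib j).2 d hd hc0) G An I (fun c _ => rfl) (c := IsLocalRing.residue 𝒪[L] c₀)
      ⟨c₀, hc₀, rfl⟩ (by
        rw [Ne, residue_eq_zero_iff hϖ]
        exact hϖ.not_vge hu0 (by norm_num))
    have hzero : ∑ j, IsLocalRing.residue 𝒪[L] (Nm j ((0 : Fin a → 𝓀[L]) j)) = 0 := by
      refine Finset.sum_eq_zero fun j _ => ?_
      have h0 := hlift 0
      rw [residue_eq_zero_iff hϖ] at h0 ⊢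
      simp only [Nm, Pi.zero_apply]
      rw [mul_assoc, mul_comm]
      exact hϖ.vge_mul_left (mul_mem (hσ.mem _ (lift 0).2) (vge_zero_iff.mp (hu j).1)) h0
    have hite : ∑ s : Fin a → 𝓀[L], (if s = 0 then 0 else
        G (∑ j, IsLocalRing.residue 𝒪[L] (Nm j (s j)))) =
        ∑ s : Fin a → 𝓀[L], G (∑ j, IsLocalRing.residue 𝒪[L] (Nm j (s j))) - I := by
      rw [← Finset.add_sum_erase _ _ (Finset.mem_univ (0 : Fin a → 𝓀[L])),
        ← Finset.add_sum_erase _ (fun s : Fin a → 𝓀[L] =>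
          G (∑ j, IsLocalRing.residue 𝒪[L] (Nm j (s j)))) (Finset.mem_univ (0 : Fin a → 𝓀[L]))]
      rw [hzero, if_pos rfl, zero_add]
      have : G 0 = I := if_pos rfl
      rw [this, add_sub_cancel_left]
      exact Finset.sum_congr rfl fun s hs => if_neg (Finset.ne_of_mem_erase hs)
    rw [Finset.sum_sub_distrib, hite, hβ.insert_sort (s := typ h ϖ N) (x := x) (by
      rw [htyp]
      intro y hy
      obtain ⟨i, -, rfl⟩ := Multiset.mem_map.mp hy
      exact he i), hcount]
    linear_combination -hmain
  · intro y hy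
    obtain ⟨z, rfl⟩ := Submodule.Quotient.mk_surjective _ y
    obtain ⟨c, hc, hz⟩ := hb.exists_sum_of_smul_mem hϖ (hHN z z.2)
    have hy0 : (Submodule.Quotient.mk z : H ⧸ N.submoduleOf H) ≠ 0 := fun h0 =>
      hy ⟨0, hφ0.trans h0.symm⟩
    rw [if_neg hy0, hR _ z rfl, hP _ z rfl, hU, sup_span_add_eq hϖ (hHN z z.2), ← hU, hz]
    -- A pole along a basis vector of exponent at most `x + 1` allows `typ_sup_span_add`; without
    -- such a pole the class is of the form `φ s`, contrary to the assumption.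
    by_cases hex : ∃ i, e i ≤ x + 1 ∧ ¬ VGe ϖ (-1 + 1) (c i)
    · obtain ⟨i, hi, hci⟩ := hex
      rw [typ_sup_span_add hσ hh hb hv hperp hc (hϖ.veq_of_vge (hc i) hci) hi, sub_self]
    · push Not at hex
      refine absurd ?_ hy
      let s : Fin a → 𝓀[L] := fun j => IsLocalRing.residue 𝒪[L] ⟨ϖ * c (f j), by
        rw [← vge_zero_iff (ϖ := ϖ)]
        simpa using hϖ.vge_mul hϖ.veq_self.1 (hc (f j))⟩
      refine ⟨s, ((hφeq s z c hz).mpr fun i => ?_).symm⟩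
      by_cases hi : e i = x + 2
      · obtain ⟨j, rfl⟩ := hfr i hi
        have h1 : IsLocalRing.residue 𝒪[L] (lift (s j)) = _ := hlift (s j)
        rw [residue_eq_iff hϖ] at h1
        rw [hcf, ← vge_zero_iff (ϖ := ϖ)]
        have h2 := (hϖ.vge_mul hϖ.veq_self.2.1 h1).neg
        simp only [neg_add_cancel] at h2
        convert h2 using 1
        field_simp
        ring
      · rw [hcf0 s i hi, sub_zero]
        have := hex i (by have := he i; omega)
        rw [neg_add_cancel] at this
        exact vge_zero_iff.mp this
  · intro s
    rw [hP _ _ rfl, hR _ _ rfl, hG1]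
    by_cases hs : s = 0
    · rw [if_pos hs, if_pos (by rw [hs, hφ0])]
    · rw [if_neg hs, if_neg (fun h0 => hs (hφ (h0.trans hφ0.symm))), hG2 s hs]

end LocalIdentity

/-- The operator `∏ (1 - τ Q ^ (n - 1 - k) X_k ^ 2)`, evaluated at a list of length `n`. -/
def listDenom (Q τ : ℤ) : List ℤ → (List ℤ → ℤ) → ℤ
  | [], β => β []
  | x :: l, β => listDenom Q τ l (fun l' => β (x :: l')) -
      τ * Q ^ l.length * listDenom Q τ l (fun l' => β ((x + 2) :: l'))

/-! ### Weighted sums over the lattices between `𝔪 M` and `M` -/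

section LatticeSum

variable {L : Type*} [Field L] [ValuativeRel L] {σ : L →+* L} {ϖ : L} {q : ℕ}
  {W : Type*} [AddCommGroup W] [Module L W] {h : W →ₗ[L] W →ₛₗ[σ] L} {M N H : Submodule 𝒪[L] W}
  {β : List ℤ → ℤ}

theorem NondegLat.of_le (hσ : UnramInvol σ ϖ q) (hM : NondegLat h ϖ M) (n : ℕ) (hNM : N ≤ M)
    (hMN : ∀ z ∈ M, ϖ ^ n • z ∈ N) : NondegLat h ϖ N := by
  obtain ⟨C, hC⟩ := hM.bdd
  refine ⟨⟨C, fun z hz y hy => hC z (hNM hz) y (hNM hy)⟩, fun z hz h0 => hM.nondeg z (hNM hz)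
    fun y hy => ?_⟩
  have h1 := h0 _ (hMN y hy)
  rw [map_smulₛₗ, map_pow, hσ.fix, smul_eq_mul] at h1
  exact (mul_eq_zero.mp h1).resolve_left (pow_ne_zero _ hσ.unif.ne_zero)

theorem smul_mem_of_maximalIdeal_smul_le (hϖ : IsUnif ϖ) (hN : 𝓂[L] • H ≤ N) {z : W}
    (hz : z ∈ H) : ϖ • z ∈ N :=
  hN (Submodule.smul_mem_smul (r := (⟨ϖ, hϖ.mem⟩ : 𝒪[L]))
    ((hϖ.mem_maximalIdeal_iff _).mpr hϖ.veq_self.1) hz)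

theorem maximalIdeal_smul_sup_span (v : W) :
    𝓂[L] • (H ⊔ Submodule.span 𝒪[L] {v}) = radSpan 𝒪[L] v ⊔ 𝓂[L] • H := by
  rw [Submodule.smul_sup, sup_comm]
  congr 1
  ext z
  rw [Submodule.mem_smul_span_singleton, mem_radSpan]

/-- Pairing with `v` reads off the coefficient of `v`, as `H` is orthogonal to it. -/
theorem separated_of_perp {A : Submodule 𝒪[L] W} {v : W} (hv : h v v ≠ 0)
    (hH : ∀ z ∈ H, h z v = 0) : Separated A H v := by
  intro N hN u hu a hua
  obtain ⟨z₁, hz₁, z₂, hz₂, hz⟩ := Submodule.mem_sup.mp hua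
  obtain ⟨b, hb, rfl⟩ := mem_radSpan.mp hz₁
  have h1 := congrArg (fun z => h z v) hz
  simp only [map_add, LinearMap.add_apply, herm_smul_left, hH u hu, hH z₂ (hN.2 hz₂), add_zero,
    zero_add] at h1
  have h2 : b = a := Subtype.ext (mul_right_cancel₀ hv h1)
  rw [h2, add_comm] at hz
  exact ⟨h2 ▸ hb, add_right_cancel hz ▸ hz₂⟩

theorem OrthBasis.tail (hσ : UnramInvol σ ϖ q) (hh : IsHerm h) {n : ℕ} {v : Fin (n + 1) → W}
    {e : Fin (n + 1) → ℤ} (hb : OrthBasis h ϖ v e M) :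
    ∃ M' : Submodule 𝒪[L] W, OrthBasis h ϖ (fun i : Fin n => v i.succ) (fun i => e i.succ) M' ∧
      M = M' ⊔ Submodule.span 𝒪[L] {v 0} ∧ ∀ z ∈ M', h z (v 0) = 0 := by
  have hb' : OrthBasis h ϖ (fun i : Fin n => v i.succ) (fun i => e i.succ)
      (box ϖ (fun i : Fin n => v i.succ) 0) :=
    ⟨fun i j hij => hb.orth _ _ (fun h => hij (Fin.succ_injective _ h)), fun i => hb.ord _, rfl⟩
  have hperp : ∀ z ∈ box ϖ (fun i : Fin n => v i.succ) 0, h z (v 0) = 0 := by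
    intro z hz
    obtain ⟨c, -, rfl⟩ := hb'.exists_sum hz
    rw [map_sum, LinearMap.sum_apply]
    refine Finset.sum_eq_zero fun i _ => ?_
    rw [map_smul, LinearMap.smul_apply, hb.orth _ _ (Fin.succ_ne_zero i), smul_zero]
  refine ⟨_, hb', ?_, hperp⟩
  rw [(hb'.cons hσ hh (hb.ord 0) hperp).eq, hb.eq]
  congr 1
  exact (Fin.cons_self_tail v).symm

theorem OrthBasis.smul_mem_iff {ι : Type*} [Fintype ι] {v : ι → W} {e : ι → ℤ}
    (hb : OrthBasis h ϖ v e M) {c : L} {i : ι} : c • v i ∈ M ↔ c ∈ 𝒪[L] := by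
  classical
  have h1 : c • v i = ∑ j, (Pi.single i c : ι → L) j • v j := by simp [Pi.single_apply]
  rw [h1, hb.sum_mem_iff]
  refine ⟨fun h2 => by simpa using h2 i, fun h2 j => ?_⟩
  rcases eq_or_ne j i with rfl | hj
  · simpa using h2
  · simpa [hj] using zero_mem _

/-- The entries of the type increase by at most two for sublattices that contain `ϖ M`. -/
theorem OrthBasis.le_add_two (hσ : UnramInvol σ ϖ q) {ι κ : Type*} [Fintype ι] [Fintype κ]
    {v : ι → W} {e : ι → ℤ}
    (hb : OrthBasis h ϖ v e M) {x : ℤ} (hx : ∀ i, e i ≤ x) {n : κ → W} {e' : κ → ℤ}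
    (hb' : OrthBasis h ϖ n e' N) (hNM : N ≤ M) (hMN : ∀ z ∈ M, ϖ • z ∈ N) (j : κ) :
    e' j ≤ x + 2 ∧ ϖ ^ (x + 1 - e' j) • n j ∈ M := by
  have hϖ := hσ.unif
  -- This vector has products of valuation at least `x` with `M`, since `ϖ M ⊆ N`; as no exponent of
  -- `M` exceeds `x`, its coordinates are integral.
  have h1 : ϖ ^ (x + 1 - e' j) • n j ∈ M := by
    obtain ⟨c, hc, hcz⟩ := hb.exists_sum (hNM (hb'.mem hϖ j))
    have h2 : ∀ u ∈ M, VGe ϖ x (h (ϖ ^ (x + 1 - e' j) • n j) u) := by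
      intro u hu
      obtain ⟨d, hd, hdu⟩ := hb'.exists_sum (hMN u hu)
      have h3 : h (n j) (ϖ • u) = σ (d j) * h (n j) (n j) := by
        rw [hdu, map_sum, Finset.sum_eq_single j]
        · rw [map_smulₛₗ, smul_eq_mul]
        · intro i _ hij
          rw [map_smulₛₗ, hb'.orth j i hij.symm, smul_zero]
        · simp
      have h4 : VGe ϖ (e' j) (ϖ ^ (1 : ℤ) * h (n j) u) := by
        have := hϖ.vge_mul_left (hσ.mem _ (hd j)) (hb'.ord j).1
        rw [← h3, map_smulₛₗ, hσ.fix, smul_eq_mul] at this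
        simpa using this
      rw [hϖ.vge_zpow_mul_iff] at h4
      rw [map_smul, LinearMap.smul_apply, smul_eq_mul, hϖ.vge_zpow_mul_iff]
      convert h4 using 1
      ring
    rw [hcz, Finset.smul_sum]
    simp only [smul_smul]
    refine hb.sum_mem_iff.mpr fun i => ?_
    have h5 := h2 _ (hb.mem hϖ i)
    rw [hcz, Finset.smul_sum] at h5
    simp only [smul_smul] at h5
    rw [hb.apply_sum, hϖ.vge_mul_iff (hb.ord i)] at h5
    exact hϖ.mem_of_vge (by have := hx i; omega) h5
  refine ⟨?_, h1⟩
  have h2 := hMN _ h1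
  rw [smul_smul] at h2
  rw [hb'.smul_mem_iff, ← vge_zero_iff (ϖ := ϖ),
    hϖ.vge_iff (hϖ.veq_mul hϖ.veq_self (hϖ.veq_zpow _))] at h2
  omega

/-- Induction on the rank, splitting off the vector `v 0` of largest exponent. Over each `N` in the
complement `M₁` lie `radSpan ⊔ N`, whose type gains the entry `e 0 + 2`, and the graphs of `v 0 +
y`. The local identity replaces the graphs by the value with `e 0` put in front and by terms that
again belong to lattices `radSpan ⊔ N'`. Collected, these give the recursion of `listDenom`. -/
theorem OrthBasis.finsum_wt_typ [FiniteDimensional L W] [Finite 𝓀[L]] (hσ : UnramInvol σ ϖ q)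
    (hh : IsHerm h) {n : ℕ} {v : Fin n → W} {e : Fin n → ℤ} (hb : OrthBasis h ϖ v e M)
    (he : Antitone e) :
    Elem (𝓂[L] • M) M ∧ dim (𝓂[L] • M) M = n ∧ ∀ (τ : ℤ) (β : List ℤ → ℤ), Rels q β →
      ∑ᶠ N ∈ Set.Icc (𝓂[L] • M) M, wt (resCard 𝒪[L]) τ (dim N M) * sortVal β (typ h ϖ N) =
        listDenom (resCard 𝒪[L]) τ (List.ofFn e) β := by
  classical
  have hϖ := hσ.unif
  induction n generalizing M with
  | zero =>
    have hM : M = ⊥ := by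
      rw [hb.eq, eq_bot_iff]
      rintro _ ⟨c, -, rfl⟩
      simp
    have hM' : 𝓂[L] • M = M := by rw [hM, Submodule.smul_bot]
    rw [hM']
    refine ⟨⟨le_rfl, fun a _ v hv => M.smul_mem a hv, by rw [idx_self]; exact one_ne_zero⟩,
      dim_self M, fun τ β _ => ?_⟩
    rw [Set.Icc_self, finsum_mem_singleton, dim_self, wt_zero, hb.typ_eq hσ]
    simp [sortVal, listDenom]
  | succ n ih =>
    obtain ⟨M₁, hb₁, hM, hperp⟩ := hb.tail hσ hh
    obtain ⟨hA, hdim, hsum⟩ := ih hb₁ fun i j hij => he (Fin.succ_le_succ_iff.mpr hij)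
    have hs : Separated (𝓂[L] • M₁) M₁ (v 0) := separated_of_perp (hb.ord 0).2.2 hperp
    have hrad : 𝓂[L] • M = radSpan 𝒪[L] (v 0) ⊔ 𝓂[L] • M₁ := by
      rw [hM, maximalIdeal_smul_sup_span]
    refine ⟨?_, ?_, fun τ β hβ => ?_⟩
    · rw [hrad, hM]
      exact elem_extend hs hA
    · rw [hrad, hM, dim_radSpan_sup hs hA ⟨le_rfl, hA.le⟩, hdim]
    rw [hrad, hM, finsum_Icc_extend hs hA]
    -- the lattices between `𝔪 M₁` and `M₁`
    have hN : ∀ N ∈ Set.Icc (𝓂[L] • M₁) M₁, ∃ (k : ℕ) (w : Fin k → W) (f : Fin k → ℤ),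
        OrthBasis h ϖ w f N ∧ (∀ j, h (w j) (v 0) = 0) ∧ (∀ j, f j ≤ e 0 + 2) ∧
          ∀ j, f j = e 0 + 2 → ϖ⁻¹ • w j ∈ M₁ := by
      intro N hN
      have hMN : ∀ z ∈ M₁, ϖ • z ∈ N := fun z hz => smul_mem_of_maximalIdeal_smul_le hϖ hN.1 hz
      obtain ⟨k, w, f, hw⟩ := ((hb₁.nondegLat hσ).of_le hσ 1 hN.2
        (by simpa using hMN)).exists_orthBasis hσ hh
      have hle := hb₁.le_add_two hσ (x := e 0) (fun i => he (Fin.zero_le _)) hw hN.2 hMN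
      refine ⟨k, w, f, hw, fun j => hperp _ (hN.2 (hw.mem hϖ j)), fun j => (hle j).1,
        fun j hj => ?_⟩
      have := (hle j).2
      rw [hj] at this
      simpa using this
    have hrels : ∀ N ∈ Set.Icc (𝓂[L] • M₁) M₁,
        sortVal β (typ h ϖ (radSpan 𝒪[L] (v 0) ⊔ N)) =
          sortVal (fun l => β ((e 0 + 2) :: l)) (typ h ϖ N) := by
      intro N hN'
      obtain ⟨k, w, f, hw, hw0, hf, -⟩ := hN N hN'
      have h1 : OrthType h ϖ (radSpan 𝒪[L] (v 0) ⊔ N) ((e 0 + 2) ::ₘ typ h ϖ N) := by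
        rw [radSpan_eq hϖ, sup_comm, hw.typ_eq hσ]
        refine hw.orthType.cons hσ hh ?_ fun z hz => ?_
        · rw [map_smulₛₗ, hσ.fix, smul_eq_mul, map_smul, LinearMap.smul_apply, smul_eq_mul]
          have := hϖ.veq_mul hϖ.veq_self (hϖ.veq_mul hϖ.veq_self (hb.ord 0))
          rwa [show 1 + (1 + e 0) = e 0 + 2 by ring] at this
        · rw [map_smulₛₗ, hperp z (hN'.2 hz), smul_zero]
      rw [h1.typ_eq hσ, sortVal_cons]
      rw [hw.typ_eq hσ]
      intro y hy
      obtain ⟨i, -, rfl⟩ := Multiset.mem_map.mp hy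
      exact hf i
    have hfin := hA.finite_Icc
    have hw := fun J => wt_succ (resCard 𝒪[L] : ℤ) τ J
    have hterm : ∀ N ∈ Set.Icc (𝓂[L] • M₁) M₁,
        wt (resCard 𝒪[L]) τ (dim (radSpan 𝒪[L] (v 0) ⊔ N) (M₁ ⊔ Submodule.span 𝒪[L] {v 0})) *
            sortVal β (typ h ϖ (radSpan 𝒪[L] (v 0) ⊔ N)) +
          ∑ᶠ y : M₁ ⧸ N.submoduleOf M₁,
            wt (resCard 𝒪[L]) τ (dim (N ⊔ Submodule.span 𝒪[L] {v 0 + (y.out : W)})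
              (M₁ ⊔ Submodule.span 𝒪[L] {v 0})) *
              sortVal β (typ h ϖ (N ⊔ Submodule.span 𝒪[L] {v 0 + (y.out : W)})) =
        (wt (resCard 𝒪[L]) τ (dim N M₁ + 1) * sortVal β (typ h ϖ (radSpan 𝒪[L] (v 0) ⊔ N)) +
          wt (resCard 𝒪[L]) τ (dim N M₁) * sortVal (fun l => β (e 0 :: l)) (typ h ϖ N)) +
        wt (resCard 𝒪[L]) τ (dim N M₁) * ∑ᶠ y : M₁ ⧸ N.submoduleOf M₁, (if y = 0 then 0 else
          sortVal β (typ h ϖ (radSpan 𝒪[L] (v 0) ⊔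
            (N ⊔ Submodule.span 𝒪[L] {(y.out : W)})))) := by
      intro N hN'
      obtain ⟨k, w, f, hw', hw0, hf, hf2⟩ := hN N hN'
      have hEl := hA.right hN'.1 hN'.2
      have := finite_quotient hEl.idx_ne_zero
      rw [dim_radSpan_sup hs hA hN']
      simp only [dim_span_sup hs hA hN' (SetLike.coe_mem _)]
      rw [← mul_finsum, finsum_typ_sup_span_add hσ hh hβ hw' (hb.ord 0) hw0 hf
        (fun z hz => smul_mem_of_maximalIdeal_smul_le hϖ hN'.1 hz) hf2 hEl.idx_ne_zero]
      have hsv : sortVal (fun l => β (e 0 :: l)) (typ h ϖ N) =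
        β (e 0 :: (typ h ϖ N).sort (· ≥ ·)) := rfl
      rw [hsv]
      ring
    -- With `d = dim N M₁`, the value at `radSpan ⊔ N` has coefficient `wt (d + 1)` directly and `wt
    -- (d + 1) * (Q ^ dim (𝔪 M₁) N - 1)` by double counting. Altogether this is `-τ Q ^ n * wt d`,
    -- the coefficient in `listDenom`.
    rw [finsum_mem_congr rfl hterm, finsum_mem_add_distrib hfin,
      finsum_pairs hA (wt (resCard 𝒪[L]) τ)
        (fun N => sortVal β (typ h ϖ (radSpan 𝒪[L] (v 0) ⊔ N))),
      ← finsum_mem_add_distrib hfin, List.ofFn_succ, listDenom, ← hsum τ _ (hβ.cons (e 0)),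
      ← hsum τ _ (hβ.cons (e 0 + 2)), List.length_ofFn, mul_finsum_mem,
      ← finsum_mem_sub_distrib _ _ hfin]
    refine finsum_mem_congr rfl fun N hN' => ?_
    rw [hrels N hN', hw]
    have hd := hA.dim_add hN'.1 hN'.2
    rw [hdim] at hd
    have hp : (resCard 𝒪[L] : ℤ) ^ n =
        (resCard 𝒪[L] : ℤ) ^ dim (𝓂[L] • M₁) N * (resCard 𝒪[L] : ℤ) ^ dim N M₁ := by
      rw [← pow_add, ← hd]
    rw [hp]
    ring

end LatticeSum

/-! ### Functions on lists and on vectors -/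

section ListFun

variable {r q : ℕ}

/-- The function on lists that agrees with `B` on lists of length `r`. -/
def listFun (B : Typ r → ℤ) (l : List ℤ) : ℤ := if l.length = r then B (fun i => l.getD i 0) else 0

theorem listFun_ofFn (B : Typ r → ℤ) (e : Typ r) : listFun B (List.ofFn e) = B e := by
  rw [listFun, if_pos (List.length_ofFn)]
  congr 1
  ext i
  simp [List.getD]

theorem listFun_cons {r : ℕ} (B : Typ (r + 1) → ℤ) (x : ℤ) (l : List ℤ) :
    listFun B (x :: l) = listFun (fun e : Typ r => B (Fin.cons x e : Typ (r + 1))) l := by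
  simp only [listFun, List.length_cons, Nat.add_right_cancel_iff]
  split_ifs with h
  · congr 1
    ext i
    induction i using Fin.cases with
    | zero => simp
    | succ i => simp
  · rfl

theorem getD_append_cons_cons (l l' : List ℤ) (a b : ℤ) (k : ℕ) :
    (l ++ a :: b :: l').getD k 0 = if k < l.length then l.getD k 0 else
      if k = l.length then a else if k = l.length + 1 then b else
        l'.getD (k - (l.length + 2)) 0 := by
  split_ifs with h1 h2 h3
  · exact List.getD_append _ _ _ _ h1
  · rw [List.getD_append_right _ _ _ _ (by omega), h2]
    simp
  · rw [List.getD_append_right _ _ _ _ (by omega), h3]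
    simp
  · rw [List.getD_append_right _ _ _ _ (by omega),
      show k - l.length = (k - (l.length + 2)) + 1 + 1 by omega]
    simp

theorem rels_listFun {B : Typ r → ℤ}
    (hswap : ∀ (e : Typ r) (i j : Fin r), (i : ℕ) + 1 = j → e j = e i + 1 →
      B e = B (swapEquiv i j e))
    (hpair : ∀ (e : Typ r) (i j : Fin r), (i : ℕ) + 1 = j → e j = e i + 2 →
        B e = (1 + q) * B (e + (basisVec i - basisVec j)) - q * B (swapEquiv i j e)) :
    Rels q (listFun B) := by
  have key : ∀ (l : List ℤ) (a b : ℤ) (l' : List ℤ), (l ++ a :: b :: l').length = r →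
      ∃ i j : Fin r, (i : ℕ) + 1 = j ∧ (i : ℕ) = l.length ∧
        (fun k : Fin r => (l ++ b :: a :: l').getD k 0) =
          swapEquiv i j fun k : Fin r => (l ++ a :: b :: l').getD k 0 := by
    intro l a b l' hl
    simp only [List.length_append, List.length_cons] at hl
    refine ⟨⟨l.length, by omega⟩, ⟨l.length + 1, by omega⟩, rfl, rfl, ?_⟩
    ext k
    change _ = (l ++ a :: b :: l').getD (Equiv.swap _ _ k : Fin r) 0
    rw [Equiv.swap_apply_def, getD_append_cons_cons]
    split_ifs with h1 h2 h3 h4 h5 <;> simp only [Fin.ext_iff] at * <;>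
      first | omega | (rw [getD_append_cons_cons]; simp_all; try omega)
  constructor
  · intro l a l'
    have hlen : (l ++ (a + 1) :: a :: l').length = (l ++ a :: (a + 1) :: l').length := by simp
    rw [listFun, listFun, hlen]
    split_ifs with hl
    · obtain ⟨i, j, hij, hi, he⟩ := key l a (a + 1) l' hl
      rw [he]
      refine hswap _ i j hij ?_
      simp only [getD_append_cons_cons]
      rw [← hij, hi]
      simp
    · rfl
  · intro l a l'
    have hlen : (l ++ (a + 2) :: a :: l').length = (l ++ a :: (a + 2) :: l').length := by simp
    have hlen' : (l ++ (a + 1) :: (a + 1) :: l').length = (l ++ a :: (a + 2) :: l').length := by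
      simp
    rw [listFun, listFun, listFun, hlen, hlen']
    split_ifs with hl
    · obtain ⟨i, j, hij, hi, he⟩ := key l a (a + 2) l' hl
      rw [he]
      have h1 : (fun k : Fin r => (l ++ (a + 1) :: (a + 1) :: l').getD k 0) =
          (fun k : Fin r => (l ++ a :: (a + 2) :: l').getD k 0) + (basisVec i - basisVec j) := by
        ext k
        simp only [getD_append_cons_cons, Pi.add_apply, Pi.sub_apply, basisVec, Pi.single_apply,
          Fin.ext_iff, ← hij, hi]
        split_ifs <;> omega
      rw [h1]
      refine hpair _ i j hij ?_
      simp only [getD_append_cons_cons]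
      rw [← hij, hi]
      simp
    · simp

theorem act_prod_succ {r : ℕ} (s : Finset (Fin r)) (c : Fin r → ℤ) (B : Typ (r + 1) → ℤ) (x : ℤ)
    (e : Typ r) :
    act (∏ k ∈ s, (1 - AddMonoidAlgebra.single
        (basisVec (r := r + 1) k.succ + basisVec (r := r + 1) k.succ) (c k))) B
        (Fin.cons x e : Typ (r + 1)) =
      act (∏ k ∈ s, (1 - AddMonoidAlgebra.single (basisVec k + basisVec k) (c k)))
        (fun e : Typ r => B (Fin.cons x e : Typ (r + 1))) e := by
  classical
  induction s using Finset.induction_on generalizing e with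
  | empty => simp
  | insert k s hk ih =>
    rw [Finset.prod_insert hk, Finset.prod_insert hk, map_mul, map_mul, Module.End.mul_apply,
      Module.End.mul_apply, act_one_sub, act_one_sub]
    have hv : (Fin.cons x e : Typ (r + 1)) +
        (basisVec (r := r + 1) k.succ + basisVec (r := r + 1) k.succ) =
          (Fin.cons x (e + (basisVec k + basisVec k)) : Typ (r + 1)) := by
      ext j
      induction j using Fin.cases with
      | zero => simp [basisVec]
      | succ j => simp [basisVec, Pi.single_apply, Fin.succ_inj]
    rw [hv, ih, ih]

theorem listDenom_eq_act (c : ℤ) (B : Typ r → ℤ) (e : Typ r) :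
    listDenom ((q : ℤ) ^ 2) c (List.ofFn e) (listFun B) = act (denomInt q r c) B e := by
  induction r with
  | zero => simp [listDenom, denomInt, ← listFun_ofFn]
  | succ r ih =>
    have key : ∀ x, listDenom ((q : ℤ) ^ 2) c (List.ofFn fun i => e i.succ)
        (fun l => listFun B (x :: l)) = act (denomInt q r c)
          (fun e : Typ r => B (Fin.cons x e : Typ (r + 1))) fun i => e i.succ := by
      intro x
      rw [← ih]
      congr 1
      ext l
      exact listFun_cons B x l
    rw [List.ofFn_succ, listDenom, key, key, List.length_ofFn]
    have hprod : ∀ x, act (denomInt q r c)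
          (fun e : Typ r => B (Fin.cons x e : Typ (r + 1))) (fun i => e i.succ) =
        act (∏ k : Fin r, (1 - AddMonoidAlgebra.single
          (basisVec (r := r + 1) k.succ + basisVec (r := r + 1) k.succ)
            (c * (q : ℤ) ^ (2 * (r + 1 - 1 - (k.succ : ℕ)))))) B
          (Fin.cons x (fun i => e i.succ) : Typ (r + 1)) := by
      intro x
      rw [act_prod_succ, denomInt]
      simp only [Fin.val_succ]
      congr! 7
      omega
    have h0 : (Fin.cons (e 0) (fun i => e i.succ) : Typ (r + 1)) = e := Fin.cons_self_tail e
    have h2 : (Fin.cons (e 0 + 2) (fun i => e i.succ) : Typ (r + 1)) =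
        e + (basisVec 0 + basisVec 0) := by
      ext j
      induction j using Fin.cases with
      | zero => simp [basisVec]
      | succ j => simp [basisVec]
    rw [hprod, hprod, h0, h2, denomInt, Fin.prod_univ_succ, map_mul, Module.End.mul_apply,
      act_one_sub]
    simp [pow_mul]

end ListFun

/-! ### Orthogonal bases compared with types and residue dimensions -/

theorem Elem.length_eq {R W : Type*} [CommRing R] [IsLocalRing R] [AddCommGroup W] [Module R W]
    [Finite (IsLocalRing.ResidueField R)] {A V : Submodule R W} (h : Elem A V) :
    (Module.length R (V ⧸ A.submoduleOf V)).toNat = dim A V := by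
  have hT : Module.IsTorsionBySet R (V ⧸ A.submoduleOf V) (IsLocalRing.maximalIdeal R) := by
    rintro y ⟨a, ha⟩
    obtain ⟨z, rfl⟩ := Submodule.Quotient.mk_surjective _ y
    exact (Submodule.Quotient.mk_eq_zero (A.submoduleOf V)).mpr (h.smul_mem a ha z z.2)
  letI : Module (R ⧸ IsLocalRing.maximalIdeal R) (V ⧸ A.submoduleOf V) := hT.module
  letI : Module (IsLocalRing.ResidueField R) (V ⧸ A.submoduleOf V) :=
    inferInstanceAs (Module (R ⧸ IsLocalRing.maximalIdeal R) (V ⧸ A.submoduleOf V))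
  haveI : IsScalarTower R (IsLocalRing.ResidueField R) (V ⧸ A.submoduleOf V) :=
    hT.isScalarTower (S := R)
  have := finite_quotient h.idx_ne_zero
  rw [Module.length_eq_of_surjective (R := IsLocalRing.ResidueField R)
    IsLocalRing.residue_surjective, Module.length_eq_finrank, ENat.toNat_coe, eq_comm]
  refine dim_eq_of_idx ?_
  rw [← card_quotient, resCard]
  exact Module.natCard_eq_pow_finrank

section Diag

variable {K L : Type*} [Field K] [ValuativeRel K] [Field L] [ValuativeRel L] [Algebra K L]
  {σ : L ≃ₐ[K] L} {ϖ : 𝒪[K]} {r q : ℕ}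

theorem quotientDim_eq [Finite 𝓀[L]] {W : Type*} [AddCommGroup W] [Module L W]
    {Λ Λ' : Submodule 𝒪[L] W} (h : Elem (𝓂[L] • Λ ⊔ Λ') Λ) :
    quotientDim Λ Λ' = dim (𝓂[L] • Λ ⊔ Λ') Λ := by
  have hΛ' : Λ' ≤ Λ := le_sup_right.trans h.le
  rw [← h.length_eq, quotientDim]
  have : (𝓂[L] • Λ ⊔ Λ').submoduleOf Λ = 𝓂[L] • (⊤ : Submodule 𝒪[L] Λ) ⊔ Λ'.submoduleOf Λ := by
    apply Submodule.map_injective_of_injective Λ.subtype_injective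
    rw [Submodule.submoduleOf, Submodule.map_comap_subtype, Submodule.map_sup, Submodule.map_smul'',
      Submodule.map_top, Submodule.range_subtype, Submodule.submoduleOf,
      Submodule.map_comap_subtype, inf_eq_right.mpr hΛ', inf_eq_right.mpr h.le]
  rw [this]

/-- This is the product of the `q`-binomial theorem with base `q²` at the parameter `q²`, which is
what links `c` to the parameter `τ = q²`. -/
theorem cFactor_eq (k : ℕ) : cFactor q k = ∏ i ∈ Finset.range k,
    (1 - (q : ℤ) ^ 2 * (((q ^ 2 : ℕ) : ℤ)) ^ i) := by
  induction k with
  | zero => simp [cFactor]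
  | succ k ih =>
    rw [cFactor] at ih ⊢
    rw [Finset.prod_Icc_succ_top (by omega), ih, Finset.prod_range_succ]
    push_cast
    ring

theorem diagForm_apply (f : Typ r) (x y : Fin r → L) :
    diagForm σ ϖ f x y = ∑ i, algebraMap K L ϖ ^ f i * x i * σ (y i) := rfl

theorem isHerm_diagForm (hσ : UnramInvol (σ : L →+* L) (algebraMap K L ϖ) q) (f : Typ r) :
    IsHerm (σ := (σ : L →+* L)) (diagForm σ ϖ f) := by
  intro x y
  rw [diagForm_apply, diagForm_apply, map_sum]
  refine Finset.sum_congr rfl fun i _ => ?_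
  have h1 : σ (σ (y i)) = y i := hσ.invol (y i)
  have h2 : σ (algebraMap K L ϖ ^ f i) = algebraMap K L ϖ ^ f i := hσ.map_zpow (f i)
  change _ = σ _
  rw [map_mul, map_mul, h1, h2]
  ring

theorem orthBasis_diagForm (hσ : UnramInvol (σ : L →+* L) (algebraMap K L ϖ) q) (f : Typ r) :
    OrthBasis (σ := (σ : L →+* L)) (diagForm σ ϖ f) (algebraMap K L ϖ)
      (fun i : Fin r => (Pi.single i 1 : Fin r → L)) f (stdLattice L r) := by
  have hval : ∀ i j : Fin r, diagForm σ ϖ f (Pi.single i 1) (Pi.single j 1) =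
      if i = j then algebraMap K L ϖ ^ f i else 0 := by
    intro i j
    rw [diagForm_apply, Finset.sum_eq_single i]
    · by_cases h : i = j
      · subst h
        simp
      · simp [h]
    · intro k _ hk
      simp [hk]
    · simp
  refine ⟨fun i j hij => by rw [hval, if_neg hij], fun i => ?_, ?_⟩
  · rw [hval, if_pos rfl]
    exact hσ.unif.veq_zpow _
  · ext z
    have hz : z = ∑ i, z i • (Pi.single i 1 : Fin r → L) := by
      ext j
      simp [Finset.sum_apply, Pi.single_apply]
    constructor
    · exact fun h => ⟨z, fun i => vge_zero_iff.mpr (h i), hz⟩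
    · rintro ⟨c, hc, rfl⟩ i
      have : (∑ i, c i • (Pi.single i 1 : Fin r → L)) i = c i := by
        simp [Finset.sum_apply, Pi.single_apply]
      rw [this]
      exact vge_zero_iff.mp (hc i)

variable {W : Type*} [AddCommGroup W] [Module L W] {h : W →ₗ[L] W →ₛₗ[(σ : L →+* L)] L}
  {M : Submodule 𝒪[L] W}

theorem OrthBasis.hasType [FiniteDimensional L W]
    (hσ : UnramInvol (σ : L →+* L) (algebraMap K L ϖ) q)
    {v : Fin r → W} {e : Typ r}
    (hr : Module.finrank L W = r) (hb : OrthBasis h (algebraMap K L ϖ) v e M) :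
    HasType ϖ h e M := by
  have hϖ := hσ.unif
  set p := algebraMap K L ϖ with hp
  have hp0 := hϖ.ne_zero
  have hli := hb.linearIndependent
  let b₀ : Module.Basis (Fin r) L W := Module.Basis.mk hli
    (hli.span_eq_top_of_card_eq_finrank' (by simp [hr])).ge
  have hb₀ : ∀ i, b₀ i = v i := fun i => by simp [b₀]
  let b := b₀.isUnitSMul (w := fun i => p ^ (-e i)) fun i => (zpow_ne_zero _ hp0).isUnit
  have hbi : ∀ i, b i = p ^ (-e i) • v i := fun i => by
    rw [Module.Basis.isUnitSMul_apply, hb₀]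
  refine ⟨b, ?_, ?_⟩
  · have h1 : Set.range b = Set.range fun i => p ^ (-e i) • v i := by
      congr 1
      ext i
      exact hbi i
    rw [h1, span_eq_box hϖ (k := fun i => -e i)]
    ext z
    constructor
    · intro hz
      have hz' : z = ∑ i, b₀.repr z i • v i := by
        conv_lhs => rw [← b₀.sum_repr z]
        simp only [hb₀]
      rw [hz']
      refine (sum_mem_box_iff hli).mpr fun i => ?_
      have h2 := hz (v i) (hb.mem hϖ i)
      rw [hz', hb.apply_sum, ← vge_zero_iff (ϖ := p), hϖ.vge_mul_iff (hb.ord i)] at h2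
      simpa using h2
    · rintro ⟨c, hc, rfl⟩ y hy
      obtain ⟨d, hd, rfl⟩ := hb.exists_sum hy
      rw [hb.apply_sum_sum, ← vge_zero_iff (ϖ := p)]
      refine VGe.sum fun i _ => ?_
      rw [hϖ.vge_mul_iff (hb.ord i), mul_comm, zero_sub]
      exact hϖ.vge_mul_left (hσ.mem _ (hd i)) (hc i)
  · have h1 : (fun i => p ^ e i • b i) = fun i => p ^ (0 : Fin r → ℤ) i • v i := by
      ext i
      rw [hbi, smul_smul, ← zpow_add₀ hp0]
      simp
    rw [h1, span_eq_box hϖ, ← hb.eq]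

/-- The invariants `lev` can also be computed from a basis of the dual lattice: both `M` and its
dual are boxes in that basis. Their indices again determine the multiset. -/
theorem HasType.map_univ_eq (hσ : UnramInvol (σ : L →+* L) (algebraMap K L ϖ) q)
    {e : Typ r} (ht : HasType ϖ h e M) {κ : Type*} [Fintype κ] {v : κ → W} {e' : κ → ℤ}
    (hb : OrthBasis h (algebraMap K L ϖ) v e' M) :
    Finset.univ.val.map e = Finset.univ.val.map e' := by
  have hϖ := hσ.unif
  obtain ⟨b, hdual, hM⟩ := ht
  set p := algebraMap K L ϖ with hp
  have hp0 := hϖ.ne_zero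
  have hd : dualLattice h M = box p b 0 := by
    rw [hdual, ← span_eq_box hϖ]
    simp
  rw [span_eq_box hϖ] at hM
  refine map_univ_eq_of_sum_toNat fun m => ?_
  have h1 := hb.idx_lev hσ m
  have h2 : lev p h M m = box p b fun i => e i + ((m - e i).toNat : ℤ) := by
    ext z
    have hz' : z = ∑ i, b.repr z i • b i := (b.sum_repr z).symm
    have hiff : (∀ y ∈ M, VGe p m (h z y)) ↔ p ^ (-m) • z ∈ dualLattice h M := by
      refine forall₂_congr fun y _ => ?_
      rw [map_smul, LinearMap.smul_apply, smul_eq_mul, VGe]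
    change (z ∈ M ∧ ∀ y ∈ M, VGe p m (h z y)) ↔ _
    rw [hiff, hd, hM, hz', Finset.smul_sum]
    simp only [smul_smul]
    rw [sum_mem_box_iff b.linearIndependent, sum_mem_box_iff b.linearIndependent,
      sum_mem_box_iff b.linearIndependent, ← forall_and]
    refine forall_congr' fun i => ?_
    rw [hϖ.vge_zpow_mul_iff, Pi.zero_apply, zero_sub, neg_neg]
    constructor
    · rintro ⟨h3, h4⟩
      rcases le_total (m - e i) 0 with h5 | h5
      · rw [Int.toNat_of_nonpos h5]
        simpa using h3
      · rw [Int.toNat_of_nonneg h5]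
        simpa using h4
    · intro h3
      exact ⟨hϖ.vge_mono (by omega) h3, hϖ.vge_mono (by omega) h3⟩
  have h3 := idx_box (k := e) hϖ b.linearIndependent fun i => (m - e i).toNat
  rw [← h2, ← hM, h1] at h3
  have h4 : resCard 𝒪[L] = q ^ 2 := hσ.card
  rw [h4] at h3
  exact (Nat.pow_right_injective (a := q ^ 2) (by nlinarith [hσ.two_le]) h3).symm

end Diag

/-! ### Expansion in lattice counting functions -/

section Expansion

variable {K L : Type*} [Field K] [ValuativeRel K] [Field L] [ValuativeRel L] [Algebra K L]
  {σ : L ≃ₐ[K] L} {ϖ : 𝒪[K]} {r q : ℕ}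

theorem TypFlat.pairwise (e : TypFlat r) : (List.ofFn e.1).Pairwise (· ≥ ·) :=
  List.pairwise_ofFn.mpr fun _ _ hij => e.2.1 hij.le

theorem TypFlat.map_univ_injective {e e' : TypFlat r}
    (h : Finset.univ.val.map e.1 = Finset.univ.val.map e'.1) : e = e' := by
  rw [Fin.univ_val_map, Fin.univ_val_map, Multiset.coe_eq_coe] at h
  have := h.eq_of_pairwise' e.pairwise e'.pairwise
  exact Subtype.ext (List.ofFn_injective this)

theorem TypFlat.le_of_coordSum_le (e : TypFlat r) {C : ℤ} (h : coordSum r e.1 ≤ C) (i : Fin r) :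
    e.1 i ≤ C :=
  (Finset.single_le_sum (fun j _ => e.2.2 j) (Finset.mem_univ i)).trans h

variable {W : Type*} [AddCommGroup W] [Module L W] {h : W →ₗ[L] W →ₛₗ[(σ : L →+* L)] L}
  {M N Λ : Submodule 𝒪[L] W}

/-- Lattices of bounded type in an integral lattice contain a fixed multiple of it. -/
theorem HasType.smul_mem (hσ : UnramInvol (σ : L →+* L) (algebraMap K L ϖ) q) {e : Typ r}
    (ht : HasType ϖ h e M) (hM : M ≤ Λ) (hΛ : ∀ z ∈ Λ, ∀ y ∈ Λ, h z y ∈ 𝒪[L]) {n : ℕ}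
    (hn : ∀ i, e i ≤ n) {z : W} (hz : z ∈ Λ) : algebraMap K L ϖ ^ n • z ∈ M := by
  have hϖ := hσ.unif
  obtain ⟨b, hdual, hMb⟩ := ht
  set p := algebraMap K L ϖ with hp
  have hd : z ∈ box p b 0 := by
    rw [← span_eq_box hϖ]
    simp only [Pi.zero_apply, zpow_zero, one_smul]
    change z ∈ Submodule.span 𝒪[L] (Set.range b)
    rw [← hdual]
    exact fun y hy => hΛ z hz y (hM hy)
  obtain ⟨c, hc, rfl⟩ := hd
  rw [span_eq_box hϖ] at hMb
  rw [hMb, Finset.smul_sum]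
  simp only [smul_smul]
  refine ⟨_, fun i => ?_, rfl⟩
  rw [← zpow_natCast, hϖ.vge_zpow_mul_iff]
  exact hϖ.vge_mono (by have := hn i; simp; omega) (hc i)

variable [FiniteDimensional L W]

theorem exists_typFlat (hσ : UnramInvol (σ : L →+* L) (algebraMap K L ϖ) q) (hh : IsHerm h)
    {v : Fin r → W} {f : Typ r} (hb : OrthBasis h (algebraMap K L ϖ) v f Λ)
    (hr : Module.finrank L W = r)
    (hΛ : ∀ z ∈ Λ, ∀ y ∈ Λ, h z y ∈ 𝒪[L]) (hM : M ≤ Λ) (n : ℕ)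
    (hn : ∀ z ∈ Λ, algebraMap K L ϖ ^ n • z ∈ M) :
    ∃ (w : Fin r → W) (e : TypFlat r), OrthBasis h (algebraMap K L ϖ) w e.1 M := by
  have hϖ := hσ.unif
  set p := algebraMap K L ϖ with hp
  obtain ⟨k, w, e, hw⟩ := ((hb.nondegLat hσ).of_le hσ n hM hn).exists_orthBasis hσ hh
  have hspan : Submodule.span L (Set.range w) = ⊤ := by
    rw [← top_le_iff, ← hb.linearIndependent.span_eq_top_of_card_eq_finrank' (by simp [hr]),
      Submodule.span_le]
    rintro _ ⟨i, rfl⟩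
    obtain ⟨c, -, hc⟩ := hw.exists_sum (hn _ (hb.mem hϖ i))
    have h1 : v i = (p ^ n)⁻¹ • ∑ j, c j • w j := by
      rw [← hc, smul_smul, inv_mul_cancel₀ (pow_ne_zero _ hϖ.ne_zero), one_smul]
    rw [h1]
    exact Submodule.smul_mem _ _ (Submodule.sum_mem _ fun j _ =>
      Submodule.smul_mem _ _ (Submodule.subset_span ⟨j, rfl⟩))
  have hk : r = k := by
    rw [← hr, Module.finrank_eq_card_basis (Module.Basis.mk hw.linearIndependent hspan.ge),
      Fintype.card_fin]
  subst hk
  let s : Equiv.Perm (Fin r) := Tuple.sort fun i => OrderDual.toDual (e i)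
  have hs : Antitone (e ∘ s) := by
    intro i j hij
    exact Tuple.monotone_sort (fun i => OrderDual.toDual (e i)) hij
  refine ⟨w ∘ s, ⟨e ∘ s, hs, fun i => ?_⟩, hw.reindex s⟩
  have h1 := hΛ _ (hM (hw.mem hϖ (s i))) _ (hM (hw.mem hϖ (s i)))
  rwa [← vge_zero_iff (ϖ := p), hϖ.vge_iff (hw.ord (s i))] at h1

theorem OrthBasis.sortVal_typ (hσ : UnramInvol (σ : L →+* L) (algebraMap K L ϖ) q) {w : Fin r → W}
    {e : TypFlat r} (hw : OrthBasis h (algebraMap K L ϖ) w e.1 M) (B : Typ r → ℤ) :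
    sortVal (listFun B) (typ h (algebraMap K L ϖ) M) = B e.1 := by
  rw [hw.typ_eq hσ, Fin.univ_val_map, sortVal_coe e.pairwise, listFun_ofFn]

theorem OrthBasis.hasType_iff (hσ : UnramInvol (σ : L →+* L) (algebraMap K L ϖ) q) {w : Fin r → W}
    (hr : Module.finrank L W = r) {e e' : TypFlat r}
    (hw : OrthBasis h (algebraMap K L ϖ) w e.1 M) : HasType ϖ h e'.1 M ↔ e' = e := by
  constructor
  · exact fun ht => TypFlat.map_univ_injective (ht.map_univ_eq hσ hw)
  · rintro rfl
    exact hw.hasType hσ hr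

open scoped Classical in
/-- The expansion of the function `∏ (1 - q ^ 2 q ^ (2 (r - 1 - k)) X_k ^ 2) B` in terms of lattice
counting functions. -/
theorem act_denomInt_eq_sum_latticeSum [Finite 𝓀[L]]
    (hσ : UnramInvol (σ : L →+* L) (algebraMap K L ϖ) (residueCard K)) (hh : IsHerm h)
    {v : Fin r → W} {f : TypFlat r} (hb : OrthBasis h (algebraMap K L ϖ) v f.1 Λ)
    (hr : Module.finrank L W = r) {B : Typ r → ℤ} (hβ : Rels (residueCard K) (listFun B)) {C : ℤ}
    (hC : ∀ e, C < coordSum r e → B e = 0) {E : Finset (TypFlat r)}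
    (hE : ∀ e ∈ E, coordSum r e.1 ≤ C)
    (hE' : ∀ e ∉ E, act (denomInt (residueCard K) r 1) B e.1 = 0) :
    act (denomInt (residueCard K) r ((residueCard K : ℤ) ^ 2)) B f.1 =
      ∑ e ∈ E, act (denomInt (residueCard K) r 1) B e.1 * latticeSum ϖ h Λ e.1 := by
  have hϖ := hσ.unif
  set p := algebraMap K L ϖ with hp
  set q := residueCard K with hq
  have hp0 := hϖ.ne_zero
  have hres : resCard 𝒪[L] = q ^ 2 := hσ.card
  have hΛ : ∀ z ∈ Λ, ∀ y ∈ Λ, h z y ∈ 𝒪[L] := by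
    intro z hz y hy
    obtain ⟨c, hc, rfl⟩ := hb.exists_sum hz
    obtain ⟨d, hd, rfl⟩ := hb.exists_sum hy
    rw [hb.apply_sum_sum]
    exact sum_mem fun i _ => mul_mem (mul_mem (hc i) (hσ.mem _ (hd i)))
      (hϖ.mem_of_vge (f.2.2 i) (hb.ord i).1)
  -- `1 ≤ n` places `U` inside `𝔪 Λ`, and `C ≤ n` places it inside every sublattice whose type has
  -- sum at most `C`; so one finite interval contains all lattices that matter.
  obtain ⟨n, hn1, hnC⟩ : ∃ n : ℕ, 1 ≤ n ∧ C ≤ n := ⟨max 1 C.toNat, by omega, by omega⟩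
  set U := box p v fun _ => (n : ℤ) with hU
  have hUΛ : U ≤ Λ := by
    rw [hb.eq]
    exact box_mono hϖ fun i => by simp
  have hUle : ∀ M : Submodule 𝒪[L] W, (∀ z ∈ Λ, p ^ n • z ∈ M) → U ≤ M := by
    rintro M hM _ ⟨c, hc, rfl⟩
    have h1 : ∑ i, c i • v i = p ^ n • ∑ i, (p ^ (-(n : ℤ)) * c i) • v i := by
      rw [Finset.smul_sum]
      refine Finset.sum_congr rfl fun i _ => ?_
      rw [smul_smul, ← mul_assoc, ← zpow_natCast, ← zpow_add₀ hp0]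
      simp
    rw [h1]
    exact hM _ (hb.sum_mem_iff.mpr hc)
  have hleU : ∀ z ∈ Λ, p ^ n • z ∈ U := by
    intro z hz
    obtain ⟨c, hc, rfl⟩ := hb.exists_sum hz
    rw [Finset.smul_sum]
    simp only [smul_smul]
    refine ⟨_, fun i => ?_, rfl⟩
    rw [← zpow_natCast, hϖ.vge_zpow_mul_iff, sub_self]
    exact vge_zero_iff.mpr (hc i)
  have hidx : idx U Λ ≠ 0 := by
    have h1 := idx_box (k := (0 : Fin r → ℤ)) hϖ hb.linearIndependent fun _ => n
    simp only [Pi.zero_apply, zero_add] at h1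
    rw [← hb.eq] at h1
    rw [hU, h1]
    exact pow_ne_zero _ (by have := one_lt_resCard (R := 𝒪[L]); omega)
  have hp𝓂 : (⟨p, hϖ.mem⟩ : 𝒪[L]) ∈ 𝓂[L] := (hϖ.mem_maximalIdeal_iff _).mpr hϖ.veq_self.1
  have hU𝓂 : U ≤ 𝓂[L] • Λ := by
    refine hUle _ fun z hz => ?_
    obtain ⟨k, rfl⟩ : ∃ k, n = k + 1 := ⟨n - 1, by omega⟩
    rw [pow_succ', mul_smul]
    exact Submodule.smul_mem_smul (r := (⟨p, hϖ.mem⟩ : 𝒪[L])) hp𝓂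
      (smul_mem_of_vge (vge_zero_iff (ϖ := p).mpr (pow_mem hϖ.mem k)) hz)
  have hdvd : ∀ a ∈ 𝓂[L], (⟨p, hϖ.mem⟩ : 𝒪[L]) ∣ a := by
    intro a ha
    have h1 := (hϖ.mem_maximalIdeal_iff a).mp ha
    refine ⟨⟨p ^ (-1 : ℤ) * a, h1⟩, Subtype.ext ?_⟩
    change (a : L) = p * (p ^ (-1 : ℤ) * a)
    rw [zpow_neg_one, mul_inv_cancel_left₀ hp0]
  obtain ⟨hElem, -, hD⟩ := hb.finsum_wt_typ hσ hh f.2.1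
  have hflat : ∀ N ∈ Set.Icc U Λ, ∃ (w : Fin r → W) (e : TypFlat r), OrthBasis h p w e.1 N :=
    fun N hN => exists_typFlat hσ hh hb hr hΛ hN.2 n fun z hz => hN.1 (hleU z hz)
  -- the inner sums
  have hinner : ∀ N ∈ Set.Icc U Λ, ∀ (w : Fin r → W) (e : TypFlat r), OrthBasis h p w e.1 N →
      ∑ᶠ M ∈ Set.Icc (U ⊔ 𝓂[L] • N) N, wt (resCard 𝒪[L]) 1 (dim M N) *
        sortVal (listFun B) (typ h p M) = act (denomInt q r 1) B e.1 := by
    intro N hN w e hw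
    obtain ⟨-, -, hDN⟩ := hw.finsum_wt_typ hσ hh e.2.1
    rw [← listDenom_eq_act]
    have h1 := hDN 1 _ hβ
    rw [hres] at h1 ⊢
    rw [Nat.cast_pow] at h1
    rw [← h1]
    -- The lower bounds `U ⊔ 𝔪 N` and `𝔪 N` give the same sum: where `B` does not vanish, the type
    -- has sum at most `C`, and the lattice contains `U`.
    refine finsum_mem_inter_support_eq' _ _ _ fun M hM => ?_
    constructor
    · exact fun h2 => ⟨le_sup_right.trans h2.1, h2.2⟩
    · refine fun h2 => ⟨sup_le ?_ h2.1, h2.2⟩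
      have hMΛ := h2.2.trans hN.2
      obtain ⟨w', e', hw'⟩ := exists_typFlat hσ hh hb hr hΛ hMΛ (n + 1) fun z hz => by
        rw [pow_succ', mul_smul]
        exact smul_mem_of_maximalIdeal_smul_le hϖ h2.1 (hN.1 (hleU z hz))
      have hM' := right_ne_zero_of_mul hM
      rw [hw'.sortVal_typ hσ] at hM'
      have hsum : coordSum r e'.1 ≤ C := by
        by_contra hlt
        exact hM' (hC _ (not_le.mp hlt))
      exact hUle M fun z hz => (hw'.hasType hσ hr).smul_mem hσ hMΛ hΛ
        (fun i => (e'.le_of_coordSum_le hsum i).trans hnC) hz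
  have hfin := finite_Icc_of_idx hidx
  -- The weighted sum at `Λ` with `τ = q²`, inverted: the outer factors become `c`, and the inner
  -- sums are the weighted sums with `τ = 1`, which are the coefficients of the expansion.
  have hT : act (denomInt q r ((q : ℤ) ^ 2)) B f.1 = ∑ N ∈ hfin.toFinset,
      ∑ e ∈ E, (if HasType ϖ h e.1 N then
        act (denomInt q r 1) B e.1 * cFactor q (quotientDim Λ N) else 0) := by
    rw [← listDenom_eq_act]
    have h1 := hD ((q : ℤ) ^ 2) _ hβ
    rw [← finsum_inversion hidx hUΛ hU𝓂 hdvd ⟨n, fun z hz => hleU z hz⟩] at h1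
    rw [hres, Nat.cast_pow] at h1
    rw [← h1, finsum_mem_eq_finite_toFinset_sum _ hfin]
    refine Finset.sum_congr rfl fun N hN => ?_
    rw [Set.Finite.mem_toFinset] at hN
    obtain ⟨w, e, hw⟩ := hflat N hN
    have h2 := hinner N hN w e hw
    rw [hres, Nat.cast_pow] at h2
    rw [h2, quotientDim_eq (hElem.right le_sup_left (sup_le hElem.le hN.2)), cFactor_eq,
      Nat.cast_pow, mul_comm]
    simp only [hw.hasType_iff hσ hr]
    rw [Finset.sum_ite_eq']
    split_ifs with he
    · rfl
    · rw [hE' e he, zero_mul]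
  rw [hT, Finset.sum_comm]
  refine Finset.sum_congr rfl fun e he => ?_
  have hsub : {N | N ≤ Λ ∧ HasType ϖ h e.1 N} ⊆ Set.Icc U Λ := fun N hN =>
    ⟨hUle N fun z hz => hN.2.smul_mem hσ hN.1 hΛ
      (fun i => (e.le_of_coordSum_le (hE e he) i).trans hnC) hz, hN.1⟩
  have hphi : latticeSum ϖ h Λ e.1 = ∑ N ∈ hfin.toFinset,
      if HasType ϖ h e.1 N then cFactor q (quotientDim Λ N) else 0 := by
    have h1 : latticeSum ϖ h Λ e.1 =
        ∑ᶠ N ∈ {N | N ≤ Λ ∧ HasType ϖ h e.1 N}, cFactor q (quotientDim Λ N) := rfl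
    rw [h1, finsum_mem_eq_finite_toFinset_sum _ (hfin.subset hsub), ← Finset.sum_filter]
    refine Finset.sum_congr ?_ fun _ _ => rfl
    ext N
    simp only [Set.Finite.mem_toFinset, Finset.mem_filter]
    exact ⟨fun hN => ⟨hsub hN, hN.2⟩, fun hN => ⟨hN.1.2, hN.2⟩⟩
  rw [hphi, Finset.mul_sum]
  refine Finset.sum_congr rfl fun N _ => ?_
  rw [mul_ite, mul_zero]

end Expansion

/-! ### Hecke images in the span of the lattice counting functions -/

section Main

variable {K L : Type*} [Field K] [ValuativeRel K] [Field L] [ValuativeRel L] [Algebra K L]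
  {σ : L ≃ₐ[K] L} {ϖ : 𝒪[K]} {r : ℕ}

theorem finite_typFlat_le (C : ℤ) : {e : TypFlat r | coordSum r e.1 ≤ C}.Finite := by
  have h1 : (Set.Icc (0 : Typ r) fun _ => C).Finite := Set.finite_Icc _ _
  refine Set.Finite.of_injOn (f := fun e : TypFlat r => e.1) ?_ Subtype.val_injective.injOn h1
  exact fun e he => ⟨fun i => e.2.2 i, fun i => e.le_of_coordSum_le he i⟩

/-- The entries decrease to nonnegative values, so zeros stand at the end; two of them would occupy
the last two positions. -/
theorem mult_zero_le_one {e : TypFlat r} (he : ∀ i j : Fin r, (i : ℕ) + 1 = j → (j : ℕ) + 1 = r →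
    e.1 i = 0 → e.1 j ≠ 0) : mult 0 e.1 ≤ 1 := by
  rw [mult, Finset.card_le_one]
  intro a ha b hb
  simp only [Finset.mem_filter, Finset.mem_univ, true_and] at ha hb
  by_contra hab
  wlog hlt : a < b generalizing a b with H
  · exact H b a hb ha (Ne.symm hab) (lt_of_le_of_ne (not_lt.mp hlt) (Ne.symm hab))
  have hlt' : (a : ℕ) < b := hlt
  have hb2 := b.2
  have hzero : ∀ i : Fin r, a ≤ i → e.1 i = 0 := fun i hi =>
    le_antisymm ((e.2.1 hi).trans ha.le) (e.2.2 i)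
  refine he ⟨r - 2, by omega⟩ ⟨r - 1, by omega⟩ (by simp; omega) (by simp; omega)
    (hzero _ ?_) (hzero _ ?_)
  · rw [Fin.le_def]
    simp
    omega
  · rw [Fin.le_def]
    simp
    omega

/-- The coefficients of the expansion vanish for large sums, so only finitely many types occur; they
also vanish where the last two entries are zero, so these types have at most one zero. -/
theorem heckeOp_mem_PhiSpan [Finite 𝓀[L]]
    (hσ : UnramInvol (σ : L →+* L) (algebraMap K L ϖ) (residueCard K)) (b : Bool)
    {g : TypFlat r → ℤ} (hg : (Function.support g).Finite) :
    heckeOp (residueCard K) r b g ∈ PhiSpan σ ϖ r 1 := by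
  classical
  obtain ⟨B, hB, hswap, hpair, hT, hzero⟩ := exists_expansion hσ.two_le b hg
  have hA : Bdd (coordSum r) (act (denomInt (residueCard K) r 1) B) := hB.act _
  obtain ⟨C₁, hC₁⟩ := hB
  obtain ⟨C₂, hC₂⟩ := hA
  let E := ((finite_typFlat_le (r := r) (max C₁ C₂)).subset (Set.inter_subset_left
    (t := {e | act (denomInt (residueCard K) r 1) B e.1 ≠ 0}))).toFinset
  have hmem : ∀ e, e ∈ E ↔ coordSum r e.1 ≤ max C₁ C₂ ∧
      act (denomInt (residueCard K) r 1) B e.1 ≠ 0 := fun e => by simp [E]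
  have hexp : heckeOp (residueCard K) r b g =
      ∑ e ∈ E, act (denomInt (residueCard K) r 1) B e.1 • phiFlat σ ϖ e := by
    ext f
    rw [← hT f, Finset.sum_apply]
    exact act_denomInt_eq_sum_latticeSum hσ (isHerm_diagForm hσ f.1) (orthBasis_diagForm hσ f.1)
      (by simp) (rels_listFun hswap hpair)
      (fun e he => hC₁ e (lt_of_le_of_lt (le_max_left _ _) he)) (fun e he => ((hmem e).mp he).1)
      fun e he => by
        by_contra hne
        refine he ((hmem e).mpr ⟨?_, hne⟩)
        by_contra hlt
        exact hne (hC₂ _ (lt_of_le_of_lt (le_max_right _ _) (not_le.mp hlt)))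
  rw [hexp]
  refine Submodule.sum_mem _ fun e he => Submodule.smul_mem _ _ (Submodule.subset_span
    ⟨e, mult_zero_le_one fun i j hij hj hi hj0 => ?_, rfl⟩)
  exact ((hmem e).mp he).2 (hzero e.1 i j hij hj hi hj0)

end Main

/-! ### Quadratic extensions of finite fields -/

section FiniteFields

variable {k l : Type*} [Field k] [Finite k] [Field l] [Finite l] [Algebra k l]

/-- The automorphisms over `k` are the powers of Frobenius with exponent below the degree 2. -/
theorem eq_pow_of_card_eq_sq (hcard : Nat.card l = Nat.card k ^ 2) {s : l ≃ₐ[k] l} (hs : s ≠ 1)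
    (x : l) : s x = x ^ Nat.card k := by
  classical
  letI := Fintype.ofFinite k
  have hk : 1 < Nat.card k := Finite.one_lt_card
  have h2 : Module.finrank k l = 2 :=
    Nat.pow_right_injective hk ((Module.natCard_eq_pow_finrank (K := k) (V := l)).symm.trans hcard)
  obtain ⟨n, hn⟩ := (FiniteField.bijective_frobeniusAlgEquivOfAlgebraic_pow k l).2 s
  have hn2 := n.2
  have hn0 : (n : ℕ) ≠ 0 := fun h0 => hs (by rw [← hn]; simp [h0])
  have hn1 : (n : ℕ) = 1 := by omega
  rw [← hn]
  simp [hn1, FiniteField.coe_frobeniusAlgEquivOfAlgebraic, Nat.card_eq_fintype_card]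

theorem card_norm_fiber_le (hcard : Nat.card l = Nat.card k ^ 2) {s : l ≃ₐ[k] l} (hs : s ≠ 1)
    (c : l) : Nat.card {x : l // x * s x = c} ≤ Nat.card k + 1 := by
  classical
  have h : {x : l | x * s x = c} ⊆ ((Polynomial.nthRoots (Nat.card k + 1) c).toFinset : Set l) := by
    intro x hx
    simp only [Finset.mem_coe, Multiset.mem_toFinset]
    rw [Polynomial.mem_nthRoots (Nat.succ_pos _), pow_succ', ← eq_pow_of_card_eq_sq hcard hs]
    exact hx
  calc Nat.card {x : l // x * s x = c} = {x : l | x * s x = c}.ncard := rfl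
    _ ≤ ((Polynomial.nthRoots (Nat.card k + 1) c).toFinset : Set l).ncard :=
      Set.ncard_le_ncard h (Finset.finite_toSet _)
    _ ≤ _ := by
      rw [Set.ncard_coe_finset]
      exact (Multiset.toFinset_card_le _).trans (Polynomial.card_nthRoots _ _)

/-- The norm is `x ↦ x ^ (|k| + 1)`, so no fibre has more than `|k| + 1` elements. The `|k|² - 1`
nonzero elements fill the `|k| - 1` fibres over nonzero values, so all the bounds are attained. -/
theorem card_norm_fiber (hcard : Nat.card l = Nat.card k ^ 2) {s : l ≃ₐ[k] l} (hs : s ≠ 1)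
    (hfix : ∀ x : l, s x = x → ∃ a : k, algebraMap k l a = x) {c : k} (hc : c ≠ 0) :
    Nat.card {x : l // x * s x = algebraMap k l c} = Nat.card k + 1 := by
  classical
  letI := Fintype.ofFinite k
  letI := Fintype.ofFinite l
  have hinv : ∀ x : l, s (s x) = x := fun x => by
    rw [eq_pow_of_card_eq_sq hcard hs (s x), eq_pow_of_card_eq_sq hcard hs x, ← pow_mul, ← sq,
      ← hcard, Nat.card_eq_fintype_card, FiniteField.pow_card]
  have hN : ∀ x : l, ∃ a : k, algebraMap k l a = x * s x := fun x =>
    hfix _ (by rw [map_mul, hinv, mul_comm])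
  choose N hN using hN
  have hfib : ∀ c : k, (Finset.univ.filter fun x : l => N x = c).card =
      Nat.card {x : l // x * s x = algebraMap k l c} := fun c => by
    rw [Nat.card_eq_fintype_card, Fintype.card_subtype]
    congr 1
    ext x
    simp only [Finset.mem_filter, Finset.mem_univ, true_and]
    rw [← hN x]
    exact ((algebraMap k l).injective.eq_iff).symm
  have hsum : ∑ c ∈ Finset.univ.erase (0 : k), (Finset.univ.filter fun x : l => N x = c).card =
      ∑ _c ∈ Finset.univ.erase (0 : k), (Nat.card k + 1) := by
    have h1 := Finset.card_eq_sum_card_fiberwise (f := N) (s := Finset.univ.erase (0 : l))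
      (t := Finset.univ.erase (0 : k)) (by
        intro x hx
        simp only [Finset.coe_erase, Finset.coe_univ, Set.mem_diff, Set.mem_univ, true_and,
          Set.mem_singleton_iff] at hx ⊢
        intro h0
        have := hN x
        rw [h0, map_zero, eq_comm, mul_eq_zero] at this
        rcases this with h | h
        · exact hx h
        · exact hx (by simpa using h))
    rw [Finset.card_erase_of_mem (Finset.mem_univ _), Finset.card_univ,
      ← Nat.card_eq_fintype_card, hcard] at h1
    rw [Finset.sum_const, Finset.card_erase_of_mem (Finset.mem_univ _), Finset.card_univ,
      ← Nat.card_eq_fintype_card, smul_eq_mul, mul_comm, ← Nat.sq_sub_sq, one_pow, h1]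
    refine Finset.sum_congr rfl fun c hc => congrArg _ ?_
    ext x
    simp only [Finset.mem_filter, Finset.mem_univ, true_and, Finset.mem_erase, and_true,
      iff_and_self]
    rintro h rfl
    have := hN 0
    rw [zero_mul, map_eq_zero, h] at this
    exact (Finset.ne_of_mem_erase hc) this
  rw [← hfib]
  exact (Finset.sum_eq_sum_iff_of_le fun c _ => by
    rw [hfib]; exact card_norm_fiber_le hcard hs _).mp hsum c (by simpa using hc)

/-- Separability: otherwise `y` would be a double root, equal to `t / 2`, or in characteristic two a
square root of an element of `k`, and in both cases would lie in `k`. -/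
theorem two_mul_ne_of_notMem_range {y : l} (hy : ∀ a : k, algebraMap k l a ≠ y) {t n : k}
    (hroot : y * y = algebraMap k l t * y - algebraMap k l n) : algebraMap k l t ≠ 2 * y := by
  intro h
  by_cases h2 : (2 : k) = 0
  · have h2' : (2 : l) = 0 := by
      rw [← map_ofNat (algebraMap k l) 2, h2, map_zero]
    rw [h2', zero_mul] at h
    rw [h, zero_mul, zero_sub] at hroot
    have hchar : ringChar k = 2 := by
      haveI : CharP k 2 := CharTwo.of_one_ne_zero_of_two_eq_zero one_ne_zero h2
      exact ringChar.eq k 2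
    obtain ⟨m, hm⟩ := FiniteField.isSquare_of_char_two hchar n
    refine hy m ?_
    have h3 : (algebraMap k l m - y) * (algebraMap k l m - y) = 0 := by
      rw [hm, map_mul] at hroot
      linear_combination hroot - algebraMap k l m * y * h2'
    exact sub_eq_zero.mp (mul_self_eq_zero.mp h3)
  · refine hy (t / 2) ?_
    rw [map_div₀, h]
    have h2' : algebraMap k l 2 ≠ 0 := by simpa using h2
    rw [map_ofNat] at h2' ⊢
    field_simp

end FiniteFields

/-! ### Unramified quadratic extensions of local fields -/

section LocalFields

variable {K L : Type*} [Field K] [ValuativeRel K] [Field L] [ValuativeRel L] [Algebra K L]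
  [ValuativeExtension K L]

theorem algebraMap_mem_integer_iff {a : K} : algebraMap K L a ∈ 𝒪[L] ↔ a ∈ 𝒪[K] := by
  rw [Valuation.mem_integer_iff, Valuation.mem_integer_iff, ← map_one (ValuativeRel.valuation L),
    ← map_one (ValuativeRel.valuation K), ← Valuation.Compatible.vle_iff_le,
    ← Valuation.Compatible.vle_iff_le, ← map_one (algebraMap K L), ValuativeExtension.vle_iff_vle]

theorem mem_integer_or_inv_mem (x : L) : x ∈ 𝒪[L] ∨ x⁻¹ ∈ 𝒪[L] := by
  rw [Valuation.mem_integer_iff, Valuation.mem_integer_iff, map_inv₀]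
  rcases le_total (ValuativeRel.valuation L x) 1 with h | h
  · exact Or.inl h
  · exact Or.inr (inv_le_one_of_one_le₀ h)

theorem isUnif_of_irreducible [IsDiscreteValuationRing 𝒪[K]] {ϖ : 𝒪[K]} (hϖ : Irreducible ϖ) :
    IsUnif (ϖ : K) := by
  have h0 : (ϖ : K) ≠ 0 := fun h => hϖ.ne_zero (Subtype.ext h)
  have key : ∀ x : K, x ∈ 𝒪[K] → x ≠ 0 →
      ∃ n : ℤ, (ϖ : K) ^ (-n) * x ∈ 𝒪[K] ∧ (ϖ : K) ^ n * x⁻¹ ∈ 𝒪[K] := by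
    intro x hx hx0
    obtain ⟨n, u, hu⟩ := IsDiscreteValuationRing.eq_unit_mul_pow_irreducible (x := ⟨x, hx⟩)
      (fun h => hx0 (congrArg Subtype.val h)) hϖ
    have hux : x = (u : 𝒪[K]) * (ϖ : K) ^ n := congrArg Subtype.val hu
    have h1 : ((u : 𝒪[K]) : K) * ((u⁻¹ : (𝒪[K])ˣ) : 𝒪[K]) = 1 := by
      exact_mod_cast congrArg Subtype.val u.mul_inv
    have hu0 : ((u : 𝒪[K]) : K) ≠ 0 := left_ne_zero_of_mul_eq_one h1
    refine ⟨n, ?_, ?_⟩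
    · have : (ϖ : K) ^ (-(n : ℤ)) * x = (u : 𝒪[K]) := by
        rw [hux, zpow_neg, zpow_natCast]
        field_simp
      rw [this]
      exact (u : 𝒪[K]).2
    · have : (ϖ : K) ^ (n : ℤ) * x⁻¹ = ((u⁻¹ : (𝒪[K])ˣ) : 𝒪[K]) := by
        rw [hux, zpow_natCast, eq_inv_of_mul_eq_one_right h1]
        field_simp
      rw [this]
      exact ((u⁻¹ : (𝒪[K])ˣ) : 𝒪[K]).2
  refine ⟨h0, ϖ.2, fun h => ?_, fun x hx0 => ?_⟩
  · exact hϖ.not_isUnit (IsUnit.of_mul_eq_one ⟨_, h⟩ (Subtype.ext (mul_inv_cancel₀ h0)))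
  · rcases mem_integer_or_inv_mem x with hx | hx
    · exact key x hx hx0
    · obtain ⟨n, h1, h2⟩ := key _ hx (inv_ne_zero hx0)
      rw [inv_inv] at h2
      exact ⟨-n, by rwa [neg_neg], h1⟩

theorem IsUnif.algebraMap {ϖ : K} (hϖ : IsUnif ϖ) (hunr : IsUnramifiedExtension K L) :
    IsUnif (algebraMap K L ϖ) := by
  refine ⟨by simpa using hϖ.ne_zero, algebraMap_mem_integer_iff.mpr hϖ.mem, fun h => ?_,
    fun x hx => ?_⟩
  · rw [← map_inv₀, algebraMap_mem_integer_iff] at h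
    exact hϖ.inv_notMem h
  · obtain ⟨g, hg⟩ := hunr (ValuativeRel.valuation L x)
    obtain ⟨a, rfl⟩ := ValuativeRel.valuation_surjective g
    rw [ValuativeExtension.mapValueGroupWithZero_valuation] at hg
    have ha : a ≠ 0 := by
      rintro rfl
      rw [map_zero, map_zero, eq_comm, map_eq_zero] at hg
      exact hx hg
    obtain ⟨n, h1, h2⟩ := hϖ.exists_ord a ha
    rw [← algebraMap_mem_integer_iff (L := L), Valuation.mem_integer_iff, map_mul, map_mul,
      map_zpow₀] at h1 h2
    rw [map_inv₀, map_inv₀, hg] at h2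
    rw [hg] at h1
    refine ⟨n, ?_, ?_⟩
    · rwa [Valuation.mem_integer_iff, map_mul]
    · rwa [Valuation.mem_integer_iff, map_mul, map_inv₀]

theorem vge_algebraMap_iff {ϖ a : K} {n : ℤ} :
    VGe (algebraMap K L ϖ) n (algebraMap K L a) ↔ VGe ϖ n a := by
  rw [VGe, VGe, ← map_zpow₀, ← map_mul, algebraMap_mem_integer_iff]

theorem exists_vge_sub_algebraMap {ϖ : K} (hϖ : IsUnif (algebraMap K L ϖ))
    (h : ∀ x ∈ 𝒪[L], ∃ a ∈ 𝒪[K], VGe (algebraMap K L ϖ) 1 (x - algebraMap K L a)) (n : ℕ) :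
    ∀ x ∈ 𝒪[L], ∃ a ∈ 𝒪[K], VGe (algebraMap K L ϖ) n (x - algebraMap K L a) := by
  have hmem : ϖ ∈ 𝒪[K] := algebraMap_mem_integer_iff.mp hϖ.mem
  induction n with
  | zero => exact fun x hx => ⟨0, zero_mem _, by simpa [VGe] using hx⟩
  | succ n ih =>
    intro x hx
    obtain ⟨a, ha, hxa⟩ := h x hx
    obtain ⟨b, hb, hxb⟩ := ih ((algebraMap K L ϖ) ^ (-1 : ℤ) * (x - algebraMap K L a)) hxa
    refine ⟨a + ϖ * b, add_mem ha (mul_mem hmem hb), ?_⟩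
    have h1 := (hϖ.vge_zpow_mul_iff (m := n + 1) (n := 1)).mpr (by simpa using hxb)
    convert h1 using 1
    · push_cast; rfl
    · have h0 := hϖ.ne_zero
      rw [map_add, map_mul, zpow_one]
      field_simp
      ring

/-- If every integer of `L` is congruent to one of `K` modulo `ϖ`, successive approximation gives a
Cauchy sequence in `𝒪[K]`; its limit maps to `x`. -/
theorem mem_range_of_precomplete [IsLocalRing 𝒪[K]] [IsAdicComplete 𝓂[K] 𝒪[K]] {ϖ : 𝒪[K]}
    (hspan : 𝓂[K] = Ideal.span {ϖ}) (hϖ : IsUnif (algebraMap K L ϖ))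
    (h : ∀ x ∈ 𝒪[L], ∃ a ∈ 𝒪[K], VGe (algebraMap K L ϖ) 1 (x - algebraMap K L a)) {x : L}
    (hx : x ∈ 𝒪[L]) : ∃ a : K, algebraMap K L a = x := by
  have hϖ0 : (ϖ : K) ≠ 0 := fun h0 => hϖ.ne_zero (by rw [h0, map_zero])
  have hpow : ∀ (n : ℕ) (a b : 𝒪[K]), a ≡ b [SMOD (𝓂[K] ^ n • ⊤ : Submodule 𝒪[K] 𝒪[K])] ↔
      VGe (ϖ : K) n ((a : K) - b) := by
    intro n a b
    rw [SModEq.sub_mem, smul_eq_mul, Ideal.mul_top, hspan, Ideal.span_singleton_pow,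
      Ideal.mem_span_singleton, VGe]
    constructor
    · rintro ⟨c, hc⟩
      have hc' : (a : K) - b = (ϖ : K) ^ n * c := congrArg Subtype.val hc
      have h1 : (ϖ : K) ^ (-(n : ℤ)) * ((a : K) - b) = c := by
        rw [hc', zpow_neg, zpow_natCast]
        field_simp
      rw [h1]
      exact c.2
    · intro hm
      refine ⟨⟨_, hm⟩, Subtype.ext ?_⟩
      change (a : K) - b = (ϖ : K) ^ n * ((ϖ : K) ^ (-(n : ℤ)) * ((a : K) - b))
      rw [zpow_neg, zpow_natCast]
      field_simp
  have h1 : ∀ n : ℕ, ∃ a : 𝒪[K], VGe (algebraMap K L ϖ) n (x - algebraMap K L a) := fun n => by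
    obtain ⟨a, ha, hxa⟩ := exists_vge_sub_algebraMap hϖ h n x hx
    exact ⟨⟨a, ha⟩, hxa⟩
  choose f hf using h1
  obtain ⟨a, ha⟩ := IsPrecomplete.prec (I := 𝓂[K]) (M := 𝒪[K]) inferInstance (f := f) (by
    intro m n hmn
    rw [hpow, ← vge_algebraMap_iff (L := L), map_sub]
    have := (hϖ.vge_mono (by exact_mod_cast hmn) (hf n)).sub (hf m)
    simpa using this)
  refine ⟨a, ?_⟩
  by_contra hne
  have hne' : x - algebraMap K L a ≠ 0 := fun h0 => hne (sub_eq_zero.mp h0).symm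
  obtain ⟨n, hn1, hn2⟩ := hϖ.exists_ord _ hne'
  have hall : ∀ m : ℕ, VGe (algebraMap K L ϖ) m (x - algebraMap K L a) := fun m => by
    have h2 := ha m
    rw [hpow, ← vge_algebraMap_iff (L := L), map_sub] at h2
    simpa using (hf m).add h2
  have h3 := (hϖ.vge_iff (m := ((n + 1).toNat : ℤ)) (n := n) ⟨hn1, by simpa [VGe] using hn2, hne'⟩).mp
    (hall _)
  omega

end LocalFields

/-! ### Quadratic étale extensions of local rings with finite residue fields -/

section LocalRings

open IsLocalRing

variable {A B : Type*} [CommRing A] [IsLocalRing A] [CommRing B] [IsLocalRing B] [Algebra A B]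
  [IsLocalHom (algebraMap A B)] [Finite (ResidueField A)] [Finite (ResidueField B)]
  {y : B} {t n : A}

theorem algebraMap_residue_ne (hy : ∀ a : A, algebraMap A B a - y ∉ maximalIdeal B)
    (a : ResidueField A) : algebraMap (ResidueField A) (ResidueField B) a ≠ residue B y := by
  obtain ⟨a, rfl⟩ := residue_surjective a
  intro h
  rw [ResidueField.algebraMap_residue, ← sub_eq_zero, ← map_sub, IsLocalRing.residue_eq_zero_iff] at h
  exact hy a h

theorem exists_residue_coords
    (hspan : ∀ z : B, ∃ a b : A, z = algebraMap A B a + algebraMap A B b * y)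
    (z : ResidueField B) : ∃ a b : ResidueField A,
      z = algebraMap (ResidueField A) (ResidueField B) a +
        algebraMap (ResidueField A) (ResidueField B) b * residue B y := by
  obtain ⟨z, rfl⟩ := residue_surjective z
  obtain ⟨a, b, rfl⟩ := hspan z
  exact ⟨residue A a, residue A b, by simp⟩

theorem card_residueField_eq_sq (hy : ∀ a : A, algebraMap A B a - y ∉ maximalIdeal B)
    (hspan : ∀ z : B, ∃ a b : A, z = algebraMap A B a + algebraMap A B b * y) :
    Nat.card (ResidueField B) = Nat.card (ResidueField A) ^ 2 := by
  rw [sq, ← Nat.card_prod]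
  refine (Nat.card_congr (Equiv.ofBijective (fun p : ResidueField A × ResidueField A =>
    algebraMap (ResidueField A) (ResidueField B) p.1 +
      algebraMap (ResidueField A) (ResidueField B) p.2 * residue B y) ⟨?_, ?_⟩)).symm
  · rintro ⟨a, b⟩ ⟨a', b'⟩ h
    simp only at h
    have hb : b = b' := by
      by_contra hne
      have hne' : algebraMap (ResidueField A) (ResidueField B) (b - b') ≠ 0 := by
        rwa [Ne, map_eq_zero, sub_eq_zero]
      refine algebraMap_residue_ne hy ((a' - a) / (b - b')) ?_
      rw [map_div₀, div_eq_iff hne', map_sub, map_sub]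
      linear_combination -h
    subst hb
    simpa using h
  · intro z
    obtain ⟨a, b, h⟩ := exists_residue_coords hspan z
    exact ⟨(a, b), h.symm⟩

theorem isUnit_sub_two_mul (hy : ∀ a : A, algebraMap A B a - y ∉ maximalIdeal B)
    (hroot : y * y = algebraMap A B t * y - algebraMap A B n) :
    IsUnit (algebraMap A B t - 2 * y) := by
  rw [← residue_ne_zero_iff_isUnit, map_sub, map_mul, map_ofNat, sub_ne_zero,
    ← ResidueField.algebraMap_residue]
  refine two_mul_ne_of_notMem_range (algebraMap_residue_ne hy) (n := residue A n) ?_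
  simpa using congrArg (residue B) hroot

theorem card_residue_norm_fiber (hy : ∀ a : A, algebraMap A B a - y ∉ maximalIdeal B)
    (hspan : ∀ z : B, ∃ a b : A, z = algebraMap A B a + algebraMap A B b * y)
    (hroot : y * y = algebraMap A B t * y - algebraMap A B n) {g : B ≃ₐ[A] B}
    (hg : g y = algebraMap A B t - y) {c : A} (hc : IsUnit c) :
    Nat.card {x : ResidueField B // x * ResidueField.mapAlgEquiv' g x =
      residue B (algebraMap A B c)} = Nat.card (ResidueField A) + 1 := by
  have hgy : ResidueField.mapAlgEquiv' g (residue B y) =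
      algebraMap (ResidueField A) (ResidueField B) (residue A t) - residue B y := by
    rw [ResidueField.mapAlgEquiv'_residue, hg]
    simp
  have hne := sub_ne_zero.mpr (two_mul_ne_of_notMem_range (algebraMap_residue_ne hy)
    (t := residue A t) (n := residue A n) (by simpa using congrArg (residue B) hroot))
  rw [← ResidueField.algebraMap_residue]
  refine card_norm_fiber (card_residueField_eq_sq hy hspan) ?_ ?_
    ((residue_ne_zero_iff_isUnit c).mpr hc)
  · intro h
    rw [h, AlgEquiv.one_apply] at hgy
    apply hne
    linear_combination -hgy
  · intro x hx
    obtain ⟨a, b, rfl⟩ := exists_residue_coords hspan x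
    rw [map_add, map_mul, AlgEquiv.commutes, AlgEquiv.commutes, hgy] at hx
    have h0 : algebraMap (ResidueField A) (ResidueField B) b *
        (algebraMap (ResidueField A) (ResidueField B) (residue A t) - 2 * residue B y) = 0 := by
      linear_combination hx
    rw [(mul_eq_zero.mp h0).resolve_right hne, zero_mul, add_zero]
    exact ⟨a, rfl⟩

end LocalRings

/-! ### The involution of an unramified quadratic extension -/

section LocalFields

variable {K L : Type*} [Field K] [ValuativeRel K] [Field L] [ValuativeRel L] [Algebra K L]
  [ValuativeExtension K L] {ϖ : K} {y : L}

theorem exists_coords (hdeg : Module.finrank K L = 2)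
    (hy : ∀ a : K, algebraMap K L a ≠ y) (z : L) :
    ∃ a b : K, z = algebraMap K L a + algebraMap K L b * y := by
  have hli : LinearIndependent K ![(1 : L), y] := by
    rw [LinearIndependent.pair_iff]
    intro a b hab
    rw [Algebra.smul_def, Algebra.smul_def, mul_one] at hab
    have hb : b = 0 := by
      by_contra hb
      have hb' : algebraMap K L b ≠ 0 := by simpa using hb
      refine hy (-a / b) ?_
      rw [map_div₀, div_eq_iff hb', map_neg]
      linear_combination -hab
    subst hb
    exact ⟨by simpa using hab, rfl⟩
  have htop := hli.span_eq_top_of_card_eq_finrank (by simp [hdeg])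
  have hz : z ∈ Submodule.span K (Set.range ![(1 : L), y]) := htop ▸ Submodule.mem_top
  rw [Matrix.range_cons_cons_empty, Submodule.mem_span_pair] at hz
  obtain ⟨a, b, rfl⟩ := hz
  exact ⟨a, b, by rw [Algebra.smul_def, Algebra.smul_def, mul_one]⟩

/-- If `b` had a pole, dividing by it would make `y` congruent modulo `ϖ` to the integer `-a / b` of
`K`. Thus `1` and `y` form an integral basis. -/
theorem coords_mem (hϖ : IsUnif (algebraMap K L ϖ)) (hyO : y ∈ 𝒪[L])
    (hy : ∀ a ∈ 𝒪[K], ¬ VGe (algebraMap K L ϖ) 1 (y - algebraMap K L a)) {a b : K}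
    (h : algebraMap K L a + algebraMap K L b * y ∈ 𝒪[L]) : a ∈ 𝒪[K] ∧ b ∈ 𝒪[K] := by
  have hb : b ∈ 𝒪[K] := by
    by_contra hb
    have hb0 : algebraMap K L b ≠ 0 := by
      rw [Ne, map_eq_zero]
      rintro rfl
      exact hb (zero_mem _)
    have hbL : algebraMap K L b ∉ 𝒪[L] := fun h => hb (algebraMap_mem_integer_iff.mp h)
    have hb1 : VGe (algebraMap K L ϖ) 1 (algebraMap K L b)⁻¹ := by
      by_contra h1
      have h2 := hϖ.veq_of_vge (n := 0) ((vge_zero_iff (ϖ := algebraMap K L ϖ)).mpr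
        ((mem_integer_or_inv_mem _).resolve_left hbL)) (by simpa using h1)
      exact hbL (by simpa [VGe] using h2.2.1)
    have h1 := hϖ.vge_mul_left h hb1
    have h2 : (algebraMap K L a + algebraMap K L b * y) * (algebraMap K L b)⁻¹ =
        y - algebraMap K L (-a / b) := by
      rw [map_div₀, map_neg]
      field_simp
      ring
    rw [h2] at h1
    have h3 : algebraMap K L (-a / b) ∈ 𝒪[L] := by
      have := sub_mem hyO (hϖ.mem_of_vge zero_le_one h1)
      rwa [sub_sub_cancel] at this
    exact hy _ (algebraMap_mem_integer_iff.mp h3) h1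
  refine ⟨?_, hb⟩
  have := sub_mem h (mul_mem (algebraMap_mem_integer_iff.mpr hb) hyO)
  rwa [add_sub_cancel_right, algebraMap_mem_integer_iff] at this

/-- Without such a `y` the residue extension would be trivial, and completeness would force `L = K`.
-/
theorem exists_residue_generator [IsAdicComplete 𝓂[K] 𝒪[K]]
    (hdeg : Module.finrank K L = 2) {ϖ : 𝒪[K]} (hspan : 𝓂[K] = Ideal.span {ϖ})
    (hϖ : IsUnif (algebraMap K L ϖ)) :
    ∃ y ∈ 𝒪[L], ∀ a ∈ 𝒪[K], ¬ VGe (algebraMap K L ϖ) 1 (y - algebraMap K L a) := by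
  by_contra! h
  have h1 : Module.finrank K L = 1 := by
    rw [finrank_eq_one_iff_of_nonzero' (1 : L) one_ne_zero]
    intro x
    rcases mem_integer_or_inv_mem x with hx | hx
    · obtain ⟨a, rfl⟩ := mem_range_of_precomplete hspan hϖ h hx
      exact ⟨a, by rw [Algebra.smul_def, mul_one]⟩
    · obtain ⟨a, ha⟩ := mem_range_of_precomplete hspan hϖ h hx
      exact ⟨a⁻¹, by rw [Algebra.smul_def, mul_one, map_inv₀, ha, inv_inv]⟩
  omega

end LocalFields

/-! ### Verification of `UnramInvol` for unramified quadratic extensions -/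

section LocalFields

variable {K L : Type*} [Field K] [ValuativeRel K] [Field L] [ValuativeRel L] [Algebra K L]
  [ValuativeExtension K L]

theorem isUnit_integer_iff {ϖ : L} (hϖ : IsUnif ϖ) (x : 𝒪[L]) : IsUnit x ↔ VEq ϖ 0 (x : L) := by
  rw [← not_iff_not, ← mem_nonunits_iff, ← IsLocalRing.mem_maximalIdeal, hϖ.mem_maximalIdeal_iff]
  constructor
  · exact fun h1 h2 => hϖ.not_vge h2 zero_lt_one h1
  · intro h1
    by_contra h2
    exact h1 (hϖ.veq_of_vge (vge_zero_iff.mpr x.2) (by simpa using h2))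

/-- The inclusion of valuation rings. -/
noncomputable abbrev integerAlgebra (K L : Type*) [Field K] [ValuativeRel K] [Field L] [ValuativeRel L]
    [Algebra K L] [ValuativeExtension K L] : Algebra 𝒪[K] 𝒪[L] :=
  ((algebraMap K L).restrict 𝒪[K] 𝒪[L] fun _ h => algebraMap_mem_integer_iff.mpr h).toAlgebra

theorem isLocalHom_integer :
    letI := integerAlgebra K L
    IsLocalHom (algebraMap 𝒪[K] 𝒪[L]) := by
  letI := integerAlgebra K L
  refine ⟨fun a ha => ?_⟩
  obtain ⟨b, hb⟩ := ha.exists_right_inv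
  have hb' : algebraMap K L a * (b : L) = 1 := congrArg Subtype.val hb
  have h1 : (a : K)⁻¹ ∈ 𝒪[K] := by
    rw [← algebraMap_mem_integer_iff (L := L), map_inv₀, inv_eq_of_mul_eq_one_right hb']
    exact b.2
  have h0 : (a : K) ≠ 0 := fun h0 => by simp [h0] at hb'
  exact IsUnit.of_mul_eq_one ⟨_, h1⟩ (Subtype.ext (mul_inv_cancel₀ h0))

/-- The integers of `L` are `𝒪[K] + 𝒪[K] y` with `y² = t y + n`, and `σ` exchanges the two roots, so
`σ y = t - y`. The root difference `t - 2 y` is a unit by separability of the residue extension, and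
it is skew; the counting statements reduce to the residue fields. -/
theorem unramInvol_of_generator [Finite 𝓀[K]] [Finite 𝓀[L]] {σ : L ≃ₐ[K] L}
    (hσ : σ ≠ AlgEquiv.refl) (hdeg : Module.finrank K L = 2) {ϖ : 𝒪[K]}
    (hϖ : IsUnif (algebraMap K L ϖ)) {y : L} (hyO : y ∈ 𝒪[L])
    (hy : ∀ a ∈ 𝒪[K], ¬ VGe (algebraMap K L ϖ) 1 (y - algebraMap K L a)) :
    UnramInvol (σ : L →+* L) (algebraMap K L ϖ) (residueCard K) := by
  have hyK : ∀ a : K, algebraMap K L a ≠ y := by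
    rintro a rfl
    refine hy a (algebraMap_mem_integer_iff.mp hyO) ?_
    rw [sub_self]
    exact VGe.zero _
  have hco := exists_coords hdeg hyK
  have hcm : ∀ {a b : K}, algebraMap K L a + algebraMap K L b * y ∈ 𝒪[L] → a ∈ 𝒪[K] ∧ b ∈ 𝒪[K] :=
    fun h => coords_mem hϖ hyO hy h
  obtain ⟨n, t, hroot⟩ := hco (y * y)
  obtain ⟨hn, ht⟩ := hcm (hroot ▸ mul_mem hyO hyO)
  have hσy : σ y = algebraMap K L t - y := by
    have h1 := congrArg σ hroot
    rw [map_mul, map_add, map_mul, AlgEquiv.commutes, AlgEquiv.commutes] at h1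
    have h2 : (σ y - y) * (σ y - (algebraMap K L t - y)) = 0 := by
      linear_combination h1 - hroot
    rcases mul_eq_zero.mp h2 with h3 | h3
    · refine absurd (AlgEquiv.ext fun z => ?_) hσ
      obtain ⟨a, b, rfl⟩ := hco z
      rw [map_add, map_mul, AlgEquiv.commutes, AlgEquiv.commutes, sub_eq_zero.mp h3]
      rfl
    · exact sub_eq_zero.mp h3
  have hinv : ∀ x, σ (σ x) = x := fun x => by
    obtain ⟨a, b, rfl⟩ := hco x
    simp only [map_add, map_mul, map_sub, AlgEquiv.commutes, hσy]
    ring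
  have htL : algebraMap K L t ∈ 𝒪[L] := algebraMap_mem_integer_iff.mpr ht
  have hmem : ∀ x ∈ 𝒪[L], σ x ∈ 𝒪[L] := fun x hx => by
    obtain ⟨a, b, rfl⟩ := hco x
    obtain ⟨ha, hb⟩ := hcm hx
    rw [map_add, map_mul, AlgEquiv.commutes, AlgEquiv.commutes, hσy]
    exact add_mem (algebraMap_mem_integer_iff.mpr ha)
      (mul_mem (algebraMap_mem_integer_iff.mpr hb) (sub_mem htL hyO))
  letI := integerAlgebra K L
  haveI : IsLocalHom (algebraMap 𝒪[K] 𝒪[L]) := isLocalHom_integer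
  let Y : 𝒪[L] := ⟨y, hyO⟩
  let g : 𝒪[L] ≃ₐ[𝒪[K]] 𝒪[L] :=
    { toFun := fun x => ⟨σ x, hmem x x.2⟩
      invFun := fun x => ⟨σ x, hmem x x.2⟩
      left_inv := fun x => Subtype.ext (hinv x)
      right_inv := fun x => Subtype.ext (hinv x)
      map_mul' := fun x x' => Subtype.ext (map_mul σ (x : L) x')
      map_add' := fun x x' => Subtype.ext (map_add σ (x : L) x')
      commutes' := fun a => Subtype.ext (σ.commutes a) }
  have hY : ∀ a : 𝒪[K], algebraMap 𝒪[K] 𝒪[L] a - Y ∉ 𝓂[L] := fun a h => by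
    rw [hϖ.mem_maximalIdeal_iff] at h
    refine hy a a.2 ?_
    have := h.neg
    rwa [show -(((algebraMap 𝒪[K] 𝒪[L] a - Y : 𝒪[L])) : L) = y - algebraMap K L a from
      neg_sub (algebraMap K L a) y] at this
  have hspan : ∀ z : 𝒪[L], ∃ a b : 𝒪[K],
      z = algebraMap 𝒪[K] 𝒪[L] a + algebraMap 𝒪[K] 𝒪[L] b * Y := fun z => by
    obtain ⟨a, b, hz⟩ := hco z
    obtain ⟨ha, hb⟩ := hcm (hz ▸ z.2)
    exact ⟨⟨a, ha⟩, ⟨b, hb⟩, Subtype.ext hz⟩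
  have hrootY : Y * Y =
      algebraMap 𝒪[K] 𝒪[L] ⟨t, ht⟩ * Y - algebraMap 𝒪[K] 𝒪[L] ⟨-n, neg_mem hn⟩ := by
    apply Subtype.ext
    change y * y = algebraMap K L t * y - algebraMap K L (-n)
    rw [map_neg]
    linear_combination hroot
  have hgY : g Y = algebraMap 𝒪[K] 𝒪[L] ⟨t, ht⟩ - Y := Subtype.ext hσy
  have hθ : VEq (algebraMap K L ϖ) 0 (algebraMap K L t - 2 * y) :=
    (isUnit_integer_iff hϖ _).mp (isUnit_sub_two_mul hY hrootY)
  have hσθ : σ (algebraMap K L t - 2 * y) = -(algebraMap K L t - 2 * y) := by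
    rw [map_sub, map_mul, AlgEquiv.commutes, hσy, map_ofNat]
    ring
  refine ⟨hϖ, hinv, σ.commutes _, hmem, ?_, ⟨_, hθ, hσθ⟩, card_residueField_eq_sq hY hspan,
    Finite.one_lt_card, ?_⟩
  -- An integral element of trace one: `y / t` if `t` is a unit. Otherwise `2` must be a unit,
  -- because `t - 2 y` is one, and `1 / 2` serves.
  · by_cases htu : VEq (algebraMap K L ϖ) 0 (algebraMap K L t)
    · have ht0 := htu.2.2
      refine ⟨(algebraMap K L t)⁻¹ * y, mul_mem (by simpa [VGe] using htu.2.1) hyO, ?_⟩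
      change _ + σ _ = _
      rw [map_mul, map_inv₀, AlgEquiv.commutes, hσy]
      field_simp
      ring
    · have h1 : VGe (algebraMap K L ϖ) 1 (algebraMap K L t) := by
        by_contra h
        exact htu (hϖ.veq_of_vge (vge_zero_iff.mpr htL) (by simpa using h))
      have h2 : VEq (algebraMap K L ϖ) 0 (2 : L) := by
        refine hϖ.veq_of_vge (vge_zero_iff.mpr (ofNat_mem _ 2)) fun h => ?_
        refine hϖ.not_vge hθ zero_lt_one (h1.sub ?_)
        rw [mul_comm]
        exact hϖ.vge_mul_left hyO (by simpa using h)
      refine ⟨2⁻¹, by simpa [VGe] using h2.2.1, ?_⟩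
      change _ + σ _ = _
      have h20 := h2.2.2
      rw [map_inv₀, map_ofNat]
      field_simp
      norm_num
  · intro c hc hσc
    obtain ⟨a, b, rfl⟩ := hco c
    change σ _ = _ at hσc
    rw [map_add, map_mul, AlgEquiv.commutes, AlgEquiv.commutes, hσy] at hσc
    have h0 : algebraMap K L b * (algebraMap K L t - 2 * y) = 0 := by linear_combination hσc
    rw [(mul_eq_zero.mp h0).resolve_right hθ.2.2, zero_mul, add_zero] at hc ⊢
    have haL : algebraMap K L a ∈ 𝒪[L] := (vge_zero_iff (ϖ := algebraMap K L ϖ)).mp hc.1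
    have ha : a ∈ 𝒪[K] := algebraMap_mem_integer_iff.mp haL
    have hau : IsUnit (⟨a, ha⟩ : 𝒪[K]) := by
      apply isUnit_of_map_unit (algebraMap 𝒪[K] 𝒪[L])
      exact (isUnit_integer_iff hϖ _).mpr hc
    refine (Nat.card_congr (Equiv.subtypeEquivRight fun s => ?_)).trans
      (card_residue_norm_fiber hY hspan hrootY hgY hau)
    constructor
    · rintro ⟨x, rfl, hx⟩
      rw [IsLocalRing.ResidueField.mapAlgEquiv'_residue, ← map_mul, residue_eq_iff hϖ]
      exact hx
    · obtain ⟨x, rfl⟩ := IsLocalRing.residue_surjective s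
      intro hx
      rw [IsLocalRing.ResidueField.mapAlgEquiv'_residue, ← map_mul, residue_eq_iff hϖ] at hx
      exact ⟨x, rfl, hx⟩

theorem unramInvol [TopologicalSpace K] [IsNonarchimedeanLocalField K] [TopologicalSpace L]
    [IsNonarchimedeanLocalField L] (hdeg : Module.finrank K L = 2)
    (hunr : IsUnramifiedExtension K L) {σ : L ≃ₐ[K] L} (hσ : σ ≠ AlgEquiv.refl) {ϖ : 𝒪[K]}
    (hϖ : Irreducible ϖ) : UnramInvol (σ : L →+* L) (algebraMap K L ϖ) (residueCard K) := by
  letI := IsTopologicalAddGroup.rightUniformSpace K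
  haveI := isUniformAddGroup_of_addCommGroup (G := K)
  have hL : IsUnif (algebraMap K L ϖ) := (isUnif_of_irreducible hϖ).algebraMap hunr
  obtain ⟨y, hyO, hy⟩ := exists_residue_generator hdeg hϖ.maximalIdeal_eq hL
  exact unramInvol_of_generator hσ hdeg hL hyO hy

end LocalFields

end HermitianHecke

theorem mainTheorem8 (K L : Type*)
    [Field K] [ValuativeRel K] [TopologicalSpace K] [IsNonarchimedeanLocalField K] [CharZero K]
    [Field L] [ValuativeRel L] [TopologicalSpace L] [IsNonarchimedeanLocalField L]
    [Algebra K L] [ValuativeExtension K L]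
    (hdeg : Module.finrank K L = 2) (hunr : HermitianHecke.IsUnramifiedExtension K L)
    (σ : L ≃ₐ[K] L) (hσ : σ ≠ AlgEquiv.refl)
    (ϖ : 𝒪[K]) (hϖ : Irreducible ϖ) (r : ℕ) (hr : 1 ≤ r) :
    Function.Bijective (HermitianHecke.flatToQuotient (HermitianHecke.residueCard K) r) ∧
    Submodule.map (HermitianHecke.heckeT (HermitianHecke.residueCard K) r)
        (HermitianHecke.finiteFunctions r) ≤ HermitianHecke.PhiSpan σ ϖ r 1 ∧
    Submodule.map (HermitianHecke.heckeT' (HermitianHecke.residueCard K) r)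
        (HermitianHecke.finiteFunctions r) ≤ HermitianHecke.PhiSpan σ ϖ r 1 := by
  have h := HermitianHecke.unramInvol hdeg hunr hσ hϖ
  refine ⟨HermitianHecke.flatToQuotient_bijective _ _ h.two_le, ?_, ?_⟩
  · rintro _ ⟨g, hg, rfl⟩
    exact HermitianHecke.heckeOp_mem_PhiSpan h false hg
  · rintro _ ⟨g, hg, rfl⟩
    exact HermitianHecke.heckeOp_mem_PhiSpan h true hg
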